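/- Let $\mathbb K$ be a field. For an element $a$ of a graded space write $\|a\|=|a|-1$. **Algebras and bimodules.** Let $\mathcal A$ be a $\mathbb Z$-graded, strictly unital $A_\infty$-algebra over $\mathbb K$, i.e. a graded vector space with operations $\mu^d_{\mathcal A}$ ($d\ge 1$) of degree $2-d$ satisfying $\sum_{i,j}(-1)^{\|a_1\|+\cdots+\|a_i\|}\mu_{\mathcal A}(a_d,\dots,\mu_{\mathcal A}^j(a_{i+j},\dots,a_{i+1}),a_i,\dots,a_1)=0$ and with a unit $e$ of degree $0$ ($\mu^1(e)=0$, $\mu^2(a,e)=a=(-1)^{|a|}\mu^2(e,a)$, higher operations vanish if an entry is $e$). Put $\bar{\mathcal A}=\mathcal A/\mathbb K e$. All $A_\infty$-bimodules $(\mathcal P,\mu_{\mathcal P}^{s;1;r})$ over $\mathcal A$ are graded and strictly unital. The diagonal bimodule $\mathcal A$ has $\mu^{s;1;r}(a'_s,\dots,a'_1;a;a_r,\dots,a_1)=(-1)^{\|a_1\|+\cdots+\|a_r\|+1}\mu_{\mathcal A}^{r+1+s}(a'_s,\dots,a'_1,a,a_r,\dots,a_1)$. The degree $d$ part of the complex $\hom_{[\mathcal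 A,\mathcal A]}(\mathcal P,\mathcal Q)$ consists of the maps $\phi:T(\mathcal A[1])\otimes\mathcal P\otimes T(\mathcal A[1])\to\mathcal Q[d]$ which factor through the projection to $T(\bar{\mathcal A}[1])$ on both sides, with the usual bimodule differential. The tensor product $\mathcal Q\otimes_{\mathcal A}\mathcal P$ is the bimodule $\mathcal Q\otimes T(\bar{\mathcal A}[1])\otimes\mathcal P$ with the usual bar-type structure maps, and $\mathcal P^{\otimes i}$ is the $i$-fold tensor power. The bimodule $\mathcal P$ is *invertible* if there is a bimodule $\mathcal P^{-1}$ with quasi-isomorphisms $\mathcal P^{-1}\otimes_{\mathcal A}\mathcal P\to\mathcal A$ and $\mathcal P\otimes_{\mathcal A}\mathcal P^{-1}\to\mathcal A$. **Noncommutative divisors.** Let $\mathcal P$ be an invertible bimodule. A *noncommutative divisor* on $\mathcal A$ with underlying bimodule $\mathcal P$ is an $A_\infty$-algebra structure $\mu_{\mathcal B}$, strictly unital with unit $e$, on the graded space $\mathcal B=\mathcal A\oplus\mathcal P[1]$, such that $\mathcal A\subset\mathcal B$ is an $A_\infty$-subalgebra and such that the induced $\mathcal A$-bimodule structure on $\mathcal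 B/\mathcal A=\mathcal P[1]$ is the given one. Equivalently to the latter, $\mu_{\mathcal B}(a'_s,\dots,a'_1,p,a_r,\dots,a_1)=\mu_{\mathcal P}^{s;1;r}(a'_s,\dots;p;\dots,a_1)+\theta^{s;1;r}(a'_s,\dots;p;\dots,a_1)$ with $\theta^{s;1;r}(\cdots)\in\mathcal A$. The resulting $\theta$ is a degree $0$ cocycle in $\hom_{[\mathcal A,\mathcal A]}(\mathcal P,\mathcal A)$, and its class $[\theta]\in H^0(\hom_{[\mathcal A,\mathcal A]}(\mathcal P,\mathcal A))$ is called the *section* of the divisor. Two noncommutative divisors with the same $\mathcal P$ are *isomorphic* if there is a (strictly unital) $A_\infty$-algebra isomorphism between them which restricts to the identity on $\mathcal A$ and induces the identity bimodule map on $\mathcal B/\mathcal A$. **Self-conjugation.** For an invertible $\mathcal P$, both maps from $H^0(\hom_{[\mathcal A,\mathcal A]}(\mathcal P,\mathcal A))$ to $H^0(\hom_{[\mathcal A,\mathcal A]}(\mathcal P\otimes_{\mathcal A}\mathcal P,\mathcal P))$ given by $$L:\ \phi\mapsto\big(\mathcal P\otimes_{\mathcal A}\mathcal P\xrightarrow{\mathrm{id}_{\mathcal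 P}\otimes\phi}\mathcal P\otimes_{\mathcal A}\mathcal A\simeq\mathcal P\big),\qquad R:\ \phi\mapsto\big(\mathcal P\otimes_{\mathcal A}\mathcal P\xrightarrow{\phi\otimes\mathrm{id}_{\mathcal P}}\mathcal A\otimes_{\mathcal A}\mathcal P\simeq\mathcal P\big)$$ (with the canonical quasi-isomorphisms) are isomorphisms. The *self-conjugation map* $K_1$ is the unique linear endomorphism of $H^0(\hom_{[\mathcal A,\mathcal A]}(\mathcal P,\mathcal A))$ with $R\circ K_1=L$. **Statement.** Let $\mathcal P$ be an invertible bimodule over $\mathcal A$, and suppose that $$H^n\big(\hom_{[\mathcal A,\mathcal A]}(\mathcal P^{\otimes i},\mathcal A)\big)=0\qquad\text{for all } i\ge 1 \text{ and } n<0.$$ Then: 1. Any two noncommutative divisors on $\mathcal A$ with underlying bimodule $\mathcal P$ which have the same section $[\theta]\in H^0(\hom_{[\mathcal A,\mathcal A]}(\mathcal P,\mathcal A))$ are isomorphic. 2. The map $K_1$ is well-defined, and the section of every noncommutative divisor on $\mathcal A$ with underlying bimodule $\mathcal P$ satisfies $K_1([\theta])=[\theta]$. -/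

import Mathlib

universe u

namespace NCGeom

section Splits

variable {α β M : Type*} [AddCommMonoid M]

/-- The sum of `f u v` over all ways of writing the list `l` as a concatenation `u ++ v`. -/
def splitSum (f : List α → List α → M) (l : List α) : M :=
  ∑ i ∈ Finset.range (l.length + 1), f (l.take i) (l.drop i)

/-- The sum of `f u v w` over all ways of writing `l` as a concatenation `u ++ v ++ w`. -/
def splitSum₃ (f : List α → List α → List α → M) (l : List α) : M :=
  splitSum (fun u vw => splitSum (fun v w => f u v w) vw) l

theorem splitSum_nil (f : List α → List α → M) : splitSum f [] = f [] [] := by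
  simp [splitSum]

theorem splitSum_cons (f : List α → List α → M) (a : α) (l : List α) :
    splitSum f (a :: l) = f [] (a :: l) + splitSum (fun u v => f (a :: u) v) l := by
  rw [splitSum, List.length_cons, Finset.sum_range_succ', add_comm]
  simp [splitSum]

theorem splitSum_add (f g : List α → List α → M) (l : List α) :
    splitSum (fun u v => f u v + g u v) l = splitSum f l + splitSum g l :=
  Finset.sum_add_distrib

theorem splitSum_zero (l : List α) : splitSum (fun _ _ => (0 : M)) l = 0 :=
  Finset.sum_const_zero

theorem splitSum_congr {f g : List α → List α → M} (l : List α)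
    (h : ∀ u v, l = u ++ v → f u v = g u v) : splitSum f l = splitSum g l :=
  Finset.sum_congr rfl fun i _ => h _ _ (List.take_append_drop i l).symm

theorem splitSum_map (f : List α → List α → M) (g : β → α) (l : List β) :
    splitSum f (l.map g) = splitSum (fun u v => f (u.map g) (v.map g)) l := by
  simp [splitSum, List.map_take, List.map_drop]

theorem splitSum_hom {N F : Type*} [AddCommMonoid N] [FunLike F M N] [AddMonoidHomClass F M N]
    (φ : F) (f : List α → List α → M) (l : List α) :
    φ (splitSum f l) = splitSum (fun u v => φ (f u v)) l :=
  map_sum φ _ _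

theorem splitSum_assoc (f : List α → List α → List α → M) (l : List α) :
    splitSum (fun uv w => splitSum (fun u v => f u v w) uv) l = splitSum₃ f l := by
  induction l generalizing f with
  | nil => simp [splitSum₃, splitSum_nil]
  | cons a l ih =>
    have := ih (fun u v w => f (a :: u) v w)
    simp only [splitSum₃] at this
    simp only [splitSum₃, splitSum_cons, splitSum_nil, splitSum_add, this, add_assoc]

theorem splitSum_append_cons (f : List α → List α → M) (l : List α) (a : α) (r : List α) :
    splitSum f (l ++ a :: r) =
      splitSum (fun u v => f u (v ++ a :: r)) l + splitSum (fun u v => f (l ++ a :: u) v) r := by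
  induction l generalizing f with
  | nil => simp [splitSum_nil, splitSum_cons]
  | cons b l ih => simp [splitSum_cons, ih, add_assoc]

theorem splitSum_ite_left (f : List α → M) (l : List α) [∀ u : List α, Decidable (u = [])] :
    splitSum (fun u v => if u = [] then f v else 0) l = f l := by
  cases l with
  | nil => simp [splitSum_nil]
  | cons a l => simp [splitSum_cons, splitSum_zero]

theorem splitSum_ite_right (f : List α → M) (l : List α) [∀ u : List α, Decidable (u = [])] :
    splitSum (fun u v => if v = [] then f u else 0) l = f l := by
  induction l generalizing f with
  | nil => simp [splitSum_nil]
  | cons a l ih => simp [splitSum_cons, ih (fun u => f (a :: u))]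

theorem splitSum_comm {γ : Type*} (f : List α → List α → List γ → List γ → M) (l : List α)
    (m : List γ) :
    splitSum (fun u v => splitSum (fun x y => f u v x y) m) l =
      splitSum (fun x y => splitSum (fun u v => f u v x y) l) m :=
  Finset.sum_comm

end Splits

/-- Multilinearity of a function of finite sequences of vectors. -/
def IsMultilin (K : Type*) [Semiring K] {X Y : Type*} [AddCommMonoid X] [Module K X]
    [AddCommMonoid Y] [Module K Y] (f : List X → Y) : Prop :=
  ∀ u v : List X, IsLinearMap K fun a => f (u ++ a :: v)

/-- A `ℤ`-graded vector space, `X = ⨁ i, X.gr i`. -/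
structure GrMod (K : Type u) [Field K] where
  carrier : Type u
  [acg : AddCommGroup carrier]
  [mod : Module K carrier]
  gr : ℤ → Submodule K carrier
  internal : DirectSum.IsInternal gr

attribute [instance] GrMod.acg GrMod.mod

instance (K : Type u) [Field K] : CoeSort (GrMod K) (Type u) := ⟨GrMod.carrier⟩

namespace GrMod

variable {K : Type u} [Field K] (X : GrMod K)

theorem bijective_coe : Function.Bijective (DirectSum.coeLinearMap X.gr) := X.internal

/-- The linear map which is `f i` on the degree `i` part. -/
noncomputable def lin {Y : Type*} [AddCommGroup Y] [Module K Y] (f : ∀ i, X.gr i →ₗ[K] Y) :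
    X →ₗ[K] Y :=
  DirectSum.toModule K ℤ Y f ∘ₗ
    (LinearEquiv.ofBijective (DirectSum.coeLinearMap X.gr) X.bijective_coe).symm.toLinearMap

theorem lin_of_mem {Y : Type*} [AddCommGroup Y] [Module K Y] (f : ∀ i, X.gr i →ₗ[K] Y)
    {i : ℤ} {x : X} (hx : x ∈ X.gr i) : X.lin f x = f i ⟨x, hx⟩ := by
  have : (LinearEquiv.ofBijective (DirectSum.coeLinearMap X.gr) X.bijective_coe).symm x =
      DirectSum.lof K ℤ (fun i => X.gr i) i ⟨x, hx⟩ := by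
    rw [LinearEquiv.symm_apply_eq]
    simp
  simp [lin, this]

/-- The sign `(-1)^i`. -/
def eps (i : ℤ) : ℤ := (i.negOnePow : ℤ)

theorem eps_add (i j : ℤ) : eps (i + j) = eps i * eps j := by simp [eps, Int.negOnePow_add]

@[simp] theorem eps_zero : eps 0 = 1 := rfl
@[simp] theorem eps_one : eps 1 = -1 := rfl
@[simp] theorem eps_neg_one : eps (-1) = -1 := rfl

@[simp] theorem eps_mul_self (i : ℤ) : eps i * eps i = 1 := by
  rw [← eps_add, eps, Int.negOnePow_even _ ⟨i, rfl⟩]; rfl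

theorem eps_sub_one (i : ℤ) : eps (i - 1) = -eps i := by
  rw [sub_eq_add_neg, eps_add]; simp

theorem eps_add_one (i : ℤ) : eps (i + 1) = -eps i := by
  rw [eps_add]; simp

/-- The sign operator `x ↦ (-1)^{|x|} x`. -/
noncomputable def sgn : X →ₗ[K] X := X.lin fun i => eps i • (X.gr i).subtype

/-- The reduced sign operator `x ↦ (-1)^{‖x‖} x`, where `‖x‖ = |x| - 1`. -/
noncomputable def rsgn : X →ₗ[K] X := -X.sgn

theorem sgn_of_mem {i : ℤ} {x : X} (hx : x ∈ X.gr i) : X.sgn x = eps i • x := by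
  simp [sgn, lin_of_mem X _ hx]

theorem rsgn_of_mem {i : ℤ} {x : X} (hx : x ∈ X.gr i) :
    X.rsgn x = eps (i - 1) • x := by
  simp [rsgn, sgn_of_mem X hx, eps_sub_one]

theorem eq_top_of_gr_le {S : Submodule K X} (h : ∀ i, X.gr i ≤ S) : S = ⊤ :=
  top_le_iff.1 (X.internal.submodule_iSup_eq_top ▸ iSup_le h)

theorem lin_ext {Y : Type*} [AddCommGroup Y] [Module K Y] {f g : X →ₗ[K] Y}
    (h : ∀ i, ∀ x ∈ X.gr i, f x = g x) : f = g := by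
  have := X.eq_top_of_gr_le (S := LinearMap.eqLocus f g) fun i x hx => h i x hx
  exact LinearMap.ext fun x => (this ▸ Submodule.mem_top : x ∈ LinearMap.eqLocus f g)

@[simp] theorem sgn_sgn (x : X) : X.sgn (X.sgn x) = x := by
  have : X.sgn ∘ₗ X.sgn = LinearMap.id := X.lin_ext fun i x hx => by
    rw [LinearMap.comp_apply, sgn_of_mem X hx, map_zsmul, sgn_of_mem X hx, smul_smul]
    simp
  exact LinearMap.congr_fun this x

@[simp] theorem rsgn_rsgn (x : X) : X.rsgn (X.rsgn x) = x := by simp [rsgn]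

@[simp] theorem map_rsgn_rsgn (l : List X) : (l.map X.rsgn).map X.rsgn = l := by
  simp [List.map_map, Function.comp_def]

theorem sgn_mem {i : ℤ} {x : X} (hx : x ∈ X.gr i) : X.sgn x ∈ X.gr i := by
  rw [sgn_of_mem X hx]; exact zsmul_mem hx _

theorem rsgn_mem {i : ℤ} {x : X} (hx : x ∈ X.gr i) : X.rsgn x ∈ X.gr i := by
  rw [rsgn_of_mem X hx]; exact zsmul_mem hx _

theorem rsgn_comp_rsgn : (X.rsgn : X → X) ∘ (X.rsgn : X → X) = id := funext X.rsgn_rsgn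

/-- `X.IsHom l n` says that the entries of `l` are homogeneous, of degrees `n`. -/
def IsHom (l : List X) (n : List ℤ) : Prop := List.Forall₂ (fun a i => a ∈ X.gr i) l n

/-- The sum of the reduced degrees `‖a‖ = |a| - 1`, for a sequence of degrees `|a|`. -/
def rdeg (n : List ℤ) : ℤ := (n.map fun i => i - 1).sum

@[simp] theorem rdeg_nil : rdeg [] = 0 := rfl
@[simp] theorem rdeg_cons (i : ℤ) (n : List ℤ) : rdeg (i :: n) = i - 1 + rdeg n := rfl
@[simp] theorem rdeg_append (m n : List ℤ) : rdeg (m ++ n) = rdeg m + rdeg n := by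
  simp [rdeg]

end GrMod

section Multilin

variable {K : Type u} [Field K] {X : GrMod K} {Y : Type*} [AddCommGroup Y] [Module K Y]

theorem IsMultilin.ext_hom {f g : List X → Y} (hf : IsMultilin K f) (hg : IsMultilin K g)
    (h : ∀ l n, X.IsHom l n → f l = g l) (l : List X) : f l = g l := by
  have key : ∀ v u : List X, ∀ n, X.IsHom u n → f (u ++ v) = g (u ++ v) := by
    intro v
    induction v with
    | nil => intro u n hu; simpa using h u n hu
    | cons a v ih =>
      intro u n hu
      have : (hf u v).mk' = (hg u v).mk' := X.lin_ext fun i x hx => by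
        have := ih (u ++ [x]) (n ++ [i]) (List.rel_append hu (.cons hx .nil))
        simpa using this
      exact LinearMap.congr_fun this a
  exact key l [] [] .nil

theorem IsMultilin.mem_of_hom {f : List X → Y} (hf : IsMultilin K f) (S : Submodule K Y)
    (h : ∀ l n, X.IsHom l n → f l ∈ S) (l : List X) : f l ∈ S := by
  have hq : IsMultilin K fun l => S.mkQ (f l) := fun u v =>
    (S.mkQ ∘ₗ (hf u v).mk').isLinear
  have := hq.ext_hom (g := fun _ => 0) (fun u v => (0 : X →ₗ[K] Y ⧸ S).isLinear)
    (fun l n hl => by simpa using h l n hl) l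
  simpa using this

theorem IsMultilin.map_rsgn {f : List X → Y} (hf : IsMultilin K f) :
    IsMultilin K fun l => f (l.map X.rsgn) := fun u v => by
  simpa [Function.comp_def] using ((hf (u.map X.rsgn) (v.map X.rsgn)).mk' ∘ₗ X.rsgn).isLinear

theorem IsMultilin.map_hom {f : List X → Y} (hf : IsMultilin K f) {l : List X} {n : List ℤ}
    (h : X.IsHom l n) : f (l.map X.rsgn) = GrMod.eps (GrMod.rdeg n) • f l := by
  have key : ∀ (l : List X) (n : List ℤ), X.IsHom l n → ∀ u : List X,
      f (u ++ l.map X.rsgn) = GrMod.eps (GrMod.rdeg n) • f (u ++ l) := by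
    intro l n h
    induction h with
    | nil => intro u; simp
    | @cons a i l n ha _ ih =>
      intro u
      have h1 := ih (u ++ [X.rsgn a])
      have h2 : f (u ++ X.rsgn a :: l) = GrMod.eps (i - 1) • f (u ++ a :: l) := by
        rw [X.rsgn_of_mem ha]
        exact map_zsmul (hf u l).mk' _ _
      simp only [List.append_assoc, List.cons_append, List.nil_append] at h1
      simp only [List.map_cons, h1, h2, GrMod.rdeg_cons, GrMod.eps_add, smul_smul]
      rw [mul_comm]
  simpa using key l n h []

theorem IsMultilin.comp_lin {Z : Type*} [AddCommGroup Z] [Module K Z] {f : List X → Y}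
    (hf : IsMultilin K f) (φ : Y →ₗ[K] Z) : IsMultilin K fun l => φ (f l) := fun u v =>
  (φ ∘ₗ (hf u v).mk').isLinear

theorem IsMultilin.add {f g : List X → Y} (hf : IsMultilin K f) (hg : IsMultilin K g) :
    IsMultilin K fun l => f l + g l := fun u v => ((hf u v).mk' + (hg u v).mk').isLinear

theorem IsMultilin.neg {f : List X → Y} (hf : IsMultilin K f) :
    IsMultilin K fun l => -f l := fun u v => (-(hf u v).mk').isLinear

theorem IsMultilin.of_apply {Z : Type*} [AddCommGroup Z] [Module K Z] {f : List X → Z →ₗ[K] Y}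
    (h : ∀ z, IsMultilin K fun l => f l z) : IsMultilin K f := fun u v =>
  ⟨fun a b => LinearMap.ext fun z => (h z u v).map_add a b,
    fun c a => LinearMap.ext fun z => (h z u v).map_smul c a⟩

theorem IsMultilin.zero : IsMultilin K (fun _ : List X => (0 : Y)) := fun _ _ =>
  (0 : X →ₗ[K] Y).isLinear

theorem IsMultilin.prepend {f : List X → Y} (hf : IsMultilin K f) (w : List X) :
    IsMultilin K fun l => f (w ++ l) := fun u v => by
  simpa using hf (w ++ u) v

theorem IsMultilin.append {f : List X → Y} (hf : IsMultilin K f) (w : List X) :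
    IsMultilin K fun l => f (l ++ w) := fun u v => by
  simpa using hf u (v ++ w)

theorem IsLinearMap.splitSum {f : X → List X → List X → Y} (l : List X)
    (hf : ∀ u v, l = u ++ v → IsLinearMap K fun a => f a u v) :
    IsLinearMap K fun a => splitSum (f a) l := by
  constructor
  · intro x y
    rw [← splitSum_add]
    exact splitSum_congr l fun u v h => (hf u v h).map_add x y
  · intro c x
    have := splitSum_hom (c • (LinearMap.id : Y →ₗ[K] Y)) (f x) l
    simp only [LinearMap.smul_apply, LinearMap.id_apply] at this
    rw [this]
    exact splitSum_congr l fun u v h => (hf u v h).map_smul c x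

theorem IsMultilin.splitSum {f : List X → List X → Y} (h₁ : ∀ v, IsMultilin K fun u => f u v)
    (h₂ : ∀ u, IsMultilin K fun v => f u v) : IsMultilin K fun l => splitSum f l := by
  intro u v
  simp only [splitSum_append_cons]
  have e₁ := IsLinearMap.splitSum (K := K) (f := fun a x y => f x (y ++ a :: v)) u
    fun x y _ => h₂ x y v
  have e₂ := IsLinearMap.splitSum (K := K) (f := fun a x y => f (u ++ a :: x) y) v
    fun x y _ => h₁ y u x
  exact (e₁.mk' + e₂.mk').isLinear

end Multilin

/-- A strictly unital `A∞`-algebra structure on a graded vector space `X`. The word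
`μ [a_d, …, a_1]` is `μ^d(a_d, …, a_1)`, an operation of degree `2 - d`. The sign
`(-1)^{‖a_1‖ + ⋯ + ‖a_n‖}` is written by applying `X.rsgn` to the entries `a_n, …, a_1`. -/
structure AInfStr {K : Type u} [Field K] (X : GrMod K) where
  μ : List X → X
  multilin : IsMultilin K μ
  μ_nil : μ [] = 0
  μ_mem : ∀ l n, X.IsHom l n → μ l ∈ X.gr (GrMod.rdeg n + 2)
  assoc : ∀ l, splitSum₃ (fun u v w => μ (u ++ μ v :: w.map X.rsgn)) l = 0
  one : X
  one_mem : one ∈ X.gr 0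
  μ_one : μ [one] = 0
  one_left : ∀ a, μ [one, a] = X.sgn a
  one_right : ∀ a, μ [a, one] = a
  μ_eq_zero : ∀ l, 3 ≤ l.length → one ∈ l → μ l = 0

/-- A strictly unital `A∞`-bimodule over `A`. The value `act [a'_s, …, a'_1] [a_r, …, a_1] p` is
`μ^{s;1;r}(a'_s, …, a'_1; p; a_r, …, a_1)`, an operation of degree `1 - r - s`. -/
structure ABimod {K : Type u} [Field K] {X : GrMod K} (A : AInfStr X) extends GrMod K where
  act : List X → List X → carrier →ₗ[K] carrier
  multilin_left : ∀ r, IsMultilin K fun l => act l r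
  multilin_right : ∀ l, IsMultilin K fun r => act l r
  act_mem : ∀ l m r n i p, X.IsHom l m → X.IsHom r n → p ∈ gr i →
    act l r p ∈ gr (GrMod.rdeg m + i + GrMod.rdeg n + 1)
  assoc : ∀ l r p,
    splitSum (fun x y => splitSum (fun z w => act x (w.map X.rsgn) (act y z p)) r) l +
    splitSum₃ (fun x y z => act l (x ++ A.μ y :: z.map X.rsgn) p) r +
    splitSum₃ (fun x y z => act (x ++ A.μ y :: z.map X.rsgn) (r.map X.rsgn) (toGrMod.sgn p)) l = 0
  one_left : ∀ p, act [A.one] [] p = -toGrMod.sgn p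
  one_right : ∀ p, act [] [A.one] p = p
  act_eq_zero : ∀ l r, 2 ≤ l.length + r.length → (A.one ∈ l ∨ A.one ∈ r) → act l r = 0

section Bimodules

variable {K : Type u} [Field K] {X : GrMod K} {A : AInfStr X}

theorem AInfStr.rsgn_μ (A : AInfStr X) (l : List X) : X.rsgn (A.μ l) = -A.μ (l.map X.rsgn) := by
  refine (A.multilin.comp_lin X.rsgn).ext_hom (A.multilin.map_rsgn.neg) (fun l n hl => ?_) l
  rw [X.rsgn_of_mem (A.μ_mem l n hl), A.multilin.map_hom hl,
    show GrMod.rdeg n + 2 - 1 = GrMod.rdeg n + 1 by ring, GrMod.eps_add_one, neg_smul]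

theorem ABimod.sgn_act (P : ABimod A) (l r : List X) (p : P.carrier) :
    P.sgn (P.act l r p) = -P.act (l.map X.rsgn) (r.map X.rsgn) (P.sgn p) := by
  have h : P.sgn ∘ₗ P.act l r = -(P.act (l.map X.rsgn) (r.map X.rsgn) ∘ₗ P.sgn) := by
    refine IsMultilin.ext_hom (f := fun l => P.sgn ∘ₗ P.act l r)
      (g := fun l => -(P.act (l.map X.rsgn) (r.map X.rsgn) ∘ₗ P.sgn))
      ((P.multilin_left r).comp_lin (LinearMap.llcomp K _ _ _ P.sgn))
      ((P.multilin_left _).map_rsgn.comp_lin (LinearMap.lcomp K P.carrier P.sgn)).neg ?_ l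
    intro l m hl
    refine IsMultilin.ext_hom (f := fun r => P.sgn ∘ₗ P.act l r)
      (g := fun r => -(P.act (l.map X.rsgn) (r.map X.rsgn) ∘ₗ P.sgn))
      ((P.multilin_right l).comp_lin (LinearMap.llcomp K _ _ _ P.sgn))
      ((P.multilin_right _).map_rsgn.comp_lin (LinearMap.lcomp K P.carrier P.sgn)).neg ?_ r
    intro r n hr
    refine P.lin_ext fun i p hp => ?_
    have e₁ := (P.multilin_left (r.map X.rsgn)).map_hom hl
    have e₂ := (P.multilin_right l).map_hom hr
    simp only [LinearMap.comp_apply, LinearMap.neg_apply]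
    rw [P.sgn_of_mem (P.act_mem l m r n i p hl hr hp), e₁, e₂, P.sgn_of_mem hp]
    simp only [GrMod.eps_add, GrMod.eps_one, smul_smul, LinearMap.smul_apply, map_zsmul, ← neg_smul]
    congr 1; ring
  simpa using LinearMap.congr_fun h p

/-- The diagonal bimodule, with
`μ^{s;1;r}(a'_s, …; a; a_r, …, a_1) = (-1)^{‖a_1‖ + ⋯ + ‖a_r‖ + 1} μ^{r+1+s}(a'_s, …, a, …, a_1)`. -/
noncomputable def diag (A : AInfStr X) : ABimod A where
  toGrMod := X
  act l r := -(A.multilin l (r.map X.rsgn)).mk'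
  multilin_left r := .of_apply fun p => (A.multilin.append (p :: r.map X.rsgn)).neg
  multilin_right l := .of_apply fun p => by
    have := (A.multilin.prepend (l ++ [p])).map_rsgn.neg
    simpa using this
  act_mem l m r n i p hl hr hp := by
    have h' : X.IsHom (r.map X.rsgn) n := by
      clear hp hl
      induction hr with
      | nil => exact .nil
      | cons h _ ih => exact .cons (X.rsgn_mem h) ih
    have := A.μ_mem _ _ (List.rel_append hl (List.Forall₂.cons hp h'))
    simp only [GrMod.rdeg_append, GrMod.rdeg_cons] at this
    rw [show GrMod.rdeg m + i + GrMod.rdeg n + 1 =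
      GrMod.rdeg m + (i - 1 + GrMod.rdeg n) + 2 by ring]
    simpa using this
  assoc l r p := by
    have h := A.assoc (l ++ p :: r.map X.rsgn)
    simp only [splitSum₃, splitSum_append_cons, splitSum_add, splitSum_map, List.map_append,
      List.map_cons, List.append_assoc, List.cons_append, GrMod.map_rsgn_rsgn] at h
    have hh : ∀ (a : X) (u v : List X), A.μ (u ++ (-a) :: v) = -A.μ (u ++ a :: v) :=
      fun a u v => (A.multilin u v).map_neg a
    have hh' : ∀ (a : X) (l u v : List X),
        A.μ (l ++ p :: (u ++ (-a) :: v)) = -A.μ (l ++ p :: (u ++ a :: v)) := fun a l u v => by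
      have := hh a (l ++ p :: u) v
      simpa using this
    simp only [splitSum₃, LinearMap.neg_apply, IsLinearMap.mk'_apply, List.map_append,
      List.map_cons, List.map_map, hh, hh', neg_neg, A.rsgn_μ, List.append_assoc,
      List.cons_append]
    have hs : ∀ u l v : List X, A.μ (u ++ A.μ l :: (v ++ X.rsgn p :: r)) =
        -A.μ (u ++ A.μ l :: (v ++ X.sgn p :: r)) := fun u l v => by
      have := (A.multilin (u ++ A.μ l :: v) r).map_neg (X.sgn p)
      simpa [GrMod.rsgn] using this
    simp only [GrMod.rsgn_comp_rsgn, List.map_id] at h ⊢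
    simp only [hs] at h
    rw [← h]
    abel
  one_left p := by simp [A.one_left]
  one_right p := by
    have : X.rsgn A.one = -A.one := by simp [X.rsgn_of_mem A.one_mem]
    have h := (A.multilin [p] []).map_neg A.one
    simp only [List.cons_append, List.nil_append, A.one_right] at h
    simp [this, h]
  act_eq_zero l r h₁ h₂ := by
    ext p
    have : X.rsgn A.one = -A.one := by simp [X.rsgn_of_mem A.one_mem]
    rcases h₂ with h | h
    · simp [A.μ_eq_zero (l ++ p :: r.map X.rsgn) (by simp; omega) (by simp [h])]
    · obtain ⟨r₁, r₂, rfl⟩ := List.append_of_mem h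
      have e := (A.multilin (l ++ p :: r₁.map X.rsgn) (r₂.map X.rsgn)).map_neg A.one
      simp only [List.append_assoc, List.cons_append] at e
      simp only [LinearMap.neg_apply, IsLinearMap.mk'_apply, List.map_append, List.map_cons, this, e,
        LinearMap.zero_apply, neg_neg]
      exact A.μ_eq_zero _ (by simp at h₁ ⊢; omega) (by simp)

end Bimodules

section BarWords

variable {K : Type u} [Field K] {X : GrMod K} (A : AInfStr X)

/-- The tensor algebra `T(Ā)`, where `Ā = A / K e` is the quotient by the unit. -/
abbrev BarT : Type u := TensorAlgebra K (X ⧸ Submodule.span K {A.one})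

/-- The word `a_d ⊗ ⋯ ⊗ a_1` in `T(Ā)`. -/
noncomputable def bar (l : List X) : BarT A :=
  (l.map fun a => TensorAlgebra.ι K ((Submodule.span K {A.one}).mkQ a)).prod

@[simp] theorem bar_nil : bar A [] = 1 := rfl

@[simp] theorem bar_cons (a : X) (l : List X) :
    bar A (a :: l) = TensorAlgebra.ι K ((Submodule.span K {A.one}).mkQ a) * bar A l := rfl

@[simp] theorem bar_append (l m : List X) : bar A (l ++ m) = bar A l * bar A m := by
  simp [bar]

/-- Multilinear functions of words in `A` which factor through words in `Ā`. -/
def MRed (Y : Type*) [AddCommGroup Y] [Module K Y] : Submodule K (List X → Y) where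
  carrier := {f | IsMultilin K f ∧ ∀ l, A.one ∈ l → f l = 0}
  add_mem' hf hg := ⟨hf.1.add hg.1, fun l h => by simp [hf.2 l h, hg.2 l h]⟩
  zero_mem' := ⟨.zero, fun _ _ => rfl⟩
  smul_mem' c f hf := ⟨hf.1.comp_lin (c • LinearMap.id), fun l h => by simp [hf.2 l h]⟩

variable {A} {Y : Type*} [AddCommGroup Y] [Module K Y]

/-- The operation `f ↦ f(⋯, a)` on multilinear functions. -/
def pushLast : X →ₗ[K] (MRed A Y →ₗ[K] MRed A Y) :=
  LinearMap.mk₂ K (fun a f => ⟨fun l => f.1 (l ++ [a]), f.2.1.append [a], fun _ h =>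
      f.2.2 _ (List.mem_append_left _ h)⟩)
    (fun a b f => Subtype.ext (funext fun l => (f.2.1 l []).map_add a b))
    (fun c a f => Subtype.ext (funext fun l => (f.2.1 l []).map_smul c a))
    (fun _ _ _ => rfl) (fun _ _ _ => rfl)

theorem pushLast_one : pushLast (A := A) (Y := Y) A.one = 0 :=
  LinearMap.ext fun f => Subtype.ext (funext fun l => f.2.2 _ (by simp))

/-- The operation `f ↦ f(⋯, a)`, as a function of the class of `a` in `Ā`. -/
noncomputable def pushQuot : (X ⧸ Submodule.span K {A.one}) →ₗ[K] (MRed A Y →ₗ[K] MRed A Y) :=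
  Submodule.liftQSpanSingleton (R := K) (M := X) (M₂ := MRed A Y →ₗ[K] MRed A Y) A.one
    (pushLast (A := A) (Y := Y)) (pushLast_one (A := A) (Y := Y))

/-- The action of `T(Ā)` on multilinear functions. -/
noncomputable def pushBar : BarT A →ₐ[K] Module.End K (MRed A Y) :=
  TensorAlgebra.lift K (A := Module.End K (MRed A Y)) (pushQuot (A := A) (Y := Y))

theorem pushBar_bar (l m : List X) (f : MRed A Y) :
    (pushBar (bar A l) f).1 m = f.1 (m ++ l) := by
  induction l generalizing f m with
  | nil => simp
  | cons a l ih =>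
    have : pushBar (bar A (a :: l)) f = pushLast a (pushBar (bar A l) f) := by
      simp [pushBar, pushQuot]
    rw [this]
    have h2 := ih (m ++ [a]) f
    simp only [List.append_assoc, List.cons_append, List.nil_append] at h2
    exact h2

/-- The linear map on `T(Ā)` defined by a multilinear function of words. -/
noncomputable def barLift (f : MRed A Y) : BarT A →ₗ[K] Y where
  toFun t := (pushBar t f).1 []
  map_add' s t := by simp
  map_smul' c t := by simp

@[simp] theorem barLift_bar (f : MRed A Y) (l : List X) : barLift f (bar A l) = f.1 l :=
  pushBar_bar l [] f

theorem span_bar : Submodule.span K (Set.range (bar A)) = ⊤ := by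
  refine top_le_iff.1 fun t _ => ?_
  induction t using TensorAlgebra.induction with
  | algebraMap r =>
    rw [Algebra.algebraMap_eq_smul_one]
    exact Submodule.smul_mem _ _ (Submodule.subset_span ⟨[], rfl⟩)
  | ι x =>
    obtain ⟨a, rfl⟩ := Submodule.mkQ_surjective _ x
    exact Submodule.subset_span ⟨[a], by simp⟩
  | mul a b ha hb =>
    have h := Submodule.mul_mem_mul (ha trivial) (hb trivial)
    rw [Submodule.span_mul_span] at h
    refine Submodule.span_mono ?_ h
    rintro _ ⟨_, ⟨l, rfl⟩, _, ⟨m, rfl⟩, rfl⟩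
    exact ⟨l ++ m, by simp⟩
  | add a b ha hb => exact add_mem (ha trivial) (hb trivial)

theorem bar_eq_zero {l : List X} (h : A.one ∈ l) : bar A l = 0 := by
  obtain ⟨u, v, rfl⟩ := List.append_of_mem h
  have : Submodule.Quotient.mk (p := Submodule.span K {A.one}) A.one = 0 :=
    (Submodule.Quotient.mk_eq_zero _).2 (Submodule.mem_span_singleton_self _)
  simp [this]

theorem bar_multilin : IsMultilin K (bar A) := fun u v => by
  have := ((LinearMap.mulLeft K (bar A u)) ∘ₗ (LinearMap.mulRight K (bar A v)) ∘ₗ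
    (TensorAlgebra.ι K) ∘ₗ (Submodule.span K {A.one}).mkQ).isLinear
  simpa [Function.comp_def] using this

/-- The part of degree `n` of an element of `T(Ā[1])`. -/
noncomputable def barPart (n : ℤ) : BarT A →ₗ[K] BarT A :=
  ({ toFun := fun x => x.coeff n, map_add' := fun _ _ => rfl, map_smul' := fun _ _ => rfl } :
      AddMonoidAlgebra (BarT A) ℤ →ₗ[K] BarT A) ∘ₗ
    (TensorAlgebra.lift K ((Submodule.span K {A.one}).liftQ
      (X.lin fun i => ({
          toFun := fun a => AddMonoidAlgebra.single (i - 1) (bar A [a.1])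
          map_add' := fun a b => by
            rw [← AddMonoidAlgebra.single_add]; simp [-LaurentPolynomial.single_eq_C_mul_T]
          map_smul' := fun c a => by
            rw [RingHom.id_apply, AddMonoidAlgebra.smul_single]; simp [-LaurentPolynomial.single_eq_C_mul_T] } : X.gr i →ₗ[K] AddMonoidAlgebra (BarT A) ℤ)) (by
        rw [Submodule.span_le, Set.singleton_subset_iff]
        have := bar_eq_zero (A := A) (l := [A.one]) (by simp)
        simp [LinearMap.mem_ker, X.lin_of_mem _ A.one_mem, this, -bar_cons]))).toLinearMap

theorem barPart_bar (k : ℤ) {l : List X} {n : List ℤ} (h : X.IsHom l n) :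
    barPart k (bar A l) = if GrMod.rdeg n = k then bar A l else 0 := by
  have key : ∀ f : X ⧸ Submodule.span K {A.one} →ₗ[K] AddMonoidAlgebra (BarT A) ℤ,
      (∀ i, ∀ a ∈ X.gr i, f ((Submodule.span K {A.one}).mkQ a) =
        AddMonoidAlgebra.single (i - 1) (bar A [a])) →
      TensorAlgebra.lift K f (bar A l) = AddMonoidAlgebra.single (GrMod.rdeg n) (bar A l) := by
    intro f hf
    induction h with
    | nil => rw [bar_nil, map_one]; rfl
    | @cons a i l n ha _ ih =>
      rw [bar_cons, map_mul, ih, TensorAlgebra.lift_ι_apply, hf i a ha,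
        AddMonoidAlgebra.single_mul_single]
      simp
  rw [barPart, LinearMap.comp_apply, AlgHom.toLinearMap_apply, key]
  · exact Finsupp.single_apply
  · intro i a ha
    rw [Submodule.mkQ_apply, Submodule.liftQ_apply, X.lin_of_mem _ ha]
    rfl

end BarWords

section TensorOps

variable {K : Type u} [Field K] {X : GrMod K} {A : AInfStr X} (Q P : ABimod A)
  {Y : Type*} [AddCommGroup Y] [Module K Y]

/-- The terms of the differential on `Q ⊗ T(Ā[1]) ⊗ P` which involve `μ_Q`. -/
noncomputable def opQ (l' : List X) (f : List X → Q.carrier →ₗ[K] P.carrier →ₗ[K] Y) (l : List X) :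
    Q.carrier →ₗ[K] P.carrier →ₗ[K] Y :=
  splitSum (fun u v => (f (v.map X.rsgn)).compl₁₂ (Q.act l' u) P.sgn) l

/-- The terms of the differential on `Q ⊗ T(Ā[1]) ⊗ P` which involve `μ_A`. -/
noncomputable def opA (f : List X → Q.carrier →ₗ[K] P.carrier →ₗ[K] Y) (l : List X) :
    Q.carrier →ₗ[K] P.carrier →ₗ[K] Y :=
  splitSum₃ (fun u v w => (f (u ++ A.μ v :: w.map X.rsgn)).compl₂ P.sgn) l

/-- The terms of the differential on `Q ⊗ T(Ā[1]) ⊗ P` which involve `μ_P`. -/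
noncomputable def opP (r : List X) (f : List X → Q.carrier →ₗ[K] P.carrier →ₗ[K] Y) (l : List X) :
    Q.carrier →ₗ[K] P.carrier →ₗ[K] Y :=
  splitSum (fun u v => (f u).compl₂ (P.act v r)) l

/-- The structure maps of the tensor product, on `q ⊗ l ⊗ p`. With `f l q p = q ⊗ l ⊗ p`, this is
`∑ ± μ_Q(l'; q; u) ⊗ v ⊗ p` (for `r = ∅`), plus `∑ ± q ⊗ u ⊗ μ_A(v) ⊗ w ⊗ p` (for `l' = r = ∅`),
plus `∑ q ⊗ u ⊗ μ_P(v; p; r)` (for `l' = ∅`), where `l = u ⊗ v` or `l = u ⊗ v ⊗ w`. -/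
noncomputable def opT (l' r : List X) (f : List X → Q.carrier →ₗ[K] P.carrier →ₗ[K] Y)
    (l : List X) : Q.carrier →ₗ[K] P.carrier →ₗ[K] Y :=
  (if r = [] then opQ Q P l' f l else 0) + (if l' = [] ∧ r = [] then opA Q P f l else 0) +
    (if l' = [] then opP Q P r f l else 0)

variable {Q P}

theorem splitSum_apply₂ {V W α : Type*} [AddCommGroup V] [Module K V] [AddCommGroup W] [Module K W]
    (F : List α → List α → V →ₗ[K] W →ₗ[K] Y) (l : List α) (q : V) (p : W) :
    splitSum F l q p = splitSum (fun u v => F u v q p) l := by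
  simp [splitSum, LinearMap.sum_apply]

theorem opQ_apply (l' : List X) (f : List X → Q.carrier →ₗ[K] P.carrier →ₗ[K] Y) (l : List X)
    (q : Q.carrier) (p : P.carrier) : opQ Q P l' f l q p =
      splitSum (fun u v => f (v.map X.rsgn) (Q.act l' u q) (P.sgn p)) l := by
  simp [opQ, splitSum_apply₂]

theorem opA_apply (f : List X → Q.carrier →ₗ[K] P.carrier →ₗ[K] Y) (l : List X)
    (q : Q.carrier) (p : P.carrier) : opA Q P f l q p =
      splitSum₃ (fun u v w => f (u ++ A.μ v :: w.map X.rsgn) q (P.sgn p)) l := by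
  simp [opA, splitSum₃, splitSum_apply₂]

theorem opP_apply (r : List X) (f : List X → Q.carrier →ₗ[K] P.carrier →ₗ[K] Y) (l : List X)
    (q : Q.carrier) (p : P.carrier) : opP Q P r f l q p =
      splitSum (fun u v => f u q (P.act v r p)) l := by
  simp [opP, splitSum_apply₂]

theorem splitSum_neg {α : Type*} (f : List α → List α → Y) (l : List α) :
    splitSum (fun u v => -f u v) l = -splitSum f l := by
  simp [splitSum]

theorem splitSum_rot {α M : Type*} [AddCommMonoid M] (f : List α → List α → List α → M)
    (l : List α) :
    splitSum (fun uv w => splitSum (fun u v => f u v w) uv) l =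
      splitSum (fun u vw => splitSum (fun v w => f u v w) vw) l := splitSum_assoc f l

theorem splitSum_rot₁ {α M : Type*} [AddCommMonoid M] (G : List α → List α → List α → List α → M)
    (l : List α) :
    splitSum (fun u x => splitSum (fun v w => splitSum (fun c s => G c s v w) u) x) l =
      splitSum (fun c m => splitSum (fun s x => splitSum (fun v w => G c s v w) x) m) l := by
  rw [← splitSum_rot fun c s x => splitSum (fun v w => G c s v w) x]
  exact splitSum_congr l fun u x _ => splitSum_comm (fun v w c s => G c s v w) x u

theorem splitSum_rot₂ {α M : Type*} [AddCommMonoid M]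
    (G : List α → List α → List α → List α → List α → M) (l : List α) :
    splitSum (fun u x => splitSum (fun v w => splitSum (fun c s =>
      splitSum (fun d e => G c d e v w) s) u) x) l =
    splitSum (fun c m => splitSum (fun d s => splitSum (fun e x =>
      splitSum (fun v w => G c d e v w) x) s) m) l := by
  rw [splitSum_rot₁ fun c s v w => splitSum (fun d e => G c d e v w) s]
  exact splitSum_congr l fun c m _ => splitSum_rot₁ (fun d e v w => G c d e v w) m

theorem splitSum_rot₃ {α M : Type*} [AddCommMonoid M]
    (G : List α → List α → List α → List α → M) (m : List α) :
    splitSum (fun k e => splitSum (fun s y => splitSum (fun v d => G s v d e) y) k) m =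
    splitSum (fun s x => splitSum (fun v w => splitSum (fun d e => G s v d e) w) x) m := by
  rw [splitSum_rot fun s y e => splitSum (fun v d => G s v d e) y]
  exact splitSum_congr m fun s x _ => splitSum_rot (fun v d e => G s v d e) x

section Identities

variable {f : List X → Q.carrier →ₗ[K] P.carrier →ₗ[K] Y}

theorem apply_rsgn_μ (hf : IsMultilin K f) (u v w : List X) (q : Q.carrier) (p : P.carrier) :
    f (u ++ X.rsgn (A.μ v) :: w) q p = -f (u ++ A.μ (v.map X.rsgn) :: w) q p := by
  rw [A.rsgn_μ]
  have := (hf u w).map_neg (A.μ (v.map X.rsgn))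
  simp only [this, LinearMap.neg_apply]

theorem opQ_opP (r l' l : List X) (q : Q.carrier) (p : P.carrier) :
    opQ Q P l' (opP Q P (r.map X.rsgn) f) l q p + opP Q P r (opQ Q P l' f) l q p = 0 := by
  simp only [opQ_apply, opP_apply, splitSum_map, P.sgn_act, map_neg, splitSum_neg]
  rw [splitSum_rot]
  exact add_neg_cancel _

theorem apply_rsgn_μ' (hf : IsMultilin K f) (u v w x : List X) (a : X) (q : Q.carrier)
    (p : P.carrier) : f (u ++ a :: (x ++ X.rsgn (A.μ v) :: w)) q p =
      -f (u ++ a :: (x ++ A.μ (v.map X.rsgn) :: w)) q p := by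
  have := apply_rsgn_μ hf (u ++ a :: x) v w q p
  simpa using this

theorem opA_opA (hf : IsMultilin K f) (l : List X) (q : Q.carrier) (p : P.carrier) :
    opA Q P (opA Q P f) l q p = 0 := by
  have h0 : ∀ c e m, splitSum₃ (fun u v w => f (c ++ A.μ (u ++ A.μ v :: w.map X.rsgn) :: e) q p) m
      = 0 := fun c e m => by
    have this := A.assoc m
    have h2 := splitSum_hom ((LinearMap.applyₗ p) ∘ₗ (LinearMap.applyₗ q) ∘ₗ (hf c e).mk')
      (fun u vw => splitSum (fun v w => A.μ (u ++ A.μ v :: w.map X.rsgn)) vw) m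
    simp only [splitSum₃] at this
    rw [this, map_zero] at h2
    rw [h2, splitSum₃]
    simp only [splitSum_hom]
    rfl
  simp only [opA_apply, splitSum₃, splitSum_append_cons, splitSum_add, splitSum_map, List.map_append,
    List.map_cons, List.append_assoc, List.cons_append, List.map_map, X.rsgn_comp_rsgn, List.map_id,
    GrMod.sgn_sgn, apply_rsgn_μ' hf, splitSum_neg] at h0 ⊢
  rw [splitSum_rot₂ fun c d e v w => f (c ++ A.μ d :: (e.map X.rsgn ++ A.μ (v.map X.rsgn) :: w)) q p,
    splitSum_rot₁ fun c s v w => splitSum (fun d e =>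
      f (c ++ A.μ (s ++ A.μ v :: d.map X.rsgn) :: e) q p) w]
  simp only [← splitSum_rot₃ fun s v d e => f (_ ++ A.μ (s ++ A.μ v :: d.map X.rsgn) :: e) q p]
  simp only [h0, splitSum_zero]
  abel

theorem opQ_opA (hf : IsMultilin K f) (l' l : List X) (q : Q.carrier) (p : P.carrier) :
    splitSum (fun x y => opQ Q P y (opQ Q P x f) l q p) l' +
      splitSum₃ (fun x y z => opQ Q P (x ++ A.μ y :: z.map X.rsgn) f (l.map X.rsgn) (Q.sgn q)
        (P.sgn p)) l' + opQ Q P l' (opA Q P f) l q p + opA Q P (opQ Q P l' f) l q p = 0 := by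
  have h0 : ∀ m d, splitSum (fun x y => splitSum (fun z w =>
        f d (Q.act x (w.map X.rsgn) (Q.act y z q)) p) m) l' +
      splitSum (fun x v => splitSum (fun y z => f d (Q.act l' (x ++ A.μ y :: z.map X.rsgn) q) p) v) m +
      splitSum (fun x v => splitSum (fun y z =>
        f d (Q.act (x ++ A.μ y :: z.map X.rsgn) (m.map X.rsgn) (Q.sgn q)) p) v) l' = 0 := by
    intro m d
    have h := congrArg ((f d).flip p) (Q.assoc l' m q)
    simpa only [map_add, splitSum₃, splitSum_hom, map_zero, LinearMap.flip_apply] using h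
  have h1 : splitSum (fun m d => splitSum (fun x y => splitSum (fun z w =>
        f d (Q.act x (w.map X.rsgn) (Q.act y z q)) p) m) l' +
      splitSum (fun x v => splitSum (fun y z => f d (Q.act l' (x ++ A.μ y :: z.map X.rsgn) q) p) v) m +
      splitSum (fun x v => splitSum (fun y z =>
        f d (Q.act (x ++ A.μ y :: z.map X.rsgn) (m.map X.rsgn) (Q.sgn q)) p) v) l') l = 0 := by
    simp only [h0, splitSum_zero]
  rw [splitSum_add, splitSum_add] at h1
  have e1 : splitSum (fun m d => splitSum (fun x y => splitSum (fun z w =>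
        f d (Q.act x (w.map X.rsgn) (Q.act y z q)) p) m) l') l =
      splitSum (fun x y => splitSum (fun u v => splitSum (fun z w =>
        f w (Q.act x (z.map X.rsgn) (Q.act y u q)) p) v) l) l' := by
    rw [splitSum_comm fun m d x y => splitSum (fun z w =>
        f d (Q.act x (w.map X.rsgn) (Q.act y z q)) p) m]
    exact splitSum_congr _ fun x y _ =>
      splitSum_rot (fun z w d => f d (Q.act x (w.map X.rsgn) (Q.act y z q)) p) l
  have e3 : splitSum (fun m d => splitSum (fun x v => splitSum (fun y z =>
        f d (Q.act (x ++ A.μ y :: z.map X.rsgn) (m.map X.rsgn) (Q.sgn q)) p) v) l') l =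
      splitSum (fun x v => splitSum (fun y z => splitSum (fun m d =>
        f d (Q.act (x ++ A.μ y :: z.map X.rsgn) (m.map X.rsgn) (Q.sgn q)) p) l) v) l' := by
    rw [splitSum_comm fun m d x v => splitSum (fun y z =>
        f d (Q.act (x ++ A.μ y :: z.map X.rsgn) (m.map X.rsgn) (Q.sgn q)) p) v]
    exact splitSum_congr _ fun x v _ => splitSum_comm (fun m d y z =>
      f d (Q.act (x ++ A.μ y :: z.map X.rsgn) (m.map X.rsgn) (Q.sgn q)) p) l v
  have e2 := splitSum_rot₃ (fun x y z d => f d (Q.act l' (x ++ A.μ y :: z.map X.rsgn) q) p) l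
  have e4 := splitSum_rot₁ (fun c s v w =>
    f (s.map X.rsgn ++ A.μ (v.map X.rsgn) :: w) (Q.act l' c q) p) l
  rw [e1, e2, e3] at h1
  simp only [opA_apply, opQ_apply, splitSum₃, splitSum_append_cons, splitSum_add, splitSum_map,
    List.map_append, List.map_cons, List.map_map, X.rsgn_comp_rsgn, List.map_id,
    GrMod.sgn_sgn, apply_rsgn_μ hf, splitSum_neg]
  rw [e4, ← h1]
  abel

theorem opA_opP (r l : List X) (q : Q.carrier) (p : P.carrier) :
    splitSum (fun z w => opP Q P z (opP Q P (w.map X.rsgn) f) l q p) r +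
      splitSum₃ (fun x y z => opP Q P (x ++ A.μ y :: z.map X.rsgn) f l q p) r +
      opA Q P (opP Q P (r.map X.rsgn) f) l q p + opP Q P r (opA Q P f) l q p = 0 := by
  have h0 : ∀ d m, splitSum (fun x y => splitSum (fun z w =>
        f d q (P.act x (w.map X.rsgn) (P.act y z p))) r) m +
      splitSum (fun x v => splitSum (fun y z => f d q (P.act m (x ++ A.μ y :: z.map X.rsgn) p)) v) r +
      splitSum (fun x v => splitSum (fun y z =>
        f d q (P.act (x ++ A.μ y :: z.map X.rsgn) (r.map X.rsgn) (P.sgn p))) v) m = 0 := by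
    intro d m
    have h := congrArg (f d q) (P.assoc m r p)
    simpa only [map_add, splitSum₃, splitSum_hom, map_zero] using h
  have h1 : splitSum (fun d m => splitSum (fun x y => splitSum (fun z w =>
        f d q (P.act x (w.map X.rsgn) (P.act y z p))) r) m +
      splitSum (fun x v => splitSum (fun y z => f d q (P.act m (x ++ A.μ y :: z.map X.rsgn) p)) v) r +
      splitSum (fun x v => splitSum (fun y z =>
        f d q (P.act (x ++ A.μ y :: z.map X.rsgn) (r.map X.rsgn) (P.sgn p))) v) m) l = 0 := by
    simp only [h0, splitSum_zero]
  rw [splitSum_add, splitSum_add] at h1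
  have e1 : splitSum (fun d m => splitSum (fun x y => splitSum (fun z w =>
        f d q (P.act x (w.map X.rsgn) (P.act y z p))) r) m) l =
      splitSum (fun z w => splitSum (fun u y => splitSum (fun d x =>
        f d q (P.act x (w.map X.rsgn) (P.act y z p))) u) l) r := by
    rw [← splitSum_rot fun d x y => splitSum (fun z w =>
        f d q (P.act x (w.map X.rsgn) (P.act y z p))) r]
    rw [← splitSum_comm fun u y z w => splitSum (fun d x =>
        f d q (P.act x (w.map X.rsgn) (P.act y z p))) u]
    exact splitSum_congr _ fun u y _ => splitSum_comm (fun d x z w =>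
        f d q (P.act x (w.map X.rsgn) (P.act y z p))) u r
  have e2 : splitSum (fun d m => splitSum (fun x v => splitSum (fun y z =>
        f d q (P.act m (x ++ A.μ y :: z.map X.rsgn) p)) v) r) l =
      splitSum (fun x v => splitSum (fun y z => splitSum (fun d m =>
        f d q (P.act m (x ++ A.μ y :: z.map X.rsgn) p)) l) v) r := by
    rw [splitSum_comm fun d m x v => splitSum (fun y z =>
        f d q (P.act m (x ++ A.μ y :: z.map X.rsgn) p)) v]
    exact splitSum_congr _ fun x v _ => splitSum_comm (fun d m y z =>
      f d q (P.act m (x ++ A.μ y :: z.map X.rsgn) p)) l v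
  have e3 := splitSum_rot₁ (fun d x y z =>
    f d q (P.act (x ++ A.μ y :: z.map X.rsgn) (r.map X.rsgn) (P.sgn p))) l
  have e4 := splitSum_rot₃ (fun x y z d =>
    f (x ++ A.μ y :: z.map X.rsgn) q (P.act (d.map X.rsgn) (r.map X.rsgn) (P.sgn p))) l
  rw [e1, e2, ← e3] at h1
  simp only [opA_apply, opP_apply, splitSum₃, splitSum_append_cons, splitSum_add, splitSum_map, P.sgn_act, map_neg, splitSum_neg]
  rw [e4, ← h1]
  abel

theorem opQ_add (l' l : List X) (f g : List X → Q.carrier →ₗ[K] P.carrier →ₗ[K] Y)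
    (q : Q.carrier) (p : P.carrier) :
    opQ Q P l' (fun l => f l + g l) l q p = opQ Q P l' f l q p + opQ Q P l' g l q p := by
  simp only [opQ_apply, LinearMap.add_apply, splitSum_add]

theorem opA_add (l : List X) (f g : List X → Q.carrier →ₗ[K] P.carrier →ₗ[K] Y)
    (q : Q.carrier) (p : P.carrier) :
    opA Q P (fun l => f l + g l) l q p = opA Q P f l q p + opA Q P g l q p := by
  simp only [opA_apply, LinearMap.add_apply, splitSum₃, splitSum_add]

theorem opP_add (r l : List X) (f g : List X → Q.carrier →ₗ[K] P.carrier →ₗ[K] Y)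
    (q : Q.carrier) (p : P.carrier) :
    opP Q P r (fun l => f l + g l) l q p = opP Q P r f l q p + opP Q P r g l q p := by
  simp only [opP_apply, LinearMap.add_apply, splitSum_add]

theorem opT_nil_nil (f : List X → Q.carrier →ₗ[K] P.carrier →ₗ[K] Y) :
    opT Q P [] [] f = fun l => opQ Q P [] f l + opA Q P f l + opP Q P [] f l := by
  funext l; simp [opT]

theorem opT_left {l' : List X} (h : l' ≠ []) (f : List X → Q.carrier →ₗ[K] P.carrier →ₗ[K] Y) :
    opT Q P l' [] f = opQ Q P l' f := by
  funext l; simp [opT, h]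

theorem opT_right {r : List X} (h : r ≠ []) (f : List X → Q.carrier →ₗ[K] P.carrier →ₗ[K] Y) :
    opT Q P [] r f = opP Q P r f := by
  funext l; simp [opT, h]

theorem opT_zero {l' r : List X} (hl : l' ≠ []) (hr : r ≠ [])
    (f : List X → Q.carrier →ₗ[K] P.carrier →ₗ[K] Y) : opT Q P l' r f = 0 := by
  funext l; simp [opT, hl, hr]

theorem opT_of_zero (l' r l : List X) (q : Q.carrier) (p : P.carrier) :
    opT Q P l' r (0 : List X → Q.carrier →ₗ[K] P.carrier →ₗ[K] Y) l q p = 0 := by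
  have hq : opQ Q P l' (0 : List X → Q.carrier →ₗ[K] P.carrier →ₗ[K] Y) l q p = 0 := by
    simp [opQ_apply, splitSum_zero]
  have ha : opA Q P (0 : List X → Q.carrier →ₗ[K] P.carrier →ₗ[K] Y) l q p = 0 := by
    simp [opA_apply, splitSum₃, splitSum_zero]
  have hp : opP Q P r (0 : List X → Q.carrier →ₗ[K] P.carrier →ₗ[K] Y) l q p = 0 := by
    simp [opP_apply, splitSum_zero]
  simp only [opT]
  split_ifs <;> simp [hq, ha, hp]

theorem splitSum_single_left {α M : Type*} [AddCommMonoid M] (f : List α → List α → M) (l : List α)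
    (h : ∀ u v, l = u ++ v → u ≠ [] → f u v = 0) : splitSum f l = f [] l := by
  cases l with
  | nil => simp [splitSum_nil]
  | cons a l =>
    rw [splitSum_cons, splitSum_congr (g := fun _ _ => 0), splitSum_zero, add_zero]
    intro u v e
    exact h _ _ (by simp [e]) (by simp)

theorem splitSum_single_right {α M : Type*} [AddCommMonoid M] (f : List α → List α → M) (l : List α)
    (h : ∀ u v, l = u ++ v → v ≠ [] → f u v = 0) : splitSum f l = f l [] := by
  induction l generalizing f with
  | nil => simp [splitSum_nil]
  | cons a l ih =>
    rw [splitSum_cons, h [] (a :: l) rfl (by simp), zero_add]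
    exact ih (fun u v => f (a :: u) v) fun u v e hv => h _ _ (by simp [e]) hv

/-- Sums with a contribution from each of the two trivial splittings. -/
theorem splitSum_ends {α M : Type*} [AddCommMonoid M] (f : List α → List α → M) (l : List α)
    (hl : l ≠ []) (g : List α → List α → M) (c d : M)
    (h : ∀ u v, l = u ++ v → u ≠ [] → v ≠ [] → f u v = g u v)
    (h₁ : f [] l = g [] l + c) (h₂ : f l [] = g l [] + d) : splitSum f l = splitSum g l + c + d := by
  obtain ⟨a, m, rfl⟩ := List.exists_cons_of_ne_nil hl
  have e : splitSum (fun u v => f (a :: u) v) m =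
      splitSum (fun u v => g (a :: u) v + if v = [] then d else 0) m :=
    splitSum_congr _ fun u v e => by
      by_cases hv : v = []
      · subst hv
        simp only [List.append_nil] at e
        subst e
        simpa using h₂
      · simpa [hv] using h (a :: u) v (by simp [e]) (by simp) hv
  rw [splitSum_cons, e, splitSum_add, splitSum_ite_right (fun _ => d), splitSum_cons, h₁]
  abel

theorem opT_assoc (hf : IsMultilin K f) (l' r l : List X) (q : Q.carrier) (p : P.carrier) :
    splitSum (fun x y => splitSum (fun z w =>
      opT Q P y z (opT Q P x (w.map X.rsgn) f) l q p) r) l' +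
    splitSum₃ (fun x y z => opT Q P l' (x ++ A.μ y :: z.map X.rsgn) f l q p) r +
    splitSum₃ (fun x y z => opT Q P (x ++ A.μ y :: z.map X.rsgn) (r.map X.rsgn) f
      (l.map X.rsgn) (Q.sgn q) (P.sgn p)) l' = 0 := by
  have hne : ∀ (x z : List X) (y : X), x ++ y :: z ≠ [] := by simp
  have hmap : ∀ {r : List X}, r ≠ [] → r.map X.rsgn ≠ [] := by simp
  have hQ := opQ_opA hf l' l q p
  have hP := opA_opP (f := f) r l q p
  have hA := opA_opA hf l q p
  have hQP := opQ_opP (f := f) r l' l q p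
  by_cases hl : l' = []
  · by_cases hr : r = []
    · subst hl hr
      simp only [splitSum₃, splitSum_nil, List.map_nil, opT_nil_nil, LinearMap.add_apply, opQ_add,
        opA_add, opP_add, opT_left (hne _ _ _), opT_right (hne _ _ _)] at hQ hP hQP ⊢
      have h := congrArg₂ (· + ·) (congrArg₂ (· + ·) hQ hP) (congrArg₂ (· + ·) hA hQP)
      simp only [add_zero] at h
      refine Eq.trans ?_ h
      abel
    · subst hl
      simp only [splitSum₃, splitSum_nil, opT_zero (hne _ _ _) (hmap hr),
        opT_right (hne _ _ _), Pi.zero_apply, LinearMap.zero_apply, add_zero] at hP hQP ⊢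
      rw [splitSum_ends _ r hr (fun z w => opP Q P z (opP Q P (w.map X.rsgn) f) l q p)
        (opQ Q P [] (opP Q P (r.map X.rsgn) f) l q p + opA Q P (opP Q P (r.map X.rsgn) f) l q p)
        (opP Q P r (opQ Q P [] f) l q p + opP Q P r (opA Q P f) l q p)]
      · rw [← add_zero (0 : Y)]
        nth_rewrite 1 [← hP]
        rw [← hQP]
        abel
      · intro u v _ hu hv
        rw [opT_right hu, opT_right (hmap hv)]
      · rw [opT_nil_nil, opT_right (hmap hr)]
        simp only [LinearMap.add_apply]
        abel
      · rw [List.map_nil, opT_nil_nil, opT_right hr]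
        simp only [opP_add]
        abel
  · by_cases hr : r = []
    · subst hr
      simp only [splitSum₃, splitSum_nil, List.map_nil, opT_zero hl (hne _ _ _),
        opT_left (hne _ _ _), Pi.zero_apply, LinearMap.zero_apply, add_zero] at hQ hQP ⊢
      rw [splitSum_ends _ l' hl (fun x y => opQ Q P y (opQ Q P x f) l q p)
        (opQ Q P l' (opA Q P f) l q p + opQ Q P l' (opP Q P [] f) l q p)
        (opA Q P (opQ Q P l' f) l q p + opP Q P [] (opQ Q P l' f) l q p)]
      · rw [← add_zero (0 : Y)]
        nth_rewrite 1 [← hQ]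
        rw [← hQP]
        abel
      · intro u v _ hu hv
        rw [opT_left hu, opT_left hv]
      · rw [opT_nil_nil, opT_left hl]
        simp only [opQ_add]
        abel
      · rw [opT_nil_nil, opT_left hl]
        simp only [LinearMap.add_apply]
        abel
    · simp only [splitSum₃, opT_zero hl (hne _ _ _), opT_zero (hne _ _ _) (hmap hr),
        Pi.zero_apply, LinearMap.zero_apply, splitSum_zero, add_zero]
      rw [splitSum_ends _ l' hl (fun _ _ => 0) (opQ Q P l' (opP Q P (r.map X.rsgn) f) l q p)
        (opP Q P r (opQ Q P l' f) l q p), splitSum_zero, zero_add, hQP]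
      · intro u v _ hu hv
        rw [splitSum_congr (g := fun _ _ => 0), splitSum_zero]
        intro z w _
        by_cases hz : z = []
        · subst hz
          simp only [List.nil_append] at *
          subst_vars
          rw [opT_zero hu (hmap hr), opT_of_zero]
        · rw [opT_zero hv hz]; rfl
      · rw [splitSum_single_left, zero_add, opT_left hl, opT_right (hmap hr)]
        intro u v _ hu
        rw [opT_zero hl hu]; rfl
      · rw [splitSum_single_right, zero_add, List.map_nil, opT_left hl, opT_right hr]
        intro u v _ hv
        rw [opT_zero hl (hmap hv), opT_of_zero]

theorem AInfStr.rsgn_one (A : AInfStr X) : X.rsgn A.one = -A.one := by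
  simp [X.rsgn_of_mem A.one_mem]

theorem MRed.map_rsgn {Z : Type*} [AddCommGroup Z] [Module K Z] {g : List X → Z}
    (hg : g ∈ MRed A Z) {l : List X} (h : A.one ∈ l) : g (l.map X.rsgn) = 0 := by
  obtain ⟨u, v, rfl⟩ := List.append_of_mem h
  have := (hg.1 (u.map X.rsgn) (v.map X.rsgn)).map_neg A.one
  simp only [List.map_append, List.map_cons, A.rsgn_one, this]
  rw [hg.2 _ (by simp), neg_zero]

theorem opQ_one (hf : f ∈ MRed A _) (l' u v : List X) (q : Q.carrier) (p : P.carrier) :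
    opQ Q P l' f (u ++ A.one :: v) q p =
      if l' = [] ∧ u = [] then f (v.map X.rsgn) q (P.sgn p) else 0 := by
  rw [opQ_apply, splitSum_append_cons, splitSum_congr (g := fun _ _ => 0), splitSum_zero, zero_add,
    splitSum_single_left]
  · split_ifs with h
    · rw [h.1, h.2, List.nil_append, Q.one_right]
    · rw [Q.act_eq_zero _ _ _ (by simp)]
      · simp
      · rcases not_and_or.1 h with h | h <;>
        · have := List.length_pos_iff.2 h
          simp; omega
  · intro x y _ hx
    rw [Q.act_eq_zero _ _ _ (by simp)]
    · simp
    · have := List.length_pos_iff.2 hx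
      simp; omega
  · intro x y _
    rw [MRed.map_rsgn hf (by simp)]; rfl

theorem opP_one (hf : f ∈ MRed A _) (r u v : List X) (q : Q.carrier) (p : P.carrier) :
    opP Q P r f (u ++ A.one :: v) q p =
      if v = [] ∧ r = [] then -f u q (P.sgn p) else 0 := by
  rw [opP_apply, splitSum_append_cons, splitSum_congr (f := fun x y => f (u ++ A.one :: x) q _)
    (g := fun _ _ => 0), splitSum_zero, add_zero, splitSum_single_right]
  · split_ifs with h
    · rw [h.1, h.2, List.nil_append, P.one_left, map_neg]
    · rw [P.act_eq_zero _ _ _ (by simp)]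
      · simp
      · rcases not_and_or.1 h with h | h <;>
        · have := List.length_pos_iff.2 h
          simp; omega
  · intro x y _ hy
    rw [P.act_eq_zero _ _ _ (by simp)]
    · simp
    · have := List.length_pos_iff.2 hy
      simp; omega
  · intro x y _
    rw [hf.2 _ (by simp)]; rfl

theorem opA_one (hf : f ∈ MRed A _) (u v : List X) (q : Q.carrier) (p : P.carrier) :
    opA Q P f (u ++ A.one :: v) q p =
      (if u = [] then 0 else f (u ++ v.map X.rsgn) q (P.sgn p)) +
        (if v = [] then 0 else -f (u ++ v.map X.rsgn) q (P.sgn p)) := by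
  have hz : ∀ x y, f (x ++ 0 :: y) = 0 := fun x y => (hf.1 x y).map_zero
  have hI₀ : ∀ x, splitSum (fun w y => f (x ++ A.μ (A.one :: w) :: y.map X.rsgn) q (P.sgn p)) v =
      if v = [] then 0 else -f (x ++ v.map X.rsgn) q (P.sgn p) := by
    intro x
    cases v with
    | nil => simp [splitSum_nil, A.μ_one, hz]
    | cons b v =>
      rw [splitSum_cons, A.μ_one, hz, splitSum_single_left]
      · have := (hf.1 x (v.map X.rsgn)).map_neg (X.sgn b)
        have hb : X.rsgn b = -X.sgn b := rfl
        simp [A.one_left, hb, this]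
      · intro y z _ hy
        rw [A.μ_eq_zero _ _ (by simp), hz]; · rfl
        have := List.length_pos_iff.2 hy
        simp; omega
  have hI₁ : ∀ x c, c ≠ [] →
      splitSum (fun w y => f (x ++ A.μ (c ++ A.one :: w) :: y.map X.rsgn) q (P.sgn p)) v =
      f (x ++ A.μ (c ++ [A.one]) :: v.map X.rsgn) q (P.sgn p) := by
    intro x c hc
    rw [splitSum_single_left]
    intro y z _ hy
    rw [A.μ_eq_zero _ _ (by simp), hz]; · rfl
    have := List.length_pos_iff.2 hy
    have := List.length_pos_iff.2 hc
    simp; omega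
  have h1 : ∀ x y : List X, f (x ++ A.one :: y) = 0 := fun x y => hf.2 _ (by simp)
  have h2 : ∀ (x y z : List X) (a : X), f (x ++ a :: (y ++ X.rsgn A.one :: z)) = 0 :=
    fun x y z a => by
      have e := (hf.1 (x ++ a :: y) z).map_neg A.one
      have e' := hf.2 ((x ++ a :: y) ++ A.one :: z) (by simp)
      rw [e', neg_zero] at e
      rw [A.rsgn_one]
      simpa using e
  simp only [opA_apply, splitSum₃, splitSum_append_cons, List.map_append,
    List.map_cons, List.append_assoc, List.cons_append, h1, h2, LinearMap.zero_apply, splitSum_zero,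
    add_zero, zero_add]
  rcases List.eq_nil_or_concat u with rfl | ⟨L, a, rfl⟩
  · simpa [splitSum_nil] using hI₀ []
  · rw [List.concat_eq_append, splitSum_append_cons, splitSum_nil]
    congr 1
    · rw [splitSum_single_right]
      · rw [hI₁ _ _ (by simp)]
        simp [A.one_right]
      · intro x y _ hy
        rw [hI₁ _ _ (by simp), A.μ_eq_zero _ _ (by simp), hz]; · rfl
        have := List.length_pos_iff.2 hy
        simp; omega
    · simpa using hI₀ (L ++ [a])

theorem opT_mem (hf : f ∈ MRed A _) (l' r : List X) : opT Q P l' r f ∈ MRed A _ := by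
  have hQ : IsMultilin K (opQ Q P l' f) := .of_apply fun q => .of_apply fun p => by
    simp only [opQ_apply]
    exact .splitSum
      (fun v => (Q.multilin_right l').comp_lin
        ((f (v.map X.rsgn)).flip (P.sgn p) ∘ₗ LinearMap.applyₗ q))
      (fun u => hf.1.map_rsgn.comp_lin
        (LinearMap.applyₗ (P.sgn p) ∘ₗ LinearMap.applyₗ (Q.act l' u q)))
  have hP : IsMultilin K (opP Q P r f) := .of_apply fun q => .of_apply fun p => by
    simp only [opP_apply]
    exact .splitSum
      (fun v => hf.1.comp_lin (LinearMap.applyₗ (P.act v r p) ∘ₗ LinearMap.applyₗ q))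
      (fun u => (P.multilin_left r).comp_lin ((f u q) ∘ₗ LinearMap.applyₗ p))
  have hA : IsMultilin K (opA Q P f) := .of_apply fun q => .of_apply fun p => by
    simp only [opA_apply, splitSum₃]
    have hf' : IsMultilin K fun l => f l q (P.sgn p) :=
      hf.1.comp_lin (LinearMap.applyₗ (P.sgn p) ∘ₗ LinearMap.applyₗ q)
    refine .splitSum (fun vw => ?_) (fun u => .splitSum (fun w => ?_) (fun v => ?_))
    · intro a b
      exact NCGeom.IsLinearMap.splitSum vw fun v w _ => by
        simpa using hf' a (b ++ A.μ v :: w.map X.rsgn)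
    · exact A.multilin.comp_lin (hf' u (w.map X.rsgn)).mk'
    · have := (hf'.prepend (u ++ [A.μ v])).map_rsgn
      simpa using this
  have hite : ∀ (c : Prop) [Decidable c] {g : List X → Q.carrier →ₗ[K] P.carrier →ₗ[K] Y},
      IsMultilin K g → IsMultilin K fun l => if c then g l else 0 := fun c _ g hg => by
    split_ifs
    exacts [hg, .zero]
  refine ⟨((hite _ hQ).add (hite _ hA)).add (hite _ hP), fun l hl => ?_⟩
  · obtain ⟨u, v, rfl⟩ := List.append_of_mem hl
    refine LinearMap.ext fun q => LinearMap.ext fun p => ?_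
    by_cases hl' : l' = [] <;> by_cases hr : r = []
    · subst hl' hr
      rw [opT_nil_nil, LinearMap.add_apply, LinearMap.add_apply, LinearMap.add_apply,
        LinearMap.add_apply, opQ_one hf, opA_one hf, opP_one hf]
      by_cases hu : u = [] <;> by_cases hv : v = [] <;> simp [hu, hv]
    · subst hl'
      rw [opT_right hr, opP_one hf]; simp [hr]
    · subst hr
      rw [opT_left hl', opQ_one hf]; simp [hl']
    · rw [opT_zero hl' hr]; rfl

theorem opT_hom {Z : Type*} [AddCommGroup Z] [Module K Z] (φ : Y →ₗ[K] Z) (l' r l : List X)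
    (q : Q.carrier) (p : P.carrier) :
    φ (opT Q P l' r f l q p) = opT Q P l' r (fun l => (f l).compr₂ φ) l q p := by
  simp only [opT, LinearMap.add_apply, map_add]
  congr 1
  · congr 1
    · split_ifs
      · simp [opQ_apply, splitSum_hom]
      · simp
    · split_ifs
      · simp [opA_apply, splitSum₃, splitSum_hom]
      · simp
  · split_ifs
    · simp [opP_apply, splitSum_hom]
    · simp

end Identities

end TensorOps

section Tensor

open scoped TensorProduct

variable {K : Type u} [Field K] {X : GrMod K} {A : AInfStr X} (Q P : ABimod A)

/-- The vector space `Q ⊗ T(Ā) ⊗ P`. -/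
abbrev TensorCarrier : Type u := Q.carrier ⊗[K] (BarT A ⊗[K] P.carrier)

/-- The element `q ⊗ a_t ⊗ ⋯ ⊗ a_1 ⊗ p` of `Q ⊗ T(Ā) ⊗ P`, for `l = [a_t, …, a_1]`. -/
noncomputable def wd (l : List X) : Q.carrier →ₗ[K] P.carrier →ₗ[K] TensorCarrier Q P :=
  LinearMap.mk₂ K (fun q p => q ⊗ₜ[K] (bar A l ⊗ₜ[K] p))
    (fun _ _ _ => TensorProduct.add_tmul _ _ _) (fun _ _ _ => TensorProduct.smul_tmul' _ _ _)
    (fun _ _ _ => by rw [TensorProduct.tmul_add, TensorProduct.tmul_add])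
    (fun _ _ _ => by rw [TensorProduct.tmul_smul, TensorProduct.tmul_smul])

theorem wd_apply (l : List X) (q : Q.carrier) (p : P.carrier) :
    wd Q P l q p = q ⊗ₜ[K] (bar A l ⊗ₜ[K] p) := rfl

theorem wd_mem : wd Q P ∈ MRed A (Q.carrier →ₗ[K] P.carrier →ₗ[K] TensorCarrier Q P) := by
  refine ⟨.of_apply fun q => .of_apply fun p => ?_, fun l hl => ?_⟩
  · exact bar_multilin.comp_lin ((TensorProduct.mk K Q.carrier (BarT A ⊗[K] P.carrier) q) ∘ₗ
      (TensorProduct.mk K (BarT A) P.carrier).flip p)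
  · refine LinearMap.ext fun q => LinearMap.ext fun p => ?_
    simp [wd_apply, bar_eq_zero hl]

variable {Q P} {Y : Type*} [AddCommGroup Y] [Module K Y]

theorem wd_comp (φ : TensorCarrier Q P →ₗ[K] Y) (q : Q.carrier) (p : P.carrier) :
    IsMultilin K fun l => φ (wd Q P l q p) :=
  bar_multilin.comp_lin (φ ∘ₗ (TensorProduct.mk K Q.carrier (BarT A ⊗[K] P.carrier) q) ∘ₗ
    (TensorProduct.mk K (BarT A) P.carrier).flip p)

/-- The linear map on `Q ⊗ T(Ā) ⊗ P` with given values on the elements `q ⊗ l ⊗ p`. -/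
noncomputable def tensorLift (f : MRed A (Q.carrier →ₗ[K] P.carrier →ₗ[K] Y)) :
    TensorCarrier Q P →ₗ[K] Y :=
  TensorProduct.lift ((TensorProduct.uncurry (.id K) (BarT A) P.carrier Y) ∘ₗ (barLift f).flip)

@[simp] theorem tensorLift_wd (f : MRed A (Q.carrier →ₗ[K] P.carrier →ₗ[K] Y)) (l : List X)
    (q : Q.carrier) (p : P.carrier) : tensorLift f (wd Q P l q p) = f.1 l q p := by
  simp [tensorLift, wd_apply]

theorem tensor_ext {F G : TensorCarrier Q P →ₗ[K] Y}
    (h : ∀ l q p, F (wd Q P l q p) = G (wd Q P l q p)) : F = G := by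
  refine TensorProduct.ext' fun q tp => ?_
  have key : F ∘ₗ TensorProduct.mk K _ _ q = G ∘ₗ TensorProduct.mk K _ _ q := by
    refine TensorProduct.ext' fun t p => ?_
    have : (F ∘ₗ TensorProduct.mk K _ _ q) ∘ₗ (TensorProduct.mk K (BarT A) P.carrier).flip p =
        (G ∘ₗ TensorProduct.mk K _ _ q) ∘ₗ (TensorProduct.mk K (BarT A) P.carrier).flip p := by
      refine LinearMap.ext_on span_bar ?_
      rintro _ ⟨l, rfl⟩
      exact h l q p
    exact LinearMap.congr_fun this t
  exact LinearMap.congr_fun key tp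

variable (Q P)

/-- The degree `n` part of `Q ⊗ T(Ā[1]) ⊗ P`, spanned by the elements
`q ⊗ a_t ⊗ ⋯ ⊗ a_1 ⊗ p` with `|q| + ‖a_t‖ + ⋯ + ‖a_1‖ + |p| = n`. -/
def tensorGr (n : ℤ) : Submodule K (TensorCarrier Q P) :=
  Submodule.span K {m | ∃ i d j l q p, q ∈ Q.gr i ∧ X.IsHom l d ∧ p ∈ P.gr j ∧
    i + GrMod.rdeg d + j = n ∧ m = wd Q P l q p}

variable {Q P}

theorem wd_mem_tensorGr {i j n : ℤ} {d : List ℤ} {l : List X} {q : Q.carrier} {p : P.carrier}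
    (hq : q ∈ Q.gr i) (hl : X.IsHom l d) (hp : p ∈ P.gr j) (h : i + GrMod.rdeg d + j = n) :
    wd Q P l q p ∈ tensorGr Q P n :=
  Submodule.subset_span ⟨i, d, j, l, q, p, hq, hl, hp, h, rfl⟩

theorem tensor_ext_hom {F G : TensorCarrier Q P →ₗ[K] Y}
    (h : ∀ i d j l q p, q ∈ Q.gr i → X.IsHom l d → p ∈ P.gr j →
      F (wd Q P l q p) = G (wd Q P l q p)) : F = G := by
  refine tensor_ext fun l q p => ?_
  have hF : IsMultilin K fun l => (wd Q P l).compr₂ F := .of_apply fun q => .of_apply fun p =>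
    wd_comp F q p
  have hG : IsMultilin K fun l => (wd Q P l).compr₂ G := .of_apply fun q => .of_apply fun p =>
    wd_comp G q p
  have := hF.ext_hom hG (fun l d hl => Q.lin_ext fun i q hq => P.lin_ext fun j p hp => by
    simpa using h i d j l q p hq hl hp) l
  exact LinearMap.congr_fun (LinearMap.congr_fun this q) p

theorem iSup_tensorGr : iSup (tensorGr Q P) = ⊤ := by
  have : (iSup (tensorGr Q P)).mkQ = 0 := tensor_ext_hom fun i d j l q p hq hl hp => by
    have := Submodule.mem_iSup_of_mem (p := tensorGr Q P) _ (wd_mem_tensorGr hq hl hp rfl)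
    simpa using this
  rw [← Submodule.ker_mkQ (iSup (tensorGr Q P)), this, LinearMap.ker_zero]

/-- The projection of `T(Ā[1]) ⊗ P` to its degree `k` part. -/
noncomputable def rightPart (k : ℤ) : BarT A ⊗[K] P.carrier →ₗ[K] BarT A ⊗[K] P.carrier :=
  TensorProduct.lift (P.lin (Y := BarT A →ₗ[K] BarT A ⊗[K] P.carrier) fun j => LinearMap.lcomp K _ (barPart (k - j)) ∘ₗ
    (TensorProduct.mk K (BarT A) P.carrier).flip ∘ₗ (P.gr j).subtype).flip

/-- The projection of `Q ⊗ T(Ā[1]) ⊗ P` to its degree `n` part. -/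
noncomputable def tensorPart (n : ℤ) : TensorCarrier Q P →ₗ[K] TensorCarrier Q P :=
  TensorProduct.lift (Q.lin (Y := BarT A ⊗[K] P.carrier →ₗ[K] TensorCarrier Q P) fun i => LinearMap.lcomp K _ (rightPart (n - i)) ∘ₗ
    (TensorProduct.mk K Q.carrier (BarT A ⊗[K] P.carrier)) ∘ₗ (Q.gr i).subtype)

theorem tensorPart_wd {i j n : ℤ} {d : List ℤ} {l : List X} {q : Q.carrier} {p : P.carrier}
    (hq : q ∈ Q.gr i) (hl : X.IsHom l d) (hp : p ∈ P.gr j) :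
    tensorPart n (wd Q P l q p) = if i + GrMod.rdeg d + j = n then wd Q P l q p else 0 := by
  have e : (i + GrMod.rdeg d + j = n) = (GrMod.rdeg d = n - i - j) := by
    apply propext; omega
  simp only [wd_apply, tensorPart, TensorProduct.lift.tmul, Q.lin_of_mem _ hq, rightPart,
    LinearMap.comp_apply, LinearMap.lcomp_apply, TensorProduct.mk_apply, Submodule.subtype_apply,
    LinearMap.flip_apply, P.lin_of_mem _ hp, barPart_bar _ hl, e]
  split_ifs <;> simp

theorem tensor_internal : DirectSum.IsInternal (tensorGr Q P) := by
  refine DirectSum.isInternal_submodule_of_iSupIndep_of_iSup_eq_top ?_ iSup_tensorGr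
  have h₁ : ∀ n, tensorGr Q P n ≤ LinearMap.eqLocus (tensorPart n) LinearMap.id := fun n =>
    Submodule.span_le.2 <| by
      rintro _ ⟨i, d, j, l, q, p, hq, hl, hp, h, rfl⟩
      change tensorPart n _ = _
      rw [tensorPart_wd hq hl hp, if_pos h]; rfl
  have h₂ : ∀ n k, k ≠ n → tensorGr Q P k ≤ LinearMap.ker (tensorPart n) := fun n k hk =>
    Submodule.span_le.2 <| by
      rintro _ ⟨i, d, j, l, q, p, hq, hl, hp, h, rfl⟩
      change tensorPart n _ = _
      rw [tensorPart_wd hq hl hp, if_neg (h ▸ hk)]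
  intro n
  rw [Submodule.disjoint_def]
  intro x hx hx'
  have e₁ : tensorPart n x = x := h₁ n hx
  have e₂ : tensorPart n x = 0 := (iSup₂_le fun k hk => h₂ n k hk : _ ≤ LinearMap.ker _) hx'
  rw [← e₁, e₂]

variable (Q P)

/-- The graded vector space `Q ⊗ T(Ā[1]) ⊗ P`. -/
noncomputable def tensorGrMod : GrMod K where
  carrier := TensorCarrier Q P
  gr := tensorGr Q P
  internal := tensor_internal

/-- The structure maps of `Q ⊗_A P`. -/
noncomputable def tensorAct (l' r : List X) : TensorCarrier Q P →ₗ[K] TensorCarrier Q P :=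
  tensorLift ⟨opT Q P l' r (wd Q P), opT_mem (wd_mem Q P) l' r⟩

variable {Q P}

theorem tensorAct_wd (l' r l : List X) (q : Q.carrier) (p : P.carrier) :
    tensorAct Q P l' r (wd Q P l q p) = opT Q P l' r (wd Q P) l q p :=
  tensorLift_wd _ _ _ _

theorem tensor_sgn_wd (l : List X) (q : Q.carrier) (p : P.carrier) :
    (tensorGrMod Q P).sgn (wd Q P l q p) = wd Q P (l.map X.rsgn) (Q.sgn q) (P.sgn p) := by
  obtain ⟨S, hS⟩ : ∃ S : TensorCarrier Q P →ₗ[K] TensorCarrier Q P,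
    S = (tensorGrMod Q P).sgn := ⟨_, rfl⟩
  have hS' : ∀ n, ∀ m ∈ tensorGr Q P n, S m = GrMod.eps n • m := fun n m hm => by
    rw [hS]; exact (tensorGrMod Q P).sgn_of_mem hm
  rw [← hS]
  have hF : IsMultilin K fun l => (wd Q P l).compr₂ S :=
    .of_apply fun q => .of_apply fun p => wd_comp S q p
  have hG : IsMultilin K fun l => (wd Q P (l.map X.rsgn)).compl₁₂ Q.sgn P.sgn :=
    .of_apply fun q => .of_apply fun p =>
      (wd_comp LinearMap.id (Q.sgn q) (P.sgn p)).map_rsgn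
  have := hF.ext_hom hG (fun l d hl => Q.lin_ext fun i q hq => P.lin_ext fun j p hp => by
    have e := hS' _ _ (wd_mem_tensorGr hq hl hp rfl)
    have e' := (wd_comp (LinearMap.id : TensorCarrier Q P →ₗ[K] _) q p).map_hom hl
    simp only [LinearMap.id_apply] at e'
    simp only [LinearMap.compr₂_apply, LinearMap.compl₁₂_apply]
    rw [e, Q.sgn_of_mem hq, P.sgn_of_mem hp]
    simp only [map_zsmul, LinearMap.smul_apply, smul_smul, GrMod.eps_add, e']
    congr 1; ring) l
  exact LinearMap.congr_fun (LinearMap.congr_fun this q) p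

theorem isHom_map_rsgn {l : List X} {d : List ℤ} (h : X.IsHom l d) : X.IsHom (l.map X.rsgn) d := by
  induction h with
  | nil => exact .nil
  | cons h _ ih => exact .cons (X.rsgn_mem h) ih

theorem isHom_append {u v : List X} {d : List ℤ} (h : X.IsHom (u ++ v) d) :
    ∃ d₁ d₂, d = d₁ ++ d₂ ∧ X.IsHom u d₁ ∧ X.IsHom v d₂ := by
  refine ⟨d.take u.length, d.drop u.length, (List.take_append_drop _ _).symm, ?_, ?_⟩
  · exact (List.forall₂_take_append d u v h.flip).flip
  · exact (List.forall₂_drop_append d u v h.flip).flip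

theorem splitSum_mem {α : Type*} {S : Submodule K Y} {f : List α → List α → Y} {l : List α}
    (h : ∀ u v, l = u ++ v → f u v ∈ S) : splitSum f l ∈ S :=
  Submodule.sum_mem _ fun i _ => h _ _ (List.take_append_drop i l).symm

theorem tensorAct_mem (l' : List X) (d' : List ℤ) (r : List X) (e : List ℤ) (n : ℤ)
    (m : TensorCarrier Q P) (hl' : X.IsHom l' d') (hr : X.IsHom r e) (hm : m ∈ tensorGr Q P n) :
    tensorAct Q P l' r m ∈ tensorGr Q P (GrMod.rdeg d' + n + GrMod.rdeg e + 1) := by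
  have : tensorGr Q P n ≤ (tensorGr Q P (GrMod.rdeg d' + n + GrMod.rdeg e + 1)).comap
      (tensorAct Q P l' r) := by
    refine Submodule.span_le.2 ?_
    rintro _ ⟨i, d, j, l, q, p, hq, hl, hp, rfl, rfl⟩
    change tensorAct Q P l' r _ ∈ tensorGr Q P _
    rw [tensorAct_wd, opT, LinearMap.add_apply, LinearMap.add_apply, LinearMap.add_apply,
      LinearMap.add_apply]
    refine add_mem (add_mem ?_ ?_) ?_
    · split_ifs with h
      · subst h
        cases hr
        rw [opQ_apply]
        refine splitSum_mem fun u v huv => ?_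
        subst huv
        obtain ⟨d₁, d₂, rfl, h₁, h₂⟩ := isHom_append hl
        refine wd_mem_tensorGr (Q.act_mem _ _ _ _ _ _ hl' h₁ hq) (isHom_map_rsgn h₂)
          (P.sgn_mem hp) ?_
        simp; ring
      · exact zero_mem _
    · split_ifs with h
      · obtain ⟨rfl, rfl⟩ := h
        cases hr; cases hl'
        rw [opA_apply]
        refine splitSum_mem fun u x hx => splitSum_mem fun v w hw => ?_
        subst hx hw
        obtain ⟨d₁, d', rfl, h₁, h'⟩ := isHom_append hl
        obtain ⟨d₂, d₃, rfl, h₂, h₃⟩ := isHom_append h'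
        refine wd_mem_tensorGr hq (List.rel_append h₁ (.cons (A.μ_mem _ _ h₂) (isHom_map_rsgn h₃)))
          (P.sgn_mem hp) ?_
        simp; ring
      · exact zero_mem _
    · split_ifs with h
      · subst h
        cases hl'
        rw [opP_apply]
        refine splitSum_mem fun u v huv => ?_
        subst huv
        obtain ⟨d₁, d₂, rfl, h₁, h₂⟩ := isHom_append hl
        refine wd_mem_tensorGr hq h₁ (P.act_mem _ _ _ _ _ _ h₂ hr hp) ?_
        simp; ring
      · exact zero_mem _
  exact this hm

theorem tensorAct_comp (x y z w l : List X) (q : Q.carrier) (p : P.carrier) :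
    tensorAct Q P x w (opT Q P y z (wd Q P) l q p) =
      opT Q P y z (opT Q P x w (wd Q P)) l q p := by
  have e : (fun l => (wd Q P l).compr₂ (tensorAct Q P x w)) = opT Q P x w (wd Q P) := by
    funext l
    exact LinearMap.ext fun q => LinearMap.ext fun p => tensorAct_wd _ _ _ _ _
  rw [opT_hom, e]

theorem tensorAct_multilin_left (r : List X) : IsMultilin K fun l' => tensorAct Q P l' r := by
  intro u v
  have hne : ∀ a, u ++ a :: v ≠ [] := by simp
  have h : ∀ l q p, IsLinearMap K fun a => opT Q P (u ++ a :: v) r (wd Q P) l q p := by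
    intro l q p
    by_cases hr : r = []
    · subst hr
      simp only [opT_left (hne _), opQ_apply]
      exact NCGeom.IsLinearMap.splitSum l fun x y _ =>
        (((wd Q P (y.map X.rsgn)).flip (P.sgn p)) ∘ₗ LinearMap.applyₗ q ∘ₗ
          (Q.multilin_left x u v).mk').isLinear
    · simp only [opT_zero (hne _) hr]
      exact (0 : X →ₗ[K] TensorCarrier Q P).isLinear
  exact ⟨fun a b => tensor_ext fun l q p => by
      simpa only [tensorAct_wd, LinearMap.add_apply] using (h l q p).map_add a b,
    fun c a => tensor_ext fun l q p => by
      simpa only [tensorAct_wd, LinearMap.smul_apply] using (h l q p).map_smul c a⟩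

theorem tensorAct_multilin_right (l' : List X) : IsMultilin K fun r => tensorAct Q P l' r := by
  intro u v
  have hne : ∀ a, u ++ a :: v ≠ [] := by simp
  have h : ∀ l q p, IsLinearMap K fun a => opT Q P l' (u ++ a :: v) (wd Q P) l q p := by
    intro l q p
    by_cases hr : l' = []
    · subst hr
      simp only [opT_right (hne _), opP_apply]
      exact NCGeom.IsLinearMap.splitSum l fun x y _ =>
        ((wd Q P x q) ∘ₗ LinearMap.applyₗ p ∘ₗ (P.multilin_right y u v).mk').isLinear
    · simp only [opT_zero hr (hne _)]
      exact (0 : X →ₗ[K] TensorCarrier Q P).isLinear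
  exact ⟨fun a b => tensor_ext fun l q p => by
      simpa only [tensorAct_wd, LinearMap.add_apply] using (h l q p).map_add a b,
    fun c a => tensor_ext fun l q p => by
      simpa only [tensorAct_wd, LinearMap.smul_apply] using (h l q p).map_smul c a⟩

theorem splitSum_lapply {V α : Type*} [AddCommGroup V] [Module K V]
    (F : List α → List α → V →ₗ[K] Y) (l : List α) (m : V) :
    splitSum F l m = splitSum (fun u v => F u v m) l := by
  simp [splitSum, LinearMap.sum_apply]

theorem tensorAct_assoc (S : TensorCarrier Q P →ₗ[K] TensorCarrier Q P)
    (hS : ∀ l q p, S (wd Q P l q p) = wd Q P (l.map X.rsgn) (Q.sgn q) (P.sgn p))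
    (l' r : List X) (m : TensorCarrier Q P) :
    splitSum (fun x y => splitSum (fun z w =>
      tensorAct Q P x (w.map X.rsgn) (tensorAct Q P y z m)) r) l' +
    splitSum₃ (fun x y z => tensorAct Q P l' (x ++ A.μ y :: z.map X.rsgn) m) r +
    splitSum₃ (fun x y z => tensorAct Q P (x ++ A.μ y :: z.map X.rsgn) (r.map X.rsgn) (S m)) l'
      = 0 := by
  have h : splitSum (fun x y => splitSum (fun z w =>
      tensorAct Q P x (w.map X.rsgn) ∘ₗ tensorAct Q P y z) r) l' +
    splitSum₃ (fun x y z => tensorAct Q P l' (x ++ A.μ y :: z.map X.rsgn)) r +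
    splitSum₃ (fun x y z => tensorAct Q P (x ++ A.μ y :: z.map X.rsgn) (r.map X.rsgn) ∘ₗ S) l'
      = 0 := tensor_ext fun l q p => by
    have := opT_assoc (wd_mem Q P).1 l' r l q p
    simpa only [splitSum₃, LinearMap.add_apply, splitSum_lapply, LinearMap.comp_apply,
      tensorAct_comp, hS, tensorAct_wd, LinearMap.zero_apply] using this
  have := LinearMap.congr_fun h m
  simpa only [splitSum₃, LinearMap.add_apply, splitSum_lapply, LinearMap.comp_apply,
    LinearMap.zero_apply] using this

theorem tensorAct_one_left (S : TensorCarrier Q P →ₗ[K] TensorCarrier Q P)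
    (hS : ∀ l q p, S (wd Q P l q p) = wd Q P (l.map X.rsgn) (Q.sgn q) (P.sgn p)) :
    tensorAct Q P [A.one] [] = -S := tensor_ext fun l q p => by
  rw [tensorAct_wd, opT_left (by simp), opQ_apply, splitSum_single_left]
  · simp [Q.one_left, hS]
  · intro u v _ hu
    rw [Q.act_eq_zero _ _ _ (by simp)]
    · simp
    · have := List.length_pos_iff.2 hu
      simp; omega

theorem tensorAct_one_right : tensorAct Q P [] [A.one] = LinearMap.id :=
    tensor_ext fun l q p => by
  rw [tensorAct_wd, opT_right (by simp), opP_apply, splitSum_single_right]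
  · simp [P.one_right]
  · intro u v _ hv
    rw [P.act_eq_zero _ _ _ (by simp)]
    · simp
    · have := List.length_pos_iff.2 hv
      simp; omega

theorem tensorAct_eq_zero (l' r : List X) (h : 2 ≤ l'.length + r.length)
    (h' : A.one ∈ l' ∨ A.one ∈ r) : tensorAct Q P l' r = 0 := tensor_ext fun l q p => by
  rw [tensorAct_wd]
  by_cases hl : l' = [] <;> by_cases hr : r = []
  · simp [hl, hr] at h
  · subst hl
    rw [opT_right hr, opP_apply, splitSum_congr (g := fun _ _ => 0), splitSum_zero]
    · rfl
    intro u v _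
    rw [P.act_eq_zero _ _ (by simp at h; omega) (.inr (by simpa using h'))]
    simp
  · subst hr
    rw [opT_left hl, opQ_apply, splitSum_congr (g := fun _ _ => 0), splitSum_zero]
    · rfl
    intro u v _
    rw [Q.act_eq_zero _ _ (by simp at h; omega) (.inl (by simpa using h'))]
    simp
  · rw [opT_zero hl hr]; rfl

variable (Q P)

/-- The tensor product `Q ⊗_A P` of two bimodules. -/
noncomputable def tensor : ABimod A where
  toGrMod := tensorGrMod Q P
  act := tensorAct Q P
  multilin_left := tensorAct_multilin_left
  multilin_right := tensorAct_multilin_right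
  act_mem := tensorAct_mem
  assoc := tensorAct_assoc (tensorGrMod Q P).sgn tensor_sgn_wd
  one_left := LinearMap.congr_fun (tensorAct_one_left (tensorGrMod Q P).sgn tensor_sgn_wd)
  one_right := LinearMap.congr_fun tensorAct_one_right
  act_eq_zero := tensorAct_eq_zero

end Tensor

section Homs

variable {K : Type u} [Field K] {X : GrMod K} {A : AInfStr X}

/-- Collections of maps `φ l r`, sending `p` to `φ^{s;1;r}(a'_s, …, a'_1; p; a_r, …, a_1)` for
`l = [a'_s, …, a'_1]` and `r = [a_r, …, a_1]`. -/
abbrev PreHom (P Q : ABimod A) : Type u := List X → List X → P.carrier →ₗ[K] Q.carrier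

/-- The degree `d` part of the complex `hom_{[A,A]}(P, Q)`: multilinear maps of degree `d` which
factor through the projection to `T(Ā[1]) ⊗ P ⊗ T(Ā[1])`. -/
def hom (P Q : ABimod A) (d : ℤ) : Submodule K (PreHom P Q) where
  carrier := {φ | (∀ r, IsMultilin K fun l => φ l r) ∧ (∀ l, IsMultilin K fun r => φ l r) ∧
    (∀ l r, A.one ∈ l ∨ A.one ∈ r → φ l r = 0) ∧
    ∀ l m r n i p, X.IsHom l m → X.IsHom r n → p ∈ P.gr i →
      φ l r p ∈ Q.gr (GrMod.rdeg m + i + GrMod.rdeg n + d)}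
  add_mem' := fun {φ ψ} hφ hψ => ⟨fun r => (hφ.1 r).add (hψ.1 r), fun l => (hφ.2.1 l).add (hψ.2.1 l),
    fun l r h => by simp [hφ.2.2.1 l r h, hψ.2.2.1 l r h],
    fun l m r n i p hl hr hp => add_mem (hφ.2.2.2 l m r n i p hl hr hp)
      (hψ.2.2.2 l m r n i p hl hr hp)⟩
  zero_mem' := ⟨fun _ => .zero, fun _ => .zero, fun _ _ _ => rfl,
    fun _ _ _ _ _ _ _ _ _ => Submodule.zero_mem _⟩
  smul_mem' c φ hφ := ⟨fun r => (hφ.1 r).comp_lin (c • LinearMap.id),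
    fun l => (hφ.2.1 l).comp_lin (c • LinearMap.id), fun l r h => by simp [hφ.2.2.1 l r h],
    fun l m r n i p hl hr hp => Submodule.smul_mem _ c (hφ.2.2.2 l m r n i p hl hr hp)⟩

/-- The differential on `hom_{[A,A]}(P, Q)`, in degree `d`. -/
noncomputable def homD (P Q : ABimod A) (d : ℤ) : PreHom P Q →ₗ[K] PreHom P Q where
  toFun φ l r :=
    splitSum (fun x y => splitSum (fun z w =>
      Q.act x (w.map (X.rsgn ^ d.natAbs)) ∘ₗ φ y z) r) l -
    GrMod.eps d •
      (splitSum (fun x y => splitSum (fun z w => φ x (w.map X.rsgn) ∘ₗ P.act y z) r) l +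
      splitSum₃ (fun x y z => φ l (x ++ A.μ y :: z.map X.rsgn)) r +
      splitSum₃ (fun x y z => φ (x ++ A.μ y :: z.map X.rsgn) (r.map X.rsgn) ∘ₗ P.sgn) l)
  map_add' φ ψ := by
    funext l r
    simp only [Pi.add_apply, LinearMap.comp_add, LinearMap.add_comp, splitSum₃, splitSum_add,
      smul_add]
    abel
  map_smul' c φ := by
    have h : ∀ {α : Type u} (f : List α → List α → P.carrier →ₗ[K] Q.carrier) (l : List α),
        splitSum (fun u v => c • f u v) l = c • splitSum f l := fun f l =>
      Finset.smul_sum.symm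
    funext l r
    simp only [Pi.smul_apply, LinearMap.comp_smul, LinearMap.smul_comp, splitSum₃, h,
      RingHom.id_apply, ← smul_add, smul_sub, smul_comm c]

/-- The cocycles of degree `d` in `hom_{[A,A]}(P, Q)`. -/
noncomputable def cocycles (P Q : ABimod A) (d : ℤ) : Submodule K (PreHom P Q) :=
  hom P Q d ⊓ LinearMap.ker (homD P Q d)

/-- The coboundaries of degree `d` in `hom_{[A,A]}(P, Q)`. -/
noncomputable def coboundaries (P Q : ABimod A) (d : ℤ) : Submodule K (PreHom P Q) :=
  (hom P Q (d - 1)).map (homD P Q (d - 1))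

/-- The cohomology group `H^d(hom_{[A,A]}(P, Q))`. -/
abbrev HomCoh (P Q : ABimod A) (d : ℤ) : Type u :=
  cocycles P Q d ⧸ (coboundaries P Q d).submoduleOf (cocycles P Q d)

/-- The cohomology class of a cocycle. -/
noncomputable def homClass {P Q : ABimod A} {d : ℤ} (φ : PreHom P Q) (h : φ ∈ cocycles P Q d) :
    HomCoh P Q d :=
  Submodule.Quotient.mk ⟨φ, h⟩

/-- A quasi-isomorphism is a bimodule map (a cocycle of degree `0`) whose linear part
`P → Q` is injective and surjective on the cohomology of `μ^{0;1;0}`. -/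
def IsQuasiIso {P Q : ABimod A} (φ : PreHom P Q) : Prop :=
  φ ∈ cocycles P Q 0 ∧
    (∀ p, P.act [] [] p = 0 → (∃ q, Q.act [] [] q = φ [] [] p) → ∃ p', P.act [] [] p' = p) ∧
    ∀ q, Q.act [] [] q = 0 → ∃ p q', P.act [] [] p = 0 ∧ φ [] [] p + Q.act [] [] q' = q

/-- Invertible bimodules. -/
def ABimod.Invertible (P : ABimod A) : Prop :=
  ∃ (P' : ABimod A) (φ : PreHom (tensor P' P) (diag A)) (ψ : PreHom (tensor P P') (diag A)),
    IsQuasiIso φ ∧ IsQuasiIso ψ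

/-- The tensor powers `P^{⊗ i}`, with `P^{⊗ 0} = A`. -/
noncomputable def tpow (P : ABimod A) : ℕ → ABimod A
  | 0 => diag A
  | 1 => P
  | n + 2 => tensor P (tpow P (n + 1))

end Homs

section SelfConjugation

variable {K : Type u} [Field K] {X : GrMod K} {A : AInfStr X}

/-- The composition of bimodule maps of degree `0`. -/
noncomputable def homComp {P Q R : ABimod A} (g : PreHom Q R) (f : PreHom P Q) : PreHom P R :=
  fun l r => splitSum (fun x y => splitSum (fun z w => g x w ∘ₗ f y z) r) l

theorem idTensor_mem (P : ABimod A) {Q R : ABimod A} (φ : hom Q R 0) (r : List X) :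
    (fun l => splitSum (fun u v => (wd P R u).compl₂ (φ.1 v r)) l) ∈
      MRed A (P.carrier →ₗ[K] Q.carrier →ₗ[K] TensorCarrier P R) := by
  refine ⟨.of_apply fun p => .of_apply fun q => ?_, fun l hl => ?_⟩
  · simp only [splitSum_apply₂, LinearMap.compl₂_apply]
    exact .splitSum (fun v => wd_comp LinearMap.id p (φ.1 v r q))
      (fun u => (φ.2.1 r).comp_lin (wd P R u p ∘ₗ LinearMap.applyₗ q))
  · beta_reduce
    rw [splitSum_congr (g := fun _ _ => 0), splitSum_zero]
    rintro u v rfl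
    refine LinearMap.ext fun p => LinearMap.ext fun q => ?_
    rcases List.mem_append.1 hl with h | h
    · rw [LinearMap.compl₂_apply, (wd_mem P R).2 u h]; rfl
    · rw [LinearMap.compl₂_apply, φ.2.2.2.1 v r (.inl h)]; simp

/-- The map `id_P ⊗ φ : P ⊗_A Q → P ⊗_A R` induced by `φ : Q → R` of degree `0`. It takes
`(∅; p ⊗ l ⊗ q; r)` to `∑ p ⊗ u ⊗ φ(v; q; r)`, where `l = u ⊗ v`, and `(l'; p ⊗ l ⊗ q; r)` to zero
if `l'` is nonempty. -/
noncomputable def idTensor (P : ABimod A) {Q R : ABimod A} (φ : hom Q R 0) :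
    PreHom (tensor P Q) (tensor P R) := fun l' r =>
  if l' = [] then tensorLift ⟨_, idTensor_mem P φ r⟩ else 0

theorem tensorId_mem (P : ABimod A) {Q R : ABimod A} (φ : hom Q R 0) (l' : List X) :
    (fun l => splitSum (fun u v => (wd R P v) ∘ₗ (φ.1 l' u)) l) ∈
      MRed A (Q.carrier →ₗ[K] P.carrier →ₗ[K] TensorCarrier R P) := by
  refine ⟨.of_apply fun q => .of_apply fun p => ?_, fun l hl => ?_⟩
  · simp only [splitSum_apply₂, LinearMap.comp_apply]
    exact .splitSum
      (fun v => (φ.2.2.1 l').comp_lin ((wd R P v).flip p ∘ₗ LinearMap.applyₗ q))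
      (fun u => wd_comp LinearMap.id (φ.1 l' u q) p)
  · beta_reduce
    rw [splitSum_congr (g := fun _ _ => 0), splitSum_zero]
    rintro u v rfl
    rcases List.mem_append.1 hl with h | h
    · rw [φ.2.2.2.1 l' u (.inr h), LinearMap.comp_zero]
    · rw [(wd_mem R P).2 v h, LinearMap.zero_comp]

/-- The map `φ ⊗ id_P : Q ⊗_A P → R ⊗_A P` induced by `φ : Q → R` of degree `0`. It takes
`(l'; q ⊗ l ⊗ p; ∅)` to `∑ φ(l'; q; u) ⊗ v ⊗ p`, where `l = u ⊗ v`, and `(l'; q ⊗ l ⊗ p; r)` to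
zero if `r` is nonempty. -/
noncomputable def tensorId (P : ABimod A) {Q R : ABimod A} (φ : hom Q R 0) :
    PreHom (tensor Q P) (tensor R P) := fun l' r =>
  if r = [] then tensorLift ⟨_, tensorId_mem P φ l'⟩ else 0

theorem rightUnit_mem (P : ABimod A) (l' r : List X) :
    (fun l => (P.multilin_right l' l (r.map X.rsgn)).mk'.flip) ∈
      MRed A (P.carrier →ₗ[K] X →ₗ[K] P.carrier) := by
  refine ⟨.of_apply fun p => .of_apply fun a => ?_, fun l hl => ?_⟩
  · exact ((P.multilin_right l').append (a :: r.map X.rsgn)).comp_lin (LinearMap.applyₗ p)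
  · refine LinearMap.ext fun p => LinearMap.ext fun a => ?_
    have hlen := List.length_pos_of_mem hl
    have := P.act_eq_zero l' (l ++ a :: r.map X.rsgn) (by simp; omega) (.inr (by simp [hl]))
    exact LinearMap.congr_fun this p

/-- The canonical quasi-isomorphism `P ⊗_A A → P`,
`(l'; p ⊗ l ⊗ a; r) ↦ (-1)^{‖a_1‖ + ⋯ + ‖a_s‖} μ_P(l'; p; l, a, r)`, where `r = [a_s, …, a_1]`. -/
noncomputable def rightUnit (P : ABimod A) : PreHom (tensor P (diag A)) P := fun l' r =>
  tensorLift (Q := P) (P := diag A) ⟨_, rightUnit_mem P l' r⟩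

theorem leftUnit_mem (P : ABimod A) (l' r : List X) :
    (fun l => -(P.multilin_left (r.map X.rsgn) l' (l.map X.rsgn)).mk'.compl₂ P.sgn) ∈
      MRed A (X →ₗ[K] P.carrier →ₗ[K] P.carrier) := by
  refine ⟨.of_apply fun a => .of_apply fun p => ?_, fun l hl => ?_⟩
  · have := ((P.multilin_left (r.map X.rsgn)).prepend (l' ++ [a])).map_rsgn.comp_lin
      (-LinearMap.applyₗ (P.sgn p))
    simpa using this
  · refine LinearMap.ext fun a => LinearMap.ext fun p => ?_
    have hlen := List.length_pos_of_mem hl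
    obtain ⟨u, v, rfl⟩ := List.append_of_mem hl
    have e := (P.multilin_left (r.map X.rsgn) (l' ++ a :: u.map X.rsgn)
      (v.map X.rsgn)).map_neg A.one
    dsimp only at e
    have h0 := P.act_eq_zero ((l' ++ a :: u.map X.rsgn) ++ A.one :: v.map X.rsgn)
      (r.map X.rsgn) (by simp; omega) (.inl (by simp))
    rw [h0, neg_zero] at e
    simp only [List.append_assoc, List.cons_append] at e
    have e' := LinearMap.congr_fun e (P.sgn p)
    simpa [A.rsgn_one] using e'

/-- The canonical quasi-isomorphism `A ⊗_A P → P`,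
`(l'; a ⊗ l ⊗ p; r) ↦ (-1)^{‖l‖ + |p| + ‖r‖ + 1} μ_P(l', a, l; p; r)`, where `‖l‖` and `‖r‖` are
the sums of the reduced degrees of the entries of `l` and `r`. -/
noncomputable def leftUnit (P : ABimod A) : PreHom (tensor (diag A) P) P := fun l' r =>
  tensorLift (Q := diag A) (P := P) ⟨_, leftUnit_mem P l' r⟩

/-- The relation `K₁ x = y` on `H^0(hom_{[A,A]}(P, A))`, where `K₁` is the self-conjugation map:
the images of `x` and `y` in `H^0(hom_{[A,A]}(P ⊗_A P, P))`, under
`φ ↦ (P ⊗ P → P ⊗ A ≃ P)` given by `id_P ⊗ φ`, respectively `ψ ↦ (P ⊗ P → A ⊗ P ≃ P)` given by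
`ψ ⊗ id_P`, agree. -/
def SelfConj (P : ABimod A) (x y : HomCoh P (diag A) 0) : Prop :=
  ∃ φ ψ : cocycles P (diag A) 0, Submodule.Quotient.mk φ = x ∧ Submodule.Quotient.mk ψ = y ∧
    homComp (rightUnit P) (idTensor P (⟨φ.1, φ.2.1⟩ : hom P (diag A) 0)) -
      homComp (leftUnit P) (tensorId P (⟨ψ.1, ψ.2.1⟩ : hom P (diag A) 0)) ∈
    coboundaries (tensor P P) P 0

end SelfConjugation

section Divisors

variable {K : Type u} [Field K] {X : GrMod K} {A : AInfStr X}

theorem GrMod.ext_internal (X Y : GrMod K) :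
    DirectSum.IsInternal fun n => (X.gr n).prod (Y.gr (n + 1)) := by
  have hX : ∀ n, ∃ f : X →ₗ[K] X, (∀ x ∈ X.gr n, f x = x) ∧ ∀ k ≠ n, ∀ x ∈ X.gr k, f x = 0 :=
    fun n => ⟨X.lin fun i => if i = n then (X.gr i).subtype else 0,
      fun x hx => by simp [X.lin_of_mem _ hx], fun k hk x hx => by simp [X.lin_of_mem _ hx, hk]⟩
  have hY : ∀ n, ∃ f : Y →ₗ[K] Y, (∀ x ∈ Y.gr n, f x = x) ∧ ∀ k ≠ n, ∀ x ∈ Y.gr k, f x = 0 :=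
    fun n => ⟨Y.lin fun i => if i = n then (Y.gr i).subtype else 0,
      fun x hx => by simp [Y.lin_of_mem _ hx], fun k hk x hx => by simp [Y.lin_of_mem _ hx, hk]⟩
  refine DirectSum.isInternal_submodule_of_iSupIndep_of_iSup_eq_top (fun n => ?_) ?_
  · obtain ⟨f, hf, hf'⟩ := hX n
    obtain ⟨g, hg, hg'⟩ := hY (n + 1)
    rw [Submodule.disjoint_def]
    intro x hx hx'
    have e₁ : f.prodMap g x = x := Prod.ext (hf _ hx.1) (hg _ hx.2)
    have e₂ : x ∈ LinearMap.ker (f.prodMap g) := (iSup₂_le fun k hk y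
      (hy : y ∈ (X.gr k).prod (Y.gr (k + 1))) => Prod.ext (hf' k hk _ hy.1)
        (hg' (k + 1) (by omega) _ hy.2) : _ ≤ LinearMap.ker (f.prodMap g)) hx'
    rw [← e₁, e₂]
  · have h₁ : (LinearMap.range (LinearMap.inl K X Y)) ≤
        ⨆ n, (X.gr n).prod (Y.gr (n + 1)) := by
      rw [LinearMap.range_le_iff_comap]
      refine X.eq_top_of_gr_le fun n x hx => Submodule.mem_iSup_of_mem n ⟨hx, zero_mem _⟩
    have h₂ : (LinearMap.range (LinearMap.inr K X Y)) ≤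
        ⨆ n, (X.gr n).prod (Y.gr (n + 1)) := by
      rw [LinearMap.range_le_iff_comap]
      refine Y.eq_top_of_gr_le fun n x hx => Submodule.mem_iSup_of_mem (n - 1) ⟨zero_mem _, ?_⟩
      simpa using hx
    rw [← top_le_iff, ← LinearMap.sup_range_inl_inr]
    exact sup_le h₁ h₂

/-- The graded vector space `A ⊕ P[1]`. -/
def extSpace (P : ABimod A) : GrMod K where
  carrier := X × P.carrier
  gr n := (X.gr n).prod (P.gr (n + 1))
  internal := GrMod.ext_internal X P.toGrMod

/-- The inclusion of `A` into `A ⊕ P[1]`. -/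
def inA (P : ABimod A) : X →ₗ[K] extSpace P := LinearMap.inl K X P.carrier

/-- The inclusion of `P[1]` into `A ⊕ P[1]`. -/
def inP (P : ABimod A) : P.carrier →ₗ[K] extSpace P := LinearMap.inr K X P.carrier

/-- The projection from `A ⊕ P[1]` to `A`. -/
def prA (P : ABimod A) : extSpace P →ₗ[K] X := LinearMap.fst K X P.carrier

/-- The projection from `A ⊕ P[1]` to `P[1]`. -/
def prP (P : ABimod A) : extSpace P →ₗ[K] P.carrier := LinearMap.snd K X P.carrier

@[simp] theorem prA_inA (P : ABimod A) (a : X) : prA P (inA P a) = a := rfl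
@[simp] theorem prP_inA (P : ABimod A) (a : X) : prP P (inA P a) = 0 := rfl
@[simp] theorem prA_inP (P : ABimod A) (p : P.carrier) : prA P (inP P p) = 0 := rfl
@[simp] theorem prP_inP (P : ABimod A) (p : P.carrier) : prP P (inP P p) = p := rfl

theorem inA_add_inP (P : ABimod A) (b : extSpace P) : inA P (prA P b) + inP P (prP P b) = b :=
  Prod.ext (add_zero b.1) (zero_add b.2)

theorem inA_mem (P : ABimod A) {n : ℤ} {a : X} (h : a ∈ X.gr n) : inA P a ∈ (extSpace P).gr n :=
  ⟨h, zero_mem _⟩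

theorem inP_mem (P : ABimod A) {n : ℤ} {p : P.carrier} (h : p ∈ P.gr n) :
    inP P p ∈ (extSpace P).gr (n - 1) :=
  ⟨zero_mem _, (sub_add_cancel n 1).symm ▸ h⟩

theorem rsgn_inA (P : ABimod A) (a : X) : (extSpace P).rsgn (inA P a) = inA P (X.rsgn a) := by
  have : (extSpace P).rsgn ∘ₗ inA P = inA P ∘ₗ X.rsgn := X.lin_ext fun n a ha => by
    rw [LinearMap.comp_apply, LinearMap.comp_apply, GrMod.rsgn_of_mem _ (inA_mem P ha),
      GrMod.rsgn_of_mem _ ha, map_zsmul]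
  exact LinearMap.congr_fun this a

theorem rsgn_inP (P : ABimod A) (p : P.carrier) :
    (extSpace P).rsgn (inP P p) = inP P (P.sgn p) := by
  have : (extSpace P).rsgn ∘ₗ inP P = inP P ∘ₗ P.sgn := P.lin_ext fun n p hp => by
    rw [LinearMap.comp_apply, LinearMap.comp_apply, GrMod.rsgn_of_mem _ (inP_mem P hp),
      P.sgn_of_mem hp, map_zsmul, GrMod.eps_sub_one, GrMod.eps_sub_one, neg_neg]
  exact LinearMap.congr_fun this p

theorem map_inA_rsgn (P : ABimod A) (l : List X) :
    (l.map (inA P)).map (extSpace P).rsgn = (l.map X.rsgn).map (inA P) := by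
  simp [rsgn_inA]

/-- A noncommutative divisor on `A` with underlying bimodule `P`: an `A∞`-algebra structure on
`B = A ⊕ P[1]` such that `A` is a (strictly unital) `A∞`-subalgebra, and such that the induced
`A`-bimodule structure on `B / A = P[1]` is the given one. The two shift signs
`(-1)^{‖a_1‖ + ⋯ + ‖a_r‖ + 1}`, in the diagonal bimodule `B` and in the shifted bimodule `P[1]`,
cancel, so the latter condition says that `μ_B(l, p, r)` has `P[1]`-component `μ_P(l; p; r)`. -/
structure NCDivisor (A : AInfStr X) (P : ABimod A) extends AInfStr (extSpace P) where
  one_eq : one = inA P A.one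
  sub : ∀ l : List X, μ (l.map (inA P)) = inA P (A.μ l)
  quot : ∀ (l r : List X) (p : P.carrier),
    prP P (μ (l.map (inA P) ++ inP P p :: r.map (inA P))) = P.act l r p

namespace NCDivisor

variable {P : ABimod A} (D : NCDivisor A P)

theorem multilin_word_left (p : P.carrier) (r : List X) :
    IsMultilin K fun l : List X => D.μ (l.map (inA P) ++ inP P p :: r.map (inA P)) := fun u v => by
  have := ((D.multilin (u.map (inA P)) (v.map (inA P) ++ inP P p :: r.map (inA P))).mk' ∘ₗ
    inA P).isLinear
  simpa [Function.comp_def] using this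

theorem multilin_word_right (p : P.carrier) (l : List X) :
    IsMultilin K fun r : List X => D.μ (l.map (inA P) ++ inP P p :: r.map (inA P)) := fun u v => by
  have := ((D.multilin (l.map (inA P) ++ inP P p :: u.map (inA P)) (v.map (inA P))).mk' ∘ₗ
    inA P).isLinear
  simpa [Function.comp_def] using this

/-- The `A`-component of `μ_B(l, p, r)`. -/
noncomputable def thetaA (l r : List X) : P.carrier →ₗ[K] X :=
  prA P ∘ₗ (D.multilin (l.map (inA P)) (r.map (inA P))).mk' ∘ₗ inP P

/-- The part `θ : P → A` of `μ_B`, given by the `A`-component of `μ_B(l, p, r)`. -/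
noncomputable def theta : PreHom P (diag A) := fun l r => D.thetaA l r

theorem thetaA_apply (l r : List X) (p : P.carrier) :
    D.thetaA l r p = prA P (D.μ (l.map (inA P) ++ inP P p :: r.map (inA P))) := rfl

theorem theta_apply (l r : List X) (p : P.carrier) :
    D.theta l r p = prA P (D.μ (l.map (inA P) ++ inP P p :: r.map (inA P))) := rfl

theorem word (l r : List X) (p : P.carrier) :
    D.μ (l.map (inA P) ++ inP P p :: r.map (inA P)) =
      inA P (D.thetaA l r p) + inP P (P.act l r p) := by
  rw [← D.quot l r p, D.thetaA_apply, inA_add_inP]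

theorem isHom_inA (P : ABimod A) {l : List X} {m : List ℤ} (h : X.IsHom l m) :
    (extSpace P).IsHom (l.map (inA P)) m := by
  induction h with
  | nil => exact .nil
  | cons h _ ih => exact .cons (inA_mem P h) ih

theorem theta_mem_hom : D.theta ∈ hom P (diag A) 0 := by
  refine ⟨fun r => .of_apply fun p => (D.multilin_word_left p r).comp_lin (prA P),
    fun l => .of_apply fun p => (D.multilin_word_right p l).comp_lin (prA P),
    fun l r h => LinearMap.ext fun p => ?_, fun l m r n i p hl hr hp => ?_⟩
  · have h' : D.one ∈ l.map (inA P) ++ inP P p :: r.map (inA P) := by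
      rw [D.one_eq]
      rcases h with h | h
      · exact List.mem_append_left _ (List.mem_map_of_mem h)
      · exact List.mem_append_right _ (List.mem_cons_of_mem _ (List.mem_map_of_mem h))
    change prA P (D.μ (l.map (inA P) ++ inP P p :: r.map (inA P))) = 0
    by_cases h3 : 3 ≤ (l.map (inA P) ++ inP P p :: r.map (inA P)).length
    · rw [D.μ_eq_zero _ h3 h', map_zero]
    · rcases h with h | h
      · obtain ⟨rfl, rfl⟩ : l = [A.one] ∧ r = [] := by
          have := List.length_pos_of_mem h
          simp only [List.length_append, List.length_map, List.length_cons] at h3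
          refine ⟨?_, List.eq_nil_of_length_eq_zero (by omega)⟩
          obtain ⟨a, rfl⟩ := List.length_eq_one_iff.1 (show l.length = 1 by omega)
          rw [List.mem_singleton.1 h]
        have := D.one_left (inP P p)
        have e : (extSpace P).sgn (inP P p) = -inP P (P.sgn p) := by
          rw [← rsgn_inP, GrMod.rsgn]; simp
        rw [D.one_eq, e] at this
        simp only [List.map_cons, List.map_nil, List.cons_append, List.nil_append, this, map_neg,
          prA_inP, neg_zero]
      · obtain ⟨rfl, rfl⟩ : r = [A.one] ∧ l = [] := by
          have := List.length_pos_of_mem h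
          simp only [List.length_append, List.length_map, List.length_cons] at h3
          refine ⟨?_, List.eq_nil_of_length_eq_zero (by omega)⟩
          obtain ⟨a, rfl⟩ := List.length_eq_one_iff.1 (show r.length = 1 by omega)
          rw [List.mem_singleton.1 h]
        have := D.one_right (inP P p)
        rw [D.one_eq] at this
        simp only [List.map_cons, List.map_nil, List.nil_append, this, prA_inP]
  · have := D.μ_mem _ _ (List.rel_append (isHom_inA P hl) (.cons (inP_mem P hp) (isHom_inA P hr)))
    have h := this.1
    rw [GrMod.rdeg_append, GrMod.rdeg_cons] at h
    rw [show GrMod.rdeg m + i + GrMod.rdeg n + 0 =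
      GrMod.rdeg m + (i - 1 - 1 + GrMod.rdeg n) + 2 by ring]
    exact h

theorem theta_closed : homD P (diag A) 0 D.theta = 0 := by
  funext l r
  refine LinearMap.ext fun p => ?_
  have h := congrArg (prA P) (D.assoc (l.map (inA P) ++ inP P p :: r.map (inA P)))
  have hadd : ∀ (a : X) (q : P.carrier) (u v : List (extSpace P)),
      D.μ (u ++ (inA P a + inP P q) :: v) = D.μ (u ++ inA P a :: v) + D.μ (u ++ inP P q :: v) :=
    fun a q u v => (D.multilin u v).map_add _ _
  have w₁ : ∀ (x z r : List X) (a : X) (p : P.carrier), prA P (D.μ (x.map (inA P) ++ inA P a ::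
      (z.map (inA P) ++ inP P p :: r.map (inA P)))) = D.thetaA (x ++ a :: z) r p :=
    fun x z r a p => by simp [thetaA_apply]
  have w₂ : ∀ (l x z : List X) (a : X) (p : P.carrier), prA P (D.μ (l.map (inA P) ++ inP P p ::
      (x.map (inA P) ++ inA P a :: z.map (inA P)))) = D.thetaA l (x ++ a :: z) p :=
    fun l x z a p => by simp [thetaA_apply]
  have w₃ : ∀ (x z : List X) (a : X), prA P (D.μ (x.map (inA P) ++ inA P a :: z.map (inA P))) =
      A.μ (x ++ a :: z) := fun x z a => by
    have := D.sub (x ++ a :: z)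
    rw [List.map_append, List.map_cons] at this
    rw [this, prA_inA]
  have w₄ : ∀ x y z w : List X, prA P (D.μ (x.map (inA P) ++
      (inA P (D.thetaA y z p) + inP P (P.act y z p)) :: (w.map X.rsgn).map (inA P))) =
      A.μ (x ++ D.thetaA y z p :: w.map X.rsgn) + D.thetaA x (w.map X.rsgn) (P.act y z p) :=
    fun x y z w => by
      refine (congrArg (prA P) (hadd _ _ _ _)).trans ?_
      rw [map_add, w₃, ← thetaA_apply]
  simp only [splitSum₃, splitSum_append_cons, splitSum_add, splitSum_map, List.map_append,
    List.map_cons, map_inA_rsgn, rsgn_inP, D.sub, D.word, List.append_assoc,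
    List.cons_append, map_add, splitSum_hom, w₁, w₂, w₄, map_zero] at h
  have hid : ∀ w : List X, w.map (X.rsgn ^ Int.natAbs 0 : X →ₗ[K] X) = w := fun w =>
    List.map_id w
  have key : splitSum (fun x y => splitSum (fun z w =>
      -A.μ (x ++ D.thetaA y z p :: w.map X.rsgn)) r) l -
      (splitSum (fun x y => splitSum (fun z w => D.thetaA x (w.map X.rsgn) (P.act y z p)) r) l +
      splitSum (fun x y => splitSum (fun y z => D.thetaA l (x ++ A.μ y :: z.map X.rsgn) p) y) r +
      splitSum (fun x y => splitSum (fun y z =>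
        D.thetaA (x ++ A.μ y :: z.map X.rsgn) (r.map X.rsgn) (P.sgn p)) y) l) = 0 := by
    refine neg_eq_zero.1 (Eq.trans ?_ h)
    simp only [splitSum_neg]
    abel
  simp only [homD, LinearMap.coe_mk, AddHom.coe_mk, hid, GrMod.eps_zero, one_smul,
    LinearMap.sub_apply, LinearMap.add_apply, splitSum₃, splitSum_lapply, LinearMap.comp_apply]
  exact key

/-- The section associated to a noncommutative divisor, the class
`[θ] ∈ H^0(hom_{[A,A]}(P, A))`. -/
noncomputable def sectionClass : HomCoh P (diag A) 0 :=
  homClass D.theta ⟨D.theta_mem_hom, D.theta_closed⟩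

/-- An isomorphism of noncommutative divisors: a (strictly unital) isomorphism `F` of
`A∞`-algebras `B → B'`, which restricts to the identity on `A` and induces the identity map of
bimodules on `B / A = B' / A = P[1]`. -/
structure IsIso (D D' : NCDivisor A P) (F : List (extSpace P) → extSpace P) : Prop where
  multilin : IsMultilin K F
  nil : F [] = 0
  mem : ∀ l n, (extSpace P).IsHom l n → F l ∈ (extSpace P).gr (GrMod.rdeg n + 1)
  hom_eq : ∀ l, ∑ c : Composition l.length, D'.μ ((l.splitWrtComposition c).map F) =
    splitSum₃ (fun u v w => F (u ++ D.μ v :: w.map (extSpace P).rsgn)) l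
  one : F [D.one] = D'.one
  eq_zero : ∀ l, 2 ≤ l.length → D.one ∈ l → F l = 0
  bijective : Function.Bijective fun b => F [b]
  sub : ∀ a, F [inA P a] = inA P a
  sub_eq_zero : ∀ l : List X, 2 ≤ l.length → F (l.map (inA P)) = 0
  quot : ∀ p, prP P (F [inP P p]) = p
  quot_eq_zero : ∀ (l r : List X) (p : P.carrier), 1 ≤ l.length + r.length →
    prP P (F (l.map (inA P) ++ inP P p :: r.map (inA P))) = 0

/-- Two noncommutative divisors are isomorphic. -/
def Isomorphic (D D' : NCDivisor A P) : Prop := ∃ F, IsIso D D' F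

end NCDivisor

end Divisors

end NCGeom

set_option linter.unusedSectionVars false
set_option linter.unusedSimpArgs false

/-! Call the number of letters from P in a word over B = A ⊕ P[1] its weight, with A itself in
weight 0 and P[1] in weight 1. No component of μ_B raises the weight. Those that preserve it are μ_A
and μ_P, which are prescribed. A component that lowers it by k + 1 sends words of weight k + 1 to A,
or words of weight k + 2 to P. Such words are exactly the inputs of bimodule maps on tensor powers,
the letters of A between two letters of P being the bar letters of the tensor product, so these
components belong to hom(P^{⊗(k+1)}, A) and hom(P^{⊗(k+2)}, P).

Uniqueness is obstruction theory for this filtration. The identity B → B' of graded spaces satisfies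
the A∞-homomorphism equations as far as the weight-preserving components are concerned. Given F
which satisfies them up to a certain drop in weight, the failure (`defect`) obeys a cocycle identity
(`contr_defect`). Its lowest part is therefore a cocycle (`homD_res`), of degree -2k in
hom(P^{⊗(k+1)}, A) or of degree -1 - 2k in hom(P^{⊗(k+2)}, P), and a primitive of it corrects F
(`exists_correction`). The A-part for k = 0 is θ' - θ, a coboundary because the sections agree. All
other obstructions have negative degree. In hom(P^{⊗(k+1)}, A) negative classes vanish by
assumption; for hom(P^{⊗(k+2)}, P), tensoring with the invertible P identifies its cohomology with
that of hom(P^{⊗(k+1)}, A). Corrections of weight k + 1 do not affect words with at most k letters,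
so the infinite sequence of corrections converges.

The section is fixed by K₁ because of the component P ⊗ P → P of μ_B, which has degree -1. The A∞
relation on words with two letters from P, projected to P, says that its differential is R(θ) - L(θ)
(`homD_quadHom`). Hence L[θ] = R[θ].

Both parts need homological algebra of A∞-bimodules over a field. Quasi-isomorphisms are homotopy
equivalences, since hom into the acyclic mapping cone is acyclic. The functors - ⊗ P and P ⊗ - are
compatible with differentials, there are an associativity isomorphism and unit equivalences, and (Q
⊗ P) ⊗ P' ≃ Q naturally up to homotopy. From this, - ⊗ P is fully faithful on cohomology, R is
bijective in every degree, and K₁ = R⁻¹ ∘ L. -/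

namespace NCGeom

/-! ### Contractions by μ_A: the differential of the bar construction. -/

section Contractions

variable {K : Type u} [Field K] {X : GrMod K} (A : AInfStr X)
  {Y : Type*} [AddCommGroup Y] [Module K Y]

/-- The sum of all contractions of a subword of `l` by `μ`, evaluated by `f`. -/
noncomputable def contr (f : List X → Y) (l : List X) : Y :=
  splitSum₃ (fun u v w => f (u ++ A.μ v :: w.map X.rsgn)) l

variable {A}

theorem contr_nil (f : List X → Y) : contr A f [] = f [0] := by
  simp [contr, splitSum₃, splitSum_nil, A.μ_nil]

/-- The letter produced by the contraction lies on one side of the cut. On the left it twists every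
letter of the right part, on the right it twists nothing to its left. Thus `contr` is a coderivation
for deconcatenation. -/
theorem contr_splitSum (h : List X → List X → Y) (l : List X) :
    contr A (fun l => splitSum h l) l =
      splitSum (fun u v => contr A (fun x => h x (v.map X.rsgn)) u + contr A (h u) v) l := by
  simp only [contr, splitSum₃, splitSum_append_cons, splitSum_add, splitSum_map]
  rw [splitSum_rot₁ fun a b v w => h a (b ++ A.μ v :: w.map X.rsgn),
    ← splitSum_rot₃ fun u v c e => h (u ++ A.μ v :: c.map X.rsgn) (e.map X.rsgn)]
  abel

theorem contr_comp {Z : Type*} [AddCommGroup Z] [Module K Z] (φ : Y →ₗ[K] Z) (f : List X → Y)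
    (l : List X) : φ (contr A f l) = contr A (fun x => φ (f x)) l := by
  simp only [contr, splitSum₃, splitSum_hom]

theorem contr_add (f g : List X → Y) (l : List X) :
    contr A (fun x => f x + g x) l = contr A f l + contr A g l := by
  simp only [contr, splitSum₃, splitSum_add]

theorem contr_zero (l : List X) : contr A (fun _ => (0 : Y)) l = 0 := by
  simp only [contr, splitSum₃, splitSum_zero]

theorem contr_neg (f : List X → Y) (l : List X) :
    contr A (fun x => -f x) l = -contr A f l := by
  simp only [contr, splitSum₃, splitSum_neg]

theorem contr_congr {f g : List X → Y} (h : ∀ x, x ≠ [] → f x = g x) (l : List X) :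
    contr A f l = contr A g l := by
  simp only [contr, splitSum₃]
  exact splitSum_congr _ fun u _ _ => splitSum_congr _ fun v w _ => h _ (by simp)

theorem contr_splitSum_param {α : Type*} (F : List α → List α → List X → Y) (m : List α)
    (l : List X) : contr A (fun x => splitSum (fun u v => F u v x) m) l =
      splitSum (fun u v => contr A (F u v) l) m := by
  simp only [contr, splitSum₃]
  rw [← splitSum_comm fun a b x y => splitSum (fun v w => F x y (a ++ A.μ v :: w.map X.rsgn)) b]
  exact splitSum_congr _ fun a b _ => by
    rw [← splitSum_comm fun v w x y => F x y (a ++ A.μ v :: w.map X.rsgn)]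

theorem IsMultilin.neg_mid {f : List X → Y} (hf : IsMultilin K f) (u v : List X) (a : X) :
    f (u ++ (-a) :: v) = -f (u ++ a :: v) := (hf u v).map_neg a

theorem IsMultilin.neg_mid' {f : List X → Y} (hf : IsMultilin K f) (u x w : List X) (a b : X) :
    f (u ++ a :: (x ++ (-b) :: w)) = -f (u ++ a :: (x ++ b :: w)) := by
  have := hf.neg_mid (u ++ a :: x) w b
  simpa using this

theorem IsMultilin.zero_mid {f : List X → Y} (hf : IsMultilin K f) (u v : List X) :
    f (u ++ 0 :: v) = 0 := (hf u v).map_zero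

/-- For the reduced grading μ_A has degree one, so contraction anticommutes with the sign operator.
-/
theorem contr_map_rsgn {f : List X → Y} (hf : IsMultilin K f) (l : List X) :
    contr A f (l.map X.rsgn) = -contr A (fun x => f (x.map X.rsgn)) l := by
  simp only [contr, splitSum₃, splitSum_map, List.map_append, List.map_cons, A.rsgn_μ,
    hf.neg_mid, splitSum_neg, neg_neg]

/-- Contractions at two disjoint places occur in both orders and cancel, because the left one passes
a sign to the letter produced by the right one. Nested contractions add up to the A∞ relation. -/
theorem contr_contr {f : List X → Y} (hf : IsMultilin K f) (l : List X) :
    contr A (contr A f) l = 0 := by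
  -- The A∞ relation for the subword m, placed between fixed words c and e.
  have h0 : ∀ c e m, splitSum₃ (fun u v w => f (c ++ A.μ (u ++ A.μ v :: w.map X.rsgn) :: e)) m
      = 0 := fun c e m => by
    have h2 := splitSum_hom (hf c e).mk'
      (fun u vw => splitSum (fun v w => A.μ (u ++ A.μ v :: w.map X.rsgn)) vw) m
    have this := A.assoc m
    simp only [splitSum₃] at this
    rw [this, map_zero] at h2
    rw [h2, splitSum₃]
    simp only [splitSum_hom]
    rfl
  simp only [contr, splitSum₃, splitSum_append_cons, splitSum_add, splitSum_map, List.map_append,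
    List.map_cons, List.append_assoc, List.cons_append, List.map_map, X.rsgn_comp_rsgn, List.map_id,
    A.rsgn_μ, hf.neg_mid', splitSum_neg] at h0 ⊢
  rw [splitSum_rot₂ fun c d e v w => f (c ++ A.μ d :: (e.map X.rsgn ++ A.μ (v.map X.rsgn) :: w)),
    splitSum_rot₁ fun c s v w => splitSum (fun d e =>
      f (c ++ A.μ (s ++ A.μ v :: d.map X.rsgn) :: e)) w]
  simp only [← splitSum_rot₃ fun s v d e => f (_ ++ A.μ (s ++ A.μ v :: d.map X.rsgn) :: e)]
  simp only [h0, splitSum_zero]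
  abel

theorem contr_multilin {f : List X → Y} (hf : IsMultilin K f) : IsMultilin K (contr A f) := by
  unfold contr splitSum₃
  refine .splitSum (fun vw => ?_) (fun u => .splitSum (fun w => ?_) (fun v => ?_))
  · intro a b
    exact NCGeom.IsLinearMap.splitSum vw fun v w _ => by
      simpa using hf a (b ++ A.μ v :: w.map X.rsgn)
  · exact A.multilin.comp_lin (hf u (w.map X.rsgn)).mk'
  · have := (hf.prepend (u ++ [A.μ v])).map_rsgn
    simpa using this

/-- Contractions of words with a unit entry, for `f` that vanishes on the longer such words. -/
theorem contr_one {f : List X → Y} (hf : IsMultilin K f)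
    (h0 : ∀ l, 2 ≤ l.length → A.one ∈ l → f l = 0) (u v : List X) :
    contr A f (u ++ A.one :: v) =
      (if u = [] then 0 else f (u ++ v.map X.rsgn)) +
        (if v = [] then 0 else -f (u ++ v.map X.rsgn)) := by
  have hz : ∀ x y, f (x ++ 0 :: y) = 0 := fun x y => (hf x y).map_zero
  -- Contractions whose first letter is the unit: only the block (e, b) contributes, with μ²(e, b) =
  -- (-1)^{|b|} b, which is minus the sign twist of b.
  have hI₀ : ∀ x, splitSum (fun w y => f (x ++ A.μ (A.one :: w) :: y.map X.rsgn)) v =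
      if v = [] then 0 else -f (x ++ v.map X.rsgn) := by
    intro x
    cases v with
    | nil => simp [splitSum_nil, A.μ_one, hz]
    | cons b v =>
      rw [splitSum_cons, A.μ_one, hz, splitSum_single_left]
      · have := (hf x (v.map X.rsgn)).map_neg (X.sgn b)
        have hb : X.rsgn b = -X.sgn b := rfl
        simp [A.one_left, hb, this]
      · intro y z _ hy
        rw [A.μ_eq_zero _ _ (by simp), hz]
        have := List.length_pos_iff.2 hy
        simp; omega
  -- If letters c precede the unit in the contracted block, the block must end with the unit. The
  -- outer sum then forces c to be one letter, with μ²(c, e) = c.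
  have hI₁ : ∀ x c, c ≠ [] →
      splitSum (fun w y => f (x ++ A.μ (c ++ A.one :: w) :: y.map X.rsgn)) v =
      f (x ++ A.μ (c ++ [A.one]) :: v.map X.rsgn) := by
    intro x c hc
    rw [splitSum_single_left]
    intro y z _ hy
    rw [A.μ_eq_zero _ _ (by simp), hz]
    have := List.length_pos_iff.2 hy
    have := List.length_pos_iff.2 hc
    simp; omega
  have h1 : ∀ (x y z : List X) (a : X), f (x ++ A.one :: (y ++ a :: z)) = 0 :=
    fun x y z a => h0 _ (by simp; omega) (by simp)
  have h2 : ∀ (x y z : List X) (a : X), f (x ++ a :: (y ++ X.rsgn A.one :: z)) = 0 :=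
    fun x y z a => by
      have e := (hf (x ++ a :: y) z).map_neg A.one
      have e' := h0 ((x ++ a :: y) ++ A.one :: z) (by simp; omega) (by simp)
      rw [e', neg_zero] at e
      rw [A.rsgn_one]
      simpa using e
  simp only [contr, splitSum₃, splitSum_append_cons, List.map_append,
    List.map_cons, List.append_assoc, List.cons_append, h1, h2, splitSum_zero,
    add_zero, zero_add]
  rcases List.eq_nil_or_concat u with rfl | ⟨L, a, rfl⟩
  · simpa [splitSum_nil] using hI₀ []
  · rw [List.concat_eq_append, splitSum_append_cons, splitSum_nil]
    congr 1
    · rw [splitSum_single_right]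
      · rw [hI₁ _ _ (by simp)]
        simp [A.one_right]
      · intro x y _ hy
        rw [hI₁ _ _ (by simp), A.μ_eq_zero _ _ (by simp), hz]
        have := List.length_pos_iff.2 hy
        simp; omega
    · simpa using hI₀ (L ++ [a])

theorem contr_mem {f : List X → Y} {S : Submodule K Y} {l : List X} {d : List ℤ}
    (hl : X.IsHom l d)
    (h : ∀ x e, X.IsHom x e → GrMod.rdeg e = GrMod.rdeg d + 1 → f x ∈ S) : contr A f l ∈ S := by
  rw [contr, splitSum₃]
  refine splitSum_mem fun u x hx => splitSum_mem fun v w hw => ?_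
  subst hx hw
  obtain ⟨d₁, d', rfl, h₁, h'⟩ := isHom_append hl
  obtain ⟨d₂, d₃, rfl, h₂, h₃⟩ := isHom_append h'
  refine h _ _ (List.rel_append h₁ (.cons (A.μ_mem _ _ h₂) (isHom_map_rsgn h₃))) ?_
  simp; ring

end Contractions

/-! ### Sign operators for operations of arbitrary degree. -/

section SignPowers

variable {K : Type u} [Field K] (X : GrMod K)

/-- The operator `x ↦ (-1)^{d ‖x‖} x`. -/
noncomputable abbrev rsp (d : ℤ) : X →ₗ[K] X := X.rsgn ^ d.natAbs

theorem rsgn_pow_even {n : ℕ} (h : Even n) : (X.rsgn ^ n : X →ₗ[K] X) = LinearMap.id := by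
  obtain ⟨k, rfl⟩ := h
  have : (X.rsgn * X.rsgn : X →ₗ[K] X) = 1 := LinearMap.ext fun x => X.rsgn_rsgn x
  rw [← two_mul, pow_mul, pow_two, this, one_pow]; rfl

theorem rsgn_pow_odd {n : ℕ} (h : Odd n) : (X.rsgn ^ n : X →ₗ[K] X) = X.rsgn := by
  obtain ⟨k, rfl⟩ := h
  rw [pow_succ, rsgn_pow_even X ⟨k, two_mul k⟩]; rfl

theorem rsp_of_even {d : ℤ} (h : Even d) : rsp X d = LinearMap.id :=
  rsgn_pow_even X (Int.natAbs_even.2 h)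

theorem rsp_of_odd {d : ℤ} (h : ¬ Even d) : rsp X d = X.rsgn :=
  rsgn_pow_odd X (Int.natAbs_odd.2 (Int.not_even_iff_odd.1 h))

theorem GrMod.eps_of_even {d : ℤ} (h : Even d) : GrMod.eps d = 1 := by
  simp [GrMod.eps, Int.negOnePow_even d h]

theorem GrMod.eps_of_odd {d : ℤ} (h : ¬ Even d) : GrMod.eps d = -1 := by
  simp [GrMod.eps, Int.negOnePow_odd d (Int.not_even_iff_odd.1 h)]

@[simp] theorem map_rsp_zero (l : List X) : l.map (rsp X 0) = l := by
  rw [rsp_of_even X Even.zero]; exact List.map_id l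

theorem map_rsp_one (l : List X) : l.map (rsp X 1) = l.map X.rsgn := by
  rw [rsp_of_odd X (by decide)]

theorem map_rsp_add (d e : ℤ) (l : List X) :
    l.map (rsp X (d + e)) = (l.map (rsp X e)).map (rsp X d) := by
  by_cases hd : Even d <;> by_cases he : Even e
  · simp [rsp_of_even X hd, rsp_of_even X he, rsp_of_even X (hd.add he)]
  · have : ¬ Even (d + e) := by simp [Int.even_add, hd, he]
    rw [rsp_of_even X hd, rsp_of_odd X he, rsp_of_odd X this]; simp
  · have : ¬ Even (d + e) := by simp [Int.even_add, hd, he]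
    rw [rsp_of_odd X hd, rsp_of_even X he, rsp_of_odd X this]; simp
  · have : Even (d + e) := by simp [Int.even_add, hd, he]
    rw [rsp_of_odd X hd, rsp_of_odd X he, rsp_of_even X this]; simp [X.rsgn_comp_rsgn]

theorem map_rsp_add_one (d : ℤ) (l : List X) :
    l.map (rsp X (d + 1)) = (l.map X.rsgn).map (rsp X d) := by
  rw [map_rsp_add, map_rsp_one]

theorem map_rsp_add_one' (d : ℤ) (l : List X) :
    l.map (rsp X (d + 1)) = (l.map (rsp X d)).map X.rsgn := by
  rw [add_comm, map_rsp_add, map_rsp_one]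

theorem map_rsp_comm (d : ℤ) (l : List X) :
    (l.map X.rsgn).map (rsp X d) = (l.map (rsp X d)).map X.rsgn := by
  rw [← map_rsp_add_one, map_rsp_add_one']

/-- The operator `x ↦ (-1)^{d |x|} x`. -/
noncomputable def sgnp (d : ℤ) : X →ₗ[K] X := X.sgn ^ d.natAbs

theorem sgnp_of_even {d : ℤ} (h : Even d) : sgnp X d = LinearMap.id := by
  obtain ⟨k, hk⟩ := Int.natAbs_even.2 h
  have : (X.sgn * X.sgn : X →ₗ[K] X) = 1 := LinearMap.ext fun x => X.sgn_sgn x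
  rw [sgnp, hk, ← two_mul, pow_mul, pow_two, this, one_pow]; rfl

theorem sgnp_of_odd {d : ℤ} (h : ¬ Even d) : sgnp X d = X.sgn := by
  obtain ⟨k, hk⟩ := Int.natAbs_odd.2 (Int.not_even_iff_odd.1 h)
  have : (X.sgn * X.sgn : X →ₗ[K] X) = 1 := LinearMap.ext fun x => X.sgn_sgn x
  rw [sgnp, hk, pow_succ, pow_mul, pow_two, this, one_pow]; rfl

@[simp] theorem sgnp_zero : sgnp X 0 = LinearMap.id := sgnp_of_even X Even.zero

theorem sgnp_add_one (d : ℤ) (x : X) : sgnp X (d + 1) x = sgnp X d (X.sgn x) := by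
  by_cases hd : Even d
  · have : ¬ Even (d + 1) := by rw [Int.even_add]; simp [hd]
    rw [sgnp_of_even X hd, sgnp_of_odd X this]; rfl
  · have : Even (d + 1) := by rw [Int.even_add]; simp [hd]
    rw [sgnp_of_odd X hd, sgnp_of_even X this]; simp

theorem sgnp_sgn (d : ℤ) (x : X) : sgnp X d (X.sgn x) = X.sgn (sgnp X d x) := by
  by_cases hd : Even d
  · rw [sgnp_of_even X hd]; rfl
  · rw [sgnp_of_odd X hd]

theorem sgnp_mem (d : ℤ) {i : ℤ} {x : X} (hx : x ∈ X.gr i) : sgnp X d x ∈ X.gr i := by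
  by_cases hd : Even d
  · rw [sgnp_of_even X hd]; exact hx
  · rw [sgnp_of_odd X hd]; exact X.sgn_mem hx

theorem isHom_map_rsp (d : ℤ) {l : List X} {e : List ℤ} (h : X.IsHom l e) :
    X.IsHom (l.map (rsp X d)) e := by
  by_cases hd : Even d
  · rw [rsp_of_even X hd]; simpa using h
  · rw [rsp_of_odd X hd]; exact isHom_map_rsgn h

variable {X}

/-- Moving an operation of degree d past a contraction, which has degree one, costs (-1)^d. -/
theorem contr_map_rsp {A : AInfStr X} {Y : Type*} [AddCommGroup Y] [Module K Y] {f : List X → Y}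
    (hf : IsMultilin K f) (d : ℤ) (l : List X) :
    contr A (fun x => f (x.map (rsp X d))) l = GrMod.eps d • contr A f (l.map (rsp X d)) := by
  by_cases hd : Even d
  · simp [rsp_of_even X hd, GrMod.eps_of_even hd]
  · rw [rsp_of_odd X hd, GrMod.eps_of_odd hd, contr_map_rsgn hf]; simp

theorem IsMultilin.map_rsp {Y : Type*} [AddCommGroup Y] [Module K Y] {f : List X → Y}
    (hf : IsMultilin K f) (d : ℤ) : IsMultilin K fun l => f (l.map (rsp X d)) := by
  by_cases hd : Even d
  · simpa [rsp_of_even X hd] using hf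
  · rw [rsp_of_odd X hd]; exact hf.map_rsgn

end SignPowers

/-! ### Composition of multilinear maps, the bar differential and the Leibniz rule. -/

section Composition

variable {K : Type u} [Field K] {X : GrMod K} {A : AInfStr X}

/-- Functions of words `l, p, r` with `p` an element of the bimodule `P`. -/
abbrev BiFun (P : ABimod A) (Y : Type*) [AddCommGroup Y] [Module K Y] :=
  List X → List X → P.carrier →ₗ[K] Y

/-- Multilinearity in the words on both sides. -/
def BiMultilin {P : ABimod A} {Y : Type*} [AddCommGroup Y] [Module K Y] (φ : BiFun P Y) : Prop :=
  (∀ r, IsMultilin K fun l => φ l r) ∧ ∀ l, IsMultilin K (φ l)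

/-- Compatibility with signs of an operation of degree `d`. -/
def SignDeg {P Q : ABimod A} (d : ℤ) (f : PreHom P Q) : Prop :=
  ∀ l r p, f (l.map X.rsgn) (r.map X.rsgn) (P.sgn p) = GrMod.eps d • Q.sgn (f l r p)

variable {P Q R S : ABimod A} {Y : Type*} [AddCommGroup Y] [Module K Y]

/-- The composition `g ∘ f`, where `f` has degree `d`. -/
noncomputable def comp (d : ℤ) (g : BiFun Q Y) (f : PreHom P Q) : BiFun P Y := fun l r =>
  splitSum (fun x y => splitSum (fun z w => g x (w.map (rsp X d)) ∘ₗ f y z) r) l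

/-- The terms of the bar differential which involve `μ_A`. -/
noncomputable def bdA (φ : BiFun P Y) : BiFun P Y := fun l r =>
  contr A (φ l) r + contr A (fun x => φ x (r.map X.rsgn) ∘ₗ P.sgn) l

/-- The composition with the bar differential. -/
noncomputable def bd (φ : BiFun P Y) : BiFun P Y := comp 1 φ P.act + bdA φ

theorem comp_apply (d : ℤ) (g : BiFun Q Y) (f : PreHom P Q) (l r : List X) (p : P.carrier) :
    comp d g f l r p = splitSum (fun x y => splitSum (fun z w =>
      g x (w.map (rsp X d)) (f y z p)) r) l := by
  simp only [comp, splitSum_lapply, LinearMap.comp_apply]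

theorem contr_lapply {V : Type*} [AddCommGroup V] [Module K V] (f : List X → V →ₗ[K] Y)
    (l : List X) (v : V) : contr A f l v = contr A (fun x => f x v) l :=
  contr_comp (LinearMap.applyₗ v) f l

theorem bdA_apply (φ : BiFun P Y) (l r : List X) (p : P.carrier) :
    bdA φ l r p = contr A (fun z => φ l z p) r +
      contr A (fun x => φ x (r.map X.rsgn) (P.sgn p)) l := by
  simp only [bdA, LinearMap.add_apply, contr_lapply, LinearMap.comp_apply]

theorem bd_apply (φ : BiFun P Y) (l r : List X) (p : P.carrier) :
    bd φ l r p = comp 1 φ P.act l r p + bdA φ l r p := rfl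

theorem comp_one_eq (φ : BiFun Q Y) (f : PreHom P Q) (l r : List X) : comp 1 φ f l r =
    splitSum (fun x y => splitSum (fun z w => φ x (w.map X.rsgn) ∘ₗ f y z) r) l := by
  simp only [comp, map_rsp_one]

/-- The differential is a commutator with structure maps: μ_Q after φ, minus (-1)^d times φ after
the bar differential. The signs of the later identities are computed in this form. -/
theorem homD_eq (d : ℤ) (φ : PreHom P Q) :
    homD P Q d φ = comp d Q.act φ - GrMod.eps d • bd φ := by
  funext l r
  simp only [homD, LinearMap.coe_mk, AddHom.coe_mk, Pi.sub_apply, Pi.smul_apply, bd, Pi.add_apply,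
    bdA, comp_one_eq, comp, contr, splitSum₃, add_assoc, map_rsp_one]

theorem comp_zero_eq (g : PreHom Q R) (f : PreHom P Q) : comp 0 g f = homComp g f := by
  funext l r
  simp only [comp, homComp, map_rsp_zero]

/-- This is the A∞-bimodule equation of `P`. -/
theorem act_bd (P : ABimod A) : bd (P := P) P.act = 0 := by
  funext l r
  refine LinearMap.ext fun p => ?_
  have := P.assoc l r p
  simp only [bd_apply, comp_apply, map_rsp_one, bdA_apply, contr]
  rw [← add_assoc]
  exact this

theorem act_multilin (P : ABimod A) : BiMultilin (P := P) P.act :=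
  ⟨P.multilin_left, P.multilin_right⟩

theorem act_signDeg (P : ABimod A) : SignDeg (P := P) (Q := P) 1 P.act := fun l r p => by
  rw [P.sgn_act]; simp

theorem splitSum_smul {α : Type*} (c : K) (f : List α → List α → Y) (l : List α) :
    splitSum (fun u v => c • f u v) l = c • splitSum f l := Finset.smul_sum.symm

theorem splitSum_zsmul {α : Type*} (c : ℤ) (f : List α → List α → Y) (l : List α) :
    splitSum (fun u v => c • f u v) l = c • splitSum f l := Finset.smul_sum.symm

theorem comp_add_left (d : ℤ) (g g' : BiFun Q Y) (f : PreHom P Q) :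
    comp d (g + g') f = comp d g f + comp d g' f := by
  funext l r
  refine LinearMap.ext fun p => ?_
  simp only [Pi.add_apply, LinearMap.add_apply, comp_apply, splitSum_add]

theorem comp_neg_left (d : ℤ) (g : BiFun Q Y) (f : PreHom P Q) :
    comp d (-g) f = -comp d g f := by
  funext l r
  refine LinearMap.ext fun p => ?_
  simp only [Pi.neg_apply, LinearMap.neg_apply, comp_apply, splitSum_neg]

theorem comp_zsmul_left (d : ℤ) (c : ℤ) (g : BiFun Q Y) (f : PreHom P Q) :
    comp d (c • g) f = c • comp d g f := by
  funext l r
  refine LinearMap.ext fun p => ?_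
  simp only [Pi.smul_apply, LinearMap.smul_apply, comp_apply, splitSum_zsmul]

theorem comp_sub_left (d : ℤ) (g g' : BiFun Q Y) (f : PreHom P Q) :
    comp d (g - g') f = comp d g f - comp d g' f := by
  rw [sub_eq_add_neg, comp_add_left, comp_neg_left, sub_eq_add_neg]

theorem comp_add_right (d : ℤ) (g : BiFun Q Y) (f f' : PreHom P Q) :
    comp d g (f + f') = comp d g f + comp d g f' := by
  funext l r
  refine LinearMap.ext fun p => ?_
  simp only [Pi.add_apply, LinearMap.add_apply, comp_apply, map_add, splitSum_add]

theorem comp_neg_right (d : ℤ) (g : BiFun Q Y) (f : PreHom P Q) :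
    comp d g (-f) = -comp d g f := by
  funext l r
  refine LinearMap.ext fun p => ?_
  simp only [Pi.neg_apply, LinearMap.neg_apply, comp_apply, map_neg, splitSum_neg]

theorem comp_zsmul_right (d : ℤ) (c : ℤ) (g : BiFun Q Y) (f : PreHom P Q) :
    comp d g (c • f) = c • comp d g f := by
  funext l r
  refine LinearMap.ext fun p => ?_
  simp only [Pi.smul_apply, LinearMap.smul_apply, comp_apply, map_zsmul, splitSum_zsmul]

theorem comp_smul_right (d : ℤ) (c : K) (g : BiFun Q Y) (f : PreHom P Q) :
    comp d g (c • f) = c • comp d g f := by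
  funext l r
  refine LinearMap.ext fun p => ?_
  simp only [Pi.smul_apply, LinearMap.smul_apply, comp_apply, map_smul, splitSum_smul]

theorem comp_sub_right (d : ℤ) (g : BiFun Q Y) (f f' : PreHom P Q) :
    comp d g (f - f') = comp d g f - comp d g f' := by
  rw [sub_eq_add_neg, comp_add_right, comp_neg_right, sub_eq_add_neg]

theorem comp_zero_right (d : ℤ) (g : BiFun Q Y) : comp d g (0 : PreHom P Q) = 0 := by
  funext l r
  refine LinearMap.ext fun p => ?_
  simp only [comp_apply, Pi.zero_apply, LinearMap.zero_apply, map_zero, splitSum_zero]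

theorem comp_zero_left (d : ℤ) (f : PreHom P Q) : comp d (0 : BiFun Q Y) f = 0 := by
  funext l r
  refine LinearMap.ext fun p => ?_
  simp only [comp_apply, Pi.zero_apply, LinearMap.zero_apply, splitSum_zero]

theorem bdA_add (φ ψ : BiFun P Y) : bdA (φ + ψ) = bdA φ + bdA ψ := by
  funext l r
  refine LinearMap.ext fun p => ?_
  simp only [bdA_apply, Pi.add_apply, LinearMap.add_apply, contr_add]
  abel

theorem bdA_neg (φ : BiFun P Y) : bdA (-φ) = -bdA φ := by
  funext l r
  refine LinearMap.ext fun p => ?_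
  simp only [bdA_apply, Pi.neg_apply, LinearMap.neg_apply, contr_neg]
  abel

theorem bd_add (φ ψ : BiFun P Y) : bd (φ + ψ) = bd φ + bd ψ := by
  rw [bd, bdA_add, comp_add_left, bd, bd]; abel

theorem bd_neg (φ : BiFun P Y) : bd (-φ) = -bd φ := by
  rw [bd, bdA_neg, comp_neg_left, bd]; abel

theorem bd_sub (φ ψ : BiFun P Y) : bd (φ - ψ) = bd φ - bd ψ := by
  rw [sub_eq_add_neg, bd_add, bd_neg, sub_eq_add_neg]

theorem eps_smul_cases {M : Type*} [AddCommGroup M] (d : ℤ) :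
    (∀ m : M, GrMod.eps d • m = m) ∨ ∀ m : M, GrMod.eps d • m = -m := by
  by_cases h : Even d
  · exact .inl fun m => by rw [GrMod.eps_of_even h, one_smul]
  · exact .inr fun m => by rw [GrMod.eps_of_odd h, neg_smul, one_smul]

theorem bd_eps_smul (d : ℤ) (φ : BiFun P Y) : bd (GrMod.eps d • φ) = GrMod.eps d • bd φ := by
  by_cases h : Even d
  · rw [GrMod.eps_of_even h, one_smul, one_smul]
  · rw [GrMod.eps_of_odd h, neg_smul, one_smul, neg_smul, one_smul, bd_neg]

/-- Both sides sum over cuts of the left and the right word into three parts. The right letters fed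
to h have been passed by f and by g, whence the exponent d + e. -/
theorem comp_assoc (d e : ℤ) (h : BiFun R Y) (g : PreHom Q R) (f : PreHom P Q) :
    comp d (comp e h g) f = comp (d + e) h (comp d g f) := by
  funext l r
  refine LinearMap.ext fun p => ?_
  simp only [comp_apply, splitSum_hom, splitSum_map, ← map_rsp_add]
  simp only [add_comm e d]
  rw [splitSum_congr l fun x y _ => splitSum_comm (fun z w x v => splitSum (fun a b =>
    h x (b.map (rsp X (d + e))) (g v (a.map (rsp X d)) (f y z p))) w) r x]
  rw [splitSum_rot fun x y v => splitSum (fun z w => splitSum (fun a b =>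
    h x (b.map (rsp X (d + e))) (g y (a.map (rsp X d)) (f v z p))) w) r]
  refine splitSum_congr _ fun x v _ => ?_
  rw [← splitSum_comm fun y v z w => splitSum (fun u a =>
    h x (w.map (rsp X (d + e))) (g y (a.map (rsp X d)) (f v u p))) z]
  refine splitSum_congr _ fun y v _ => ?_
  exact (splitSum_rot (fun z a b => h x (b.map (rsp X (d + e))) (g y (a.map (rsp X d)) (f v z p)))
    r).symm

/-- A contraction hits letters fed to f or letters fed to g. Contracting letters of g to the left of
f twists the whole input of f, and `SignDeg` moves this twist to the value of f at the cost of
(-1)^d. -/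
theorem bdA_comp {d : ℤ} {g : BiFun Q Y} {f : PreHom P Q} (hg : BiMultilin g) (hf : SignDeg d f) :
    bdA (comp d g f) = comp (d + 1) g (bdA f) + GrMod.eps d • comp d (bdA g) f := by
  funext l r
  refine LinearMap.ext fun p => ?_
  have h1 : ∀ x y : List X, contr A (fun r => splitSum (fun z w =>
      g x (w.map (rsp X d)) (f y z p)) r) r =
      splitSum (fun z w => g x (w.map (rsp X (d + 1))) (contr A (fun z => f y z p) z) +
        GrMod.eps d • contr A (fun w => g x w (f y z p)) (w.map (rsp X d))) r := fun x y => by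
    rw [contr_splitSum]
    refine splitSum_congr _ fun z w _ => ?_
    rw [contr_comp, contr_map_rsp (f := fun w => g x w (f y z p))
      ((hg.2 x).comp_lin (LinearMap.applyₗ _)), map_rsp_add_one]
  have h2 : ∀ x y : List X, contr A (fun x => splitSum (fun z w =>
      g x ((w.map X.rsgn).map (rsp X d)) (f (y.map X.rsgn) (z.map X.rsgn) (P.sgn p))) r) x =
      splitSum (fun z w => GrMod.eps d • contr A (fun x => g x ((w.map (rsp X d)).map X.rsgn)
        (Q.sgn (f y z p))) x) r := fun x y => by
    rw [contr_splitSum_param]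
    refine splitSum_congr _ fun z w _ => ?_
    simp only [hf y z p, map_zsmul, map_rsp_comm]
    rcases eps_smul_cases (M := Y) d with h | h <;> simp only [h, contr_neg]
  have h3 : ∀ x y : List X, contr A (fun y => splitSum (fun z w =>
      g x ((w.map X.rsgn).map (rsp X d)) (f y (z.map X.rsgn) (P.sgn p))) r) y =
      splitSum (fun z w => g x (w.map (rsp X (d + 1)))
        (contr A (fun y => f y (z.map X.rsgn) (P.sgn p)) y)) r := fun x y => by
    rw [contr_splitSum_param]
    refine splitSum_congr _ fun z w _ => ?_
    rw [contr_comp, map_rsp_add_one]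
  simp only [bdA_apply, Pi.add_apply, Pi.smul_apply, LinearMap.add_apply, LinearMap.smul_apply,
    comp_apply, map_add, splitSum_add, splitSum_map, contr_splitSum_param, h1, smul_add,
    contr_splitSum, h2, h3, splitSum_zsmul]
  abel

/-- A Leibniz rule in which the target of g is a bare vector space, so that no structure maps act on
its values. In this generality it applies to the tautological maps `pairRight` and `pairLeft` into a
tensor product. -/
theorem bd_comp {d : ℤ} {g : BiFun Q Y} {f : PreHom P Q} (hg : BiMultilin g) (hf : SignDeg d f) :
    comp d (bd g) f - GrMod.eps d • bd (comp d g f) = comp (d + 1) g (homD P Q d f) := by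
  rw [bd, bd, homD_eq, bdA_comp hg hf, comp_sub_right, comp_zsmul_right, comp_add_left, bd,
    comp_add_right, comp_assoc, comp_assoc, add_comm 1 d]
  simp only [smul_add, smul_smul, GrMod.eps_mul_self, one_smul]
  abel

theorem contr_contr_comm (f : List X → List X → Y) (l r : List X) :
    contr A (fun x => contr A (fun z => f x z) r) l =
      contr A (fun z => contr A (fun x => f x z) l) r := by
  have h : ∀ x, contr A (fun z => f x z) r = splitSum (fun a b =>
      splitSum (fun v w => f x (a ++ A.μ v :: w.map X.rsgn)) b) r := fun x => rfl
  simp only [h, contr_splitSum_param]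
  rfl

/-- Contractions on one side square to zero. Contractions on opposite sides commute, except that the
left one twists the right word, so the mixed terms cancel. -/
theorem bdA_bdA {φ : BiFun P Y} (hφ : BiMultilin φ) : bdA (bdA φ) = 0 := by
  funext l r
  refine LinearMap.ext fun p => ?_
  have e1 := contr_contr (A := A) (((hφ.2 l)).comp_lin (LinearMap.applyₗ p)) r
  have e2 := contr_contr (A := A) ((hφ.1 r).comp_lin (LinearMap.applyₗ p)) l
  simp only [LinearMap.applyₗ_apply_apply] at e1 e2
  change contr A (contr A fun l => φ l r p) l = 0 at e2
  change contr A (contr A fun r => φ l r p) r = 0 at e1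
  simp only [bdA_apply, contr_add, GrMod.map_rsgn_rsgn, GrMod.sgn_sgn]
  have e4 : ∀ x, contr A (fun z => φ x z (P.sgn p)) (r.map X.rsgn) =
      -contr A (fun z => φ x (z.map X.rsgn) (P.sgn p)) r := fun x =>
    contr_map_rsgn (f := fun z => φ x z (P.sgn p)) ((hφ.2 x).comp_lin (LinearMap.applyₗ _)) r
  simp only [e4, contr_neg]
  have e3 : contr A (fun x => contr A (fun z => φ x (z.map X.rsgn) (P.sgn p)) r) l =
      contr A (fun z => contr A (fun x => φ x (z.map X.rsgn) (P.sgn p)) l) r :=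
    contr_contr_comm (fun x z => φ x (z.map X.rsgn) (P.sgn p)) l r
  rw [e3]
  change contr A (contr A fun r => φ l r p) r + _ + (_ + contr A (contr A fun l => φ l r p) l) = _
  rw [e1, e2, zero_add, add_zero, add_neg_cancel]
  rfl

theorem homD_act (P : ABimod A) : homD P P 1 P.act = comp 1 P.act P.act := by
  rw [homD_eq, act_bd, smul_zero, sub_zero]

/-- In the Leibniz rule let f be the structure maps of P, whose differential is their composition
with themselves. This self-composition appears on both sides and drops out. -/
theorem bd_bd {φ : BiFun P Y} (hφ : BiMultilin φ) : bd (bd φ) = 0 := by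
  have h := bd_comp hφ (act_signDeg P)
  rw [homD_act, GrMod.eps_one, neg_smul, one_smul, sub_neg_eq_add] at h
  have h2 : bd (comp 1 φ P.act) = comp 1 (comp 1 φ P.act) P.act + bdA (comp 1 φ P.act) := rfl
  have h3 : bd (bd φ) = comp 1 (bd φ) P.act + bdA (comp 1 φ P.act) + bdA (bdA φ) := by
    rw [bd, bd, bdA_add, add_assoc]
  rw [h3, bdA_bdA hφ, add_zero]
  rw [h2, comp_assoc, ← add_assoc] at h
  have h4 : comp 1 (bd φ) P.act + bdA (comp 1 φ P.act) =
      comp (1 + 1) φ (comp 1 P.act P.act) - comp (1 + 1) φ (comp 1 P.act P.act) := by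
    nth_rewrite 1 [← h]; abel
  rw [h4, sub_self]

theorem homD_comp {d e : ℤ} {g : PreHom Q R} {f : PreHom P Q} (hg : BiMultilin g)
    (hf : SignDeg d f) : homD P R (d + e) (comp d g f) =
      comp d (homD Q R e g) f + GrMod.eps e • comp (d + 1) g (homD P Q d f) := by
  rw [← bd_comp hg hf, homD_eq, homD_eq, comp_sub_left, comp_assoc, comp_zsmul_left, smul_sub,
    smul_smul, ← GrMod.eps_add, add_comm e d]
  abel

/-- Put g = μ_Q in the Leibniz rule. As `bd` kills μ_Q, composing μ_Q with the differential of f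
gives the same as applying `bd` to μ_Q ∘ f, up to sign, and `bd_bd` removes the rest. -/
theorem homD_homD {d : ℤ} {f : PreHom P Q} (hf : BiMultilin f) (hs : SignDeg d f) :
    homD P Q (d + 1) (homD P Q d f) = 0 := by
  have h := bd_comp (act_multilin Q) hs
  rw [act_bd, comp_zero_left, zero_sub] at h
  rw [homD_eq (d + 1), ← h]
  rw [homD_eq, bd_sub, bd_eps_smul, bd_bd hf, smul_zero, sub_zero, GrMod.eps_add_one]
  simp

theorem IsMultilin.splitSum_param {α : Type*} {F : List X → List α → List α → Y} (m : List α)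
    (h : ∀ u v, m = u ++ v → IsMultilin K fun l => F l u v) :
    IsMultilin K fun l => NCGeom.splitSum (F l) m := by
  intro x y
  constructor
  · intro a b
    rw [← splitSum_add]
    exact splitSum_congr m fun u v e => (h u v e x y).map_add a b
  · intro c a
    rw [← splitSum_smul]
    exact splitSum_congr m fun u v e => (h u v e x y).map_smul c a

theorem IsMultilin.contr_param {F : List X → List X → Y} (m : List X)
    (h : ∀ x, IsMultilin K fun l => F l x) : IsMultilin K fun l => contr A (F l) m := by
  simp only [contr, splitSum₃]
  exact IsMultilin.splitSum_param m fun u v _ => IsMultilin.splitSum_param v fun v w _ => h _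

theorem comp_multilin {d : ℤ} {g : BiFun Q Y} {f : PreHom P Q} (hg : BiMultilin g)
    (hf : BiMultilin f) : BiMultilin (comp d g f) := by
  refine ⟨fun r => .of_apply fun p => ?_, fun l => .of_apply fun p => ?_⟩
  · simp only [comp_apply]
    refine .splitSum (fun y => ?_) (fun x => ?_)
    · exact IsMultilin.splitSum_param r fun z w _ =>
        (hg.1 (w.map (rsp X d))).comp_lin (LinearMap.applyₗ (f y z p))
    · exact IsMultilin.splitSum_param r fun z w _ =>
        (hf.1 z).comp_lin ((g x (w.map (rsp X d))) ∘ₗ LinearMap.applyₗ p)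
  · simp only [comp_apply]
    refine IsMultilin.splitSum_param l fun x y _ => .splitSum (fun w => ?_) (fun z => ?_)
    · exact (hf.2 y).comp_lin ((g x (w.map (rsp X d))) ∘ₗ LinearMap.applyₗ p)
    · exact ((hg.2 x).map_rsp d).comp_lin (LinearMap.applyₗ (f y z p))

theorem bdA_multilin {φ : BiFun P Y} (hφ : BiMultilin φ) : BiMultilin (bdA φ) := by
  refine ⟨fun r => ?_, fun l => ?_⟩
  · refine .add ?_ ?_
    · exact IsMultilin.contr_param r fun z => hφ.1 z
    · exact contr_multilin ((hφ.1 _).comp_lin (LinearMap.lcomp K Y P.sgn))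
  · refine .add ?_ ?_
    · exact contr_multilin (hφ.2 l)
    · exact IsMultilin.contr_param l fun x => (hφ.2 x).map_rsgn.comp_lin (LinearMap.lcomp K Y P.sgn)

theorem bd_multilin {φ : BiFun P Y} (hφ : BiMultilin φ) : BiMultilin (bd φ) :=
  ⟨fun r => ((comp_multilin hφ (act_multilin P)).1 r).add ((bdA_multilin hφ).1 r),
    fun l => ((comp_multilin hφ (act_multilin P)).2 l).add ((bdA_multilin hφ).2 l)⟩

theorem hom_multilin {d : ℤ} {f : PreHom P Q} (hf : f ∈ hom P Q d) : BiMultilin f :=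
  ⟨hf.1, hf.2.1⟩

theorem BiMultilin.ext_hom {φ ψ : BiFun P Y} (hφ : BiMultilin φ) (hψ : BiMultilin ψ)
    (h : ∀ l m r n i p, X.IsHom l m → X.IsHom r n → p ∈ P.gr i → φ l r p = ψ l r p) :
    φ = ψ := by
  funext l r
  refine IsMultilin.ext_hom (f := fun l => φ l r) (g := fun l => ψ l r) (hφ.1 r) (hψ.1 r)
    (fun l m hl => ?_) l
  exact (hφ.2 l).ext_hom (hψ.2 l) (fun r n hr => P.lin_ext fun i p hp => h l m r n i p hl hr hp) r

theorem hom_signDeg {d : ℤ} {f : PreHom P Q} (hf : f ∈ hom P Q d) : SignDeg d f := by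
  have h : (fun l r => f (l.map X.rsgn) (r.map X.rsgn) ∘ₗ P.sgn : BiFun P Q.carrier) =
      fun l r => (GrMod.eps d • Q.sgn) ∘ₗ f l r := by
    refine BiMultilin.ext_hom (φ := fun l r => f (l.map X.rsgn) (r.map X.rsgn) ∘ₗ P.sgn)
      (ψ := fun l r => (GrMod.eps d • Q.sgn) ∘ₗ f l r)
      ⟨fun r => (hf.1 _).map_rsgn.comp_lin (LinearMap.lcomp K _ P.sgn),
        fun l => (hf.2.1 _).map_rsgn.comp_lin (LinearMap.lcomp K _ P.sgn)⟩
      ⟨fun r => (hf.1 r).comp_lin (LinearMap.llcomp K _ _ _ (GrMod.eps d • Q.sgn)),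
        fun l => (hf.2.1 l).comp_lin (LinearMap.llcomp K _ _ _ (GrMod.eps d • Q.sgn))⟩ ?_
    intro l m r n i p hl hr hp
    have e₁ := (hf.1 (r.map X.rsgn)).map_hom hl
    have e₂ := (hf.2.1 l).map_hom hr
    simp only [LinearMap.comp_apply, LinearMap.smul_apply]
    rw [e₁, e₂, P.sgn_of_mem hp, Q.sgn_of_mem (hf.2.2.2 l m r n i p hl hr hp)]
    simp only [smul_smul, LinearMap.smul_apply, map_zsmul]
    congr 1
    rw [GrMod.eps_add, GrMod.eps_add, GrMod.eps_add]
    have := GrMod.eps_mul_self d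
    linear_combination (-(GrMod.eps (GrMod.rdeg m) * GrMod.eps i * GrMod.eps (GrMod.rdeg n))) * this
  intro l r p
  exact LinearMap.congr_fun (congrFun (congrFun h l) r) p

end Composition

/-! ### The hom complex of reduced maps. -/

section HomComplex

variable {K : Type u} [Field K] {X : GrMod K} {A : AInfStr X} {P Q R S : ABimod A}
  {Y : Type*} [AddCommGroup Y] [Module K Y]

/-- Homogeneity of degree `d`. -/
def IsDeg {P Q : ABimod A} (d : ℤ) (f : PreHom P Q) : Prop :=
  ∀ l m r n i p, X.IsHom l m → X.IsHom r n → p ∈ P.gr i →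
    f l r p ∈ Q.gr (GrMod.rdeg m + i + GrMod.rdeg n + d)

theorem act_isDeg (P : ABimod A) : IsDeg (P := P) (Q := P) 1 P.act := P.act_mem

theorem comp_isDeg {d e : ℤ} {g : PreHom Q R} {f : PreHom P Q} (hg : IsDeg e g)
    (hf : IsDeg d f) : IsDeg (d + e) (comp d g f) := by
  intro l m r n i p hl hr hp
  rw [comp_apply]
  refine splitSum_mem fun x y hx => splitSum_mem fun z w hz => ?_
  subst hx hz
  obtain ⟨m₁, m₂, rfl, hx, hy⟩ := isHom_append hl
  obtain ⟨n₁, n₂, rfl, hz, hw⟩ := isHom_append hr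
  have := hg _ _ _ _ _ _ hx (isHom_map_rsp X d hw) (hf _ _ _ _ _ _ hy hz hp)
  convert this using 2
  simp; ring

theorem bdA_isDeg {d : ℤ} {f : PreHom P Q} (hf : IsDeg d f) : IsDeg (d + 1) (bdA f) := by
  intro l m r n i p hl hr hp
  rw [bdA_apply]
  refine add_mem (contr_mem hr fun x e hx he => ?_) (contr_mem hl fun x e hx he => ?_)
  · have := hf _ _ _ _ _ _ hl hx hp
    rw [he] at this
    convert this using 2
    ring
  · have := hf _ _ _ _ _ _ hx (isHom_map_rsgn hr) (P.sgn_mem hp)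
    rw [he] at this
    convert this using 2
    ring

theorem homD_isDeg {d : ℤ} {f : PreHom P Q} (hf : IsDeg d f) : IsDeg (d + 1) (homD P Q d f) := by
  intro l m r n i p hl hr hp
  rw [homD_eq]
  refine sub_mem (comp_isDeg (act_isDeg Q) hf _ _ _ _ _ _ hl hr hp) (zsmul_mem (add_mem ?_ ?_) _)
  · have := comp_isDeg hf (act_isDeg P) _ _ _ _ _ _ hl hr hp
    rwa [add_comm 1 d] at this
  · exact bdA_isDeg hf _ _ _ _ _ _ hl hr hp

theorem MRed.map_rsp {g : List X → Y} (hg : g ∈ MRed A Y) (d : ℤ) {l : List X}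
    (h : A.one ∈ l) : g (l.map (rsp X d)) = 0 := by
  by_cases hd : Even d
  · rw [rsp_of_even X hd]; simpa using hg.2 l h
  · rw [rsp_of_odd X hd]; exact MRed.map_rsgn hg h

theorem hom_mred_right {d : ℤ} {f : PreHom P Q} (hf : f ∈ hom P Q d) (l : List X) :
    f l ∈ MRed A (P.carrier →ₗ[K] Q.carrier) :=
  ⟨hf.2.1 l, fun r h => hf.2.2.1 l r (.inr h)⟩

theorem comp_mem {d e : ℤ} {g : PreHom Q R} {f : PreHom P Q} (hg : g ∈ hom Q R e)
    (hf : f ∈ hom P Q d) : comp d g f ∈ hom P R (d + e) := by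
  have hm := comp_multilin (d := d) (hom_multilin hg) (hom_multilin hf)
  refine ⟨hm.1, hm.2, fun l r h => LinearMap.ext fun p => ?_, comp_isDeg hg.2.2.2 hf.2.2.2⟩
  rw [comp_apply, splitSum_congr (g := fun _ _ => 0), splitSum_zero]; · rfl
  rintro x y rfl
  rw [splitSum_congr (g := fun _ _ => 0), splitSum_zero]
  rintro z w rfl
  rcases h with h | h <;> rcases List.mem_append.1 h with h | h
  · rw [hg.2.2.1 _ _ (.inl h)]; rfl
  · rw [hf.2.2.1 _ _ (.inl h)]; simp
  · rw [hf.2.2.1 _ _ (.inr h)]; simp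
  · rw [MRed.map_rsp (hom_mred_right hg x) d h]; rfl

theorem splitSum_eq_zero {α M : Type*} [AddCommMonoid M] {f : List α → List α → M} {l : List α}
    (h : ∀ u v, l = u ++ v → f u v = 0) : splitSum f l = 0 :=
  (splitSum_congr l h).trans (splitSum_zero l)

theorem rsp_one_eq (A : AInfStr X) (d : ℤ) : rsp X d A.one = GrMod.eps d • A.one := by
  by_cases hd : Even d
  · rw [rsp_of_even X hd, GrMod.eps_of_even hd, one_smul]; rfl
  · rw [rsp_of_odd X hd, GrMod.eps_of_odd hd, A.rsgn_one, neg_smul, one_smul]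

theorem act_rsp_one (P : ABimod A) (d : ℤ) (l u v : List X)
    (h : 1 ≤ l.length + u.length + v.length) :
    P.act l (u ++ rsp X d A.one :: v) = 0 := by
  have := map_zsmul (P.multilin_right l u v).mk' (GrMod.eps d) A.one
  simp only [IsLinearMap.mk'_apply] at this
  rw [rsp_one_eq, this, P.act_eq_zero _ _ (by simp; omega) (by simp), smul_zero]

variable {d : ℤ} {f : PreHom P Q}

/-- Here and in the following lemmas the kinds of terms of the differential are evaluated, one at a
time, on a word containing the unit. As f is reduced and the structure maps are strictly unital,
only binary products of the unit with a neighbour survive. -/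
theorem act_comp_one_left (hf : f ∈ hom P Q d) (u v r : List X) (p : P.carrier) :
    comp d Q.act f (u ++ A.one :: v) r p = if u = [] then -Q.sgn (f v r p) else 0 := by
  rw [comp_apply, splitSum_append_cons, splitSum_eq_zero, zero_add, splitSum_single_left,
    splitSum_single_right]
  · split_ifs with h
    · subst h
      exact Q.one_left _
    · rw [List.map_nil, Q.act_eq_zero _ _ _ (by simp)]; · rfl
      have := List.length_pos_iff.2 h
      simp; omega
  · intro z w _ hw
    rw [Q.act_eq_zero _ _ _ (by simp)]; · rfl
    have := List.length_pos_iff.2 hw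
    simp; omega
  · intro x y _ hx
    refine splitSum_eq_zero fun z w _ => ?_
    rw [Q.act_eq_zero _ _ _ (by simp)]; · rfl
    have := List.length_pos_iff.2 hx
    simp; omega
  · intro x y _
    refine splitSum_eq_zero fun z w _ => ?_
    rw [hf.2.2.1 _ _ (.inl (by simp))]; simp

theorem act_comp_one_right (hf : f ∈ hom P Q d) (l u v : List X) (p : P.carrier) :
    comp d Q.act f l (u ++ A.one :: v) p = if v = [] then GrMod.eps d • f l u p else 0 := by
  rw [comp_apply, splitSum_single_left]
  · rw [splitSum_append_cons, splitSum_eq_zero (l := v), add_zero, splitSum_single_right]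
    · split_ifs with h
      · subst h
        have := map_zsmul (Q.multilin_right [] [] []).mk' (GrMod.eps d) A.one
        simp only [IsLinearMap.mk'_apply, List.nil_append] at this
        rw [List.nil_append, List.map_cons, List.map_nil, rsp_one_eq, this]
        exact congrArg _ (Q.one_right _)
      · rw [List.map_append, List.map_cons, act_rsp_one]; · rfl
        have := List.length_pos_iff.2 h
        simp; omega
    · intro z w _ hw
      rw [List.map_append, List.map_cons, act_rsp_one]; · rfl
      have := List.length_pos_iff.2 hw
      simp; omega
    · intro z w _
      rw [hf.2.2.1 _ _ (.inr (by simp))]; simp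
  · intro x y _ hx
    refine splitSum_eq_zero fun z w hzw => ?_
    have h1 : A.one ∈ z ++ w := by rw [← hzw]; simp
    rcases List.mem_append.1 h1 with h | h
    · rw [hf.2.2.1 _ _ (.inr h)]; simp
    · obtain ⟨w₁, w₂, rfl⟩ := List.append_of_mem h
      rw [List.map_append, List.map_cons, act_rsp_one]; · rfl
      have := List.length_pos_iff.2 hx
      simp; omega

theorem comp_act_one_left (hf : f ∈ hom P Q d) (u v r : List X) (p : P.carrier) :
    comp 1 f P.act (u ++ A.one :: v) r p =
      if v = [] then -f u (r.map X.rsgn) (P.sgn p) else 0 := by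
  rw [comp_apply, splitSum_append_cons, splitSum_eq_zero (l := v), add_zero,
    splitSum_single_right, splitSum_single_left]
  · split_ifs with h
    · subst h
      rw [map_rsp_one, List.nil_append, P.one_left, map_neg]
    · rw [P.act_eq_zero _ _ _ (by simp)]; · simp
      have := List.length_pos_iff.2 h
      simp; omega
  · intro z w _ hz
    rw [P.act_eq_zero _ _ _ (by simp)]; · simp
    have := List.length_pos_iff.2 hz
    simp; omega
  · intro x y _ hy
    refine splitSum_eq_zero fun z w _ => ?_
    rw [P.act_eq_zero _ _ _ (by simp)]; · simp
    have := List.length_pos_iff.2 hy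
    simp; omega
  · intro x y _
    refine splitSum_eq_zero fun z w _ => ?_
    rw [hf.2.2.1 _ _ (.inl (by simp))]; rfl

theorem comp_act_one_right (hf : f ∈ hom P Q d) (l u v : List X) (p : P.carrier) :
    comp 1 f P.act l (u ++ A.one :: v) p =
      if u = [] then f l (v.map X.rsgn) p else 0 := by
  rw [comp_apply, splitSum_single_right]
  · rw [splitSum_append_cons, splitSum_eq_zero (l := u), zero_add, splitSum_single_left]
    · split_ifs with h
      · subst h
        rw [map_rsp_one, List.nil_append, P.one_right]
      · rw [P.act_eq_zero _ _ _ (by simp)]; · simp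
        have := List.length_pos_iff.2 h
        simp; omega
    · intro z w _ hz
      rw [P.act_eq_zero _ _ _ (by simp)]; · simp
      have := List.length_pos_iff.2 hz
      simp; omega
    · intro z w _
      rw [MRed.map_rsp (hom_mred_right hf l) 1 (by simp)]; rfl
  · intro x y _ hy
    refine splitSum_eq_zero fun z w hzw => ?_
    have h1 : A.one ∈ z ++ w := by rw [← hzw]; simp
    rcases List.mem_append.1 h1 with h | h
    · rw [P.act_eq_zero _ _ _ (.inr h)]; · simp
      have := List.length_pos_iff.2 hy
      have := List.length_pos_of_mem h
      omega
    · rw [MRed.map_rsp (hom_mred_right hf x) 1 h]; rfl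

theorem bdA_one_left (hf : f ∈ hom P Q d) (u v r : List X) (p : P.carrier) :
    bdA f (u ++ A.one :: v) r p =
      (if u = [] then 0 else f (u ++ v.map X.rsgn) (r.map X.rsgn) (P.sgn p)) +
        (if v = [] then 0 else -f (u ++ v.map X.rsgn) (r.map X.rsgn) (P.sgn p)) := by
  have h1 := contr_one (f := fun x => f x (r.map X.rsgn) (P.sgn p))
    ((hf.1 _).comp_lin (LinearMap.applyₗ _))
    (fun l _ hl => by rw [hf.2.2.1 _ _ (.inl hl)]; rfl) u v
  rw [bdA_apply, h1]
  have h2 : (fun z => f (u ++ A.one :: v) z p) = fun _ => 0 := funext fun z => by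
    rw [hf.2.2.1 _ _ (.inl (by simp))]; rfl
  rw [h2, contr_zero, zero_add]

theorem bdA_one_right (hf : f ∈ hom P Q d) (l u v : List X) (p : P.carrier) :
    bdA f l (u ++ A.one :: v) p =
      (if u = [] then 0 else f l (u ++ v.map X.rsgn) p) +
        (if v = [] then 0 else -f l (u ++ v.map X.rsgn) p) := by
  have h1 := contr_one (f := fun x => f l x p)
    ((hf.2.1 _).comp_lin (LinearMap.applyₗ _))
    (fun l _ hl => by rw [hf.2.2.1 _ _ (.inr hl)]; rfl) u v
  rw [bdA_apply, h1]
  have h2 : (fun x => f x ((u ++ A.one :: v).map X.rsgn) (P.sgn p)) = fun _ => 0 :=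
    funext fun z => by
      rw [MRed.map_rsgn (hom_mred_right hf z) (by simp)]; rfl
  rw [h2, contr_zero, add_zero]

/-- That reduced maps are preserved rests on a cancellation: multiplying the unit into its left and
into its right neighbour gives opposite terms. At the ends of a word, the missing neighbour is
replaced by the element of `P` or by the value in `Q`. -/
theorem homD_mem (hf : f ∈ hom P Q d) : homD P Q d f ∈ hom P Q (d + 1) := by
  have h1 := comp_multilin (d := d) (act_multilin Q) (hom_multilin hf)
  have h2 := bd_multilin (hom_multilin hf)
  refine ⟨fun r => ?_, fun l => ?_, fun l r h => LinearMap.ext fun p => ?_,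
    homD_isDeg hf.2.2.2⟩
  · rw [homD_eq]
    simp only [Pi.sub_apply, Pi.smul_apply, sub_eq_add_neg]
    rcases eps_smul_cases (M := P.carrier →ₗ[K] Q.carrier) d with h | h <;> simp only [h]
    · exact (h1.1 r).add (h2.1 r).neg
    · exact (h1.1 r).add (h2.1 r).neg.neg
  · rw [homD_eq]
    simp only [Pi.sub_apply, Pi.smul_apply, sub_eq_add_neg]
    rcases eps_smul_cases (M := P.carrier →ₗ[K] Q.carrier) d with h | h <;> simp only [h]
    · exact (h1.2 l).add (h2.2 l).neg
    · exact (h1.2 l).add (h2.2 l).neg.neg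
  · rw [homD_eq, Pi.sub_apply, Pi.sub_apply, Pi.smul_apply, Pi.smul_apply, LinearMap.sub_apply,
      LinearMap.smul_apply, bd_apply]
    rcases h with h | h <;> obtain ⟨u, v, rfl⟩ := List.append_of_mem h
    · rw [act_comp_one_left hf, comp_act_one_left hf, bdA_one_left hf]
      -- Needed when the unit is the outermost letter on the left: its action on `Q` produces the
      -- sign of the value, which has to be compared with the signs of the entries.
      have hs := hom_signDeg hf v r p
      by_cases hu : u = [] <;> by_cases hv : v = [] <;>
        simp [hu, hv, smul_smul] at hs ⊢ <;> simp [hs, smul_smul]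
    · rw [act_comp_one_right hf, comp_act_one_right hf, bdA_one_right hf]
      by_cases hu : u = [] <;> by_cases hv : v = [] <;> simp [hu, hv]

end HomComplex

/-! ### Cocycles, homotopies and homotopy equivalences. -/

section Homotopy

variable {K : Type u} [Field K] {X : GrMod K} {A : AInfStr X} {P Q R S : ABimod A}
  {Y : Type*} [AddCommGroup Y] [Module K Y]

theorem mem_cocycles {d : ℤ} {f : PreHom P Q} :
    f ∈ cocycles P Q d ↔ f ∈ hom P Q d ∧ homD P Q d f = 0 := Iff.rfl

theorem mem_coboundaries {d : ℤ} {f : PreHom P Q} :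
    f ∈ coboundaries P Q d ↔ ∃ h ∈ hom P Q (d - 1), homD P Q (d - 1) h = f := Iff.rfl

theorem homD_mem_coboundaries {d e : ℤ} {h : PreHom P Q} (hh : h ∈ hom P Q e) (hd : d = e + 1) :
    homD P Q e h ∈ coboundaries P Q d := by
  obtain rfl : e = d - 1 := by omega
  exact ⟨h, hh, rfl⟩

theorem coboundaries_le_cocycles (P Q : ABimod A) (d : ℤ) :
    coboundaries P Q d ≤ cocycles P Q d := by
  rintro f ⟨h, hh, rfl⟩
  have h1 := homD_mem hh
  have h2 := homD_homD (hom_multilin hh) (hom_signDeg hh)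
  rw [sub_add_cancel] at h1 h2
  exact ⟨h1, h2⟩

theorem homD_comp' {d e n : ℤ} {g : PreHom Q R} {f : PreHom P Q} (hg : g ∈ hom Q R e)
    (hf : f ∈ hom P Q d) (hn : n = d + e) : homD P R n (comp d g f) =
      comp d (homD Q R e g) f + GrMod.eps e • comp (d + 1) g (homD P Q d f) := by
  subst hn
  exact homD_comp (hom_multilin hg) (hom_signDeg hf)

theorem comp_mem_cocycles {d e n : ℤ} {g : PreHom Q R} {f : PreHom P Q}
    (hg : g ∈ cocycles Q R e) (hf : f ∈ cocycles P Q d) (hn : n = d + e) :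
    comp d g f ∈ cocycles P R n := by
  refine ⟨hn ▸ comp_mem hg.1 hf.1, ?_⟩
  refine LinearMap.mem_ker.2 ?_
  rw [homD_comp' hg.1 hf.1 hn, (mem_cocycles.1 hg).2, (mem_cocycles.1 hf).2,
    comp_zero_left, comp_zero_right, smul_zero, add_zero]

theorem comp_coboundary_left {d e n : ℤ} {g : PreHom Q R} {f : PreHom P Q}
    (hg : g ∈ coboundaries Q R e) (hf : f ∈ cocycles P Q d) (hn : n = d + e) :
    comp d g f ∈ coboundaries P R n := by
  obtain ⟨h, hh, rfl⟩ := hg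
  have := homD_comp' hh hf.1 (n := n - 1) (by omega)
  rw [(mem_cocycles.1 hf).2, comp_zero_right, smul_zero, add_zero] at this
  rw [← this]
  exact homD_mem_coboundaries (show n - 1 = d + (e - 1) by omega ▸ comp_mem hh hf.1) (by omega)

theorem comp_coboundary_right {d e n : ℤ} {g : PreHom Q R} {f : PreHom P Q}
    (hg : g ∈ cocycles Q R e) (hf : f ∈ coboundaries P Q d) (hn : n = d + e) :
    comp d g f ∈ coboundaries P R n := by
  obtain ⟨h, hh, rfl⟩ := hf
  have := homD_comp' hg.1 hh (n := n - 1) (by omega)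
  rw [(mem_cocycles.1 hg).2, comp_zero_left, zero_add, sub_add_cancel] at this
  have h2 : homD P R (n - 1) (GrMod.eps e • comp (d - 1) g h) = comp d g (homD P Q (d - 1) h) := by
    rw [map_zsmul, this, smul_smul, GrMod.eps_mul_self, one_smul]
  rw [← h2]
  refine homD_mem_coboundaries (zsmul_mem ?_ _) (by omega)
  exact (show n - 1 = d - 1 + e by omega) ▸ comp_mem hg.1 hh

/-- Cohomologous maps of degree `d`. -/
def Htpy {P Q : ABimod A} (d : ℤ) (f g : PreHom P Q) : Prop := f - g ∈ coboundaries P Q d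

theorem Htpy.refl (d : ℤ) (f : PreHom P Q) : Htpy d f f := by
  rw [Htpy, sub_self]; exact zero_mem _

theorem Htpy.of_eq {d : ℤ} {f g : PreHom P Q} (h : f = g) : Htpy d f g := h ▸ .refl d f

theorem Htpy.symm {d : ℤ} {f g : PreHom P Q} (h : Htpy d f g) : Htpy d g f := by
  rw [Htpy, ← neg_sub]; exact neg_mem h

theorem Htpy.trans {d : ℤ} {f g h : PreHom P Q} (h₁ : Htpy d f g) (h₂ : Htpy d g h) :
    Htpy d f h := by
  rw [Htpy, ← sub_add_sub_cancel f g h]; exact add_mem h₁ h₂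

theorem Htpy.comp_right {d e n : ℤ} {g g' : PreHom Q R} {f : PreHom P Q} (hg : Htpy e g g')
    (hf : f ∈ cocycles P Q d) (hn : n = d + e) : Htpy n (comp d g f) (comp d g' f) := by
  rw [Htpy, ← comp_sub_left]; exact comp_coboundary_left hg hf hn

theorem Htpy.comp_left {d e n : ℤ} {g : PreHom Q R} {f f' : PreHom P Q} (hf : Htpy d f f')
    (hg : g ∈ cocycles Q R e) (hn : n = d + e) : Htpy n (comp d g f) (comp d g f') := by
  rw [Htpy, ← comp_sub_right]; exact comp_coboundary_right hg hf hn

/-- The bimodule map given by a linear map, without higher terms. -/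
noncomputable def strictHom (φ : P.carrier →ₗ[K] Q.carrier) : PreHom P Q :=
  fun l r => if l = [] ∧ r = [] then φ else 0

theorem strictHom_nil (φ : P.carrier →ₗ[K] Q.carrier) : strictHom φ [] [] = φ := by
  simp [strictHom]

theorem strictHom_zero (φ : P.carrier →ₗ[K] Q.carrier) {l r : List X} (h : ¬ (l = [] ∧ r = [])) :
    strictHom φ l r = 0 := by
  simp only [strictHom, if_neg h]

theorem comp_strictHom (d : ℤ) (g : BiFun Q Y) (φ : P.carrier →ₗ[K] Q.carrier) (l r : List X) :
    comp d g (strictHom φ) l r = g l (r.map (rsp X d)) ∘ₗ φ := by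
  rw [comp, splitSum_single_right, splitSum_single_left, strictHom_nil]
  · intro z w _ hz
    rw [strictHom_zero _ (by simp [hz]), LinearMap.comp_zero]
  · intro x y _ hy
    refine splitSum_eq_zero fun z w _ => ?_
    rw [strictHom_zero _ (by simp [hy]), LinearMap.comp_zero]

theorem strictHom_comp (d : ℤ) (φ : Q.carrier →ₗ[K] R.carrier) (f : PreHom P Q) (l r : List X) :
    comp d (strictHom φ) f l r = φ ∘ₗ f l r := by
  rw [comp, splitSum_single_left, splitSum_single_right, List.map_nil, strictHom_nil]
  · intro z w _ hw
    rw [strictHom_zero _ (by simp [hw]), LinearMap.zero_comp]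
  · intro x y _ hx
    refine splitSum_eq_zero fun z w _ => ?_
    rw [strictHom_zero _ (by simp [hx]), LinearMap.zero_comp]

theorem IsMultilin.of_ne_nil {f : List X → Y} (h : ∀ l, l ≠ [] → f l = 0) : IsMultilin K f :=
  fun u v => by
    have : (fun a => f (u ++ a :: v)) = fun _ => 0 := funext fun a => h _ (by simp)
    rw [this]
    exact (0 : X →ₗ[K] Y).isLinear

theorem strictHom_mem_hom {d : ℤ} {φ : P.carrier →ₗ[K] Q.carrier}
    (hd : ∀ i, ∀ p ∈ P.gr i, φ p ∈ Q.gr (i + d)) : strictHom φ ∈ hom P Q d := by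
  refine ⟨fun r => .of_ne_nil fun l hl => strictHom_zero _ (by simp [hl]),
    fun l => .of_ne_nil fun r hr => strictHom_zero _ (by simp [hr]),
    fun l r h => strictHom_zero _ ?_, fun l m r n i p hl hr hp => ?_⟩
  · rintro ⟨rfl, rfl⟩
    simp at h
  · by_cases h : l = [] ∧ r = []
    · obtain ⟨rfl, rfl⟩ := h
      cases hl; cases hr
      rw [strictHom_nil]
      simpa using hd i p hp
    · rw [strictHom_zero _ h]; exact zero_mem _

/-- A contraction always leaves at least one letter, and a strict map vanishes on such words. -/
theorem bdA_strictHom (φ : P.carrier →ₗ[K] Q.carrier) : bdA (strictHom φ) = 0 := by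
  funext l r
  refine LinearMap.ext fun p => ?_
  rw [bdA_apply, contr_congr (g := fun _ => 0), contr_congr (l := l) (g := fun _ => 0), contr_zero,
    contr_zero, add_zero]; · rfl
  · intro x hx
    rw [strictHom_zero _ (by simp [hx])]; rfl
  · intro x hx
    rw [strictHom_zero _ (by simp [hx])]; rfl

theorem strictHom_mem_cocycles {φ : P.carrier →ₗ[K] Q.carrier}
    (hd : ∀ i, ∀ p ∈ P.gr i, φ p ∈ Q.gr i)
    (hc : ∀ l r p, φ (P.act l r p) = Q.act l r (φ p)) : strictHom φ ∈ cocycles P Q 0 := by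
  refine ⟨strictHom_mem_hom (by simpa using hd), ?_⟩
  refine LinearMap.mem_ker.2 ?_
  rw [homD_eq, bd, bdA_strictHom, GrMod.eps_zero, one_smul, add_zero, sub_eq_zero]
  funext l r
  rw [comp_strictHom, strictHom_comp, map_rsp_zero]
  exact LinearMap.ext fun p => (hc l r p).symm

/-- The identity bimodule map. -/
noncomputable def idHom (P : ABimod A) : PreHom P P := strictHom LinearMap.id

theorem idHom_mem (P : ABimod A) : idHom P ∈ cocycles P P 0 :=
  strictHom_mem_cocycles (fun _ _ h => h) fun _ _ _ => rfl

theorem comp_idHom (f : BiFun P Y) : comp 0 f (idHom P) = f := by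
  funext l r
  rw [idHom, comp_strictHom, map_rsp_zero, LinearMap.comp_id]

theorem idHom_comp (d : ℤ) (f : PreHom P Q) : comp d (idHom Q) f = f := by
  funext l r
  rw [idHom, strictHom_comp, LinearMap.id_comp]

/-- Bimodule maps which are invertible up to homotopy. -/
def IsHtpyEquiv (f : PreHom P Q) : Prop :=
  f ∈ cocycles P Q 0 ∧ ∃ g ∈ cocycles Q P 0, Htpy 0 (comp 0 f g) (idHom Q) ∧
    Htpy 0 (comp 0 g f) (idHom P)

theorem comp_assoc_zero (h : BiFun R Y) (g : PreHom Q R) (f : PreHom P Q) :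
    comp 0 (comp 0 h g) f = comp 0 h (comp 0 g f) := comp_assoc 0 0 h g f

theorem isHtpyEquiv_comp {g : PreHom Q R} {f : PreHom P Q} (hg : IsHtpyEquiv g)
    (hf : IsHtpyEquiv f) : IsHtpyEquiv (comp 0 g f) := by
  obtain ⟨hg, g', hg', h1, h2⟩ := hg
  obtain ⟨hf, f', hf', h3, h4⟩ := hf
  refine ⟨comp_mem_cocycles hg hf rfl, comp 0 f' g', comp_mem_cocycles hf' hg' rfl, ?_, ?_⟩
  · refine Htpy.trans ?_ h1
    rw [comp_assoc_zero, ← comp_assoc_zero f f' g']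
    refine .comp_left ?_ hg rfl
    have := h3.comp_right hg' (n := 0) rfl
    rwa [idHom_comp] at this
  · refine Htpy.trans ?_ h4
    rw [comp_assoc_zero, ← comp_assoc_zero g' g f]
    refine .comp_left ?_ hf' rfl
    have := h2.comp_right hf (n := 0) rfl
    rwa [idHom_comp] at this

theorem IsHtpyEquiv.strict {φ : P.carrier →ₗ[K] Q.carrier} {ψ : Q.carrier →ₗ[K] P.carrier}
    (hφ : strictHom φ ∈ cocycles P Q 0) (hψ : strictHom ψ ∈ cocycles Q P 0)
    (h₁ : φ ∘ₗ ψ = LinearMap.id) (h₂ : ψ ∘ₗ φ = LinearMap.id) : IsHtpyEquiv (strictHom φ) := by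
  refine ⟨hφ, _, hψ, .of_eq ?_, .of_eq ?_⟩ <;> funext l r <;>
    rw [strictHom_comp, idHom, strictHom, strictHom] <;> split_ifs <;> simp [h₁, h₂]

/-- A degree `d` map into an equivalence is null-homotopic if its composition is. -/
theorem IsHtpyEquiv.cancel_left {d : ℤ} {g : PreHom Q R} (hg : IsHtpyEquiv g)
    {f : PreHom P Q} (hf : f ∈ cocycles P Q d) (h : comp d g f ∈ coboundaries P R d) :
    f ∈ coboundaries P Q d := by
  obtain ⟨hg, g', hg', h1, h2⟩ := hg
  have e1 := comp_coboundary_right hg' h (n := d) (by simp)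
  have e2 := h2.comp_right hf (n := d) (by simp)
  rw [idHom_comp, comp_assoc, add_zero] at e2
  have := sub_mem e1 e2
  rwa [sub_sub_cancel] at this

/-- If f ∘ g bounds, so does f ∘ g ∘ g', which is homotopic to f when g' is a homotopy inverse of g.
-/
theorem IsHtpyEquiv.cancel_right {d : ℤ} {g : PreHom P Q} (hg : IsHtpyEquiv g)
    {f : PreHom Q R} (hf : f ∈ cocycles Q R d) (h : comp 0 f g ∈ coboundaries P R d) :
    f ∈ coboundaries Q R d := by
  obtain ⟨hg, g', hg', h1, h2⟩ := hg
  have e1 := comp_coboundary_left h hg' (n := d) (by simp)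
  have e2 := h1.comp_left hf (n := d) (by simp)
  rw [comp_idHom, ← comp_assoc_zero] at e2
  have := sub_mem e1 e2
  rwa [sub_sub_cancel] at this

end Homotopy

/-! ### Maps into an acyclic bimodule. -/

section Acyclic

variable {K : Type u} [Field K] {X : GrMod K} {A : AInfStr X} {P Q R S M N : ABimod A}
  {Y : Type*} [AddCommGroup Y] [Module K Y]

/-- The projection to the degree `n` part. -/
noncomputable def GrMod.proj (X : GrMod K) (n : ℤ) : X →ₗ[K] X :=
  X.lin fun i => if i = n then (X.gr i).subtype else 0

theorem GrMod.proj_of_mem (X : GrMod K) {n : ℤ} {x : X} (hx : x ∈ X.gr n) : X.proj n x = x := by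
  rw [GrMod.proj, X.lin_of_mem _ hx]; simp

theorem GrMod.proj_of_ne (X : GrMod K) {n i : ℤ} {x : X} (hx : x ∈ X.gr i) (h : i ≠ n) :
    X.proj n x = 0 := by
  rw [GrMod.proj, X.lin_of_mem _ hx]; simp [h]

theorem GrMod.proj_mem (X : GrMod K) (n : ℤ) (x : X) : X.proj n x ∈ X.gr n := by
  have : Submodule.comap (X.proj n) (X.gr n) = ⊤ := X.eq_top_of_gr_le fun i y hy => by
    rw [Submodule.mem_comap]
    by_cases h : i = n
    · subst h; rwa [X.proj_of_mem hy]
    · rw [X.proj_of_ne hy h]; exact zero_mem _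
  exact (this ▸ Submodule.mem_top : x ∈ Submodule.comap (X.proj n) (X.gr n))

theorem ABimod.d_mem (C : ABimod A) {i : ℤ} {c : C.carrier} (hc : c ∈ C.gr i) :
    C.act [] [] c ∈ C.gr (i + 1) := by
  have := C.act_mem [] [] [] [] i c .nil .nil hc
  simpa using this

theorem ABimod.d_d (C : ABimod A) (c : C.carrier) : C.act [] [] (C.act [] [] c) = 0 := by
  have h := C.assoc [] [] c
  have h1 : C.act [] [0] = 0 := (C.multilin_right [] [] []).map_zero
  have h2 : C.act [0] [] = 0 := (C.multilin_left [] [] []).map_zero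
  simpa [splitSum₃, splitSum_nil, A.μ_nil, h1, h2] using h

theorem ABimod.proj_d (C : ABimod A) (n : ℤ) (c : C.carrier) :
    C.proj (n + 1) (C.act [] [] c) = C.act [] [] (C.proj n c) := by
  have : C.proj (n + 1) ∘ₗ C.act [] [] = C.act [] [] ∘ₗ C.proj n := C.lin_ext fun i x hx => by
    simp only [LinearMap.comp_apply]
    by_cases h : i = n
    · subst h; rw [C.proj_of_mem hx, C.proj_of_mem (C.d_mem hx)]
    · rw [C.proj_of_ne hx h, C.proj_of_ne (C.d_mem hx) (by omega), map_zero]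
  exact LinearMap.congr_fun this c

/-- Acyclic bimodules. -/
def ABimod.Acyclic (C : ABimod A) : Prop :=
  ∀ c, C.act [] [] c = 0 → ∃ c', C.act [] [] c' = c

/-- Over a field, the surjection d from degree i - 1 onto the cycles of degree i splits linearly.
The section is extended arbitrarily to all of C. -/
theorem ABimod.Acyclic.exists_section {C : ABimod A} (hC : C.Acyclic) (i : ℤ) :
    ∃ s : C.carrier →ₗ[K] C.carrier, ∀ z ∈ C.gr i, C.act [] [] z = 0 →
      C.act [] [] (s z) = z ∧ s z ∈ C.gr (i - 1) := by
  let Z : Submodule K C.carrier := C.gr i ⊓ LinearMap.ker (C.act [] [])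
  have hmap : ∀ x ∈ C.gr (i - 1), C.act [] [] x ∈ Z := fun x hx =>
    ⟨by simpa using C.d_mem hx, LinearMap.mem_ker.2 (C.d_d x)⟩
  let δ : C.gr (i - 1) →ₗ[K] Z := (C.act [] []).restrict hmap
  have hδ : LinearMap.range δ = ⊤ := by
    refine LinearMap.range_eq_top.2 fun z => ?_
    obtain ⟨c, hc⟩ := hC z.1 z.2.2
    -- A primitive of a homogeneous cycle need not be homogeneous, but its component of degree i - 1
    -- is again a primitive.
    refine ⟨⟨C.proj (i - 1) c, C.proj_mem _ _⟩, Subtype.ext ?_⟩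
    have := C.proj_d (i - 1) c
    rw [hc, sub_add_cancel, C.proj_of_mem z.2.1] at this
    exact this.symm
  obtain ⟨s, hs⟩ := δ.exists_rightInverse_of_surjective hδ
  obtain ⟨t, ht⟩ := ((C.gr (i - 1)).subtype ∘ₗ s).exists_extend
  refine ⟨t, fun z hz hz' => ?_⟩
  have e : t z = (s ⟨z, hz, hz'⟩).1 := LinearMap.congr_fun ht ⟨z, hz, hz'⟩
  rw [e]
  exact ⟨congrArg Subtype.val (LinearMap.congr_fun hs ⟨z, hz, hz'⟩), (s ⟨z, hz, hz'⟩).2⟩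

/-- With s a section of d over the cycles, h = s ∘ (1 - s ∘ d) works: c - s(dc) is a cycle, so d(h
c) = c - s(dc), while h(dc) = s(dc). -/
theorem ABimod.Acyclic.exists_contraction {C : ABimod A} (hC : C.Acyclic) :
    ∃ h : C.carrier →ₗ[K] C.carrier, (∀ i, ∀ c ∈ C.gr i, h c ∈ C.gr (i + -1)) ∧
      ∀ c, C.act [] [] (h c) + h (C.act [] [] c) = c := by
  choose s hs using hC.exists_section
  let h : C.carrier →ₗ[K] C.carrier :=
    C.lin fun i => (s i ∘ₗ (LinearMap.id - s (i + 1) ∘ₗ C.act [] [])) ∘ₗ (C.gr i).subtype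
  have e : ∀ i, ∀ c ∈ C.gr i, h c = s i (c - s (i + 1) (C.act [] [] c)) := fun i c hc =>
    C.lin_of_mem _ hc
  have key : ∀ i, ∀ c ∈ C.gr i, C.act [] [] (s (i + 1) (C.act [] [] c)) = C.act [] [] c ∧
      s (i + 1) (C.act [] [] c) ∈ C.gr i := fun i c hc => by
    simpa using hs (i + 1) _ (C.d_mem hc) (C.d_d c)
  have key2 : ∀ i, ∀ c ∈ C.gr i, C.act [] [] (h c) = c - s (i + 1) (C.act [] [] c) ∧
      h c ∈ C.gr (i - 1) := fun i c hc => by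
    rw [e i c hc]
    exact hs i _ (sub_mem hc (key i c hc).2) (by rw [map_sub, (key i c hc).1, sub_self])
  refine ⟨h, fun i c hc => (key2 i c hc).2, fun c => ?_⟩
  have : C.act [] [] ∘ₗ h + h ∘ₗ C.act [] [] = LinearMap.id := C.lin_ext fun i c hc => by
    simp only [LinearMap.add_apply, LinearMap.comp_apply, LinearMap.id_apply]
    rw [(key2 i c hc).1, e (i + 1) _ (C.d_mem hc), C.d_d, map_zero, sub_zero, sub_add_cancel]
  exact LinearMap.congr_fun this c

/-- Contracting a nonempty block does not lengthen a word, and the empty block contributes zero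
because μ vanishes on the empty word. -/
theorem contr_congr_length {f g : List X → Y} (hf : IsMultilin K f) (hg : IsMultilin K g)
    (l : List X) (h : ∀ x, x.length ≤ l.length → f x = g x) : contr A f l = contr A g l := by
  simp only [contr, splitSum₃]
  refine splitSum_congr _ fun u t e => splitSum_congr _ fun v w e' => ?_
  by_cases hv : v = []
  · rw [hv, A.μ_nil, hf.zero_mid, hg.zero_mid]
  · refine h _ ?_
    have := List.length_pos_iff.2 hv
    rw [e, e']
    simp; omega

theorem homD_congr_length {d : ℤ} {f g : PreHom P Q} (hf : BiMultilin f) (hg : BiMultilin g)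
    (l r : List X) (h : ∀ x y, x.length + y.length ≤ l.length + r.length → f x y = g x y) :
    homD P Q d f l r = homD P Q d g l r := by
  have hcomp : comp d Q.act f l r = comp d Q.act g l r := by
    refine splitSum_congr _ fun x y e => splitSum_congr _ fun z w e' => ?_
    rw [h y z (by rw [e, e']; simp; omega)]
  have hcomp' : comp 1 f P.act l r = comp 1 g P.act l r := by
    refine splitSum_congr _ fun x y e => splitSum_congr _ fun z w e' => ?_
    rw [h x _ (by rw [e, e']; simp; omega)]
  have hb : bdA f l r = bdA g l r := by
    unfold bdA
    congr 1
    · exact contr_congr_length (hf.2 l) (hg.2 l) r fun x hx => h _ _ (by omega)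
    · refine contr_congr_length ((hf.1 _).comp_lin (LinearMap.lcomp K _ P.sgn))
        ((hg.1 _).comp_lin (LinearMap.lcomp K _ P.sgn)) l fun x hx => ?_
      rw [h _ _ (by simp; omega)]
  rw [homD_eq, homD_eq]
  simp only [Pi.sub_apply, Pi.smul_apply, bd, Pi.add_apply, hcomp, hcomp', hb]

/-- On the shortest words where f can be nonzero, f must consume all letters, which leaves only the
linear part of g. -/
theorem comp_lead {d : ℤ} {g : PreHom Q R} {f : PreHom P Q} {n : ℕ}
    (hf : ∀ l r, l.length + r.length < n → f l r = 0) (l r : List X)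
    (h : l.length + r.length ≤ n) : comp d g f l r = g [] [] ∘ₗ f l r := by
  rw [comp, splitSum_single_left, splitSum_single_right]; · rfl
  · rintro z w rfl hw
    rw [hf l z, LinearMap.comp_zero]
    have := List.length_pos_iff.2 hw
    simp at h; omega
  · rintro x y rfl hx
    refine splitSum_eq_zero fun z w e => ?_
    rw [hf y z, LinearMap.comp_zero]
    have := List.length_pos_iff.2 hx
    have := congrArg List.length e
    simp at h this; omega

/-- Multilinearity compares only words of equal length, so the function may be chosen for each
length separately. -/
theorem IsMultilin.of_length {F : ℕ → List X → Y} (h : ∀ n, IsMultilin K (F n)) :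
    IsMultilin K fun l => F l.length l := fun u v => by
  simp only [List.length_append, List.length_cons]
  exact h _ u v

theorem IsMultilin.sum {ι : Type*} {F : ι → List X → Y} (s : Finset ι)
    (h : ∀ n ∈ s, IsMultilin K (F n)) : IsMultilin K fun l => ∑ n ∈ s, F n l := fun x y => by
  constructor
  · intro a b
    rw [← Finset.sum_add_distrib]
    exact Finset.sum_congr rfl fun n hn => (h n hn x y).map_add a b
  · intro c a
    rw [Finset.smul_sum]
    exact Finset.sum_congr rfl fun n hn => (h n hn x y).map_smul c a

/-- Infinite sums of operations, which are finite on words of a given length. -/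
theorem exists_hom_sum {d : ℤ} (η : ℕ → PreHom P Q) (hη : ∀ n, η n ∈ hom P Q d)
    (h0 : ∀ n l r, l.length + r.length < n → η n l r = 0) :
    ∃ ζ ∈ hom P Q d, ∀ (N : ℕ) (l r : List X), l.length + r.length < N →
      ζ l r = ∑ n ∈ Finset.range N, η n l r := by
  refine ⟨fun l r => ∑ n ∈ Finset.range (l.length + r.length + 1), η n l r,
    ⟨fun r => ?_, fun l => ?_, fun l r h => ?_, fun l m r n i p hl hr hp => ?_⟩, fun N l r h => ?_⟩
  · exact IsMultilin.of_length (F := fun k l => ∑ n ∈ Finset.range (k + r.length + 1), η n l r)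
      fun k => .sum _ fun n _ => (hη n).1 r
  · exact IsMultilin.of_length (F := fun k r => ∑ n ∈ Finset.range (l.length + k + 1), η n l r)
      fun k => .sum _ fun n _ => (hη n).2.1 l
  · exact Finset.sum_eq_zero fun n _ => (hη n).2.2.1 l r h
  · rw [LinearMap.sum_apply]
    exact Submodule.sum_mem _ fun k _ => (hη k).2.2.2 l m r n i p hl hr hp
  · refine Finset.sum_subset (fun k hk => ?_) fun k _ hk => h0 k l r ?_
    · simp only [Finset.mem_range] at hk ⊢; omega
    · simp only [Finset.mem_range] at hk ⊢; omega

theorem bd_postcomp {Z : Type*} [AddCommGroup Z] [Module K Z] (h : Y →ₗ[K] Z) (f : BiFun P Y) :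
    bd (fun l r => h ∘ₗ f l r) = fun l r => h ∘ₗ bd f l r := by
  funext l r
  refine LinearMap.ext fun p => ?_
  rw [LinearMap.comp_apply, bd_apply, bd_apply, map_add]
  congr 1
  · simp only [comp_apply, splitSum_hom, LinearMap.comp_apply]
  · simp only [bdA_apply, map_add, contr_comp, LinearMap.comp_apply]

theorem bd_prod {Z : Type*} [AddCommGroup Z] [Module K Z] (f : BiFun P Y) (g : BiFun P Z) :
    bd (fun l r => (f l r).prod (g l r)) = fun l r => (bd f l r).prod (bd g l r) := by
  have h1 := bd_postcomp (LinearMap.fst K Y Z) fun l r => (f l r).prod (g l r)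
  have h2 := bd_postcomp (LinearMap.snd K Y Z) fun l r => (f l r).prod (g l r)
  funext l r
  refine LinearMap.ext fun p => Prod.ext ?_ ?_
  · exact (LinearMap.congr_fun (congrFun (congrFun h1 l) r) p).symm
  · exact (LinearMap.congr_fun (congrFun (congrFun h2 l) r) p).symm

theorem strictHom_comp' (d : ℤ) (φ : Q.carrier →ₗ[K] R.carrier) (f : PreHom P Q) :
    comp d (strictHom φ) f = fun l r => φ ∘ₗ f l r :=
  funext fun l => funext fun r => strictHom_comp d φ f l r

theorem bd_strictHom_comp (d : ℤ) (h : Q.carrier →ₗ[K] R.carrier) (f : PreHom P Q) :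
    bd (comp d (strictHom h) f) = comp d (strictHom h) (bd f) := by
  rw [strictHom_comp', bd_postcomp, strictHom_comp']

/-- Successive approximation in the number of letters. If a cocycle φ vanishes on words with fewer
than n letters, then on n letters the differential of h ∘ φ is (dh + hd)φ = φ, where h is a linear
contraction of C. Subtracting it gains one letter, and the corrections h ∘ φ form a locally finite
sum. -/
theorem ABimod.Acyclic.hom_acyclic {C : ABimod A} (hC : C.Acyclic) {d : ℤ} {f : PreHom P C}
    (hf : f ∈ cocycles P C d) : f ∈ coboundaries P C d := by
  obtain ⟨h, hdeg, hh⟩ := hC.exists_contraction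
  let H : PreHom P C → PreHom P C := fun f => comp d (strictHom h) f
  have hH : ∀ f, f ∈ hom P C d → H f ∈ hom P C (d - 1) := fun f hf =>
    comp_mem (e := -1) (strictHom_mem_hom hdeg) hf
  let φ : ℕ → PreHom P C := fun n => Nat.rec f (fun _ g => g - homD P C (d - 1) (H g)) n
  have hφ : ∀ n, φ n ∈ cocycles P C d := by
    intro n
    induction n with
    | zero => exact hf
    | succ n ih =>
      exact sub_mem ih (coboundaries_le_cocycles _ _ _ ⟨_, hH _ ih.1, rfl⟩)
  have hφ0 : ∀ n l r, l.length + r.length < n → φ n l r = 0 := by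
    intro n
    induction n with
    | zero => intro l r h; omega
    | succ n ih =>
      intro l r hlr
      -- The cocycle equation replaces the bar differential of φ n by μ_C ∘ φ n. Both summands then
      -- reduce to linear parts on the shortest words.
      have e1 : homD P C (d - 1) (H (φ n)) =
          comp (d - 1) C.act (H (φ n)) + comp d (strictHom h) (comp d C.act (φ n)) := by
        have hc := (mem_cocycles.1 (hφ n)).2
        rw [homD_eq, sub_eq_zero] at hc
        rw [homD_eq, bd_strictHom_comp, hc, comp_zsmul_right, GrMod.eps_sub_one, neg_smul,
          sub_neg_eq_add]
      have hH0 : ∀ l r, l.length + r.length < n → H (φ n) l r = 0 := fun l r hlr => by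
        simp only [H]
        rw [strictHom_comp, ih l r hlr, LinearMap.comp_zero]
      change φ n l r - homD P C (d - 1) (H (φ n)) l r = 0
      rw [e1, Pi.add_apply, Pi.add_apply, comp_lead hH0 l r (by omega), strictHom_comp,
        comp_lead ih l r (by omega)]
      simp only [H]
      rw [strictHom_comp, sub_eq_zero]
      exact LinearMap.ext fun p => (hh (φ n l r p)).symm
  obtain ⟨ζ, hζ, hζs⟩ := exists_hom_sum (fun n => H (φ n)) (fun n => hH _ (hφ n).1)
    fun n l r hlr => by
      simp only [H]
      rw [strictHom_comp, hφ0 n l r hlr, LinearMap.comp_zero]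
  refine ⟨ζ, hζ, ?_⟩
  funext l r
  have hS : ∑ n ∈ Finset.range (l.length + r.length + 1), H (φ n) ∈ hom P C (d - 1) :=
    Submodule.sum_mem _ fun n _ => hH _ (hφ n).1
  rw [homD_congr_length (hom_multilin hζ) (hom_multilin hS) l r fun x y hxy => by
    rw [hζs _ x y (Nat.lt_succ_of_le hxy), Finset.sum_apply, Finset.sum_apply]]
  -- The differentials of the partial sums telescope, and the remainder φ N vanishes on words with
  -- fewer than N letters.
  have e2 : ∀ N, homD P C (d - 1) (∑ n ∈ Finset.range N, H (φ n)) = f - φ N := by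
    intro N
    induction N with
    | zero => simp [φ]
    | succ N ih =>
      rw [Finset.sum_range_succ, map_add, ih]
      change _ = f - (φ N - homD P C (d - 1) (H (φ N)))
      abel
  rw [e2, Pi.sub_apply, Pi.sub_apply]
  exact (congrArg (f l r - ·) (hφ0 (l.length + r.length + 1) l r (by omega))).trans (sub_zero _)

end Acyclic

/-! ### Mapping cones; quasi-isomorphisms are homotopy equivalences. -/

section Cone

variable {K : Type u} [Field K] {X : GrMod K} {A : AInfStr X} {P Q R S M N : ABimod A}

/-- The graded space `N ⊕ M[1]` underlying the mapping cone of a map `M → N`. -/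
def coneGr (N M : ABimod A) : GrMod K where
  carrier := N.carrier × M.carrier
  gr n := (N.gr n).prod (M.gr (n + 1))
  internal := GrMod.ext_internal N.toGrMod M.toGrMod

theorem coneGr_sgn (c : N.carrier × M.carrier) :
    (coneGr N M).sgn c = ((N.sgn c.1, -M.sgn c.2) : N.carrier × M.carrier) := by
  have : (coneGr N M).sgn = N.sgn.prodMap (-M.sgn) := (coneGr N M).lin_ext fun i c hc => by
    rw [(coneGr N M).sgn_of_mem hc]
    have h1 := N.sgn_of_mem hc.1
    have h2 := M.sgn_of_mem hc.2
    refine Prod.ext h1.symm ?_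
    change GrMod.eps i • c.2 = -M.sgn c.2
    rw [h2, GrMod.eps_add_one, neg_smul, neg_neg]
  rw [this]; rfl

/-- The structure maps of the mapping cone. -/
noncomputable def coneAct (φ : PreHom M N) (l r : List X) : N.carrier × M.carrier →ₗ[K] N.carrier × M.carrier :=
  ((N.act l r).coprod (φ l (r.map X.rsgn))).prod
    (-(M.act l (r.map X.rsgn)) ∘ₗ LinearMap.snd K N.carrier M.carrier)

theorem coneAct_apply (φ : PreHom M N) (l r : List X) (c : N.carrier × M.carrier) :
    coneAct φ l r c =
      (N.act l r c.1 + φ l (r.map X.rsgn) c.2, -M.act l (r.map X.rsgn) c.2) := rfl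

theorem act_one_map_rsgn (M : ABimod A) {l r : List X} (h : 2 ≤ l.length + r.length)
    (h' : A.one ∈ l ∨ A.one ∈ r) : M.act l (r.map X.rsgn) = 0 := by
  rcases h' with h' | h'
  · exact M.act_eq_zero _ _ (by simpa using h) (.inl h')
  · obtain ⟨u, v, rfl⟩ := List.append_of_mem h'
    have := act_rsp_one M 1 l (u.map X.rsgn) (v.map X.rsgn) (by simp at h ⊢; omega)
    rw [rsp_of_odd X (by decide)] at this
    rw [List.map_append, List.map_cons, this]

theorem fst_splitSum {α V W : Type*} [AddCommGroup V] [AddCommGroup W]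
    (F : List α → List α → V × W) (l : List α) :
    (splitSum F l).1 = splitSum (fun u v => (F u v).1) l := splitSum_hom (AddMonoidHom.fst V W) F l

theorem snd_splitSum {α V W : Type*} [AddCommGroup V] [AddCommGroup W]
    (F : List α → List α → V × W) (l : List α) :
    (splitSum F l).2 = splitSum (fun u v => (F u v).2) l := splitSum_hom (AddMonoidHom.snd V W) F l

theorem cone_one_left {φ : PreHom M N} (hφ : φ ∈ cocycles M N 0)
    (S : N.carrier × M.carrier →ₗ[K] N.carrier × M.carrier)
    (hS : ∀ c, S c = (N.sgn c.1, -M.sgn c.2)) (c : N.carrier × M.carrier) :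
    coneAct φ [A.one] [] c = -S c := by
  rw [hS]
  refine Prod.ext ?_ ?_
  · change N.act [A.one] [] c.1 + φ [A.one] [] c.2 = -N.sgn c.1
    rw [N.one_left, hφ.1.2.2.1 _ _ (.inl (by simp))]; simp
  · change -M.act [A.one] [] c.2 = -(-M.sgn c.2)
    rw [M.one_left]

/-- The N-component is the bimodule equation of N plus the cocycle equation of φ; the M-component is
the bimodule equation of M. The twist of the right letters and the minus sign are those of the shift
M[1]. -/
theorem cone_assoc {φ : PreHom M N} (hφ : φ ∈ cocycles M N 0)
    (S : N.carrier × M.carrier →ₗ[K] N.carrier × M.carrier)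
    (hS : ∀ c, S c = (N.sgn c.1, -M.sgn c.2)) (l r : List X)
    (c : N.carrier × M.carrier) :
    splitSum (fun x y => splitSum (fun z w =>
      coneAct φ x (w.map X.rsgn) (coneAct φ y z c)) r) l +
    splitSum₃ (fun x y z => coneAct φ l (x ++ A.μ y :: z.map X.rsgn) c) r +
    splitSum₃ (fun x y z => coneAct φ (x ++ A.μ y :: z.map X.rsgn) (r.map X.rsgn) (S c)) l = 0 := by
  obtain ⟨n, m⟩ := c
  have hN := N.assoc l r n
  have hM := M.assoc l (r.map X.rsgn) m
  have hD := LinearMap.congr_fun (congrFun (congrFun (mem_cocycles.1 hφ).2 l) (r.map X.rsgn)) m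
  have e1 := contr_map_rsgn (A := A) (f := fun z => φ l z m)
    ((hφ.1.2.1 l).comp_lin (LinearMap.applyₗ m)) r
  have e2 := contr_map_rsgn (A := A) (f := fun z => M.act l z m)
    ((M.multilin_right l).comp_lin (LinearMap.applyₗ m)) r
  rw [homD_eq] at hD
  simp only [Pi.sub_apply, Pi.smul_apply, GrMod.eps_zero, one_smul, LinearMap.sub_apply, bd_apply,
    bdA_apply, comp_apply, map_rsp_zero, map_rsp_one, splitSum_map, e1, Pi.zero_apply,
    LinearMap.zero_apply] at hD
  change _ + contr A (fun z => M.act l z m) (r.map X.rsgn) + _ = _ at hM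
  rw [e2] at hM
  simp only [contr, splitSum₃, splitSum_map] at hN hM hD
  simp only [coneAct_apply, splitSum₃, hS]
  refine Prod.ext ?_ ?_
  · simp only [Prod.fst_add, fst_splitSum, map_add, map_neg, splitSum_add, splitSum_neg,
      Prod.fst_zero]
    have := congrArg₂ (· + ·) hN hD
    simp only [add_zero] at this
    refine Eq.trans ?_ this
    abel
  · simp only [Prod.snd_add, snd_splitSum, map_neg, splitSum_neg, Prod.snd_zero, neg_neg]
    refine Eq.trans ?_ hM
    abel

/-- The mapping cone of a bimodule map of degree zero. -/
noncomputable def cone {φ : PreHom M N} (hφ : φ ∈ cocycles M N 0) : ABimod A where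
  toGrMod := coneGr N M
  act := coneAct φ
  multilin_left r := .of_apply fun c => by
    have h1 := (N.multilin_left r).comp_lin (LinearMap.inl K N.carrier M.carrier ∘ₗ
      LinearMap.applyₗ c.1)
    have h2 := (hφ.1.1 (r.map X.rsgn)).comp_lin (LinearMap.inl K N.carrier M.carrier ∘ₗ
      LinearMap.applyₗ c.2)
    have h3 := (M.multilin_left (r.map X.rsgn)).comp_lin (LinearMap.inr K N.carrier M.carrier ∘ₗ
      (-LinearMap.applyₗ c.2))
    have := (h1.add h2).add h3
    simpa [coneAct_apply] using this
  multilin_right l := .of_apply fun c => by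
    have h1 := (N.multilin_right l).comp_lin (LinearMap.inl K N.carrier M.carrier ∘ₗ
      LinearMap.applyₗ c.1)
    have h2 := (hφ.1.2.1 l).map_rsgn.comp_lin (LinearMap.inl K N.carrier M.carrier ∘ₗ
      LinearMap.applyₗ c.2)
    have h3 := (M.multilin_right l).map_rsgn.comp_lin (LinearMap.inr K N.carrier M.carrier ∘ₗ
      (-LinearMap.applyₗ c.2))
    have := (h1.add h2).add h3
    simpa [coneAct_apply] using this
  act_mem l m r n i c hl hr hc := by
    have h1 := N.act_mem l m r n i c.1 hl hr hc.1
    have h2 := hφ.1.2.2.2 l m _ n (i + 1) c.2 hl (isHom_map_rsgn hr) hc.2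
    have h3 := M.act_mem l m _ n (i + 1) c.2 hl (isHom_map_rsgn hr) hc.2
    refine ⟨add_mem h1 ?_, neg_mem ?_⟩
    · rw [show GrMod.rdeg m + (i + 1) + GrMod.rdeg n + 0 = GrMod.rdeg m + i + GrMod.rdeg n + 1 by
        ring] at h2
      exact h2
    · rw [show GrMod.rdeg m + (i + 1) + GrMod.rdeg n + 1 = GrMod.rdeg m + i + GrMod.rdeg n + 1 + 1
        by ring] at h3
      exact h3
  assoc := cone_assoc hφ (coneGr N M).sgn coneGr_sgn
  one_left := cone_one_left hφ (coneGr N M).sgn coneGr_sgn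
  one_right c := by
    refine Prod.ext ?_ ?_
    · change N.act [] [A.one] c.1 + φ [] ([A.one].map X.rsgn) c.2 = c.1
      rw [N.one_right, MRed.map_rsgn (hom_mred_right hφ.1 []) (by simp)]; simp
    · change -M.act [] [X.rsgn A.one] c.2 = c.2
      have := (M.multilin_right [] [] []).map_neg A.one
      simp only [List.nil_append] at this
      rw [A.rsgn_one, this, LinearMap.neg_apply, M.one_right, neg_neg]
  act_eq_zero l r h h' := LinearMap.ext fun c => by
    have h1 : φ l (r.map X.rsgn) = 0 := by
      rcases h' with h' | h'
      · exact hφ.1.2.2.1 _ _ (.inl h')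
      · exact MRed.map_rsgn (hom_mred_right hφ.1 l) h'
    refine Prod.ext ?_ ?_
    · change N.act l r c.1 + φ l (r.map X.rsgn) c.2 = 0
      rw [N.act_eq_zero _ _ h h', h1]; simp
    · change -M.act l (r.map X.rsgn) c.2 = 0
      rw [act_one_map_rsgn M h h']; simp

theorem cocycle_chain {φ : PreHom M N} (hφ : φ ∈ cocycles M N 0) (m : M.carrier) :
    N.act [] [] (φ [] [] m) = φ [] [] (M.act [] [] m) := by
  have hD := LinearMap.congr_fun (congrFun (congrFun (mem_cocycles.1 hφ).2 []) []) m
  have h1 : φ [] [0] = 0 := (hφ.1.2.1 [] [] []).map_zero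
  have h2 : φ [0] [] = 0 := (hφ.1.1 [] [] []).map_zero
  rw [homD_eq] at hD
  simpa [bd_apply, bdA_apply, comp_apply, splitSum_nil, contr_nil, h1, h2, sub_eq_zero] using hD

/-- For a cycle (n, m), injectivity of φ on cohomology provides a primitive m₁ of m, and
surjectivity applies to the cycle n + φ(m₁). -/
theorem cone_acyclic {φ : PreHom M N} (hφ : IsQuasiIso φ) : (cone hφ.1).Acyclic := by
  rintro ⟨n, m⟩ h
  have h1 : N.act [] [] n + φ [] [] m = 0 := congrArg Prod.fst h
  have h2 : -M.act [] [] m = 0 := congrArg Prod.snd h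
  obtain ⟨m₁, hm₁⟩ := hφ.2.1 m (neg_eq_zero.1 h2) ⟨-n, by
    rw [map_neg]; exact (eq_neg_of_add_eq_zero_right h1).symm⟩
  obtain ⟨p, q, hp, hq⟩ := hφ.2.2 (n + φ [] [] m₁) (by
    rw [map_add, cocycle_chain hφ.1, hm₁, h1])
  refine ⟨((q, p - m₁) : N.carrier × M.carrier), Prod.ext ?_ ?_⟩
  · change N.act [] [] q + φ [] [] (p - m₁) = n
    rw [map_sub, ← add_sub_assoc, add_comm, hq, add_sub_cancel_right]
  · change -M.act [] [] (p - m₁) = m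
    rw [map_sub, hp, zero_sub, neg_neg, hm₁]

/-- The map to a cone with given components. -/
def conePair {φ : PreHom M N} (hφ : φ ∈ cocycles M N 0) (ξ : PreHom P N) (α : PreHom P M) :
    PreHom P (cone hφ) := fun l r => (ξ l r).prod (α l r)

/-- The off-diagonal part φ of the cone contributes φ ∘ α, and the shift changes the sign of the
differential of α. -/
theorem homD_conePair {φ : PreHom M N} (hφ : φ ∈ cocycles M N 0) (d : ℤ) (ξ : PreHom P N)
    (α : PreHom P M) : homD P (cone hφ) d (conePair hφ ξ α) =
      conePair hφ (homD P N d ξ + comp (d + 1) φ α) (-homD P M (d + 1) α) := by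
  have hb : bd (conePair hφ ξ α) = conePair hφ (bd ξ) (bd α) := bd_prod ξ α
  have hc : comp d (cone hφ).act (conePair hφ ξ α) =
      conePair hφ (comp d N.act ξ + comp (d + 1) φ α) (-comp (d + 1) M.act α) := by
    funext l r
    refine LinearMap.ext fun p => ?_
    rw [comp_apply]
    change splitSum (fun x y => splitSum (fun z w =>
      coneAct φ x (w.map (rsp X d)) ((ξ y z p, α y z p) : N.carrier × M.carrier)) r) l =
        ((comp d N.act ξ l r p + comp (d + 1) φ α l r p, -comp (d + 1) M.act α l r p) :
          N.carrier × M.carrier)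
    refine Prod.ext ?_ ?_
    · simp only [fst_splitSum, coneAct_apply, comp_apply, map_rsp_add_one', splitSum_add]
    · simp only [snd_splitSum, coneAct_apply, comp_apply, map_rsp_add_one', splitSum_neg]
  rw [homD_eq, hb, hc, homD_eq, homD_eq, GrMod.eps_add_one]
  funext l r
  refine LinearMap.ext fun p => Prod.ext ?_ ?_
  · change comp d N.act ξ l r p + comp (d + 1) φ α l r p - GrMod.eps d • bd ξ l r p =
      comp d N.act ξ l r p - GrMod.eps d • bd ξ l r p + comp (d + 1) φ α l r p
    abel
  · change -comp (d + 1) M.act α l r p - GrMod.eps d • bd α l r p =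
      -(comp (d + 1) M.act α l r p - (-GrMod.eps d) • bd α l r p)
    rw [neg_smul]
    abel

theorem conePair_mem {φ : PreHom M N} (hφ : φ ∈ cocycles M N 0) {d : ℤ} {ξ : PreHom P N}
    {α : PreHom P M} (hξ : ξ ∈ hom P N d) (hα : α ∈ hom P M (d + 1)) :
    conePair hφ ξ α ∈ hom P (cone hφ) d := by
  refine ⟨fun r => ?_, fun l => ?_, fun l r h => ?_, fun l m r n i p hl hr hp => ?_⟩
  · exact fun u v => ((LinearMap.prodEquiv K).toLinearMap ∘ₗ
      ((hξ.1 r u v).mk'.prod (hα.1 r u v).mk')).isLinear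
  · exact fun u v => ((LinearMap.prodEquiv K).toLinearMap ∘ₗ
      ((hξ.2.1 l u v).mk'.prod (hα.2.1 l u v).mk')).isLinear
  · rw [conePair, hξ.2.2.1 l r h, hα.2.2.1 l r h]; rfl
  · refine ⟨hξ.2.2.2 l m r n i p hl hr hp, ?_⟩
    have := hα.2.2.2 l m r n i p hl hr hp
    rwa [← add_assoc] at this

/-- The hypotheses say that (ξ, α) is a cocycle with values in the cone of φ. The cone being
acyclic, the pair bounds, and η and β are the components of a primitive. -/
theorem IsQuasiIso.lift {φ : PreHom M N} (hφ : IsQuasiIso φ) {d : ℤ} {ξ : PreHom P N}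
    {α : PreHom P M} (hξ : ξ ∈ hom P N d) (hα : α ∈ cocycles P M (d + 1))
    (h : homD P N d ξ + comp (d + 1) φ α = 0) :
    ∃ η ∈ hom P N (d - 1), ∃ β ∈ hom P M d,
      homD P N (d - 1) η + comp d φ β = ξ ∧ -homD P M d β = α := by
  have hF : conePair hφ.1 ξ α ∈ cocycles P (cone hφ.1) d := by
    refine ⟨conePair_mem hφ.1 hξ hα.1, ?_⟩
    refine LinearMap.mem_ker.2 ?_
    rw [homD_conePair, h, (mem_cocycles.1 hα).2, neg_zero]; rfl
  obtain ⟨G, hG, hGF⟩ := (cone_acyclic hφ).hom_acyclic hF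
  let η : PreHom P N := fun l r => LinearMap.fst K N.carrier M.carrier ∘ₗ G l r
  let β : PreHom P M := fun l r => LinearMap.snd K N.carrier M.carrier ∘ₗ G l r
  have hGp : conePair hφ.1 η β = G := rfl
  have hη : η ∈ hom P N (d - 1) := ⟨fun r => (hG.1 r).comp_lin
      (LinearMap.llcomp K P.carrier (N.carrier × M.carrier) N.carrier (LinearMap.fst K _ _)),
    fun l => (hG.2.1 l).comp_lin
      (LinearMap.llcomp K P.carrier (N.carrier × M.carrier) N.carrier (LinearMap.fst K _ _)),
    fun l r h => by simp only [η]; rw [hG.2.2.1 l r h]; rfl,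
    fun l m r n i p hl hr hp => (hG.2.2.2 l m r n i p hl hr hp).1⟩
  have hβ : β ∈ hom P M d := ⟨fun r => (hG.1 r).comp_lin
      (LinearMap.llcomp K P.carrier (N.carrier × M.carrier) M.carrier (LinearMap.snd K _ _)),
    fun l => (hG.2.1 l).comp_lin
      (LinearMap.llcomp K P.carrier (N.carrier × M.carrier) M.carrier (LinearMap.snd K _ _)),
    fun l r h => by simp only [β]; rw [hG.2.2.1 l r h]; rfl,
    fun l m r n i p hl hr hp => by
      have := (hG.2.2.2 l m r n i p hl hr hp).2
      rwa [add_assoc, sub_add_cancel] at this⟩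
  rw [← hGp, homD_conePair, sub_add_cancel] at hGF
  refine ⟨η, hη, β, hβ, ?_, ?_⟩
  · funext l r
    refine LinearMap.ext fun p => ?_
    exact congrArg Prod.fst (LinearMap.congr_fun (congrFun (congrFun hGF l) r) p)
  · funext l r
    refine LinearMap.ext fun p => ?_
    exact congrArg Prod.snd (LinearMap.congr_fun (congrFun (congrFun hGF l) r) p)

/-- Quasi-isomorphisms are invertible up to homotopy. -/
theorem IsQuasiIso.isHtpyEquiv {φ : PreHom M N} (hφ : IsQuasiIso φ) : IsHtpyEquiv φ := by
  -- Applied to the pair (id, 0): the second component of a primitive is a right inverse of φ up to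
  -- homotopy.
  obtain ⟨η, hη, ψ, hψ, h1, h2⟩ := hφ.lift (idHom_mem N).1 (zero_mem (cocycles N M (0 + 1)))
    (by rw [(mem_cocycles.1 (idHom_mem N)).2, comp_zero_right, add_zero])
  have hψ' : ψ ∈ cocycles N M 0 := ⟨hψ, by simpa using h2⟩
  have h3 : Htpy 0 (comp 0 φ ψ) (idHom N) := by
    rw [Htpy, ← h1, sub_add_cancel_right]
    exact neg_mem ⟨η, hη, rfl⟩
  refine ⟨hφ.1, ψ, hψ', h3, ?_⟩
  obtain ⟨ξ, hξ, h4⟩ := h3.comp_right hφ.1 (n := 0) rfl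
  rw [idHom_comp] at h4
  have hα : comp 0 ψ φ - idHom M ∈ cocycles M M (-1 + 1) :=
    sub_mem (comp_mem_cocycles hψ' hφ.1 rfl) (idHom_mem M)
  -- As φ ∘ (ψφ - id) bounds, the difference ψφ - id and minus the bounding homotopy ξ form a
  -- cocycle with values in the cone. A primitive contains a homotopy between ψφ and id.
  obtain ⟨_, _, β, hβ, _, h6⟩ := hφ.lift (d := -1) (neg_mem hξ) hα (by
    rw [map_neg]
    change -homD M N (0 - 1) ξ + comp 0 φ _ = 0
    rw [h4, comp_sub_right, comp_idHom, comp_assoc_zero]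
    abel)
  rw [Htpy, ← h6]
  exact neg_mem ⟨β, hβ, rfl⟩

end Cone

/-! ### The maps f ⊗ id and id ⊗ φ and their differentials. -/

section TensorMaps

open scoped TensorProduct

variable {K : Type u} [Field K] {X : GrMod K} {A : AInfStr X} {P Q R S M N : ABimod A}
  {Y : Type*} [AddCommGroup Y] [Module K Y]

/-- The three terms are the contractions to the left of the marked letter a, those containing it,
and those to its right. -/
theorem contr_append_cons (f : List X → Y) (l : List X) (a : X) (r : List X) :
    contr A f (l ++ a :: r) = contr A (fun l => f (l ++ X.rsgn a :: r.map X.rsgn)) l +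
      splitSum (fun u v => splitSum (fun z w => f (u ++ A.μ (v ++ a :: z) :: w.map X.rsgn)) r) l +
      contr A (fun r => f (l ++ a :: r)) r := by
  simp only [contr, splitSum₃, splitSum_append_cons, splitSum_add, List.map_append, List.map_cons,
    List.append_assoc, List.cons_append]

/-- The word `q ⊗ l ⊗ p` in the tensor product `Q ⊗_A P`. -/
noncomputable def tw (Q P : ABimod A) (l : List X) :
    Q.carrier →ₗ[K] P.carrier →ₗ[K] (tensor Q P).carrier := wd Q P l

theorem tw_mred (Q P : ABimod A) :
    tw Q P ∈ MRed A (Q.carrier →ₗ[K] P.carrier →ₗ[K] (tensor Q P).carrier) := wd_mem Q P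

/-- The linear map on `Q ⊗_A P` with the given values on words. -/
noncomputable def tLift (f : MRed A (Q.carrier →ₗ[K] P.carrier →ₗ[K] Y)) :
    (tensor Q P).carrier →ₗ[K] Y := tensorLift (Q := Q) (P := P) f

@[simp] theorem tLift_tw (f : MRed A (Q.carrier →ₗ[K] P.carrier →ₗ[K] Y)) (l : List X)
    (q : Q.carrier) (p : P.carrier) : tLift f (tw Q P l q p) = f.1 l q p := tensorLift_wd f l q p

theorem tw_ext {F G : (tensor Q P).carrier →ₗ[K] Y}
    (h : ∀ l q p, F (tw Q P l q p) = G (tw Q P l q p)) : F = G :=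
  tensor_ext (Q := Q) (P := P) h

theorem tw_comp (φ : (tensor Q P).carrier →ₗ[K] Y) (q : Q.carrier) (p : P.carrier) :
    IsMultilin K fun l => φ (tw Q P l q p) := wd_comp (Q := Q) (P := P) φ q p

theorem tw_mem_gr {i j n : ℤ} {d : List ℤ} {l : List X} {q : Q.carrier} {p : P.carrier}
    (hq : q ∈ Q.gr i) (hl : X.IsHom l d) (hp : p ∈ P.gr j) (h : i + GrMod.rdeg d + j = n) :
    tw Q P l q p ∈ (tensor Q P).gr n := wd_mem_tensorGr hq hl hp h

theorem act_tw (l' r l : List X) (q : Q.carrier) (p : P.carrier) :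
    (tensor Q P).act l' r (tw Q P l q p) = opT Q P l' r (tw Q P) l q p :=
  tensorAct_wd l' r l q p

theorem sgn_tw (l : List X) (q : Q.carrier) (p : P.carrier) :
    (tensor Q P).sgn (tw Q P l q p) = tw Q P (l.map X.rsgn) (Q.sgn q) (P.sgn p) :=
  tensor_sgn_wd l q p

theorem biFun_tensor_ext {F G : BiFun (tensor Q P) Y}
    (h : ∀ l' r l q p, F l' r (tw Q P l q p) = G l' r (tw Q P l q p)) : F = G :=
  funext fun l' => funext fun r => tw_ext (h l' r)

theorem multilin_tensor {F : List X → (tensor Q P).carrier →ₗ[K] Y}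
    (h : ∀ l q p, IsMultilin K fun x => F x (tw Q P l q p)) : IsMultilin K F := fun u v =>
  ⟨fun a b => tw_ext fun l q p => (h l q p u v).map_add a b,
    fun c a => tw_ext fun l q p => (h l q p u v).map_smul c a⟩

theorem tw_gr_le {F : (tensor Q P).carrier →ₗ[K] Y} {S : Submodule K Y} {n : ℤ}
    (h : ∀ i d j l q p, q ∈ Q.gr i → X.IsHom l d → p ∈ P.gr j → i + GrMod.rdeg d + j = n →
      F (tw Q P l q p) ∈ S) {x : (tensor Q P).carrier} (hx : x ∈ (tensor Q P).gr n) : F x ∈ S := by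
  have : (tensor Q P).gr n ≤ S.comap F := Submodule.span_le.2 <| by
    rintro _ ⟨i, d, j, l, q, p, hq, hl, hp, e, rfl⟩
    exact h i d j l q p hq hl hp e
  exact this hx

/-- Membership in the hom complex for maps defined on a tensor product. -/
theorem mem_hom_tensor {F : PreHom (tensor Q P) N} {d : ℤ}
    (h₁ : ∀ r l q p, IsMultilin K fun l' => F l' r (tw Q P l q p))
    (h₂ : ∀ l' l q p, IsMultilin K fun r => F l' r (tw Q P l q p))
    (h₃ : ∀ l' r l q p, A.one ∈ l' ∨ A.one ∈ r → F l' r (tw Q P l q p) = 0)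
    (h₄ : ∀ l' m r n l e q i p j, X.IsHom l' m → X.IsHom r n → X.IsHom l e → q ∈ Q.gr i →
      p ∈ P.gr j → F l' r (tw Q P l q p) ∈
        N.gr (GrMod.rdeg m + (i + GrMod.rdeg e + j) + GrMod.rdeg n + d)) :
    F ∈ hom (tensor Q P) N d :=
  ⟨fun r => multilin_tensor (h₁ r), fun l => multilin_tensor (h₂ l),
    fun l' r h => tw_ext fun l q p => h₃ l' r l q p h, fun l' m r n _ _ hl' hr hx =>
      tw_gr_le (Q := Q) (P := P) (fun i e j l q p hq hl hp hk =>
        hk ▸ h₄ l' m r n l e q i p j hl' hr hl hq hp) hx⟩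

theorem opA_eq_contr (f : List X → Q.carrier →ₗ[K] P.carrier →ₗ[K] Y) (l : List X)
    (q : Q.carrier) (p : P.carrier) :
    opA Q P f l q p = contr A (fun l => f l q (P.sgn p)) l := opA_apply f l q p

theorem map_opT {Z : Type*} [AddCommGroup Z] [Module K Z] (F : Y →ₗ[K] Z) (l' r : List X)
    (f : List X → Q.carrier →ₗ[K] P.carrier →ₗ[K] Y) (l : List X) (q : Q.carrier) (p : P.carrier) :
    F (opT Q P l' r f l q p) =
      (if r = [] then splitSum (fun u v => F (f (v.map X.rsgn) (Q.act l' u q) (P.sgn p))) l else 0) +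
      (if l' = [] ∧ r = [] then contr A (fun l => F (f l q (P.sgn p))) l else 0) +
      (if l' = [] then splitSum (fun u v => F (f u q (P.act v r p))) l else 0) := by
  rw [opT, LinearMap.add_apply, LinearMap.add_apply, LinearMap.add_apply, LinearMap.add_apply,
    map_add, map_add]
  congr 1
  · congr 1
    · split_ifs
      · rw [opQ_apply, splitSum_hom]
      · simp
    · split_ifs
      · rw [opA_eq_contr, contr_comp]
      · simp
  · split_ifs
    · rw [opP_apply, splitSum_hom]
    · simp

/-- The bar differential on the words of a tensor product. -/
theorem bd_tensor (F : BiFun (tensor Q P) Y) (l' r l : List X) (q : Q.carrier) (p : P.carrier) :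
    bd F l' r (tw Q P l q p) =
      splitSum (fun x y => splitSum (fun u v =>
        F x (r.map X.rsgn) (tw Q P (v.map X.rsgn) (Q.act y u q) (P.sgn p))) l) l' +
      contr A (fun l => F l' (r.map X.rsgn) (tw Q P l q (P.sgn p))) l +
      splitSum (fun z w => splitSum (fun u v =>
        F l' (w.map X.rsgn) (tw Q P u q (P.act v z p))) l) r +
      contr A (fun r => F l' r (tw Q P l q p)) r +
      contr A (fun x => F x (r.map X.rsgn) (tw Q P (l.map X.rsgn) (Q.sgn q) (P.sgn p))) l' := by
  have hfirst : comp 1 F (tensor Q P).act l' r (tw Q P l q p) =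
      splitSum (fun x y => splitSum (fun u v =>
        F x (r.map X.rsgn) (tw Q P (v.map X.rsgn) (Q.act y u q) (P.sgn p))) l) l' +
      contr A (fun l => F l' (r.map X.rsgn) (tw Q P l q (P.sgn p))) l +
      splitSum (fun z w => splitSum (fun u v =>
        F l' (w.map X.rsgn) (tw Q P u q (P.act v z p))) l) r := by
    rw [comp_apply]
    -- The structure maps of the tensor product vanish if outer letters are used on both sides:
    -- terms with μ_Q use no right letters, those with μ_P no left ones, and those with μ_A none.
    -- One or both of the cuts therefore collapse.
    have e : ∀ x y z w : List X, F x (w.map (rsp X 1)) ((tensor Q P).act y z (tw Q P l q p)) =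
        (if z = [] then splitSum (fun u v => F x (w.map X.rsgn)
          (tw Q P (v.map X.rsgn) (Q.act y u q) (P.sgn p))) l else 0) +
        (if z = [] then (if y = [] then
          contr A (fun l => F x (w.map X.rsgn) (tw Q P l q (P.sgn p))) l else 0) else 0) +
        (if y = [] then splitSum (fun u v => F x (w.map X.rsgn) (tw Q P u q (P.act v z p))) l
          else 0) := fun x y z w => by
      rw [act_tw, map_rsp_one]
      refine (map_opT (F x (w.map X.rsgn)) y z (tw Q P) l q p).trans ?_
      simp only [← ite_and, and_comm]
    simp only [e, splitSum_add]
    have h1 := fun x y : List X => splitSum_ite_left (fun w => splitSum (fun u v =>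
      F x (w.map X.rsgn) (tw Q P (v.map X.rsgn) (Q.act y u q) (P.sgn p))) l) r
    have h2 := fun x y : List X => splitSum_ite_left (fun w => if y = [] then
      contr A (fun l => F x (w.map X.rsgn) (tw Q P l q (P.sgn p))) l else 0) r
    simp only [h1, h2]
    congr 1
    · congr 1
      exact splitSum_ite_right (fun x =>
        contr A (fun l => F x (r.map X.rsgn) (tw Q P l q (P.sgn p))) l) l'
    · rw [splitSum_comm fun x y z w => if y = [] then
        splitSum (fun u v => F x (w.map X.rsgn) (tw Q P u q (P.act v z p))) l else 0]
      exact splitSum_congr _ fun z w _ => splitSum_ite_right (fun x =>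
        splitSum (fun u v => F x (w.map X.rsgn) (tw Q P u q (P.act v z p))) l) l'
  rw [bd_apply, hfirst, bdA_apply]
  rw [sgn_tw]
  abel

theorem sgnp_act (P : ABimod A) (d : ℤ) (l r : List X) (p : P.carrier) :
    sgnp P.toGrMod d (P.act l r p) =
      GrMod.eps d • P.act (l.map (rsp X d)) (r.map (rsp X d)) (sgnp P.toGrMod d p) := by
  by_cases hd : Even d
  · simp [sgnp_of_even _ hd, rsp_of_even X hd, GrMod.eps_of_even hd]
  · rw [sgnp_of_odd _ hd, rsp_of_odd X hd, GrMod.eps_of_odd hd, P.sgn_act]; simp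

/-- The universal map `(r, m) ↦ m ⊗ r ⊗ p`. -/
noncomputable def pairRight (R P : ABimod A) (p : P.carrier) : BiFun R ((tensor R P).carrier) :=
  fun l r => if l = [] then (tw R P r).flip p else 0

theorem pairRight_multilin (R : ABimod A) (p : P.carrier) : BiMultilin (pairRight R P p) := by
  refine ⟨fun r => .of_ne_nil fun l hl => by simp [pairRight, hl], fun l => ?_⟩
  by_cases hl : l = []
  · simp only [pairRight, hl, if_true]
    exact .of_apply fun m => tw_comp LinearMap.id m p
  · have : pairRight R P p l = fun _ => 0 := funext fun r => by simp [pairRight, hl]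
    rw [this]; exact .zero

/-- For fixed p, the map f ⊗ id_P is f followed by a tautological map, so `bd_comp` can compute its
differential. -/
theorem comp_pairRight (d : ℤ) (f : PreHom Q R) (p : P.carrier) (l' l : List X) (q : Q.carrier) :
    comp d (pairRight R P p) f l' l q =
      splitSum (fun u v => tw R P (v.map (rsp X d)) (f l' u q) p) l := by
  rw [comp_apply, splitSum_single_left]
  · simp [pairRight]
  · intro x y _ hx
    exact splitSum_eq_zero fun u v _ => by simp [pairRight, hx]

/-- These are the terms of the differential on `R ⊗ P` that involve μ_R and μ_A. Those with μ_P are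
not seen by the tautological map, in which p is fixed. -/
theorem bd_pairRight (p : P.carrier) (x v : List X) (m : R.carrier) :
    bd (pairRight R P p) x v m =
      splitSum (fun z w => tw R P (w.map X.rsgn) (R.act x z m) p) v +
      if x = [] then contr A (fun v => tw R P v m p) v else 0 := by
  rw [bd_apply, comp_pairRight, bdA_apply]
  simp only [map_rsp_one]
  rw [contr_congr (l := x) (g := fun _ => 0), contr_zero, add_zero]
  · split_ifs with h
    · simp [pairRight, h]
    · simp [pairRight, h, contr_zero]
  · intro y hy
    simp [pairRight, hy]

theorem tensorT_mred (P : ABimod A) {Q R : ABimod A} {d : ℤ} (f : hom Q R d) (l' : List X) :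
    (fun l => splitSum (fun u v =>
      (tw R P (v.map (rsp X d))).compl₁₂ (f.1 l' u) (sgnp P.toGrMod d)) l) ∈
      MRed A (Q.carrier →ₗ[K] P.carrier →ₗ[K] (tensor R P).carrier) := by
  refine ⟨.of_apply fun q => .of_apply fun p => ?_, fun l hl => splitSum_eq_zero ?_⟩
  · simp only [splitSum_apply₂, LinearMap.compl₁₂_apply, ← comp_pairRight]
    exact ((comp_multilin (pairRight_multilin R _) (hom_multilin f.2)).2 l').comp_lin
      (LinearMap.applyₗ q)
  · rintro u v rfl
    refine LinearMap.ext fun q => LinearMap.ext fun p => ?_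
    rcases List.mem_append.1 hl with h | h
    · rw [LinearMap.compl₁₂_apply, f.2.2.2.1 l' u (.inr h)]; simp
    · rw [LinearMap.compl₁₂_apply, MRed.map_rsp (tw_mred R P) d h]; simp

/-- The map `f ⊗ id_P` induced by a map `f` of degree `d`. -/
noncomputable def tensorT (P : ABimod A) {Q R : ABimod A} {d : ℤ} (f : hom Q R d) :
    PreHom (tensor Q P) (tensor R P) := fun l' r =>
  if r = [] then tLift ⟨_, tensorT_mred P f l'⟩ else 0

theorem tensorT_nil {d : ℤ} (f : hom Q R d) (l' l : List X) (q : Q.carrier) (p : P.carrier) :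
    tensorT P f l' [] (tw Q P l q p) = splitSum (fun u v =>
      tw R P (v.map (rsp X d)) (f.1 l' u q) (sgnp P.toGrMod d p)) l := by
  rw [tensorT, if_pos rfl]
  rw [tLift_tw]
  simp only [splitSum_apply₂, LinearMap.compl₁₂_apply]

theorem tensorT_ne_nil {d : ℤ} (f : hom Q R d) (l' : List X) {r : List X} (hr : r ≠ []) :
    tensorT P f l' r = 0 := if_neg hr

theorem tensorT_eq_comp {d : ℤ} (f : hom Q R d) (l' l : List X) (q : Q.carrier) (p : P.carrier) :
    tensorT P f l' [] (tw Q P l q p) =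
      comp d (pairRight R P (sgnp P.toGrMod d p)) f.1 l' l q := by
  rw [tensorT_nil, comp_pairRight]

theorem tensorT_mem (P : ABimod A) {d : ℤ} (f : hom Q R d) :
    tensorT P f ∈ hom (tensor Q P) (tensor R P) d := by
  refine mem_hom_tensor (fun r l q p => ?_) (fun l' l q p => ?_) (fun l' r l q p h => ?_)
    fun l' m r n l e q i p j hl' hr hl hq hp => ?_
  · by_cases hr : r = []
    · subst hr
      simp only [tensorT_eq_comp]
      exact ((comp_multilin (pairRight_multilin R _) (hom_multilin f.2)).1 l).comp_lin
        (LinearMap.applyₗ q)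
    · simp only [tensorT_ne_nil f _ hr]
      exact .zero
  · exact .of_ne_nil fun r hr => by rw [tensorT_ne_nil f _ hr]; rfl
  · by_cases hr : r = []
    · subst hr
      rw [tensorT_nil]
      refine splitSum_eq_zero fun u v _ => ?_
      rw [f.2.2.2.1 l' u (.inl (by simpa using h))]; simp
    · rw [tensorT_ne_nil f _ hr]; rfl
  · by_cases h : r = []
    · subst h
      cases hr
      rw [tensorT_nil]
      refine splitSum_mem fun u v huv => ?_
      subst huv
      obtain ⟨d₁, d₂, rfl, h₁, h₂⟩ := isHom_append hl
      refine tw_mem_gr (f.2.2.2.2 _ _ _ _ _ _ hl' h₁ hq) (isHom_map_rsp X d h₂)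
        (sgnp_mem _ d hp) ?_
      simp; ring
    · rw [tensorT_ne_nil f _ h]; exact zero_mem _

/-- The terms with μ_Q, μ_R and μ_A form the Leibniz rule for f followed by `pairRight`. The terms
with μ_P occur before and after f is applied, and cancel once `sgnp_act` has matched their signs. -/
theorem homD_tensorT (P : ABimod A) {d : ℤ} (f : hom Q R d) :
    homD (tensor Q P) (tensor R P) d (tensorT P f) = tensorT P ⟨_, homD_mem f.2⟩ := by
  refine biFun_tensor_ext fun l' r l q p => ?_
  have hact : comp d (tensor R P).act (tensorT P f) l' r (tw Q P l q p) =
      splitSum (fun x y => splitSum (fun u v => opT R P x (r.map (rsp X d)) (tw R P)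
        (v.map (rsp X d)) (f.1 y u q) (sgnp P.toGrMod d p)) l) l' := by
    rw [comp_apply]
    refine splitSum_congr _ fun x y _ => ?_
    rw [splitSum_single_left, tensorT_nil]
    · rw [splitSum_hom]
      exact splitSum_congr _ fun u v _ => tensorAct_wd _ _ _ _ _
    · intro z w _ hz
      rw [tensorT_ne_nil f _ hz]; simp
  have hP : GrMod.eps d • splitSum (fun u v => tensorT P f l' [] (tw Q P u q (P.act v r p))) l =
      splitSum (fun u v => opP R P (r.map (rsp X d)) (tw R P) (v.map (rsp X d)) (f.1 l' u q)
        (sgnp P.toGrMod d p)) l := by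
    simp only [tensorT_nil, opP_apply, splitSum_map]
    rw [← splitSum_zsmul, ← splitSum_rot fun u a b => tw R P (a.map (rsp X d)) (f.1 l' u q)
      (P.act (b.map (rsp X d)) (r.map (rsp X d)) (sgnp P.toGrMod d p))]
    refine splitSum_congr _ fun c b _ => ?_
    rw [← splitSum_zsmul]
    refine splitSum_congr _ fun u a _ => ?_
    rw [sgnp_act, map_zsmul, smul_smul, GrMod.eps_mul_self, one_smul]
  rw [homD_eq, Pi.sub_apply, Pi.sub_apply, Pi.smul_apply, Pi.smul_apply, LinearMap.sub_apply,
    LinearMap.smul_apply, hact, bd_tensor]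
  by_cases hr : r = []
  · subst hr
    -- Without right letters, the structure maps of `R ⊗ P` are the boundary of the tautological map
    -- plus the terms with μ_P.
    have hA : ∀ x m v p, opT R P x [] (tw R P) v m p =
        bd (pairRight R P (P.sgn p)) x v m + if x = [] then opP R P [] (tw R P) v m p else 0 := by
      intro x m v p
      rw [bd_pairRight, opT, if_pos rfl, LinearMap.add_apply, LinearMap.add_apply,
        LinearMap.add_apply, LinearMap.add_apply, opQ_apply]
      congr 1
      · congr 1
        by_cases h : x = [] <;> simp [h, opA_eq_contr]
      · split_ifs <;> rfl
    have h1 : splitSum (fun x y => splitSum (fun u v => opT R P x ([].map (rsp X d)) (tw R P)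
        (v.map (rsp X d)) (f.1 y u q) (sgnp P.toGrMod d p)) l) l' =
        comp d (bd (pairRight R P (sgnp P.toGrMod (d + 1) p))) f.1 l' l q +
        splitSum (fun u v => opP R P [] (tw R P) (v.map (rsp X d)) (f.1 l' u q)
          (sgnp P.toGrMod d p)) l := by
      simp only [List.map_nil, hA, splitSum_add, comp_apply, sgnp_add_one, sgnp_sgn]
      congr 1
      rw [splitSum_single_left]
      · simp
      · intro x y _ hx
        simp [hx, splitSum_zero]
    have hbd := LinearMap.congr_fun (congrFun (congrFun (bd_comp
      (pairRight_multilin R (sgnp P.toGrMod (d + 1) p)) (hom_signDeg f.2)) l') l) q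
    have h2 : bd (comp d (pairRight R P (sgnp P.toGrMod (d + 1) p)) f.1) l' l q =
        splitSum (fun x y => splitSum (fun u v => tensorT P f x []
          (tw Q P (v.map X.rsgn) (Q.act y u q) (P.sgn p))) l) l' +
        contr A (fun l => tensorT P f l' [] (tw Q P l q (P.sgn p))) l +
        contr A (fun x => tensorT P f x [] (tw Q P (l.map X.rsgn) (Q.sgn q) (P.sgn p))) l' := by
      rw [bd_apply, bdA_apply, comp_apply (d := 1)]
      simp only [tensorT_eq_comp, sgnp_add_one, map_rsp_one, add_assoc]
    have h3 : splitSum (fun z w => splitSum (fun u v =>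
        tensorT P f l' (w.map X.rsgn) (tw Q P u q (P.act v z p))) l) [] =
        splitSum (fun u v => tensorT P f l' [] (tw Q P u q (P.act v [] p))) l := splitSum_nil _
    have h4 : contr A (fun r => tensorT P f l' r (tw Q P l q p)) [] = 0 := by
      rw [contr_nil, tensorT_ne_nil f _ (by simp)]; rfl
    rw [tensorT_eq_comp, ← hbd, h1, h3, h4]
    simp only [Pi.sub_apply, Pi.smul_apply, LinearMap.sub_apply, LinearMap.smul_apply, h2,
      List.map_nil, smul_add, hP, smul_zero] at hP ⊢
    abel
  -- When there are right letters only the terms with μ_P are left, and these cancel.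
  · have hr' : r.map (rsp X d) ≠ [] := by simpa using hr
    have hr'' : r.map X.rsgn ≠ [] := by simpa using hr
    have h1 : splitSum (fun x y => splitSum (fun u v => opT R P x (r.map (rsp X d)) (tw R P)
        (v.map (rsp X d)) (f.1 y u q) (sgnp P.toGrMod d p)) l) l' =
        splitSum (fun u v => opP R P (r.map (rsp X d)) (tw R P) (v.map (rsp X d)) (f.1 l' u q)
          (sgnp P.toGrMod d p)) l := by
      rw [splitSum_single_left]
      · simp only [opT_right hr']
      · intro x y _ hx
        refine splitSum_eq_zero fun u v _ => ?_
        rw [opT_zero hx hr']; rfl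
    have h2 : splitSum (fun z w => splitSum (fun u v =>
        tensorT P f l' (w.map X.rsgn) (tw Q P u q (P.act v z p))) l) r =
        splitSum (fun u v => tensorT P f l' [] (tw Q P u q (P.act v r p))) l := by
      rw [splitSum_single_right]
      · rfl
      · intro z w _ hw
        refine splitSum_eq_zero fun u v _ => ?_
        rw [tensorT_ne_nil f _ (by simpa using hw)]; rfl
    have h3 : contr A (fun r => tensorT P f l' r (tw Q P l q p)) r = 0 := by
      rw [contr_congr (g := fun _ => 0), contr_zero]
      intro x hx
      rw [tensorT_ne_nil f _ hx]; rfl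
    rw [h1, h2, h3, tensorT_ne_nil _ _ hr]
    simp only [tensorT_ne_nil f _ hr'', LinearMap.zero_apply, splitSum_zero, contr_zero, add_zero,
      zero_add, hP, sub_self]

/-- The universal map `(l, n) ↦ p ⊗ l ⊗ n`. -/
noncomputable def pairLeft (P R : ABimod A) (p : P.carrier) : BiFun R ((tensor P R).carrier) :=
  fun l r => if r = [] then tw P R l p else 0

theorem pairLeft_multilin (R : ABimod A) (p : P.carrier) : BiMultilin (pairLeft P R p) := by
  refine ⟨fun r => ?_, fun l => .of_ne_nil fun r hr => by simp [pairLeft, hr]⟩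
  by_cases hr : r = []
  · simp only [pairLeft, hr, if_true]
    exact .of_apply fun m => tw_comp LinearMap.id p m
  · have : (fun l => pairLeft P R p l r) = fun _ => 0 := funext fun l => by simp [pairLeft, hr]
    rw [this]; exact .zero

/-- The exponent e is arbitrary: the tautological map vanishes on nonempty right words, so there is
no letter to twist. -/
theorem comp_pairLeft (e : ℤ) (φ : PreHom Q R) (p : P.carrier) (l r : List X) (q : Q.carrier) :
    comp e (pairLeft P R p) φ l r q = splitSum (fun u v => tw P R u p (φ v r q)) l := by
  rw [comp_apply]
  refine splitSum_congr _ fun u v _ => ?_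
  rw [splitSum_single_right]
  · simp [pairLeft]
  · intro z w _ hw
    simp [pairLeft, hw]

theorem bd_pairLeft (p : P.carrier) (u w : List X) (n : R.carrier) :
    bd (pairLeft P R p) u w n =
      splitSum (fun x y => tw P R x p (R.act y w n)) u +
      if w = [] then contr A (fun u => tw P R u p (R.sgn n)) u else 0 := by
  rw [bd_apply, comp_pairLeft, bdA_apply]
  congr 1
  rw [contr_congr (l := w) (g := fun _ => 0), contr_zero, zero_add]
  · split_ifs with h
    · simp [pairLeft, h]
    · simp [pairLeft, h, contr_zero]
  · intro y hy
    simp [pairLeft, hy]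

theorem idT_mred (P : ABimod A) {Q R : ABimod A} {e : ℤ} (φ : hom Q R e) (r : List X) :
    (fun l => splitSum (fun u v => (tw P R u).compl₂ (φ.1 v r)) l) ∈
      MRed A (P.carrier →ₗ[K] Q.carrier →ₗ[K] (tensor P R).carrier) := by
  refine ⟨.of_apply fun p => .of_apply fun q => ?_, fun l hl => splitSum_eq_zero ?_⟩
  · simp only [splitSum_apply₂, LinearMap.compl₂_apply, ← comp_pairLeft 0]
    exact ((comp_multilin (pairLeft_multilin R _) (hom_multilin φ.2)).1 r).comp_lin
      (LinearMap.applyₗ q)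
  · rintro u v rfl
    refine LinearMap.ext fun p => LinearMap.ext fun q => ?_
    rcases List.mem_append.1 hl with h | h
    · rw [LinearMap.compl₂_apply, (tw_mred P R).2 u h]; rfl
    · rw [LinearMap.compl₂_apply, φ.2.2.2.1 v r (.inl h)]; simp

/-- The map `id_P ⊗ φ` induced by a map `φ` of degree `e`. -/
noncomputable def idT (P : ABimod A) {Q R : ABimod A} {e : ℤ} (φ : hom Q R e) :
    PreHom (tensor P Q) (tensor P R) := fun l' r =>
  if l' = [] then tLift ⟨_, idT_mred P φ r⟩ else 0

theorem idT_nil {e : ℤ} (φ : hom Q R e) (r l : List X) (p : P.carrier) (q : Q.carrier) :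
    idT P φ [] r (tw P Q l p q) = splitSum (fun u v => tw P R u p (φ.1 v r q)) l := by
  rw [idT, if_pos rfl]
  rw [tLift_tw]
  simp only [splitSum_apply₂, LinearMap.compl₂_apply]

theorem idT_ne_nil {e : ℤ} (φ : hom Q R e) {l' : List X} (r : List X) (hl : l' ≠ []) :
    idT P φ l' r = 0 := if_neg hl

theorem idT_eq_comp {e : ℤ} (d : ℤ) (φ : hom Q R e) (r l : List X) (p : P.carrier)
    (q : Q.carrier) : idT P φ [] r (tw P Q l p q) = comp d (pairLeft P R p) φ.1 l r q := by
  rw [idT_nil, comp_pairLeft]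

theorem idT_mem (P : ABimod A) {e : ℤ} (φ : hom Q R e) :
    idT P φ ∈ hom (tensor P Q) (tensor P R) e := by
  refine mem_hom_tensor (fun r l q p => ?_) (fun l' l q p => ?_) (fun l' r l q p h => ?_)
    fun l' m r n l d q i p j hl' hr hl hq hp => ?_
  · exact .of_ne_nil fun l' hl' => by rw [idT_ne_nil φ _ hl']; rfl
  · by_cases hl' : l' = []
    · subst hl'
      simp only [idT_eq_comp 0]
      exact ((comp_multilin (pairLeft_multilin R _) (hom_multilin φ.2)).2 l).comp_lin
        (LinearMap.applyₗ p)
    · simp only [idT_ne_nil φ _ hl']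
      exact .zero
  · by_cases hl' : l' = []
    · subst hl'
      rw [idT_nil]
      refine splitSum_eq_zero fun u v _ => ?_
      rw [φ.2.2.2.1 v r (.inr (by simpa using h))]; simp
    · rw [idT_ne_nil φ _ hl']; rfl
  · by_cases h : l' = []
    · subst h
      cases hl'
      rw [idT_nil]
      refine splitSum_mem fun u v huv => ?_
      subst huv
      obtain ⟨d₁, d₂, rfl, h₁, h₂⟩ := isHom_append hl
      refine tw_mem_gr hq h₁ (φ.2.2.2.2 _ _ _ _ _ _ h₂ hr hp) ?_
      simp; ring
    · rw [idT_ne_nil φ _ h]; exact zero_mem _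

/-- Mirror image of `homD_tensorT`. The terms with μ_Q, μ_R and μ_A come from `bd_comp` for
`pairLeft`; those with μ_P at the left end cancel, the sign being absorbed by `hom_signDeg`. -/
theorem homD_idT (P : ABimod A) {e : ℤ} (φ : hom Q R e) :
    homD (tensor P Q) (tensor P R) e (idT P φ) = idT P ⟨_, homD_mem φ.2⟩ := by
  refine biFun_tensor_ext fun l' r l p q => ?_
  have hact : comp e (tensor P R).act (idT P φ) l' r (tw P Q l p q) =
      splitSum (fun z w => splitSum (fun u v => opT P R l' (w.map (rsp X e)) (tw P R)
        u p (φ.1 v z q)) l) r := by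
    rw [comp_apply, splitSum_single_right]
    · refine splitSum_congr _ fun z w _ => ?_
      rw [idT_nil]
      rw [splitSum_hom]
      exact splitSum_congr _ fun u v _ => tensorAct_wd _ _ _ _ _
    · intro x y _ hy
      refine splitSum_eq_zero fun z w _ => ?_
      rw [idT_ne_nil φ _ hy]; simp
  have hQ : GrMod.eps e • splitSum (fun u v => idT P φ [] (r.map X.rsgn)
        (tw P Q (v.map X.rsgn) (P.act l' u p) (Q.sgn q))) l =
      splitSum (fun u v => opQ P R l' (tw P R) u p (φ.1 v r q)) l := by
    simp only [idT_nil, opQ_apply, splitSum_map]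
    rw [← splitSum_zsmul, splitSum_rot fun a b v => tw P R (b.map X.rsgn) (P.act l' a p)
      (R.sgn (φ.1 v r q))]
    refine splitSum_congr _ fun c b _ => ?_
    rw [← splitSum_zsmul]
    refine splitSum_congr _ fun u a _ => ?_
    rw [hom_signDeg φ.2, map_zsmul, smul_smul, GrMod.eps_mul_self, one_smul]
  rw [homD_eq, Pi.sub_apply, Pi.sub_apply, Pi.smul_apply, Pi.smul_apply, LinearMap.sub_apply,
    LinearMap.smul_apply, hact, bd_tensor]
  by_cases hl : l' = []
  · subst hl
    have hA : ∀ w u n, opT P R [] w (tw P R) u p n =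
        bd (pairLeft P R p) u w n + if w = [] then opQ P R [] (tw P R) u p n else 0 := by
      intro w u n
      rw [bd_pairLeft, opT, LinearMap.add_apply, LinearMap.add_apply,
        LinearMap.add_apply, LinearMap.add_apply, if_pos rfl, opP_apply]
      by_cases h : w = []
      · simp only [h, and_self, if_true, opA_eq_contr]; abel
      · simp [h]
    have h1 : splitSum (fun z w => splitSum (fun u v => opT P R [] (w.map (rsp X e)) (tw P R)
        u p (φ.1 v z q)) l) r = comp e (bd (pairLeft P R p)) φ.1 l r q +
        splitSum (fun u v => opQ P R [] (tw P R) u p (φ.1 v r q)) l := by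
      simp only [hA, splitSum_add, comp_apply]
      congr 1
      · rw [splitSum_comm]
      · rw [splitSum_single_right]
        · simp
        · intro z w _ hw
          simp [hw, splitSum_zero]
    have hbd := LinearMap.congr_fun (congrFun (congrFun (bd_comp
      (pairLeft_multilin R p) (hom_signDeg φ.2)) l) r) q
    have h2 : bd (comp e (pairLeft P R p) φ.1) l r q =
        splitSum (fun z w => splitSum (fun u v =>
          idT P φ [] (w.map X.rsgn) (tw P Q u p (Q.act v z q))) l) r +
        contr A (fun r => idT P φ [] r (tw P Q l p q)) r +
        contr A (fun l => idT P φ [] (r.map X.rsgn) (tw P Q l p (Q.sgn q))) l := by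
      rw [bd_apply, bdA_apply, comp_apply (d := 1), splitSum_comm]
      simp only [idT_eq_comp e, map_rsp_one, add_assoc]
    have h3 : splitSum (fun x y => splitSum (fun u v => idT P φ x (r.map X.rsgn)
        (tw P Q (v.map X.rsgn) (P.act y u p) (Q.sgn q))) l) [] =
        splitSum (fun u v => idT P φ [] (r.map X.rsgn)
          (tw P Q (v.map X.rsgn) (P.act [] u p) (Q.sgn q))) l := splitSum_nil _
    have h4 : contr A (fun x => idT P φ x (r.map X.rsgn)
        (tw P Q (l.map X.rsgn) (P.sgn p) (Q.sgn q))) [] = 0 := by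
      rw [contr_nil, idT_ne_nil φ _ (by simp)]; rfl
    rw [idT_eq_comp (e + 1), ← hbd, h1, h3, h4]
    simp only [Pi.sub_apply, Pi.smul_apply, LinearMap.sub_apply, LinearMap.smul_apply, h2,
      smul_add, hQ, smul_zero] at hQ ⊢
    abel
  · have h1 : splitSum (fun z w => splitSum (fun u v => opT P R l' (w.map (rsp X e)) (tw P R)
        u p (φ.1 v z q)) l) r = splitSum (fun u v => opQ P R l' (tw P R) u p (φ.1 v r q)) l := by
      rw [splitSum_single_right]
      · simp only [List.map_nil, opT_left hl]
      · intro z w _ hw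
        refine splitSum_eq_zero fun u v _ => ?_
        rw [opT_zero hl (by simpa using hw)]; rfl
    have h2 : splitSum (fun x y => splitSum (fun u v => idT P φ x (r.map X.rsgn)
        (tw P Q (v.map X.rsgn) (P.act y u p) (Q.sgn q))) l) l' =
        splitSum (fun u v => idT P φ [] (r.map X.rsgn)
          (tw P Q (v.map X.rsgn) (P.act l' u p) (Q.sgn q))) l := by
      rw [splitSum_single_left]
      intro x y _ hx
      refine splitSum_eq_zero fun u v _ => ?_
      rw [idT_ne_nil φ _ hx]; rfl
    have h3 : contr A (fun x => idT P φ x (r.map X.rsgn)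
        (tw P Q (l.map X.rsgn) (P.sgn p) (Q.sgn q))) l' = 0 := by
      rw [contr_congr (g := fun _ => 0), contr_zero]
      intro x hx
      rw [idT_ne_nil φ _ hx]; rfl
    rw [h1, h2, h3]
    simp only [idT_ne_nil _ _ hl, LinearMap.zero_apply, splitSum_zero, contr_zero, add_zero, hQ,
      sub_self]

end TensorMaps

/-! ### Functoriality of the tensor product. -/

section TensorFunctor

variable {K : Type u} [Field K] {X : GrMod K} {A : AInfStr X} {P Q R S M N : ABimod A}
  {Y : Type*} [AddCommGroup Y] [Module K Y]

theorem SignDeg.sgnp {f : PreHom P Q} (hf : SignDeg 0 f) (d : ℤ) (l r : List X) (p : P.carrier) :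
    f (l.map (rsp X d)) (r.map (rsp X d)) (sgnp P.toGrMod d p) = sgnp Q.toGrMod d (f l r p) := by
  by_cases hd : Even d
  · simp [sgnp_of_even _ hd, rsp_of_even X hd]
  · rw [sgnp_of_odd _ hd, rsp_of_odd X hd, sgnp_of_odd _ hd, hf]; simp

theorem sgnp_tw (d : ℤ) (l : List X) (q : Q.carrier) (p : P.carrier) :
    sgnp (tensor Q P).toGrMod d (tw Q P l q p) =
      tw Q P (l.map (rsp X d)) (sgnp Q.toGrMod d q) (sgnp P.toGrMod d p) := by
  by_cases hd : Even d
  · simp [sgnp_of_even _ hd, rsp_of_even X hd]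
  · rw [sgnp_of_odd _ hd, rsp_of_odd X hd, sgnp_of_odd _ hd, sgnp_of_odd _ hd, sgn_tw]

/-- The degrees have to agree because f ⊗ id twists everything to its right by the degree of f.
There is no such sign in id ⊗ φ. -/
theorem tensorT_congr {d d' : ℤ} (f : hom Q R d) (g : hom Q R d') (hd : d = d')
    (h : f.1 = g.1) : tensorT P f = tensorT P g := by
  subst hd
  rw [Subtype.ext h]

theorem idT_congr {d d' : ℤ} (f : hom Q R d) (g : hom Q R d')
    (h : f.1 = g.1) : idT P f = idT P g := by
  obtain ⟨f, hf⟩ := f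
  obtain ⟨g, hg⟩ := g
  subst h
  rfl

theorem tensorT_add {d : ℤ} (f g : hom Q R d) :
    tensorT P (f + g) = tensorT P f + tensorT P g := by
  refine biFun_tensor_ext fun l' r l q p => ?_
  by_cases hr : r = []
  · subst hr
    simp only [Pi.add_apply, LinearMap.add_apply, tensorT_nil, ← splitSum_add, Submodule.coe_add,
      map_add]
  · simp only [Pi.add_apply, tensorT_ne_nil _ _ hr, add_zero]

theorem tensorT_smul {d : ℤ} (c : K) (f : hom Q R d) :
    tensorT P (c • f) = c • tensorT P f := by
  refine biFun_tensor_ext fun l' r l q p => ?_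
  by_cases hr : r = []
  · subst hr
    simp only [Pi.smul_apply, LinearMap.smul_apply, tensorT_nil, ← splitSum_smul,
      Submodule.coe_smul, map_smul]
  · simp only [Pi.smul_apply, tensorT_ne_nil _ _ hr, smul_zero]

theorem idT_add {d : ℤ} (f g : hom Q R d) : idT P (f + g) = idT P f + idT P g := by
  refine biFun_tensor_ext fun l' r l q p => ?_
  by_cases hl : l' = []
  · subst hl
    simp only [Pi.add_apply, LinearMap.add_apply, idT_nil, ← splitSum_add, Submodule.coe_add,
      map_add]
  · simp only [Pi.add_apply, idT_ne_nil _ _ hl, add_zero]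

theorem idT_smul {d : ℤ} (c : K) (f : hom Q R d) : idT P (c • f) = c • idT P f := by
  refine biFun_tensor_ext fun l' r l q p => ?_
  by_cases hl : l' = []
  · subst hl
    simp only [Pi.smul_apply, LinearMap.smul_apply, idT_nil, ← splitSum_smul,
      Submodule.coe_smul, map_smul]
  · simp only [Pi.smul_apply, idT_ne_nil _ _ hl, smul_zero]

/-- The linear map `f ↦ f ⊗ id_P`. -/
noncomputable def tensorTL (P Q R : ABimod A) (d : ℤ) :
    hom Q R d →ₗ[K] PreHom (tensor Q P) (tensor R P) where
  toFun f := tensorT P f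
  map_add' := tensorT_add
  map_smul' := tensorT_smul

/-- The linear map `φ ↦ id_P ⊗ φ`. -/
noncomputable def idTL (P Q R : ABimod A) (d : ℤ) :
    hom Q R d →ₗ[K] PreHom (tensor P Q) (tensor P R) where
  toFun f := idT P f
  map_add' := idT_add
  map_smul' := idT_smul

theorem tensorT_sub {d : ℤ} (f g : hom Q R d) :
    tensorT P (f - g) = tensorT P f - tensorT P g := map_sub (tensorTL P Q R d) f g

theorem idT_sub {d : ℤ} (f g : hom Q R d) :
    idT P (f - g) = idT P f - idT P g := map_sub (idTL P Q R d) f g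

theorem tensorT_zero {d : ℤ} : tensorT P (0 : hom Q R d) = 0 := map_zero (tensorTL P Q R d)

theorem idT_zero {d : ℤ} : idT P (0 : hom Q R d) = 0 := map_zero (idTL P Q R d)

theorem tensorT_mem_cocycles (P : ABimod A) {d : ℤ} {f : PreHom Q R} (hf : f ∈ cocycles Q R d) :
    tensorT P (⟨f, hf.1⟩ : hom Q R d) ∈ cocycles (tensor Q P) (tensor R P) d := by
  refine ⟨tensorT_mem P _, LinearMap.mem_ker.2 ?_⟩
  rw [homD_tensorT, ← tensorT_zero (P := P) (d := d + 1)]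
  exact congrArg _ (Subtype.ext hf.2)

theorem idT_mem_cocycles (P : ABimod A) {d : ℤ} {f : PreHom Q R} (hf : f ∈ cocycles Q R d) :
    idT P (⟨f, hf.1⟩ : hom Q R d) ∈ cocycles (tensor P Q) (tensor P R) d := by
  refine ⟨idT_mem P _, LinearMap.mem_ker.2 ?_⟩
  rw [homD_idT, ← idT_zero (P := P) (d := d + 1)]
  exact congrArg _ (Subtype.ext hf.2)

theorem tensorT_coboundary (P : ABimod A) {d : ℤ} (f : hom Q R d)
    (hf : f.1 ∈ coboundaries Q R d) :
    tensorT P f ∈ coboundaries (tensor Q P) (tensor R P) d := by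
  obtain ⟨h, hh, e⟩ := hf
  refine ⟨tensorT P ⟨h, hh⟩, tensorT_mem P _, ?_⟩
  rw [homD_tensorT]
  exact tensorT_congr _ _ (by omega) e

theorem idT_coboundary (P : ABimod A) {d : ℤ} (f : hom Q R d)
    (hf : f.1 ∈ coboundaries Q R d) :
    idT P f ∈ coboundaries (tensor P Q) (tensor P R) d := by
  obtain ⟨h, hh, e⟩ := hf
  refine ⟨idT P ⟨h, hh⟩, idT_mem P _, ?_⟩
  rw [homD_idT]
  exact idT_congr _ _ e

theorem idT_comp (P : ABimod A) (g : hom R S 0) (f : hom Q R 0) (h : comp 0 g.1 f.1 ∈ hom Q S 0) :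
    comp 0 (idT P g) (idT P f) = idT P (⟨_, h⟩ : hom Q S 0) := by
  refine biFun_tensor_ext fun l' r l p q => ?_
  rw [comp_apply]
  by_cases hl : l' = []
  · subst hl
    simp only [splitSum_nil, idT_nil, map_rsp_zero, splitSum_hom, comp_apply]
    rw [splitSum_comm fun z w u v => splitSum (fun a b => tw P S a p (g.1 b w (f.1 v z q))) u]
    refine Eq.trans (splitSum_congr _ fun u v _ => splitSum_comm (fun z w a b =>
      tw P S a p (g.1 b w (f.1 v z q))) r u) ?_
    exact splitSum_assoc (fun a b v => splitSum (fun z w => tw P S a p (g.1 b w (f.1 v z q))) r) l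
  · rw [idT_ne_nil _ _ hl]
    refine splitSum_eq_zero fun x y hxy => splitSum_eq_zero fun z w _ => ?_
    by_cases hy : y = []
    · rw [idT_ne_nil g _ (by rintro rfl; simp [hy] at hxy; exact hl hxy)]; rfl
    · rw [idT_ne_nil f _ hy]; simp

theorem idT_idHom (P Q : ABimod A) :
    idT P (⟨idHom Q, (idHom_mem Q).1⟩ : hom Q Q 0) = idHom (tensor P Q) := by
  refine biFun_tensor_ext fun l' r l p q => ?_
  by_cases hl : l' = []
  · subst hl
    rw [idT_nil, splitSum_single_right]
    · by_cases hr : r = []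
      · subst hr; simp [idHom, strictHom_nil]
      · simp [idHom, strictHom_zero, hr]
    · intro u v _ hv
      simp [idHom, strictHom_zero, hv]
  · simp [idT_ne_nil, idHom, strictHom_zero, hl]

theorem idT_htpy_id (P : ABimod A) {f : PreHom Q R} {g : PreHom R Q} (hf : f ∈ cocycles Q R 0)
    (hg : g ∈ cocycles R Q 0) (h : Htpy 0 (comp 0 f g) (idHom R)) :
    Htpy 0 (comp 0 (idT P (⟨f, hf.1⟩ : hom Q R 0)) (idT P (⟨g, hg.1⟩ : hom R Q 0)))
      (idHom (tensor P R)) := by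
  have hm := (comp_mem_cocycles hf hg (n := 0) rfl).1
  have e := idT_comp P (⟨f, hf.1⟩ : hom Q R 0) (⟨g, hg.1⟩ : hom R Q 0) hm
  rw [e, ← idT_idHom, Htpy, ← idT_sub]
  exact idT_coboundary P _ h

theorem isHtpyEquiv_idT (P : ABimod A) {f : PreHom Q R} (hf : IsHtpyEquiv f) :
    IsHtpyEquiv (idT P (⟨f, hf.1.1⟩ : hom Q R 0)) := by
  obtain ⟨hf, g, hg, h1, h2⟩ := hf
  exact ⟨idT_mem_cocycles P hf, idT P (⟨g, hg.1⟩ : hom R Q 0), idT_mem_cocycles P hg,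
    idT_htpy_id P hf hg h1, idT_htpy_id P hg hf h2⟩

/-- The two maps act at opposite ends of the word, so either composite cuts it into three parts. No
sign arises from the exchange because φ has degree zero. -/
theorem idT_tensorT_comm {j : ℤ} (φ : hom P S 0) (f : hom Q R j) :
    comp j (idT R φ) (tensorT P f) = comp 0 (tensorT S f) (idT Q φ) := by
  refine biFun_tensor_ext fun l' r l q p => ?_
  have hL : comp j (idT R φ) (tensorT P f) l' r (tw Q P l q p) =
      idT R φ [] (r.map (rsp X j)) (tensorT P f l' [] (tw Q P l q p)) := by
    rw [comp_apply, splitSum_single_left, splitSum_single_left]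
    · intro z w _ hz
      rw [tensorT_ne_nil f _ hz]; simp
    · intro x y _ hx
      refine splitSum_eq_zero fun z w _ => ?_
      rw [idT_ne_nil φ _ hx]; simp
  have hR : comp 0 (tensorT S f) (idT Q φ) l' r (tw Q P l q p) =
      tensorT S f l' [] (idT Q φ [] r (tw Q P l q p)) := by
    rw [comp_apply, splitSum_single_right, splitSum_single_right]
    · simp
    · intro z w _ hw
      rw [tensorT_ne_nil f _ (by simpa using hw)]; simp
    · intro x y _ hy
      refine splitSum_eq_zero fun z w _ => ?_
      rw [idT_ne_nil φ _ hy]; simp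
  rw [hL, hR]
  simp only [tensorT_nil, idT_nil, splitSum_hom, splitSum_map, (hom_signDeg φ.2).sgnp]
  exact (splitSum_assoc (fun u a b => tw R S (a.map (rsp X j)) (f.1 l' u q)
    (sgnp S.toGrMod j (φ.1 b r p))) l).symm

end TensorFunctor

/-! ### Associativity of the tensor product. -/

section Associator

variable {K : Type u} [Field K] {X : GrMod K} {A : AInfStr X} {P Q R S M N : ABimod A}

/-- The associativity isomorphism of the tensor product of bimodules. -/
noncomputable def assocEquiv (Q P R : ABimod A) :
    (tensor (tensor Q P) R).carrier ≃ₗ[K] (tensor Q (tensor P R)).carrier :=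
  (TensorProduct.assoc K Q.carrier (TensorProduct K (BarT A) P.carrier)
    (TensorProduct K (BarT A) R.carrier)).trans
    (TensorProduct.congr (LinearEquiv.refl K Q.carrier) (TensorProduct.assoc K (BarT A) P.carrier
      (TensorProduct K (BarT A) R.carrier)))

theorem assocEquiv_mem {n : ℤ} {y : (tensor (tensor Q P) R).carrier}
    (hy : y ∈ (tensor (tensor Q P) R).gr n) :
    assocEquiv Q P R y ∈ (tensor Q (tensor P R)).gr n := by
  refine tw_gr_le (F := (assocEquiv Q P R).toLinearMap) (fun i e j m' z x hz hm' hx hn => ?_) hy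
  refine tw_gr_le (F := (assocEquiv Q P R).toLinearMap ∘ₗ (tw (tensor Q P) R m').flip x)
    (fun i' e' j' m q p hq hm hp hi => ?_) hz
  exact tw_mem_gr hq hm (tw_mem_gr hp hm' hx rfl) (by omega)

theorem assocEquiv_symm_mem {n : ℤ} {y : (tensor Q (tensor P R)).carrier}
    (hy : y ∈ (tensor Q (tensor P R)).gr n) :
    (assocEquiv Q P R).symm y ∈ (tensor (tensor Q P) R).gr n := by
  refine tw_gr_le (F := (assocEquiv Q P R).symm.toLinearMap)
    (fun i e j m q z hq hm hz hn => ?_) hy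
  refine tw_gr_le (F := (assocEquiv Q P R).symm.toLinearMap ∘ₗ (tw Q (tensor P R) m q))
    (fun i' e' j' m' p x hp hm' hx hi => ?_) hz
  exact tw_mem_gr (tw_mem_gr hq hm hp rfl) hm' hx (by omega)

/-- On q ⊗ m ⊗ p ⊗ m' ⊗ x both bracketings have the same terms: μ_Q at the left end, μ_R at the
right end, contractions inside m and inside m', and μ_P acting on p with letters from m and m'. -/
theorem assocEquiv_act (l' r : List X) (y : (tensor (tensor Q P) R).carrier) :
    assocEquiv Q P R ((tensor (tensor Q P) R).act l' r y) =
      (tensor Q (tensor P R)).act l' r (assocEquiv Q P R y) := by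
  have key : (assocEquiv Q P R).toLinearMap ∘ₗ (tensor (tensor Q P) R).act l' r =
      (tensor Q (tensor P R)).act l' r ∘ₗ (assocEquiv Q P R).toLinearMap := by
    refine tw_ext fun m' z x => ?_
    suffices h : ((assocEquiv Q P R).toLinearMap ∘ₗ (tensor (tensor Q P) R).act l' r) ∘ₗ
        (tw (tensor Q P) R m').flip x = ((tensor Q (tensor P R)).act l' r ∘ₗ
        (assocEquiv Q P R).toLinearMap) ∘ₗ (tw (tensor Q P) R m').flip x from
      LinearMap.congr_fun h z
    refine tw_ext fun m q p => ?_
    change (assocEquiv Q P R).toLinearMap ((tensor (tensor Q P) R).act l' r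
      (tw (tensor Q P) R m' (tw Q P m q p) x)) =
      (tensor Q (tensor P R)).act l' r (tw Q (tensor P R) m q (tw P R m' p x))
    have e1 : ∀ u v x, (assocEquiv Q P R).toLinearMap (tw (tensor Q P) R v
        ((tensor Q P).act l' u (tw Q P m q p)) x) =
        (if u = [] then splitSum (fun a b => tw Q (tensor P R) (b.map X.rsgn) (Q.act l' a q)
          (tw P R v (P.sgn p) x)) m else 0) +
        (if u = [] then if l' = [] then
          contr A (fun m => tw Q (tensor P R) m q (tw P R v (P.sgn p) x)) m else 0 else 0) +
        (if l' = [] then splitSum (fun a b => tw Q (tensor P R) a q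
          (tw P R v (P.act b u p) x)) m else 0) := fun u v x => by
      rw [act_tw]
      refine (map_opT ((assocEquiv Q P R).toLinearMap ∘ₗ (tw (tensor Q P) R v).flip x)
        l' u (tw Q P) m q p).trans ?_
      simp only [← ite_and, and_comm (a := u = [])]
      rfl
    have e2 : ∀ a b, tw Q (tensor P R) a q ((tensor P R).act b r (tw P R m' p x)) =
        (if r = [] then splitSum (fun u v => tw Q (tensor P R) a q
          (tw P R (v.map X.rsgn) (P.act b u p) (R.sgn x))) m' else 0) +
        (if b = [] then if r = [] then
          contr A (fun m' => tw Q (tensor P R) a q (tw P R m' p (R.sgn x))) m' else 0 else 0) +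
        (if b = [] then splitSum (fun u v => tw Q (tensor P R) a q
          (tw P R u p (R.act v r x))) m' else 0) := fun a b => by
      rw [act_tw]
      refine (map_opT (tw Q (tensor P R) a q) b r (tw P R) m' p x).trans ?_
      simp only [← ite_and]
    rw [act_tw, act_tw]
    refine (map_opT (assocEquiv Q P R).toLinearMap l' r (tw (tensor Q P) R) m' (tw Q P m q p)
      x).trans (Eq.trans ?_ (map_opT LinearMap.id l' r (tw Q (tensor P R)) m q
        (tw P R m' p x)).symm)
    simp only [e1, LinearMap.id_apply, e2, splitSum_add, sgn_tw]
    have h1 := splitSum_ite_left (fun v => splitSum (fun a b => tw Q (tensor P R) (b.map X.rsgn)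
      (Q.act l' a q) (tw P R (v.map X.rsgn) (P.sgn p) (R.sgn x))) m) m'
    have h2 := splitSum_ite_left (fun v => if l' = [] then contr A (fun m =>
      tw Q (tensor P R) m q (tw P R (v.map X.rsgn) (P.sgn p) (R.sgn x))) m else 0) m'
    have h3 := splitSum_ite_right (fun a => if r = [] then contr A (fun m' =>
      tw Q (tensor P R) a q (tw P R m' p (R.sgn x))) m' else 0) m
    have h4 := splitSum_ite_right (fun a => splitSum (fun u v =>
      tw Q (tensor P R) a q (tw P R u p (R.act v r x))) m') m
    rw [h1, h2, h3, h4]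
    -- The terms with μ_P in the middle come from the structure maps of `Q ⊗ P` for one bracketing
    -- and from those of `P ⊗ R` for the other, with the sums over cuts of m and m' in opposite
    -- order.
    have h5 := splitSum_comm (fun u v a b => tw Q (tensor P R) a q
      (tw P R (v.map X.rsgn) (P.act b u p) (R.sgn x))) m' m
    by_cases hl : l' = [] <;> by_cases hr : r = []
    · simp only [hl, hr, if_true, and_self, h5]
      have h6 : contr A (fun l => (assocEquiv Q P R).toLinearMap (tw (tensor Q P) R l
        (tw Q P m q p) (R.sgn x))) m' = contr A (fun m' =>
        tw Q (tensor P R) m q (tw P R m' p (R.sgn x))) m' := rfl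
      have h7 : splitSum (fun u v => (assocEquiv Q P R).toLinearMap (tw (tensor Q P) R u
        (tw Q P m q p) (R.act v [] x))) m' = splitSum (fun u v =>
        tw Q (tensor P R) m q (tw P R u p (R.act v [] x))) m' := rfl
      rw [h6, h7]
      abel
    · simp only [hl, hr, if_true, if_false, and_false, splitSum_zero, add_zero, zero_add]
      rfl
    · simp only [hl, hr, if_true, if_false, and_true, splitSum_zero, add_zero, zero_add]
    · simp only [hl, hr, if_false, and_false, splitSum_zero, add_zero]
  exact LinearMap.congr_fun key y

/-- The associativity isomorphism as a bimodule map. -/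
noncomputable def assocHom (Q P R : ABimod A) :
    PreHom (tensor (tensor Q P) R) (tensor Q (tensor P R)) :=
  strictHom (assocEquiv Q P R).toLinearMap

/-- The inverse of the associativity isomorphism as a bimodule map. -/
noncomputable def assocInv (Q P R : ABimod A) :
    PreHom (tensor Q (tensor P R)) (tensor (tensor Q P) R) :=
  strictHom (assocEquiv Q P R).symm.toLinearMap

theorem assocHom_mem (Q P R : ABimod A) :
    assocHom Q P R ∈ cocycles (tensor (tensor Q P) R) (tensor Q (tensor P R)) 0 :=
  strictHom_mem_cocycles (fun _ _ h => assocEquiv_mem h) fun l r y => assocEquiv_act l r y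

theorem assocInv_mem (Q P R : ABimod A) :
    assocInv Q P R ∈ cocycles (tensor Q (tensor P R)) (tensor (tensor Q P) R) 0 :=
  strictHom_mem_cocycles (fun _ _ h => assocEquiv_symm_mem h) fun l r y =>
    (LinearEquiv.symm_apply_eq _).2 (by
      rw [assocEquiv_act]; exact congrArg _ ((assocEquiv Q P R).apply_symm_apply y).symm)

theorem isHtpyEquiv_assocHom (Q P R : ABimod A) : IsHtpyEquiv (assocHom Q P R) :=
  .strict (assocHom_mem Q P R) (assocInv_mem Q P R) (LinearEquiv.comp_symm _)
    (LinearEquiv.symm_comp _)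

theorem isHtpyEquiv_assocInv (Q P R : ABimod A) : IsHtpyEquiv (assocInv Q P R) :=
  .strict (assocInv_mem Q P R) (assocHom_mem Q P R) (LinearEquiv.symm_comp _)
    (LinearEquiv.comp_symm _)

/-- In both composites f is applied to q and the letters next to it; the twist of everything to the
right is distributed over the factors by `sgnp_tw`. -/
theorem assocHom_tensorT {j : ℤ} (f : hom Q M j) :
    comp j (assocHom M P R) (tensorT R (⟨_, tensorT_mem P f⟩ : hom _ _ j)) =
      comp 0 (tensorT (tensor P R) f) (assocHom Q P R) := by
  refine biFun_tensor_ext fun l' r m' z x => ?_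
  rw [assocHom, assocHom, comp_strictHom, strictHom_comp, map_rsp_zero]
  by_cases hr : r = []
  · subst hr
    suffices h : (assocEquiv M P R).toLinearMap ∘ₗ (tensorT R (⟨_, tensorT_mem P f⟩ : hom _ _ j)
        l' []) ∘ₗ (tw (tensor Q P) R m').flip x =
        (tensorT (tensor P R) f l' [] ∘ₗ (assocEquiv Q P R).toLinearMap) ∘ₗ
          (tw (tensor Q P) R m').flip x from LinearMap.congr_fun h z
    refine tw_ext fun m q p => ?_
    change (assocEquiv M P R).toLinearMap (tensorT R (⟨_, tensorT_mem P f⟩ : hom _ _ j)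
        l' [] (tw (tensor Q P) R m' (tw Q P m q p) x)) =
      tensorT (tensor P R) f l' [] (tw Q (tensor P R) m q (tw P R m' p x))
    rw [tensorT_nil, tensorT_nil, splitSum_single_left]
    · refine (congrArg (fun y => (assocEquiv M P R).toLinearMap (tw (tensor M P) R
        (m'.map (rsp X j)) y (sgnp R.toGrMod j x))) (tensorT_nil f l' m q p)).trans ?_
      refine (splitSum_hom ((assocEquiv M P R).toLinearMap ∘ₗ (tw (tensor M P) R
        (m'.map (rsp X j))).flip (sgnp R.toGrMod j x)) _ _).trans ?_
      refine splitSum_congr _ fun u v _ => ?_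
      rw [sgnp_tw]
      rfl
    · intro u v _ hu
      change tw (tensor M P) R (v.map (rsp X j)) (tensorT P f l' u (tw Q P m q p)) _ = 0
      rw [tensorT_ne_nil f _ hu]; simp
  · simp [tensorT_ne_nil _ _ hr]

end Associator

/-! ### The unit equivalences P ⊗ A ≃ P and A ⊗ P ≃ P. -/

section Units

variable {K : Type u} [Field K] {X : GrMod K} {A : AInfStr X} {P Q R S M N : ABimod A}
  {Y : Type*} [AddCommGroup Y] [Module K Y]

/-- In degree zero the sign twists in `tensorT` are trivial. -/
theorem tensorId_eq (P : ABimod A) (φ : hom Q R 0) : tensorId P φ = tensorT P φ := by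
  have h : ∀ l', (fun l => splitSum (fun u v => (wd R P v) ∘ₗ (φ.1 l' u)) l) = fun l =>
      splitSum (fun u v => (tw R P (v.map (rsp X 0))).compl₁₂ (φ.1 l' u) (sgnp P.toGrMod 0)) l :=
    fun l' => funext fun l => splitSum_congr l fun u v _ => by
      rw [map_rsp_zero, sgnp_zero]; rfl
  funext l' r
  change (if r = [] then tLift ⟨_, tensorId_mem P φ l'⟩ else 0) = _
  simp only [tensorT]
  by_cases hr : r = []
  · rw [if_pos hr, if_pos hr]
    congr 1
    exact Subtype.ext (h l')
  · rw [if_neg hr, if_neg hr]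
    rfl

theorem diag_act (A : AInfStr X) (l r : List X) (a : X) :
    (diag A).act l r a = -A.μ (l ++ a :: r.map X.rsgn) := rfl

theorem IsMultilin.rsgn_mid {f : List X → Y} (hf : IsMultilin K f) (u v : List X) (a : X) :
    f (u ++ X.rsgn a :: v) = -f (u ++ X.sgn a :: v) := hf.neg_mid u v _

/-- The data of a deformation retraction: the chain map s splits the linear part of φ, and k is a
homotopy between s ∘ φ and the identity. -/
theorem isQuasiIso_of_contraction {φ : PreHom P Q} (hφ : φ ∈ cocycles P Q 0)
    {s : Q.carrier → P.carrier} {k : P.carrier →ₗ[K] P.carrier}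
    (hs : ∀ q, φ [] [] (s q) = q) (hd : ∀ q, P.act [] [] (s q) = s (Q.act [] [] q))
    (hs0 : s 0 = 0)
    (hk : ∀ p, P.act [] [] (k p) + k (P.act [] [] p) = s (φ [] [] p) - p) : IsQuasiIso φ := by
  refine ⟨hφ, fun p hp => ?_, fun q hq => ⟨s q, 0, by rw [hd, hq, hs0], by rw [hs, map_zero, add_zero]⟩⟩
  rintro ⟨q, hq⟩
  refine ⟨s q - k p, ?_⟩
  have h := hk p
  rw [hp, map_zero, add_zero] at h
  rw [map_sub, h, hd, hq]
  abel

theorem splitSum_append_singleton {α M : Type*} [AddCommMonoid M] (f : List α → List α → M)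
    (l : List α) (a : α) :
    splitSum f (l ++ [a]) = splitSum (fun u v => f u (v ++ [a])) l + f (l ++ [a]) [] := by
  rw [splitSum_append_cons, splitSum_nil]

/-- The word `q ⊗ l ⊗ a` in `Q ⊗_A A`. -/
noncomputable def twR (Q : ABimod A) (l : List X) :
    Q.carrier →ₗ[K] X →ₗ[K] (tensor Q (diag A)).carrier := tw Q (diag A) l

/-- The word `a ⊗ l ⊗ p` in `A ⊗_A P`. -/
noncomputable def twL (P : ABimod A) (l : List X) :
    X →ₗ[K] P.carrier →ₗ[K] (tensor (diag A) P).carrier := tw (diag A) P l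

theorem twR_ext {F G : (tensor Q (diag A)).carrier →ₗ[K] Y}
    (h : ∀ l q a, F (twR Q l q a) = G (twR Q l q a)) : F = G := tw_ext h

theorem twL_ext {F G : (tensor (diag A) P).carrier →ₗ[K] Y}
    (h : ∀ l a p, F (twL P l a p) = G (twL P l a p)) : F = G := tw_ext h

theorem twR_biFun_ext {F G : BiFun (tensor Q (diag A)) Y}
    (h : ∀ l' r l q a, F l' r (twR Q l q a) = G l' r (twR Q l q a)) : F = G := biFun_tensor_ext h

theorem twL_biFun_ext {F G : BiFun (tensor (diag A) P) Y}
    (h : ∀ l' r l a p, F l' r (twL P l a p) = G l' r (twL P l a p)) : F = G := biFun_tensor_ext h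

theorem twR_multilin (q : Q.carrier) (a : X) : IsMultilin K fun l => twR Q l q a :=
  tw_comp (Q := Q) (P := diag A) LinearMap.id q a

theorem twL_multilin (a : X) (p : P.carrier) : IsMultilin K fun l => twL P l a p :=
  tw_comp (Q := diag A) (P := P) LinearMap.id a p

theorem twR_zero {l : List X} (h : A.one ∈ l) : twR Q l = 0 := (tw_mred Q (diag A)).2 l h

theorem twL_zero {l : List X} (h : A.one ∈ l) : twL P l = 0 := (tw_mred (diag A) P).2 l h

theorem mem_hom_twR {F : PreHom (tensor Q (diag A)) N} {d : ℤ}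
    (h₁ : ∀ r l q a, IsMultilin K fun l' => F l' r (twR Q l q a))
    (h₂ : ∀ l' l q a, IsMultilin K fun r => F l' r (twR Q l q a))
    (h₃ : ∀ l' r l q a, A.one ∈ l' ∨ A.one ∈ r → F l' r (twR Q l q a) = 0)
    (h₄ : ∀ l' m r n l e q i (a : X) j, X.IsHom l' m → X.IsHom r n → X.IsHom l e → q ∈ Q.gr i →
      a ∈ X.gr j → F l' r (twR Q l q a) ∈
        N.gr (GrMod.rdeg m + (i + GrMod.rdeg e + j) + GrMod.rdeg n + d)) :
    F ∈ hom (tensor Q (diag A)) N d := mem_hom_tensor h₁ h₂ h₃ h₄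

theorem mem_hom_twL {F : PreHom (tensor (diag A) P) N} {d : ℤ}
    (h₁ : ∀ r l a p, IsMultilin K fun l' => F l' r (twL P l a p))
    (h₂ : ∀ l' l a p, IsMultilin K fun r => F l' r (twL P l a p))
    (h₃ : ∀ l' r l a p, A.one ∈ l' ∨ A.one ∈ r → F l' r (twL P l a p) = 0)
    (h₄ : ∀ l' m r n l e (a : X) i p j, X.IsHom l' m → X.IsHom r n → X.IsHom l e → a ∈ X.gr i →
      p ∈ P.gr j → F l' r (twL P l a p) ∈
        N.gr (GrMod.rdeg m + (i + GrMod.rdeg e + j) + GrMod.rdeg n + d)) :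
    F ∈ hom (tensor (diag A) P) N d := mem_hom_tensor h₁ h₂ h₃ h₄

theorem bd_twR (F : BiFun (tensor Q (diag A)) Y) (l' r l : List X) (q : Q.carrier) (a : X) :
    bd F l' r (twR Q l q a) =
      splitSum (fun x y => splitSum (fun u v =>
        F x (r.map X.rsgn) (twR Q (v.map X.rsgn) (Q.act y u q) (X.sgn a))) l) l' +
      contr A (fun l => F l' (r.map X.rsgn) (twR Q l q (X.sgn a))) l +
      splitSum (fun z w => splitSum (fun u v =>
        F l' (w.map X.rsgn) (twR Q u q (-A.μ (v ++ a :: z.map X.rsgn)))) l) r +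
      contr A (fun r => F l' r (twR Q l q a)) r +
      contr A (fun x => F x (r.map X.rsgn) (twR Q (l.map X.rsgn) (Q.sgn q) (X.sgn a))) l' :=
  bd_tensor (P := diag A) F l' r l q a

theorem bd_twL (F : BiFun (tensor (diag A) P) Y) (l' r l : List X) (a : X) (p : P.carrier) :
    bd F l' r (twL P l a p) =
      splitSum (fun x y => splitSum (fun u v =>
        F x (r.map X.rsgn) (twL P (v.map X.rsgn) (-A.μ (y ++ a :: u.map X.rsgn)) (P.sgn p))) l) l' +
      contr A (fun l => F l' (r.map X.rsgn) (twL P l a (P.sgn p))) l +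
      splitSum (fun z w => splitSum (fun u v =>
        F l' (w.map X.rsgn) (twL P u a (P.act v z p))) l) r +
      contr A (fun r => F l' r (twL P l a p)) r +
      contr A (fun x => F x (r.map X.rsgn) (twL P (l.map X.rsgn) (X.sgn a) (P.sgn p))) l' :=
  bd_tensor (Q := diag A) F l' r l a p

theorem act_nil_tw (l : List X) (q : Q.carrier) (p : P.carrier) :
    (tensor Q P).act [] [] (tw Q P l q p) =
      splitSum (fun u v => tw Q P (v.map X.rsgn) (Q.act [] u q) (P.sgn p)) l +
      contr A (fun l => tw Q P l q (P.sgn p)) l +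
      splitSum (fun u v => tw Q P u q (P.act v [] p)) l := by
  rw [act_tw]
  simpa using map_opT LinearMap.id [] [] (tw Q P) l q p

theorem act_nil_twR (l : List X) (q : Q.carrier) (a : X) :
    (tensor Q (diag A)).act [] [] (twR Q l q a) =
      splitSum (fun u v => twR Q (v.map X.rsgn) (Q.act [] u q) (X.sgn a)) l +
      contr A (fun l => twR Q l q (X.sgn a)) l +
      splitSum (fun u v => twR Q u q (-A.μ (v ++ [a]))) l :=
  act_nil_tw (P := diag A) l q a

theorem act_nil_twL (l : List X) (a : X) (p : P.carrier) :
    (tensor (diag A) P).act [] [] (twL P l a p) =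
      splitSum (fun u v => twL P (v.map X.rsgn) (-A.μ (a :: u.map X.rsgn)) (P.sgn p)) l +
      contr A (fun l => twL P l a (P.sgn p)) l +
      splitSum (fun u v => twL P u a (P.act v [] p)) l :=
  act_nil_tw (Q := diag A) l a p

theorem tensorT_twR {d : ℤ} (f : hom Q R d) (l' l : List X) (q : Q.carrier) (a : X) :
    tensorT (diag A) f l' [] (twR Q l q a) = splitSum (fun u v =>
      twR R (v.map (rsp X d)) (f.1 l' u q) (sgnp X d a)) l :=
  tensorT_nil (P := diag A) f l' l q a

theorem rightUnit_tw (Q : ABimod A) (l' r l : List X) (q : Q.carrier) (a : X) :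
    rightUnit Q l' r (twR Q l q a) = Q.act l' (l ++ a :: r.map X.rsgn) q :=
  tensorLift_wd (Q := Q) (P := diag A) _ l q a

theorem leftUnit_tw (P : ABimod A) (l' r l : List X) (a : X) (p : P.carrier) :
    leftUnit P l' r (twL P l a p) =
      -P.act (l' ++ a :: l.map X.rsgn) (r.map X.rsgn) (P.sgn p) :=
  tensorLift_wd (Q := diag A) (P := P) _ l a p

/-- Evaluating f on the longer word (l, a, r) turns the differential of `Q ⊗ A` into minus that of Q
on the longer word, except for the terms in which μ_Q consumes a. Those make up f ∘ `rightUnit`. -/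
theorem bd_rightExt {f : BiFun Q Y} (hf : BiMultilin f) {Φ : BiFun (tensor Q (diag A)) Y}
    (hΦ : ∀ l' r l q (a : X), Φ l' r (twR Q l q a) = f l' (l ++ a :: r.map X.rsgn) q)
    (l' r l : List X) (q : Q.carrier) (a : X) :
    bd Φ l' r (twR Q l q a) =
      comp 0 f (rightUnit Q) l' r (twR Q l q a) - bd f l' (l ++ a :: r.map X.rsgn) q := by
  have hR : ∀ (x : List X) (q : Q.carrier), IsMultilin K fun z => f x z q := fun x q =>
    (hf.2 x).comp_lin (LinearMap.applyₗ q)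
  rw [bd_twR, bd_apply, comp_apply (d := 0), comp_apply, bdA_apply, contr_append_cons]
  simp only [hΦ, rightUnit_tw, splitSum_append_cons, splitSum_map, map_rsp_one,
    map_rsp_zero, List.map_append, List.map_cons, GrMod.map_rsgn_rsgn, contr_map_rsgn ((hR l' q).prepend _)]
  have e1 := fun (x v : List X) (q : Q.carrier) => (hR x q).rsgn_mid (v.map X.rsgn) r a
  have e2 := fun (v : List X) => (hR l' q).rsgn_mid v r a
  have e3 := fun (u w : List X) (b : X) => (hR l' q).neg_mid u w b
  have e4 : contr A (fun r => f l' (l ++ a :: r) q) (r.map X.rsgn) =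
      -contr A (fun r => f l' (l ++ a :: r.map X.rsgn) q) r := by
    have := contr_map_rsgn (A := A) ((hR l' q).prepend (l ++ [a])) r
    simpa using this
  have e5 := splitSum_comm (fun z w u v => f l' (u ++ A.μ (v ++ a :: z.map X.rsgn) :: w) q) r l
  simp only [e1, e2, e3, e4, e5, contr_neg, splitSum_neg, splitSum_add]
  abel

theorem rightUnit_hom (Q : ABimod A) : rightUnit Q ∈ hom (tensor Q (diag A)) Q 0 := by
  refine mem_hom_twR (fun r l q a => ?_) (fun l' l q a => ?_) (fun l' r l q a h => ?_)
    fun l' m r n l e q i a j hl' hr hl hq ha => ?_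
  · simp only [rightUnit_tw]
    exact (Q.multilin_left _).comp_lin (LinearMap.applyₗ q)
  · simp only [rightUnit_tw]
    have := (((Q.multilin_right l').comp_lin (LinearMap.applyₗ q)).prepend (l ++ [a])).map_rsgn
    simpa using this
  · rw [rightUnit_tw]
    rcases h with h | h
    · have := List.length_pos_of_mem h
      rw [Q.act_eq_zero _ _ (by simp; omega) (.inl h)]; rfl
    · have hlen := List.length_pos_of_mem h
      obtain ⟨u, v, rfl⟩ := List.append_of_mem h
      have := act_rsp_one Q 1 l' (l ++ a :: u.map X.rsgn) (v.map X.rsgn) (by simp; omega)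
      rw [rsp_of_odd X (by decide)] at this
      have := LinearMap.congr_fun this q
      simpa using this
  · rw [rightUnit_tw]
    have := Q.act_mem _ _ _ _ _ _ hl' (List.rel_append hl (List.Forall₂.cons ha (isHom_map_rsgn hr))) hq
    simp only [GrMod.rdeg_append, GrMod.rdeg_cons] at this
    convert this using 2
    ring

/-- The case f = μ_Q of `bd_rightExt`: the map `rightUnit` is μ_Q on the longer word, and `bd` kills
μ_Q. -/
theorem rightUnit_mem_cocycles (Q : ABimod A) :
    rightUnit Q ∈ cocycles (tensor Q (diag A)) Q 0 := by
  refine ⟨rightUnit_hom Q, LinearMap.mem_ker.2 ?_⟩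
  rw [homD_eq, GrMod.eps_zero, one_smul]
  refine twR_biFun_ext fun l' r l q a => ?_
  rw [Pi.sub_apply, Pi.sub_apply, LinearMap.sub_apply,
    bd_rightExt (act_multilin Q) (rightUnit_tw Q), act_bd]
  simp

theorem twR_mred (Q : ABimod A) :
    twR Q ∈ MRed A (Q.carrier →ₗ[K] X →ₗ[K] (tensor Q (diag A)).carrier) := tw_mred Q (diag A)

theorem twL_mred (P : ABimod A) :
    twL P ∈ MRed A (X →ₗ[K] P.carrier →ₗ[K] (tensor (diag A) P).carrier) := tw_mred (diag A) P

theorem rightContraction_mem (Q : ABimod A) :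
    (fun l => ((twR_mred Q).1 l []).mk'.flip.compr₂ (LinearMap.applyₗ A.one)) ∈
      MRed A (Q.carrier →ₗ[K] X →ₗ[K] (tensor Q (diag A)).carrier) := by
  refine ⟨.of_apply fun q => .of_apply fun a => (twR_multilin q A.one).append [a],
    fun l hl => LinearMap.ext fun q => LinearMap.ext fun a => ?_⟩
  change twR Q (l ++ [a]) q A.one = 0
  rw [twR_zero (List.mem_append_left _ hl)]; rfl

/-- The operator `q ⊗ l ⊗ a ↦ q ⊗ (l, a) ⊗ e`. -/
noncomputable def rightContraction (Q : ABimod A) :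
    (tensor Q (diag A)).carrier →ₗ[K] (tensor Q (diag A)).carrier :=
  tLift (Q := Q) (P := diag A) ⟨fun l => ((twR_mred Q).1 l []).mk'.flip.compr₂
      (LinearMap.applyₗ A.one), rightContraction_mem Q⟩

theorem rightContraction_tw (Q : ABimod A) (l : List X) (q : Q.carrier) (a : X) :
    rightContraction Q (twR Q l q a) = twR Q (l ++ [a]) q A.one :=
  tLift_tw (Q := Q) (P := diag A) ⟨_, rightContraction_mem Q⟩ l q a

theorem sgn_one (A : AInfStr X) : X.sgn A.one = A.one := by
  rw [X.sgn_of_mem A.one_mem]; simp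

theorem μ_append_one (A : AInfStr X) {v : List X} (hv : 2 ≤ v.length) : A.μ (v ++ [A.one]) = 0 :=
  A.μ_eq_zero _ (by simp; omega) (by simp)

/-- The classical contraction of the bar resolution: q ↦ q ⊗ e is a section, and a homotopy is given
by moving the last entry a into the bar word and putting e in its place. -/
theorem isQuasiIso_rightUnit (Q : ABimod A) : IsQuasiIso (rightUnit Q) := by
  refine isQuasiIso_of_contraction (rightUnit_mem_cocycles Q)
    (s := fun q => twR Q [] q A.one) (k := rightContraction Q) (fun q => ?_) (fun q => ?_)
    (by simp) fun p => ?_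
  · rw [rightUnit_tw]; exact Q.one_right q
  · rw [act_nil_twR, splitSum_nil, splitSum_nil, contr_nil, sgn_one]
    have e1 := (twR_multilin (Q := Q) q A.one).zero_mid [] []
    have e2 : A.μ [A.one] = 0 := A.μ_one
    simp only [List.nil_append] at e1
    simp [e1, e2]
  · suffices h : (tensor Q (diag A)).act [] [] ∘ₗ rightContraction Q +
        rightContraction Q ∘ₗ (tensor Q (diag A)).act [] [] =
        (twR Q []).flip A.one ∘ₗ rightUnit Q [] [] - LinearMap.id from
      LinearMap.congr_fun h p
    refine twR_ext fun l q a => ?_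
    have hT := twR_multilin (Q := Q)
    simp only [LinearMap.add_apply, LinearMap.sub_apply, LinearMap.comp_apply, LinearMap.flip_apply,
      LinearMap.id_apply]
    rw [rightContraction_tw, act_nil_twR, act_nil_twR, map_add, map_add, rightUnit_tw]
    simp only [splitSum_hom, contr_comp, rightContraction_tw, sgn_one,
      List.map_nil]
    -- By strict unitality only μ²(a, e) = a survives. This is the identity term of the homotopy
    -- relation, up to sign.
    have hlast : splitSum (fun u v => twR Q u q (-A.μ (v ++ [A.one]))) (l ++ [a]) =
        -twR Q l q a := by
      rw [splitSum_append_singleton]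
      rw [splitSum_single_right]
      · simp [A.one_right, A.μ_one]
      · intro u v _ hv
        have := List.length_pos_iff.2 hv
        have h2 : A.μ (v ++ [a] ++ [A.one]) = 0 := μ_append_one A (by simp; omega)
        rw [h2]; simp
    have hc : contr A (fun l => twR Q l q A.one) (l ++ [a]) =
        contr A (fun l => twR Q (l ++ [X.rsgn a]) q A.one) l +
        splitSum (fun u v => twR Q (u ++ [A.μ (v ++ [a])]) q A.one) l := by
      rw [contr_append_cons, contr_nil]
      have e1 := (hT q A.one).zero_mid (l ++ [a]) []
      simp only [List.append_assoc, List.cons_append, List.nil_append] at e1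
      rw [e1, add_zero]
      simp only [splitSum_nil, List.map_nil]
    rw [hlast, hc, splitSum_append_singleton]
    have e1 := fun (v : List X) (q : Q.carrier) => (hT q A.one).rsgn_mid v [] a
    have e2 := fun (v : List X) (b : X) => (hT q A.one).neg_mid v [] b
    simp only [List.map_append, List.map_cons, List.map_nil, e1, e2, splitSum_neg, contr_neg]
    abel

theorem rightExt_mem {d : ℤ} {f : PreHom Q R} (hf : f ∈ hom Q R d) (l' r : List X) :
    (fun l => ((hf.2.1 l') l (r.map X.rsgn)).mk'.flip) ∈
      MRed A (Q.carrier →ₗ[K] X →ₗ[K] R.carrier) := by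
  refine ⟨.of_apply fun q => .of_apply fun a => ?_,
    fun l hl => LinearMap.ext fun q => LinearMap.ext fun a => ?_⟩
  · exact ((hf.2.1 l').comp_lin (LinearMap.applyₗ q)).append (a :: r.map X.rsgn)
  · change f l' (l ++ a :: r.map X.rsgn) q = 0
    rw [hf.2.2.1 _ _ (.inr (List.mem_append_left _ hl))]; rfl

/-- The map `(l'; q ⊗ l ⊗ a; r) ↦ ± f(l'; q; l, a, r)`. -/
noncomputable def rightExt {d : ℤ} {f : PreHom Q R} (hf : f ∈ hom Q R d) :
    PreHom (tensor Q (diag A)) R := fun l' r =>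
  tLift (Q := Q) (P := diag A) ⟨_, rightExt_mem hf l' r⟩

theorem rightExt_tw {d : ℤ} {f : PreHom Q R} (hf : f ∈ hom Q R d) (l' r l : List X)
    (q : Q.carrier) (a : X) :
    rightExt hf l' r (twR Q l q a) = f l' (l ++ a :: r.map X.rsgn) q :=
  tLift_tw (Q := Q) (P := diag A) ⟨_, rightExt_mem hf l' r⟩ l q a

theorem rightExt_mem_hom {d : ℤ} {f : PreHom Q R} (hf : f ∈ hom Q R d) :
    rightExt hf ∈ hom (tensor Q (diag A)) R (d - 1) := by
  refine mem_hom_twR (fun r l q a => ?_) (fun l' l q a => ?_) (fun l' r l q a h => ?_)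
    fun l' m r n l e q i a j hl' hr hl hq ha => ?_
  · simp only [rightExt_tw]
    exact (hf.1 _).comp_lin (LinearMap.applyₗ q)
  · simp only [rightExt_tw]
    have := (((hf.2.1 l').comp_lin (LinearMap.applyₗ q)).prepend (l ++ [a])).map_rsgn
    simpa using this
  · rw [rightExt_tw]
    rcases h with h | h
    · rw [hf.2.2.1 _ _ (.inl h)]; rfl
    · obtain ⟨u, v, rfl⟩ := List.append_of_mem h
      have h1 := (hf.2.1 l').neg_mid (l ++ a :: u.map X.rsgn) (v.map X.rsgn) A.one
      rw [hf.2.2.1 l' (l ++ a :: u.map X.rsgn ++ A.one :: v.map X.rsgn) (.inr (by simp)),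
        neg_zero] at h1
      simpa [A.rsgn_one] using LinearMap.congr_fun h1 q
  · rw [rightExt_tw]
    have := hf.2.2.2 _ _ _ _ _ _ hl' (List.rel_append hl (List.Forall₂.cons ha (isHom_map_rsgn hr))) hq
    simp only [GrMod.rdeg_append, GrMod.rdeg_cons] at this
    convert this using 2
    ring

/-- The homotopy is `rightExt`, in which f itself consumes the last entry a. The cocycle equation of
f on the word (l, a, r), sorted by which map consumes a, is the homotopy relation. -/
theorem rightUnit_natural {d : ℤ} {f : PreHom Q R} (hf : f ∈ cocycles Q R d) :
    Htpy d (comp 0 f (rightUnit Q)) (comp d (rightUnit R) (tensorT (diag A)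
      (⟨f, hf.1⟩ : hom Q R d))) := by
  have key : homD (tensor Q (diag A)) R (d - 1) (rightExt hf.1) = GrMod.eps d •
      (comp 0 f (rightUnit Q) - comp d (rightUnit R) (tensorT (diag A)
        (⟨f, hf.1⟩ : hom Q R d))) := by
    refine twR_biFun_ext fun l' r l q a => ?_
    have h0 := LinearMap.congr_fun (congrFun (congrFun (mem_cocycles.1 hf).2 l')
      (l ++ a :: r.map X.rsgn)) q
    rw [homD_eq] at h0 ⊢
    simp only [Pi.sub_apply, Pi.smul_apply, LinearMap.sub_apply, LinearMap.smul_apply,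
      bd_rightExt (hom_multilin hf.1) (rightExt_tw hf.1), GrMod.eps_sub_one, Pi.zero_apply,
      LinearMap.zero_apply] at h0 ⊢
    -- In μ_R ∘ f the letter a goes either to μ_R, which gives `rightUnit` after f ⊗ id, or to f,
    -- which gives μ_R after the homotopy.
    have h1 : comp d R.act f l' (l ++ a :: r.map X.rsgn) q =
        GrMod.eps d • comp d (rightUnit R) (tensorT (diag A) (⟨f, hf.1⟩ : hom Q R d)) l' r
          (twR Q l q a) + comp (d - 1) R.act (rightExt hf.1) l' r (twR Q l q a) := by
      simp only [comp_apply, splitSum_append_cons, splitSum_add, rightExt_tw, splitSum_map]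
      congr 1
      · rw [← splitSum_zsmul]
        refine splitSum_congr _ fun x y _ => ?_
        refine Eq.trans ?_ (congrArg (GrMod.eps d • ·) (splitSum_single_left _ _ ?_).symm)
        · rw [tensorT_twR]
          simp only [splitSum_hom, rightUnit_tw]
          rw [← splitSum_zsmul]
          refine splitSum_congr _ fun u v _ => ?_
          rw [← map_rsp_add_one', map_rsp_add_one]
          have e := map_zsmul ((R.multilin_right x (v.map (rsp X d))
            ((r.map X.rsgn).map (rsp X d))).mk') (GrMod.eps d) (sgnp X d a)
          have e2 : rsp X d a = GrMod.eps d • sgnp X d a := by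
            by_cases hd : Even d
            · rw [rsp_of_even X hd, sgnp_of_even X hd, GrMod.eps_of_even hd, one_smul]
            · rw [rsp_of_odd X hd, sgnp_of_odd X hd, GrMod.eps_of_odd hd, GrMod.rsgn]; simp
          simp only [IsLinearMap.mk'_apply, ← e2] at e
          rw [List.map_append, List.map_cons, e]; rfl
        · intro z w _ hz
          rw [tensorT_ne_nil _ _ hz]; simp
      · refine splitSum_congr _ fun x y _ => splitSum_congr _ fun z w _ => ?_
        rw [← map_rsp_add_one, ← sub_add_cancel d 1, map_rsp_add_one', map_rsp_add_one', 
          GrMod.map_rsgn_rsgn]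
        simp
    rw [h1] at h0
    rw [neg_smul, sub_neg_eq_add, smul_sub, smul_sub, ← sub_eq_zero, ← h0]
    abel
  rw [Htpy]
  have h2 : comp 0 f (rightUnit Q) - comp d (rightUnit R) (tensorT (diag A)
      (⟨f, hf.1⟩ : hom Q R d)) = homD (tensor Q (diag A)) R (d - 1)
        (GrMod.eps d • rightExt hf.1) := by
    rw [map_zsmul, key, smul_smul, GrMod.eps_mul_self, one_smul]
  rw [h2]
  exact homD_mem_coboundaries (zsmul_mem (rightExt_mem_hom hf.1) _) (by omega)

theorem leftUnit_hom (P : ABimod A) : leftUnit P ∈ hom (tensor (diag A) P) P 0 := by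
  have hL := fun (r : List X) (p : P.carrier) => (P.multilin_left r).comp_lin (LinearMap.applyₗ p)
  refine mem_hom_twL (fun r l a p => ?_) (fun l' l a p => ?_) (fun l' r l a p h => ?_)
    fun l' m r n l e a i p j hl' hr hl ha hp => ?_
  · simp only [leftUnit_tw]
    exact ((hL _ _).append _).neg
  · simp only [leftUnit_tw]
    exact ((P.multilin_right _).comp_lin (LinearMap.applyₗ (P.sgn p))).map_rsgn.neg
  · rw [leftUnit_tw]
    rcases h with h | h
    · have := List.length_pos_of_mem h
      rw [P.act_eq_zero _ _ (by simp; omega) (.inl (List.mem_append_left _ h))]; simp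
    · have hlen := List.length_pos_of_mem h
      obtain ⟨u, v, rfl⟩ := List.append_of_mem h
      have := act_rsp_one P 1 (l' ++ a :: l.map X.rsgn) (u.map X.rsgn) (v.map X.rsgn)
        (by simp; omega)
      rw [rsp_of_odd X (by decide)] at this
      have := LinearMap.congr_fun this (P.sgn p)
      simpa using this
  · rw [leftUnit_tw]
    have := P.act_mem _ _ _ _ _ _ (List.rel_append hl' (List.Forall₂.cons ha (isHom_map_rsgn hl)))
      (isHom_map_rsgn hr) (P.sgn_mem hp)
    simp only [GrMod.rdeg_append, GrMod.rdeg_cons] at this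
    refine neg_mem ?_
    convert this using 2
    ring

/-- This is the bimodule equation of P on the left word (l', a, l), with the signs of l, p and r
twisted as in `leftUnit`. -/
theorem leftUnit_mem_cocycles (P : ABimod A) :
    leftUnit P ∈ cocycles (tensor (diag A) P) P 0 := by
  refine ⟨leftUnit_hom P, LinearMap.mem_ker.2 ?_⟩
  rw [homD_eq, GrMod.eps_zero, one_smul]
  refine twL_biFun_ext fun l' r l a p => ?_
  have hL := fun (r : List X) (p : P.carrier) => (P.multilin_left r).comp_lin (LinearMap.applyₗ p)
  have hR := fun (l : List X) (p : P.carrier) => (P.multilin_right l).comp_lin (LinearMap.applyₗ p)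
  have h0 := LinearMap.congr_fun (congrFun (congrFun (act_bd P) (l' ++ a :: l.map X.rsgn))
    (r.map X.rsgn)) (P.sgn p)
  rw [bd_apply, comp_apply, bdA_apply, contr_append_cons] at h0
  simp only [splitSum_append_cons, splitSum_map, map_rsp_one, GrMod.map_rsgn_rsgn, GrMod.sgn_sgn,
    splitSum_add] at h0
  have e2 := fun (u w : List X) => (hL r p).rsgn_mid u w a
  have e3 := fun (u w : List X) (b : X) => (hL r p).neg_mid u w b
  have e4 : contr A (fun z => P.act (l' ++ a :: l.map X.rsgn) z (P.sgn p)) (r.map X.rsgn) =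
      -contr A (fun z => P.act (l' ++ a :: l.map X.rsgn) (z.map X.rsgn) (P.sgn p)) r :=
    contr_map_rsgn (hR _ _) r
  have e5 : contr A (fun l => P.act (l' ++ a :: l) r p) (l.map X.rsgn) =
      -contr A (fun l => P.act (l' ++ a :: l.map X.rsgn) r p) l := by
    have := contr_map_rsgn (A := A) ((hL r p).prepend (l' ++ [a])) l
    simpa using this
  simp only [LinearMap.applyₗ_apply_apply] at e2 e3
  rw [Pi.sub_apply, Pi.sub_apply, LinearMap.sub_apply, comp_apply, bd_twL]
  simp only [leftUnit_tw, map_rsp_zero, GrMod.map_rsgn_rsgn, GrMod.sgn_sgn, P.sgn_act, map_neg, LinearMap.neg_apply,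
    contr_neg, splitSum_neg, e3, neg_neg]
  have e6 := splitSum_comm (fun z w u v => P.act (l' ++ a :: u.map X.rsgn) w
    (P.act (v.map X.rsgn) (z.map X.rsgn) (P.sgn p))) r l
  simp only [e2, e4, e5, contr_neg] at h0
  rw [e6]
  rw [Pi.zero_apply, Pi.zero_apply, LinearMap.zero_apply] at h0 ⊢
  rw [← neg_eq_zero, ← h0]
  abel

theorem leftContraction_mem (P : ABimod A) :
    (fun l => (((twL_mred P).1 [] (l.map X.rsgn)).mk'.flip A.one).compl₂ P.sgn) ∈
      MRed A (X →ₗ[K] P.carrier →ₗ[K] (tensor (diag A) P).carrier) := by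
  refine ⟨.of_apply fun a => .of_apply fun p => ((twL_multilin A.one (P.sgn p)).prepend [a]).map_rsgn,
    fun l hl => LinearMap.ext fun a => LinearMap.ext fun p => ?_⟩
  change twL P (a :: l.map X.rsgn) A.one (P.sgn p) = 0
  obtain ⟨u, v, rfl⟩ := List.append_of_mem hl
  have := (twL_multilin (P := P) A.one (P.sgn p)).neg_mid (a :: u.map X.rsgn) (v.map X.rsgn) A.one
  rw [twL_zero (l := a :: u.map X.rsgn ++ A.one :: v.map X.rsgn) (by simp)] at this
  simpa [A.rsgn_one] using this

/-- The operator `a ⊗ l ⊗ p ↦ ± e ⊗ (a, l) ⊗ p`. -/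
noncomputable def leftContraction (P : ABimod A) :
    (tensor (diag A) P).carrier →ₗ[K] (tensor (diag A) P).carrier :=
  tLift (Q := diag A) (P := P) ⟨_, leftContraction_mem P⟩

theorem leftContraction_tw (P : ABimod A) (l : List X) (a : X) (p : P.carrier) :
    leftContraction P (twL P l a p) = twL P (a :: l.map X.rsgn) A.one (P.sgn p) :=
  tLift_tw (Q := diag A) (P := P) ⟨_, leftContraction_mem P⟩ l a p

/-- Mirror image of `isQuasiIso_rightUnit`: the section is p ↦ e ⊗ p, and the homotopy moves the
first entry into the bar word. -/
theorem isQuasiIso_leftUnit (P : ABimod A) : IsQuasiIso (leftUnit P) := by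
  refine isQuasiIso_of_contraction (leftUnit_mem_cocycles P)
    (s := fun p => twL P [] A.one p) (k := -leftContraction P) (fun p => ?_) (fun p => ?_)
    (by simp) fun z => ?_
  · rw [leftUnit_tw]
    change -P.act [A.one] [] (P.sgn p) = p
    rw [P.one_left, P.sgn_sgn, neg_neg]
  · rw [act_nil_twL, splitSum_nil, splitSum_nil, contr_nil]
    have e1 := (twL_multilin A.one (P.sgn p)).zero_mid [] []
    have e2 : A.μ [A.one] = 0 := A.μ_one
    simp only [List.nil_append] at e1
    simp [e1, e2]
  · suffices h : (tensor (diag A) P).act [] [] ∘ₗ leftContraction P +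
        leftContraction P ∘ₗ (tensor (diag A) P).act [] [] =
        LinearMap.id - twL P [] A.one ∘ₗ leftUnit P [] [] by
      have := LinearMap.congr_fun h z
      simp only [LinearMap.add_apply, LinearMap.sub_apply, LinearMap.comp_apply,
        LinearMap.id_apply] at this
      rw [LinearMap.neg_apply, LinearMap.neg_apply, map_neg, ← neg_add, this, neg_sub]
    refine twL_ext fun l a p => ?_
    have hT := twL_multilin (P := P)
    simp only [LinearMap.add_apply, LinearMap.sub_apply, LinearMap.comp_apply, LinearMap.id_apply]
    rw [leftContraction_tw, act_nil_twL, act_nil_twL, map_add, map_add, leftUnit_tw]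
    simp only [splitSum_hom, contr_comp, leftContraction_tw, List.map_nil, GrMod.sgn_sgn]
    have hfirst : splitSum (fun u v => twL P (v.map X.rsgn) (-A.μ (A.one :: u.map X.rsgn)) p)
        (a :: l.map X.rsgn) = twL P l a p := by
      rw [splitSum_cons, splitSum_map, splitSum_single_left]
      · have h1 : A.μ [A.one, X.rsgn a] = -a := by rw [A.one_left]; simp [GrMod.rsgn]
        simp [h1, A.μ_one, -List.map_map]
      · intro u v _ hu
        have := List.length_pos_iff.2 hu
        have h2 : A.μ (A.one :: (a :: u.map X.rsgn).map X.rsgn) = 0 :=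
          A.μ_eq_zero _ (by simp; omega) (by simp)
        rw [h2]; simp
    have hc : contr A (fun l => twL P l A.one p) (a :: l.map X.rsgn) =
        splitSum (fun u v => twL P (A.μ (a :: u.map X.rsgn) :: v) A.one p) l -
        contr A (fun l => twL P (a :: l.map X.rsgn) A.one p) l := by
      have h1 := contr_append_cons (A := A) (fun l => twL P l A.one p) [] a (l.map X.rsgn)
      have e1 := (hT A.one p).zero_mid [] (X.rsgn a :: (l.map X.rsgn).map X.rsgn)
      have e2 := contr_map_rsgn (A := A) ((hT A.one p).prepend [a]) l
      simp only [List.nil_append, List.cons_append, GrMod.map_rsgn_rsgn] at h1 e1 e2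
      rw [h1, contr_nil, e2]
      simp only [splitSum_nil, List.nil_append, List.cons_append, splitSum_map,
        GrMod.map_rsgn_rsgn, e1]
      abel
    have e2 := fun (u : List X) (b : X) => (hT A.one p).neg_mid [] u b
    simp only [List.nil_append] at e2
    rw [hfirst, hc]
    simp only [splitSum_cons, splitSum_map, P.sgn_act,
      List.map_nil, map_neg, LinearMap.neg_apply, GrMod.map_rsgn_rsgn, e2, splitSum_neg, List.nil_append]
    abel

end Units

/-! ### Cancelling an invertible bimodule; existence of the self-conjugation map. -/

section Invertible

variable {K : Type u} [Field K] {X : GrMod K} {A : AInfStr X} {P P' Q R S M N : ABimod A}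

/-- The map `(Q ⊗ P) ⊗ P' → Q` induced by a map `P ⊗ P' → A`. -/
noncomputable def cancelHom (Q : ABimod A) (ψ : hom (tensor P P') (diag A) 0) :
    PreHom (tensor (tensor Q P) P') Q :=
  comp 0 (rightUnit Q) (comp 0 (idT Q ψ) (assocHom Q P P'))

theorem isHtpyEquiv_rightUnit (Q : ABimod A) : IsHtpyEquiv (rightUnit Q) :=
  (isQuasiIso_rightUnit Q).isHtpyEquiv

theorem isHtpyEquiv_leftUnit (Q : ABimod A) : IsHtpyEquiv (leftUnit Q) :=
  (isQuasiIso_leftUnit Q).isHtpyEquiv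

theorem isHtpyEquiv_cancelHom (Q : ABimod A) {ψ : PreHom (tensor P P') (diag A)}
    (hψ : IsHtpyEquiv ψ) : IsHtpyEquiv (cancelHom Q ⟨ψ, hψ.1.1⟩) :=
  isHtpyEquiv_comp (isHtpyEquiv_rightUnit Q)
    (isHtpyEquiv_comp (isHtpyEquiv_idT Q hψ) (isHtpyEquiv_assocHom Q P P'))

/-- The associator, and the exchange of f ⊗ id with id ⊗ ψ, are strictly natural. Only the unit map
`rightUnit` requires a homotopy. -/
theorem cancelHom_natural {ψ : PreHom (tensor P P') (diag A)} (hψ : ψ ∈ cocycles _ _ 0) {j : ℤ}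
    {f : PreHom Q M} (hf : f ∈ cocycles Q M j) :
    Htpy j (comp j (cancelHom M ⟨ψ, hψ.1⟩)
      (tensorT P' (⟨_, tensorT_mem P (⟨f, hf.1⟩ : hom Q M j)⟩ : hom _ _ j)))
      (comp 0 f (cancelHom Q ⟨ψ, hψ.1⟩)) := by
  have hZ : comp 0 (idT Q (⟨ψ, hψ.1⟩ : hom _ _ 0)) (assocHom Q P P') ∈ cocycles _ _ 0 :=
    comp_mem_cocycles (idT_mem_cocycles Q hψ) (assocHom_mem Q P P') rfl
  have h := (rightUnit_natural hf).comp_right hZ (n := j) (by simp)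
  have e : comp j (cancelHom M ⟨ψ, hψ.1⟩)
      (tensorT P' (⟨_, tensorT_mem P (⟨f, hf.1⟩ : hom Q M j)⟩ : hom _ _ j)) =
      comp 0 (comp j (rightUnit M) (tensorT (diag A) (⟨f, hf.1⟩ : hom Q M j)))
        (comp 0 (idT Q (⟨ψ, hψ.1⟩ : hom _ _ 0)) (assocHom Q P P')) := by
    rw [cancelHom, comp_assoc, comp_assoc, assocHom_tensorT, comp_assoc 0 j, zero_add, add_zero]
    congr 1
    rw [← comp_assoc_zero, ← idT_tensorT_comm, comp_assoc 0 j, zero_add]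
  rw [e, cancelHom, ← comp_assoc_zero f]
  exact h.symm

/-- `f` is null-homotopic if `f ⊗ id_P` is, for invertible `P`. -/
theorem mem_coboundaries_of_tensorT {ψ : PreHom (tensor P P') (diag A)} (hψ : IsHtpyEquiv ψ)
    {j : ℤ} {f : PreHom Q M} (hf : f ∈ cocycles Q M j)
    (h : tensorT P (⟨f, hf.1⟩ : hom Q M j) ∈ coboundaries (tensor Q P) (tensor M P) j) :
    f ∈ coboundaries Q M j := by
  -- Composed with the equivalence (Q ⊗ P) ⊗ P' → Q, the map f becomes homotopic to f ⊗ id ⊗ id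
  -- followed by the equivalence for M, and this bounds.
  refine (isHtpyEquiv_cancelHom Q hψ).cancel_right hf ?_
  have h1 := tensorT_coboundary P' (⟨_, tensorT_mem P (⟨f, hf.1⟩ : hom Q M j)⟩ : hom _ _ j) h
  have h2 := comp_coboundary_right (isHtpyEquiv_cancelHom M hψ).1 h1 (n := j) (by simp)
  have h3 := sub_mem h2 (cancelHom_natural hψ.1 hf)
  rwa [sub_sub_cancel] at h3

/-- Conjugating g ⊗ id_{P'} by the equivalences (Q ⊗ P) ⊗ P' ≃ Q and (M ⊗ P) ⊗ P' ≃ M gives f. To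
see that f ⊗ id_P is homotopic to g it suffices to compare them after tensoring with P', which is
faithful because P' ⊗ P ≃ A; there the comparison is the naturality of the equivalences. -/
theorem exists_tensorT_htpy {ψ : PreHom (tensor P P') (diag A)} (hψ : IsHtpyEquiv ψ)
    {φ : PreHom (tensor P' P) (diag A)} (hφ : IsHtpyEquiv φ)
    {j : ℤ} {g : PreHom (tensor Q P) (tensor M P)} (hg : g ∈ cocycles _ _ j) :
    ∃ f, ∃ hf : f ∈ cocycles Q M j, Htpy j (tensorT P (⟨f, hf.1⟩ : hom Q M j)) g := by
  obtain ⟨β', hβ', h1, h2⟩ := (isHtpyEquiv_cancelHom Q hψ).2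
  have hβQ := (isHtpyEquiv_cancelHom Q hψ).1
  have hβM := isHtpyEquiv_cancelHom M hψ
  have hTg := tensorT_mem_cocycles P' hg
  have hBT := comp_mem_cocycles hβM.1 hTg (n := j) (by simp)
  have hf := comp_mem_cocycles hBT hβ' (n := j) (by simp)
  refine ⟨_, hf, ?_⟩
  have hTf := tensorT_mem_cocycles P hf
  have hd := sub_mem hTf hg
  refine mem_coboundaries_of_tensorT hφ hd ?_
  have e := tensorT_sub (P := P') (⟨_, hTf.1⟩ : hom _ _ j) (⟨_, hg.1⟩ : hom _ _ j)
  change tensorT P' ((⟨_, hTf.1⟩ : hom _ _ j) - (⟨_, hg.1⟩ : hom _ _ j)) ∈ _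
  rw [e]
  refine hβM.cancel_left (sub_mem (tensorT_mem_cocycles P' hTf) hTg) ?_
  rw [comp_sub_right]
  refine Htpy.trans (cancelHom_natural hψ.1 hf) ?_
  rw [comp_assoc_zero]
  have := h2.comp_left hBT (n := j) (by simp)
  rwa [comp_idHom] at this

/-- The map `f ↦ (Q ⊗ P → A ⊗ P ≃ P)` given by `f ⊗ id_P`. -/
noncomputable def actRight (P : ABimod A) {Q : ABimod A} {d : ℤ} (f : hom Q (diag A) d) :
    PreHom (tensor Q P) P := comp d (leftUnit P) (tensorT P f)

theorem actRight_mem (P : ABimod A) {Q : ABimod A} {d : ℤ} {f : PreHom Q (diag A)}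
    (hf : f ∈ cocycles Q (diag A) d) :
    actRight P (⟨f, hf.1⟩ : hom Q (diag A) d) ∈ cocycles (tensor Q P) P d :=
  comp_mem_cocycles (leftUnit_mem_cocycles P) (tensorT_mem_cocycles P hf) (by simp)

/-- The map R is - ⊗ P followed by the equivalence A ⊗ P ≃ P, and each of these is bijective on
cohomology. Degree zero serves the definition of K₁, negative degrees serve the obstruction groups.
-/
theorem actRight_injective {ψ : PreHom (tensor P P') (diag A)} (hψ : IsHtpyEquiv ψ)
    {d : ℤ} {f : PreHom Q (diag A)} (hf : f ∈ cocycles Q (diag A) d)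
    (h : actRight P (⟨f, hf.1⟩ : hom Q (diag A) d) ∈ coboundaries (tensor Q P) P d) :
    f ∈ coboundaries Q (diag A) d :=
  mem_coboundaries_of_tensorT hψ hf
    ((isHtpyEquiv_leftUnit P).cancel_left (tensorT_mem_cocycles P hf) h)

theorem actRight_surjective {ψ : PreHom (tensor P P') (diag A)} (hψ : IsHtpyEquiv ψ)
    {φ : PreHom (tensor P' P) (diag A)} (hφ : IsHtpyEquiv φ)
    {d : ℤ} {g : PreHom (tensor Q P) P} (hg : g ∈ cocycles (tensor Q P) P d) :
    ∃ f, ∃ hf : f ∈ cocycles Q (diag A) d,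
      Htpy d (actRight P (⟨f, hf.1⟩ : hom Q (diag A) d)) g := by
  obtain ⟨hl, l', hl', h1, h2⟩ := isHtpyEquiv_leftUnit P
  have hg' := comp_mem_cocycles hl' hg (n := d) (by simp)
  obtain ⟨f, hf, h⟩ := exists_tensorT_htpy hψ hφ hg'
  refine ⟨f, hf, (h.comp_left hl (n := d) (by simp)).trans ?_⟩
  have e := h1.comp_right hg (n := d) (by simp)
  rwa [idHom_comp, comp_assoc, add_zero] at e

/-- The tensor powers are bracketed with the first factor split off, while `actRight` removes the
last one. This equivalence moves a factor from the front to the end. -/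
theorem exists_shift (P : ABimod A) (k : ℕ) :
    ∃ c : PreHom (tensor P (tpow P (k + 1))) (tensor (tpow P (k + 1)) P), IsHtpyEquiv c := by
  induction k with
  | zero => exact ⟨idHom _, idHom_mem _, idHom _, idHom_mem _, .of_eq (comp_idHom _),
      .of_eq (comp_idHom _)⟩
  | succ k ih =>
    obtain ⟨c, hc⟩ := ih
    exact ⟨_, isHtpyEquiv_comp (isHtpyEquiv_assocInv P (tpow P (k + 1)) P) (isHtpyEquiv_idT P hc)⟩

theorem subsingleton_homCoh {d : ℤ} :
    Subsingleton (HomCoh Q R d) ↔ cocycles Q R d ≤ coboundaries Q R d := by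
  rw [Submodule.Quotient.subsingleton_iff, Submodule.submoduleOf_eq_top]

/-- The vanishing of the negative cohomology of `hom(P^{⊗ (k + 1)}, P)`. -/
theorem cocycles_le_coboundaries_tpow {ψ : PreHom (tensor P P') (diag A)} (hψ : IsHtpyEquiv ψ)
    {φ : PreHom (tensor P' P) (diag A)} (hφ : IsHtpyEquiv φ) {k : ℕ} {d : ℤ}
    (h : cocycles (tpow P (k + 1)) (diag A) d ≤ coboundaries (tpow P (k + 1)) (diag A) d) :
    cocycles (tpow P (k + 2)) P d ≤ coboundaries (tpow P (k + 2)) P d := by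
  suffices key : ∀ g ∈ cocycles (tensor P (tpow P (k + 1))) P d,
      g ∈ coboundaries (tensor P (tpow P (k + 1))) P d from fun g hg => key g hg
  intro g hg
  obtain ⟨c, hc⟩ := exists_shift P k
  obtain ⟨c', hc', h1, h2⟩ := hc.2
  -- Transport g to P^{⊗(k+1)} ⊗ P, where up to homotopy it is R of some cocycle f; f bounds by
  -- hypothesis, and so does g after transport back.
  have hg' := comp_mem_cocycles hg hc' (n := d) (by simp)
  obtain ⟨f, hf, e⟩ := actRight_surjective hψ hφ hg'
  have h3 := comp_coboundary_right (leftUnit_mem_cocycles P)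
    (tensorT_coboundary P (⟨f, hf.1⟩ : hom _ _ d) (h hf)) (n := d) (by simp)
  have h4 : comp 0 g c' ∈ coboundaries _ _ d := by
    have := sub_mem h3 e
    rwa [actRight, sub_sub_cancel] at this
  have h5 := comp_coboundary_left h4 hc.1 (n := d) (by simp)
  have h6 := h2.comp_left hg (n := d) (by simp)
  rw [comp_idHom, ← comp_assoc_zero] at h6
  have := sub_mem h5 h6
  rwa [sub_sub_cancel] at this

theorem ABimod.Invertible.exists_htpyEquiv (hP : P.Invertible) :
    ∃ (P' : ABimod A) (φ : PreHom (tensor P' P) (diag A)) (ψ : PreHom (tensor P P') (diag A)),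
      IsHtpyEquiv φ ∧ IsHtpyEquiv ψ := by
  obtain ⟨P', φ, ψ, hφ, hψ⟩ := hP
  exact ⟨P', φ, ψ, hφ.isHtpyEquiv, hψ.isHtpyEquiv⟩

/-- The map `f ↦ (P ⊗ Q → P ⊗ A ≃ P)` given by `id_P ⊗ f`. -/
noncomputable def actLeft (P : ABimod A) {Q : ABimod A} (f : hom Q (diag A) 0) :
    PreHom (tensor P Q) P := comp 0 (rightUnit P) (idT P f)

theorem actLeft_mem (P : ABimod A) {f : PreHom Q (diag A)}
    (hf : f ∈ cocycles Q (diag A) 0) :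
    actLeft P (⟨f, hf.1⟩ : hom Q (diag A) 0) ∈ cocycles (tensor P Q) P 0 :=
  comp_mem_cocycles (rightUnit_mem_cocycles P) (idT_mem_cocycles P hf) (by simp)

theorem actLeft_coboundary (P : ABimod A) {f : PreHom Q (diag A)} (hf : f ∈ hom Q (diag A) 0)
    (h : f ∈ coboundaries Q (diag A) 0) :
    actLeft P (⟨f, hf⟩ : hom Q (diag A) 0) ∈ coboundaries (tensor P Q) P 0 :=
  comp_coboundary_right (rightUnit_mem_cocycles P) (idT_coboundary P _ h) (by simp)

theorem actRight_coboundary (P : ABimod A) {d : ℤ} {f : PreHom Q (diag A)}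
    (hf : f ∈ hom Q (diag A) d) (h : f ∈ coboundaries Q (diag A) d) :
    actRight P (⟨f, hf⟩ : hom Q (diag A) d) ∈ coboundaries (tensor Q P) P d :=
  comp_coboundary_right (leftUnit_mem_cocycles P) (tensorT_coboundary P _ h) (by simp)

/-- The map `L` on cocycles. -/
noncomputable def actLeftCocycles (P Q : ABimod A) :
    cocycles Q (diag A) 0 →ₗ[K] cocycles (tensor P Q) P 0 where
  toFun f := ⟨actLeft P (⟨f.1, f.2.1⟩ : hom Q (diag A) 0), actLeft_mem P f.2⟩
  map_add' f g := Subtype.ext <| (congrArg (comp 0 (rightUnit P))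
    (idT_add (P := P) (⟨f.1, f.2.1⟩ : hom Q (diag A) 0) ⟨g.1, g.2.1⟩)).trans (comp_add_right _ _ _ _)
  map_smul' c f := Subtype.ext <| (congrArg (comp 0 (rightUnit P))
    (idT_smul (P := P) c (⟨f.1, f.2.1⟩ : hom Q (diag A) 0))).trans (comp_smul_right _ _ _ _)

/-- The map `R` on cocycles. -/
noncomputable def actRightCocycles (P Q : ABimod A) :
    cocycles Q (diag A) 0 →ₗ[K] cocycles (tensor Q P) P 0 where
  toFun f := ⟨actRight P (⟨f.1, f.2.1⟩ : hom Q (diag A) 0), actRight_mem P f.2⟩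
  map_add' f g := Subtype.ext <| (congrArg (comp 0 (leftUnit P))
    (tensorT_add (P := P) (⟨f.1, f.2.1⟩ : hom Q (diag A) 0) ⟨g.1, g.2.1⟩)).trans
      (comp_add_right _ _ _ _)
  map_smul' c f := Subtype.ext <| (congrArg (comp 0 (leftUnit P))
    (tensorT_smul (P := P) c (⟨f.1, f.2.1⟩ : hom Q (diag A) 0))).trans (comp_smul_right _ _ _ _)

/-- The map `L` on cohomology. -/
noncomputable def actLeftCoh (P Q : ABimod A) : HomCoh Q (diag A) 0 →ₗ[K] HomCoh (tensor P Q) P 0 :=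
  Submodule.mapQ _ _ (actLeftCocycles P Q) fun f hf => actLeft_coboundary P f.2.1 hf

/-- The map `R` on cohomology. -/
noncomputable def actRightCoh (P Q : ABimod A) :
    HomCoh Q (diag A) 0 →ₗ[K] HomCoh (tensor Q P) P 0 :=
  Submodule.mapQ _ _ (actRightCocycles P Q) fun f hf => actRight_coboundary P f.2.1 hf

theorem actLeftCoh_mk (f : cocycles Q (diag A) 0) :
    actLeftCoh P Q (Submodule.Quotient.mk f) = Submodule.Quotient.mk (actLeftCocycles P Q f) := rfl

theorem actRightCoh_mk (f : cocycles Q (diag A) 0) :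
    actRightCoh P Q (Submodule.Quotient.mk f) = Submodule.Quotient.mk (actRightCocycles P Q f) := rfl

theorem actRightCoh_bijective {ψ : PreHom (tensor P P') (diag A)} (hψ : IsHtpyEquiv ψ)
    {φ : PreHom (tensor P' P) (diag A)} (hφ : IsHtpyEquiv φ) :
    Function.Bijective (actRightCoh P Q) := by
  constructor
  · rw [← LinearMap.ker_eq_bot, LinearMap.ker_eq_bot']
    intro x hx
    obtain ⟨f, rfl⟩ := Submodule.Quotient.mk_surjective _ x
    rw [actRightCoh_mk, Submodule.Quotient.mk_eq_zero] at hx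
    exact (Submodule.Quotient.mk_eq_zero _).2 (actRight_injective hψ f.2 hx)
  · intro y
    obtain ⟨g, rfl⟩ := Submodule.Quotient.mk_surjective _ y
    obtain ⟨f, hf, h⟩ := actRight_surjective hψ hφ g.2
    exact ⟨Submodule.Quotient.mk ⟨f, hf⟩, (Submodule.Quotient.eq _).2 h⟩

/-- The relation asks for one pair of representatives. As L and R descend to cohomology, every pair
serves. -/
theorem selfConj_iff {x y : HomCoh P (diag A) 0} :
    SelfConj P x y ↔ actLeftCoh P P x = actRightCoh P P y := by
  have key : ∀ φ ψ : cocycles P (diag A) 0,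
      homComp (rightUnit P) (idTensor P (⟨φ.1, φ.2.1⟩ : hom P (diag A) 0)) -
      homComp (leftUnit P) (tensorId P (⟨ψ.1, ψ.2.1⟩ : hom P (diag A) 0)) ∈
        coboundaries (tensor P P) P 0 ↔ actLeftCoh P P (Submodule.Quotient.mk φ) =
          actRightCoh P P (Submodule.Quotient.mk ψ) := fun φ ψ => by
    rw [actLeftCoh_mk, actRightCoh_mk, Submodule.Quotient.eq, tensorId_eq, ← comp_zero_eq,
      ← comp_zero_eq]
    rfl
  constructor
  · rintro ⟨φ, ψ, rfl, rfl, h⟩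
    exact (key φ ψ).1 h
  · intro h
    obtain ⟨φ, rfl⟩ := Submodule.Quotient.mk_surjective _ x
    obtain ⟨ψ, rfl⟩ := Submodule.Quotient.mk_surjective _ y
    exact ⟨φ, ψ, rfl, rfl, (key φ ψ).2 h⟩

/-- K₁ is R⁻¹ ∘ L, for which only the bijectivity of R is required. -/
theorem exists_selfConj (hP : P.Invertible) :
    ∃ K₁ : HomCoh P (diag A) 0 →ₗ[K] HomCoh P (diag A) 0, ∀ x y, K₁ x = y ↔ SelfConj P x y := by
  obtain ⟨P', φ, ψ, hφ, hψ⟩ := hP.exists_htpyEquiv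
  refine ⟨(LinearEquiv.ofBijective _ (actRightCoh_bijective (Q := P) hψ hφ)).symm.toLinearMap ∘ₗ
    actLeftCoh P P, fun x y => ?_⟩
  rw [selfConj_iff, LinearMap.comp_apply, LinearEquiv.coe_coe, LinearEquiv.symm_apply_eq]
  rfl

end Invertible

/-! ### The section of a divisor is fixed by self-conjugation. -/

section SectionFixed

variable {K : Type u} [Field K] {X : GrMod K} {A : AInfStr X} {P : ABimod A}
  {Y : Type*} [AddCommGroup Y] [Module K Y]

theorem IsMultilin.map_inA {f : List (extSpace P) → Y} (hf : IsMultilin K f) :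
    IsMultilin K fun l : List X => f (l.map (inA P)) := fun u v => by
  simpa [Function.comp_def] using ((hf (u.map (inA P)) (v.map (inA P))).mk' ∘ₗ inA P).isLinear

namespace NCDivisor

variable (D : NCDivisor A P)

/-- The `P`-component of `μ_B` on words with two letters from `P`. -/
noncomputable def quad (l m r : List X) : P.carrier →ₗ[K] P.carrier →ₗ[K] P.carrier :=
  LinearMap.mk₂ K (fun p q => prP P (D.μ (l.map (inA P) ++ inP P p ::
      (m.map (inA P) ++ inP P q :: r.map (inA P)))))
    (fun p p' q => by
      rw [map_add, (D.multilin _ _).map_add, map_add])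
    (fun c p q => by
      rw [map_smul, (D.multilin _ _).map_smul, map_smul])
    (fun p q q' => by
      have := (D.multilin (l.map (inA P) ++ inP P p :: m.map (inA P)) (r.map (inA P))).map_add
        (inP P q) (inP P q')
      simp only [List.append_assoc, List.cons_append] at this
      rw [map_add, this, map_add])
    (fun c p q => by
      have := (D.multilin (l.map (inA P) ++ inP P p :: m.map (inA P)) (r.map (inA P))).map_smul
        c (inP P q)
      simp only [List.append_assoc, List.cons_append] at this
      rw [map_smul, this, map_smul])

theorem quad_apply (l m r : List X) (p q : P.carrier) : D.quad l m r p q =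
    prP P (D.μ (l.map (inA P) ++ inP P p :: (m.map (inA P) ++ inP P q :: r.map (inA P)))) := rfl

theorem quad_left (m r : List X) (p q : P.carrier) : IsMultilin K fun l => D.quad l m r p q :=
  ((D.multilin.append _).comp_lin (prP P)).map_inA

theorem quad_mid (l r : List X) (p q : P.carrier) : IsMultilin K fun m => D.quad l m r p q := by
  have := (((D.multilin.prepend (l.map (inA P) ++ [inP P p])).append
    (inP P q :: r.map (inA P))).comp_lin (prP P)).map_inA
  simpa [quad_apply] using this

theorem quad_right (l m : List X) (p q : P.carrier) : IsMultilin K fun r => D.quad l m r p q := by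
  have := ((D.multilin.prepend (l.map (inA P) ++ inP P p :: (m.map (inA P) ++ [inP P q]))).comp_lin
    (prP P)).map_inA
  simpa [quad_apply] using this

theorem quad_one {l m r : List X} (h : A.one ∈ l ∨ A.one ∈ m ∨ A.one ∈ r) (p q : P.carrier) :
    D.quad l m r p q = 0 := by
  have h1 : ∀ l : List X, A.one ∈ l → D.one ∈ l.map (inA P) := fun l hl => by
    rw [D.one_eq]; exact List.mem_map_of_mem hl
  rw [quad_apply, D.μ_eq_zero, map_zero]
  · rcases h with h | h | h <;> have := List.length_pos_of_mem h <;> simp <;> omega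
  · rcases h with h | h | h <;> simp [h1 _ h]

theorem quad_mred (l r : List X) :
    (fun m => D.quad l m r) ∈ MRed A (P.carrier →ₗ[K] P.carrier →ₗ[K] P.carrier) :=
  ⟨.of_apply fun p => .of_apply fun q => D.quad_mid l r p q, fun _ hm =>
    LinearMap.ext fun p => LinearMap.ext fun q => D.quad_one (.inr (.inl hm)) p q⟩

/-- The `P`-component of `μ_B` on words with two letters from `P`, as a map `P ⊗ P → P`. -/
noncomputable def quadHom : PreHom (tensor P P) P := fun l r => tLift ⟨_, D.quad_mred l r⟩

theorem quadHom_tw (l r m : List X) (p q : P.carrier) :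
    D.quadHom l r (tw P P m p q) = D.quad l m r p q := tLift_tw _ m p q

theorem quadHom_mem : D.quadHom ∈ hom (tensor P P) P (-1) := by
  refine mem_hom_tensor (fun r m p q => ?_) (fun l m p q => ?_) (fun l r m p q h => ?_)
    fun l d r n m e p i q j hl hr hm hp hq => ?_
  · simp only [quadHom_tw]; exact D.quad_left m r p q
  · simp only [quadHom_tw]; exact D.quad_right l m p q
  · rw [quadHom_tw, D.quad_one (by tauto)]
  · rw [quadHom_tw, quad_apply]
    have h := (D.μ_mem _ _ (List.rel_append (isHom_inA P hl) (.cons (inP_mem P hp)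
      (List.rel_append (isHom_inA P hm) (.cons (inP_mem P hq) (isHom_inA P hr)))))).2
    simp only [GrMod.rdeg_append, GrMod.rdeg_cons] at h
    rw [show GrMod.rdeg d + (i + GrMod.rdeg e + j) + GrMod.rdeg n + -1 = GrMod.rdeg d +
      (i - 1 - 1 + (GrMod.rdeg e + (j - 1 - 1 + GrMod.rdeg n))) + 2 + 1 by ring]
    exact h

theorem contr_map_inA (f : List (extSpace P) → Y) (l : List X) :
    contr D.toAInfStr f (l.map (inA P)) = contr A (fun x => f (x.map (inA P))) l := by
  simp only [contr, splitSum₃, splitSum_map, D.sub, map_inA_rsgn, List.map_append, List.map_cons]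

/-- The A-component of b contributes only to A, because A is a subalgebra; on the P-component the
operation is the given one of B / A. -/
theorem prP_word (l r : List X) (b : extSpace P) :
    prP P (D.μ (l.map (inA P) ++ b :: r.map (inA P))) = P.act l r (prP P b) := by
  conv_lhs => rw [← inA_add_inP P b]
  rw [(D.multilin _ _).map_add, map_add, D.quot]
  have := congrArg (prP P) (D.sub (l ++ prA P b :: r))
  simp only [List.map_append, List.map_cons, prP_inA] at this
  rw [this, zero_add]

theorem prP_word₂_left (l m r : List X) (b : extSpace P) (q : P.carrier) :
    prP P (D.μ (l.map (inA P) ++ b :: (m.map (inA P) ++ inP P q :: r.map (inA P)))) =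
      P.act (l ++ prA P b :: m) r q + D.quad l m r (prP P b) q := by
  conv_lhs => rw [← inA_add_inP P b]
  rw [(D.multilin _ _).map_add, map_add, quad_apply, ← D.quot]
  simp

theorem prP_word₂_right (l m r : List X) (b : extSpace P) (p : P.carrier) :
    prP P (D.μ (l.map (inA P) ++ inP P p :: (m.map (inA P) ++ b :: r.map (inA P)))) =
      P.act l (m ++ prA P b :: r) p + D.quad l m r p (prP P b) := by
  have := (D.multilin (l.map (inA P) ++ inP P p :: m.map (inA P)) (r.map (inA P))).map_add
    (inA P (prA P b)) (inP P (prP P b))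
  rw [inA_add_inP] at this
  simp only [List.append_assoc, List.cons_append] at this
  rw [this, map_add, quad_apply, ← D.quot]
  simp

/-- The P-component of the A∞ relation on words with two letters from P. When the inner operation
meets exactly one of them, the A-component of its value is θ of that letter, which then acts on the
other; this yields θ ⊗ id and id ⊗ θ. Every other term combines `quad` with μ_A or μ_P, and these
form the differential of `quadHom`. -/
theorem homD_quadHom : homD (tensor P P) P (-1) D.quadHom =
    actRight P (⟨D.theta, D.theta_mem_hom⟩ : hom P (diag A) 0) -
      actLeft P (⟨D.theta, D.theta_mem_hom⟩ : hom P (diag A) 0) := by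
  refine biFun_tensor_ext fun l r m p q => ?_
  have hA : ∀ (l r : List X) (p : P.carrier),
      prA P (D.μ (l.map (inA P) ++ inP P p :: r.map (inA P))) = D.thetaA l r p := fun _ _ _ => rfl
  have h := congrArg (prP P) (D.assoc
    (l.map (inA P) ++ inP P p :: (m.map (inA P) ++ inP P q :: r.map (inA P))))
  have hc : prP P (contr D.toAInfStr D.μ
    (l.map (inA P) ++ inP P p :: (m.map (inA P) ++ inP P q :: r.map (inA P)))) = 0 :=
    h.trans (map_zero _)
  have z₁ : ∀ (x y r : List X) (p q : P.carrier),
      P.act (x ++ prA P (inP P p) :: y) r q = 0 := fun x y r p q =>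
    LinearMap.congr_fun ((P.multilin_left r).zero_mid x y) q
  have z₂ : ∀ (l x y : List X) (p q : P.carrier),
      P.act l (x ++ prA P (inP P p) :: y) q = 0 := fun l x y p q =>
    LinearMap.congr_fun ((P.multilin_right l).zero_mid x y) q
  -- Sort the inner operations by which of the letters p and q they contain.
  rw [contr_comp, contr_append_cons, contr_append_cons] at hc
  simp only [splitSum_append_cons, splitSum_map, contr_map_inA, List.map_append, List.map_cons,
    map_inA_rsgn, rsgn_inP, List.append_assoc, List.cons_append, prP_word, prP_word₂_left,
    prP_word₂_right, z₁, z₂, hA, D.quot, ← quad_apply, splitSum_add, zero_add, prP_inP] at hc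
  have hR : actRight P (⟨D.theta, D.theta_mem_hom⟩ : hom P (diag A) 0) l r (tw P P m p q) =
      -splitSum (fun x y => splitSum (fun u v =>
        P.act (x ++ D.thetaA y u p :: v.map X.rsgn) (r.map X.rsgn) (P.sgn q)) m) l := by
    rw [actRight, comp_apply, ← splitSum_neg]
    refine splitSum_congr _ fun x y _ => ?_
    rw [splitSum_single_left, tensorT_nil, splitSum_hom, ← splitSum_neg]
    · refine splitSum_congr _ fun u v _ => ?_
      rw [map_rsp_zero, map_rsp_zero, sgnp_zero]
      exact leftUnit_tw P x r v (D.thetaA y u p) q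
    · intro z w _ hz
      rw [tensorT_ne_nil _ _ hz]; simp
  have hL : actLeft P (⟨D.theta, D.theta_mem_hom⟩ : hom P (diag A) 0) l r (tw P P m p q) =
      splitSum (fun u v => splitSum (fun z w =>
        P.act l (u ++ D.thetaA v z q :: w.map X.rsgn) p) r) m := by
    rw [actLeft, comp_apply, splitSum_single_right, splitSum_comm]
    · refine splitSum_congr _ fun z w _ => ?_
      rw [idT_nil, splitSum_hom]
      refine splitSum_congr _ fun u v _ => ?_
      rw [map_rsp_zero]
      exact rightUnit_tw P l w u p (D.thetaA v z q)
    · intro x y _ hy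
      refine splitSum_eq_zero fun z w _ => ?_
      rw [idT_ne_nil _ _ hy]; simp
  rw [homD_eq, Pi.sub_apply, Pi.sub_apply, Pi.smul_apply, Pi.smul_apply, Pi.sub_apply, Pi.sub_apply,
    LinearMap.sub_apply, LinearMap.smul_apply, LinearMap.sub_apply, hR, hL, bd_tensor, comp_apply]
  have hr : ∀ w : List X, w.map (rsp X (-1)) = w.map X.rsgn := fun w => by
    rw [rsp_of_odd X (by decide)]
  rw [splitSum_comm (l := r) (m := m)]
  simp only [quadHom_tw, hr, GrMod.eps_neg_one, neg_smul, one_smul, sub_neg_eq_add]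
  rw [← sub_eq_zero, ← hc]
  abel

theorem sectionClass_fixed : SelfConj P D.sectionClass D.sectionClass := by
  refine selfConj_iff.2 ((Submodule.Quotient.eq _).2 ?_)
  have h := homD_mem_coboundaries (neg_mem D.quadHom_mem) (d := 0) (by norm_num)
  rw [map_neg, homD_quadHom, neg_sub] at h
  exact h

end NCDivisor

end SectionFixed

/-! ### Words of letters from A and P, and their weight. -/

section Letters

variable {K : Type u} [Field K] {X : GrMod K} {A : AInfStr X} {P : ABimod A}
  {Y : Type*} [AddCommGroup Y] [Module K Y]

/-- The element of `A ⊕ P[1]` given by a letter from `A` or from `P`. -/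
def emb (P : ABimod A) : X ⊕ P.carrier → extSpace P := Sum.elim (inA P) (inP P)

@[simp] theorem emb_inl (a : X) : emb P (.inl a) = inA P a := rfl
@[simp] theorem emb_inr (p : P.carrier) : emb P (.inr p) = inP P p := rfl

@[simp] theorem emb_comp_inl : emb P ∘ Sum.inl = inA P := rfl

@[simp] theorem map_emb_inl (l : List X) : (l.map Sum.inl).map (emb P) = l.map (inA P) := by
  rw [List.map_map]; rfl

/-- The weight of a word, the number of letters from `P`. -/
def wt : List (X ⊕ P.carrier) → ℕ
  | [] => 0
  | .inl _ :: w => wt w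
  | .inr _ :: w => wt w + 1

@[simp] theorem wt_nil : wt (P := P) [] = 0 := rfl
@[simp] theorem wt_inl (a : X) (w : List (X ⊕ P.carrier)) : wt (.inl a :: w) = wt w := rfl
@[simp] theorem wt_inr (p : P.carrier) (w : List (X ⊕ P.carrier)) :
    wt (.inr p :: w) = wt w + 1 := rfl

@[simp] theorem wt_append (v w : List (X ⊕ P.carrier)) : wt (v ++ w) = wt v + wt w := by
  induction v with
  | nil => simp
  | cons b v ih => cases b <;> simp [ih]; omega

@[simp] theorem wt_map_inl (l : List X) : wt (P := P) (l.map Sum.inl) = 0 := by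
  induction l with
  | nil => rfl
  | cons a l ih => exact ih

theorem wt_le_length (w : List (X ⊕ P.carrier)) : wt w ≤ w.length := by
  induction w with
  | nil => simp
  | cons b w ih => cases b <;> simp <;> omega

theorem eq_map_inl_of_wt {w : List (X ⊕ P.carrier)} (h : wt w = 0) :
    ∃ l : List X, w = l.map Sum.inl := by
  induction w with
  | nil => exact ⟨[], rfl⟩
  | cons b w ih =>
    cases b with
    | inl a => obtain ⟨l, rfl⟩ := ih h; exact ⟨a :: l, rfl⟩
    | inr p => simp at h

/-- The sign operator on letters. -/
noncomputable def bsgn (P : ABimod A) : X ⊕ P.carrier → X ⊕ P.carrier := Sum.map X.rsgn P.sgn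

@[simp] theorem bsgn_inl (a : X) : bsgn P (.inl a) = .inl (X.rsgn a) := rfl
@[simp] theorem bsgn_inr (p : P.carrier) : bsgn P (.inr p) = .inr (P.sgn p) := rfl

theorem rsgn_emb (b : X ⊕ P.carrier) : (extSpace P).rsgn (emb P b) = emb P (bsgn P b) := by
  cases b
  · exact rsgn_inA P _
  · exact rsgn_inP P _

theorem map_emb_rsgn (w : List (X ⊕ P.carrier)) :
    (w.map (emb P)).map (extSpace P).rsgn = (w.map (bsgn P)).map (emb P) := by
  simp only [List.map_map]
  exact List.map_congr_left fun b _ => rsgn_emb b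

@[simp] theorem map_bsgn_inl (l : List X) :
    (l.map Sum.inl).map (bsgn P) = (l.map X.rsgn).map Sum.inl := by
  simp only [List.map_map]; rfl

@[simp] theorem wt_map_bsgn (w : List (X ⊕ P.carrier)) : wt (w.map (bsgn P)) = wt w := by
  induction w with
  | nil => rfl
  | cons b w ih => cases b <;> simp [ih]

/-- Every entry is the sum of its A- and its P-component, so expanding by multilinearity leaves only
words of pure letters, of the same length. -/
theorem IsMultilin.eq_zero_of_letters {f : List (extSpace P) → Y} (hf : IsMultilin K f)
    {l : List (extSpace P)}
    (h : ∀ w : List (X ⊕ P.carrier), w.length = l.length → f (w.map (emb P)) = 0) : f l = 0 := by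
  have key : ∀ (v : List (extSpace P)) (u : List (X ⊕ P.carrier)),
      (∀ w : List (X ⊕ P.carrier), w.length = u.length + v.length → f (w.map (emb P)) = 0) →
      f (u.map (emb P) ++ v) = 0 := by
    intro v
    induction v with
    | nil => intro u h; simpa using h u
    | cons b v ih =>
      intro u h
      have h1 := ih (u ++ [.inl (prA P b)]) fun w hw => h w (by rw [hw]; simp; omega)
      have h2 := ih (u ++ [.inr (prP P b)]) fun w hw => h w (by rw [hw]; simp; omega)
      rw [← inA_add_inP P b, (hf _ v).map_add]
      simp only [List.map_append, List.map_cons, List.map_nil, List.append_assoc, List.cons_append,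
        List.nil_append, emb_inl, emb_inr] at h1 h2
      rw [h1, h2, add_zero]
  simpa using key l [] (by simpa using h)

/-- The function `f` vanishes on all words of weight less than `n`. -/
def VanishBelow (n : ℕ) (f : List (extSpace P) → Y) : Prop :=
  ∀ w : List (X ⊕ P.carrier), wt w < n → f (w.map (emb P)) = 0

theorem VanishBelow.mono {m n : ℕ} (h : m ≤ n) {f : List (extSpace P) → Y} (hf : VanishBelow n f) :
    VanishBelow m f := fun w hw => hf w (by omega)

theorem VanishBelow.mid {n : ℕ} {f : List (extSpace P) → Y} (hf : IsMultilin K f)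
    (h : VanishBelow n f) {u t : List (X ⊕ P.carrier)} (hn : wt u + wt t + 1 < n)
    (b : extSpace P) : f (u.map (emb P) ++ b :: t.map (emb P)) = 0 := by
  have h1 := h (u ++ .inl (prA P b) :: t) (by simp; omega)
  have h2 := h (u ++ .inr (prP P b) :: t) (by simp; omega)
  simp only [List.map_append, List.map_cons, emb_inl, emb_inr] at h1 h2
  rw [← inA_add_inP P b, (hf _ _).map_add, h1, h2, add_zero]

/-- Contraction does not raise the weight: as A is a subalgebra, a block has a result with nonzero
P-component only if it contains a letter from P. -/
theorem VanishBelow.contr {D : NCDivisor A P} {n : ℕ} {f : List (extSpace P) → Y}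
    (hf : IsMultilin K f) (h : VanishBelow n f) : VanishBelow n (contr D.toAInfStr f) := by
  intro w hw
  simp only [NCGeom.contr, splitSum₃, splitSum_map]
  refine splitSum_eq_zero fun u vt huv => splitSum_eq_zero fun v t hvt => ?_
  subst huv hvt
  simp only [wt_append] at hw
  rw [← inA_add_inP P (D.μ _), (hf _ _).map_add, map_emb_rsgn]
  have h1 := h (u ++ .inl (prA P (D.μ (v.map (emb P)))) :: t.map (bsgn P)) (by simp; omega)
  have h2 : f (u.map (emb P) ++ inP P (prP P (D.μ (v.map (emb P)))) ::
      (t.map (bsgn P)).map (emb P)) = 0 := by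
    by_cases hv : wt v = 0
    · obtain ⟨l, rfl⟩ := eq_map_inl_of_wt hv
      rw [map_emb_inl, D.sub, prP_inA, map_zero, hf.zero_mid]
    · have := h (u ++ .inr (prP P (D.μ (v.map (emb P)))) :: t.map (bsgn P)) (by simp; omega)
      simpa using this
  rw [h2]
  simpa using h1

/-- The word `p ⊗ m ⊗ x` in a tensor power of `P`. -/
noncomputable def twp (P : ABimod A) (k : ℕ) (m : List X) :
    P.carrier →ₗ[K] (tpow P (k + 1)).carrier →ₗ[K] (tpow P (k + 2)).carrier :=
  tw P (tpow P (k + 1)) m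

theorem twp_ext {k : ℕ} {F G : (tpow P (k + 2)).carrier →ₗ[K] Y}
    (h : ∀ m p x, F (twp P k m p x) = G (twp P k m p x)) : F = G := tw_ext h

theorem sgn_twp (k : ℕ) (m : List X) (p : P.carrier) (x : (tpow P (k + 1)).carrier) :
    (tpow P (k + 2)).sgn (twp P k m p x) =
      twp P k (m.map X.rsgn) (P.sgn p) ((tpow P (k + 1)).sgn x) := sgn_tw m p x

/-- The bar differential on the words of a tensor power. -/
theorem bd_twp {k : ℕ} (F : BiFun (tpow P (k + 2)) Y) (l r m : List X) (p : P.carrier)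
    (x : (tpow P (k + 1)).carrier) :
    bd F l r (twp P k m p x) =
      splitSum (fun a y => splitSum (fun u v =>
        F a (r.map X.rsgn) (twp P k (v.map X.rsgn) (P.act y u p) ((tpow P (k + 1)).sgn x))) m) l +
      contr A (fun m => F l (r.map X.rsgn) (twp P k m p ((tpow P (k + 1)).sgn x))) m +
      splitSum (fun b z => splitSum (fun u v =>
        F l (z.map X.rsgn) (twp P k u p ((tpow P (k + 1)).act v b x))) m) r +
      contr A (fun r => F l r (twp P k m p x)) r +
      contr A (fun a => F a (r.map X.rsgn)
        (twp P k (m.map X.rsgn) (P.sgn p) ((tpow P (k + 1)).sgn x))) l :=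
  bd_tensor (Q := P) (P := tpow P (k + 1)) F l r m p x

/-- The relation between words of weight `k + 1`, which start and end with a letter from `P`, and
elements of `P^{⊗ (k + 1)}`. -/
inductive Rep (P : ABimod A) : ∀ k : ℕ, List (X ⊕ P.carrier) → (tpow P (k + 1)).carrier → Prop
  | one (p : P.carrier) : Rep P 0 [.inr p] p
  | cons {k : ℕ} {w : List (X ⊕ P.carrier)} {x : (tpow P (k + 1)).carrier} (p : P.carrier)
      (m : List X) (h : Rep P k w x) :
      Rep P (k + 1) (.inr p :: (m.map Sum.inl ++ w)) (twp P k m p x)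

theorem Rep.wt {k : ℕ} {w : List (X ⊕ P.carrier)} {x : (tpow P (k + 1)).carrier}
    (h : Rep P k w x) : wt w = k + 1 := by
  induction h with
  | one p => rfl
  | cons p m _ ih => simp [ih]

theorem Rep.bsgn {k : ℕ} {w : List (X ⊕ P.carrier)} {x : (tpow P (k + 1)).carrier}
    (h : Rep P k w x) : Rep P k (w.map (bsgn P)) ((tpow P (k + 1)).sgn x) := by
  induction h with
  | one p => exact .one _
  | cons p m _ ih =>
    rw [sgn_twp]
    have := Rep.cons (P.sgn p) (m.map X.rsgn) ih
    rwa [← map_bsgn_inl, ← List.map_append] at this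

theorem Rep.head {k : ℕ} {w : List (X ⊕ P.carrier)} {x : (tpow P (k + 1)).carrier}
    (h : Rep P k w x) : ∃ q w', w = .inr q :: w' := by
  cases h with
  | one p => exact ⟨_, _, rfl⟩
  | cons p m _ => exact ⟨_, _, rfl⟩

theorem Rep.ext : ∀ {k : ℕ} {F G : (tpow P (k + 1)).carrier →ₗ[K] Y},
    (∀ w x, Rep P k w x → F x = G x) → F = G
  | 0, _, _, h => LinearMap.ext fun p => h _ _ (.one p)
  | k + 1, F, G, h => twp_ext fun m p x => by
    have := Rep.ext (F := F ∘ₗ twp P k m p) (G := G ∘ₗ twp P k m p)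
      fun w x hw => h _ _ (hw.cons p m)
    exact LinearMap.congr_fun this x

/-- Cut off the letters from A before the first and after the last letter from P. -/
theorem exists_rep {n : ℕ} {w : List (X ⊕ P.carrier)} (h : wt w = n + 1) :
    ∃ (l : List X) (w' : List (X ⊕ P.carrier)) (r : List X) (x : (tpow P (n + 1)).carrier),
      w = l.map Sum.inl ++ (w' ++ r.map Sum.inl) ∧ Rep P n w' x := by
  induction w generalizing n with
  | nil => simp at h
  | cons b w ih =>
    cases b with
    | inl a =>
      obtain ⟨l, w', r, x, rfl, hx⟩ := ih h
      exact ⟨a :: l, w', r, x, rfl, hx⟩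
    | inr p =>
      rw [wt_inr, add_left_inj] at h
      cases n with
      | zero =>
        obtain ⟨r, rfl⟩ := eq_map_inl_of_wt h
        exact ⟨[], _, r, _, rfl, .one p⟩
      | succ n =>
        obtain ⟨l, w', r, x, rfl, hx⟩ := ih h
        exact ⟨[], _, r, _, by simp, hx.cons p l⟩

/-- Sums over the splittings of a word, for a summand which vanishes unless the left part of the
splitting contains a given subword. -/
theorem Rep.splitSum {k : ℕ} {w : List (X ⊕ P.carrier)} {x : (tpow P (k + 1)).carrier}
    (hw : Rep P k w x) (h : List (X ⊕ P.carrier) → List (X ⊕ P.carrier) → Y)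
    (h0 : ∀ u v, NCGeom.wt u ≤ k → h u v = 0) (l r : List X) :
    splitSum h (l.map Sum.inl ++ (w ++ r.map Sum.inl)) =
      NCGeom.splitSum (fun b z => h (l.map Sum.inl ++ (w ++ b.map Sum.inl)) (z.map Sum.inl)) r := by
  induction hw generalizing h l with
  | one p =>
    rw [List.cons_append, splitSum_append_cons, splitSum_eq_zero, zero_add]
    · simp [splitSum_map]
    · intro u v huv
      refine h0 _ _ ?_
      have := congrArg NCGeom.wt huv
      simp at this; omega
  | @cons k w x p m _ ih =>
    rw [List.cons_append, splitSum_append_cons, splitSum_eq_zero, zero_add, List.append_assoc,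
      ih (fun u v => h (l.map Sum.inl ++ .inr p :: u) v)]
    · simp
    · intro u v hu
      exact h0 _ _ (by simp; omega)
    · intro u v huv
      refine h0 _ _ ?_
      have := congrArg NCGeom.wt huv
      simp at this; omega

/-- The middle part must carry the full weight k + 1, so it contains w, and the two cuts lie in the
outer words of letters from A. -/
theorem Rep.splitSum₃ {k : ℕ} {w : List (X ⊕ P.carrier)} {x : (tpow P (k + 1)).carrier}
    (hw : Rep P k w x)
    (h : List (X ⊕ P.carrier) → List (X ⊕ P.carrier) → List (X ⊕ P.carrier) → Y)
    (h0 : ∀ u v t, NCGeom.wt v ≤ k → h u v t = 0) (l r : List X) :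
    splitSum₃ h (l.map Sum.inl ++ (w ++ r.map Sum.inl)) =
      NCGeom.splitSum (fun a y => NCGeom.splitSum (fun b z =>
        h (a.map Sum.inl) (y.map Sum.inl ++ (w ++ b.map Sum.inl)) (z.map Sum.inl)) r) l := by
  obtain ⟨q, w', e⟩ := hw.head
  have hwt := hw.wt
  have e' : l.map Sum.inl ++ (w ++ r.map Sum.inl) =
      l.map Sum.inl ++ .inr q :: (w' ++ r.map Sum.inl) := by rw [e]; simp
  rw [NCGeom.splitSum₃, e', splitSum_append_cons, splitSum_map,
    splitSum_eq_zero (l := w' ++ r.map Sum.inl), add_zero]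
  · refine splitSum_congr _ fun a y _ => ?_
    rw [← hw.splitSum (h (a.map Sum.inl)) (fun u v hu => h0 _ _ _ hu) y r, e]
    simp
  · intro u v huv
    refine splitSum_eq_zero fun v t hvt => h0 _ _ _ ?_
    subst hvt
    have := congrArg NCGeom.wt huv
    rw [e] at hwt
    simp at this hwt; omega

end Letters

/-! ### Restricting functions of words to a fixed weight. -/

section Restriction

variable {K : Type u} [Field K] {X : GrMod K} {A : AInfStr X} {P : ABimod A}
  {Y : Type*} [AddCommGroup Y] [Module K Y]

namespace NCDivisor

variable (D : NCDivisor A P)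

theorem one_mem_map {l : List X} (h : A.one ∈ l) : D.one ∈ l.map (inA P) := by
  rw [D.one_eq]; exact List.mem_map_of_mem h

/-- The word with one letter from `P`, in the bar construction of `B`. -/
noncomputable def barP : P.carrier →ₗ[K] BarT D.toAInfStr :=
  TensorAlgebra.ι K ∘ₗ (Submodule.span K {D.one}).mkQ ∘ₗ inP P

theorem barP_apply (p : P.carrier) : D.barP p = bar D.toAInfStr [inP P p] := by
  simp [barP]

theorem iota_mred {V : Type*} [AddCommGroup V] [Module K V] (φ : V →ₗ[K] BarT D.toAInfStr) :
    (fun m : List X => ((LinearMap.mul K (BarT D.toAInfStr)) ∘ₗ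
      (LinearMap.mulRight K (bar D.toAInfStr (m.map (inA P)))) ∘ₗ D.barP).compl₂ φ) ∈
      MRed A (P.carrier →ₗ[K] V →ₗ[K] BarT D.toAInfStr) := by
  refine ⟨.of_apply fun p => .of_apply fun v => ?_, fun m hm => ?_⟩
  · exact ((bar_multilin (A := D.toAInfStr)).comp_lin
      (LinearMap.mulRight K (φ v) ∘ₗ LinearMap.mulLeft K (D.barP p))).map_inA
  · refine LinearMap.ext fun p => LinearMap.ext fun v => ?_
    simp [bar_eq_zero (D.one_mem_map hm)]

/-- The map which sends elements of `P^{⊗ (k + 1)}` to words in the bar construction of `B`. -/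
noncomputable def iota : ∀ k : ℕ, (tpow P (k + 1)).carrier →ₗ[K] BarT D.toAInfStr
  | 0 => D.barP
  | k + 1 => tLift (Q := P) (P := tpow P (k + 1)) ⟨_, D.iota_mred (iota k)⟩

theorem iota_succ (k : ℕ) (m : List X) (p : P.carrier) (x : (tpow P (k + 1)).carrier) :
    D.iota (k + 1) (twp P k m p x) =
      bar D.toAInfStr (inP P p :: m.map (inA P)) * D.iota k x := by
  refine (tLift_tw _ m p x).trans ?_
  change D.barP p * bar D.toAInfStr (m.map (inA P)) * D.iota k x = _
  rw [barP_apply, ← bar_append]; rfl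

theorem iota_rep {k : ℕ} {w : List (X ⊕ P.carrier)} {x : (tpow P (k + 1)).carrier}
    (h : Rep P k w x) : D.iota k x = bar D.toAInfStr (w.map (emb P)) := by
  induction h with
  | one p => exact D.barP_apply p
  | cons p m _ ih =>
    rw [iota_succ, ih, ← bar_append]
    simp

/-- The restriction of a function of words in `A ⊕ P[1]` to words of weight `k + 1`. -/
noncomputable def res (f : MRed D.toAInfStr Y) (k : ℕ) : BiFun (tpow P (k + 1)) Y := fun l r =>
  barLift f ∘ₗ LinearMap.mulLeft K (bar D.toAInfStr (l.map (inA P))) ∘ₗ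
    LinearMap.mulRight K (bar D.toAInfStr (r.map (inA P))) ∘ₗ D.iota k

variable {D} {f : MRed D.toAInfStr Y}

theorem res_rep (f : MRed D.toAInfStr Y) {k : ℕ} {w : List (X ⊕ P.carrier)}
    {x : (tpow P (k + 1)).carrier} (h : Rep P k w x) (l r : List X) :
    D.res f k l r x = f.1 (l.map (inA P) ++ (w.map (emb P) ++ r.map (inA P))) := by
  rw [← barLift_bar f, bar_append, bar_append, ← D.iota_rep h]; rfl

/-- The restriction of a function of words in `A ⊕ P[1]` to words of weight one. -/
noncomputable def resOne (f : MRed D.toAInfStr Y) : BiFun P Y := D.res f 0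

theorem resOne_apply (f : MRed D.toAInfStr Y) (l r : List X) (p : P.carrier) :
    resOne f l r p = f.1 (l.map (inA P) ++ inP P p :: r.map (inA P)) :=
  res_rep f (.one p) l r

theorem res_multilin (f : MRed D.toAInfStr Y) (k : ℕ) : BiMultilin (D.res f k) :=
  ⟨fun r => .of_apply fun x => ((bar_multilin (A := D.toAInfStr)).comp_lin
      (barLift f ∘ₗ LinearMap.mulRight K (D.iota k x * bar D.toAInfStr (r.map (inA P))))).map_inA,
    fun l => .of_apply fun x => ((bar_multilin (A := D.toAInfStr)).comp_lin
      (barLift f ∘ₗ LinearMap.mulLeft K (bar D.toAInfStr (l.map (inA P))) ∘ₗ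
        LinearMap.mulLeft K (D.iota k x))).map_inA⟩

theorem res_one (f : MRed D.toAInfStr Y) (k : ℕ) {l r : List X} (h : A.one ∈ l ∨ A.one ∈ r) :
    D.res f k l r = 0 := by
  refine LinearMap.ext fun x => ?_
  change barLift f (bar D.toAInfStr (l.map (inA P)) *
    (D.iota k x * bar D.toAInfStr (r.map (inA P)))) = 0
  rcases h with h | h <;> simp [bar_eq_zero (D.one_mem_map h)]

/-- The function obtained by fixing the left part of a word. -/
def shift (f : MRed D.toAInfStr Y) (l : List X) (p : P.carrier) : MRed D.toAInfStr Y :=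
  ⟨fun v => f.1 (l.map (inA P) ++ inP P p :: v), by
    have := f.2.1.prepend (l.map (inA P) ++ [inP P p])
    simpa using this, fun v hv => f.2.2 _ (by simp [hv])⟩

theorem shift_apply (f : MRed D.toAInfStr Y) (l : List X) (p : P.carrier)
    (v : List (extSpace P)) : (shift f l p).1 v = f.1 (l.map (inA P) ++ inP P p :: v) := rfl

theorem res_succ (f : MRed D.toAInfStr Y) (k : ℕ) (l r m : List X) (p : P.carrier)
    (x : (tpow P (k + 1)).carrier) :
    D.res f (k + 1) l r (twp P k m p x) = D.res (shift f l p) k m r x := by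
  have : D.res f (k + 1) l r ∘ₗ twp P k m p = D.res (shift f l p) k m r :=
    Rep.ext fun w x hw => by
      rw [LinearMap.comp_apply, res_rep f (hw.cons p m), res_rep _ hw, shift_apply]
      simp
  exact LinearMap.congr_fun this x

theorem resOne_mem {S : ℤ → Submodule K Y} {c : ℤ}
    (h : ∀ l n, (extSpace P).IsHom l n → f.1 l ∈ S (GrMod.rdeg n + c)) {l r : List X}
    {m n : List ℤ} {i : ℤ} {p : P.carrier} (hl : X.IsHom l m) (hr : X.IsHom r n)
    (hp : p ∈ P.gr i) :
    resOne f l r p ∈ S (GrMod.rdeg m + i + GrMod.rdeg n + (c - 2)) := by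
  have e := h _ _ (List.rel_append (isHom_inA P hl) (.cons (inP_mem P hp) (isHom_inA P hr)))
  simp only [GrMod.rdeg_append, GrMod.rdeg_cons] at e
  rw [resOne_apply, show GrMod.rdeg m + i + GrMod.rdeg n + (c - 2) =
    GrMod.rdeg m + (i - 1 - 1 + GrMod.rdeg n) + c by ring]
  exact e

/-- A letter p of degree i has degree i - 1 in P[1] and hence reduced degree i - 2 in B, so each of
the k + 1 letters from P accounts for a shift by 2. Peeling off the first such letter reduces to
smaller k. -/
theorem res_mem {S : ℤ → Submodule K Y} {k : ℕ} {c : ℤ}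
    (h : ∀ l n, (extSpace P).IsHom l n → f.1 l ∈ S (GrMod.rdeg n + c)) {l r : List X}
    {m n : List ℤ} {i : ℤ} {x : (tpow P (k + 1)).carrier} (hl : X.IsHom l m) (hr : X.IsHom r n)
    (hx : x ∈ (tpow P (k + 1)).gr i) :
    D.res f k l r x ∈ S (GrMod.rdeg m + i + GrMod.rdeg n + (c - 2 * (k + 1))) := by
  induction k generalizing f c l m i with
  | zero =>
    rw [Nat.cast_zero, zero_add, mul_one]
    exact resOne_mem h hl hr hx
  | succ k ih =>
    refine tw_gr_le (Q := P) (P := tpow P (k + 1)) (F := D.res f (k + 1) l r)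
      (fun i₁ d j u q y hq hu hy hk => ?_) hx
    have e := ih (f := shift f l q) (c := GrMod.rdeg m + (i₁ - 2) + c) (fun v n hv => by
      have := h _ _ (List.rel_append (isHom_inA P hl) (.cons (inP_mem P hq) hv))
      simp only [GrMod.rdeg_append, GrMod.rdeg_cons] at this
      rw [shift_apply, show GrMod.rdeg n + (GrMod.rdeg m + (i₁ - 2) + c) =
        GrMod.rdeg m + (i₁ - 1 - 1 + GrMod.rdeg n) + c by ring]
      exact this) hu hy
    rw [← res_succ] at e
    subst hk
    rw [show GrMod.rdeg m + (i₁ + GrMod.rdeg d + j) + GrMod.rdeg n + (c - 2 * ((k + 1 : ℕ) + 1)) =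
      GrMod.rdeg d + j + GrMod.rdeg n + (GrMod.rdeg m + (i₁ - 2) + c - 2 * (k + 1)) by
        push_cast; ring]
    exact e

theorem res_mem_hom {Q : ABimod A} {f : MRed D.toAInfStr Q.carrier} {c d : ℤ} (k : ℕ)
    (h : ∀ l n, (extSpace P).IsHom l n → f.1 l ∈ Q.gr (GrMod.rdeg n + c))
    (hd : c - 2 * (k + 1) = d) : D.res f k ∈ hom (tpow P (k + 1)) Q d :=
  ⟨(res_multilin f k).1, (res_multilin f k).2, fun _ _ => res_one f k,
    fun _ _ _ _ _ _ hl hr hx => hd ▸ res_mem h hl hr hx⟩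

theorem shift_vanish {n : ℕ} (h : VanishBelow (n + 1) f.1) (l : List X) (p : P.carrier) :
    VanishBelow n (shift f l p).1 := fun w hw => by
  have := h (l.map Sum.inl ++ .inr p :: w) (by simp; omega)
  rw [shift_apply]
  simpa using this

/-- For a function which vanishes on words of lower weight, the contraction differential becomes
the bar differential. -/
theorem bd_res {k : ℕ} {w : List (X ⊕ P.carrier)} {x : (tpow P (k + 1)).carrier}
    (hw : Rep P k w x) (h : VanishBelow (k + 1) f.1) (l r : List X) :
    bd (D.res f k) l r x =
      contr D.toAInfStr f.1 (l.map (inA P) ++ (w.map (emb P) ++ r.map (inA P))) := by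
  have hmid : ∀ (u v : List (extSpace P)) (a : X) (q : P.carrier),
      f.1 (u ++ (inA P a + inP P q) :: v) = f.1 (u ++ inA P a :: v) + f.1 (u ++ inP P q :: v) :=
    fun u v a q => (f.2.1 u v).map_add _ _
  induction hw generalizing f l with
  | one p =>
    -- If p is contracted into A, the resulting word has weight zero and f vanishes on it. Only the
    -- μ_P part of the operation survives.
    have hz : ∀ (u v : List X) (a : X), f.1 (u.map (inA P) ++ inA P a :: v.map (inA P)) = 0 :=
      fun u v a => by
        have := h ((u ++ a :: v).map Sum.inl) (by simp)
        simpa [-List.map_map] using this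
    have e : bd (resOne f) l r p = contr D.toAInfStr f.1
        (l.map (inA P) ++ inP P p :: r.map (inA P)) := by
      rw [bd_apply, comp_apply, bdA_apply, contr_append_cons]
      simp only [resOne_apply, contr_map_inA, splitSum_map, D.word, hmid, hz, zero_add, rsgn_inP,
        map_inA_rsgn, map_rsp_one]
      abel
    exact e
  -- Contractions to the right of the first letter p from P form the differential of the shifted
  -- function, known by induction. Those to its left or containing it match the terms of the tensor
  -- product differential for the left word and for μ_P on p.
  | @cons k w x p m hw ih =>
    obtain ⟨q, w', e⟩ := hw.head
    have hwt := hw.wt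
    have hS : bd (D.res (shift f l p) k) m r x = _ :=
      ih (shift_vanish h l p) m fun u v a q => (shift f l p).2.1 u v |>.map_add _ _
    rw [bd_apply, comp_apply, bdA_apply] at hS
    rw [bd_twp]
    simp only [res_succ]
    have hmap : (Sum.inr p :: (m.map Sum.inl ++ w)).map (emb P) ++ r.map (inA P) =
        inP P p :: (m.map (inA P) ++ (w.map (emb P) ++ r.map (inA P))) := by simp
    have hz : ∀ (u t : List X) (a : X), f.1 (u.map (inA P) ++ inA P a ::
        (t.map (inA P) ++ ((w.map (bsgn P)).map (emb P) ++ (r.map X.rsgn).map (inA P)))) = 0 :=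
      fun u t a => by
        have := h ((u ++ a :: t).map Sum.inl ++ (w.map (bsgn P) ++ (r.map X.rsgn).map Sum.inl))
          (by simp only [wt_append, wt_map_inl, wt_map_bsgn]; omega)
        simpa only [List.map_append, List.map_cons, map_emb_inl, List.append_assoc,
          List.cons_append, emb_inl] using this
    have hW : (m.map (inA P) ++ (w.map (emb P) ++ r.map (inA P))).map (extSpace P).rsgn =
        (m.map X.rsgn).map (inA P) ++ ((w.map (bsgn P)).map (emb P) ++
          (r.map X.rsgn).map (inA P)) := by
      simp only [List.map_append, map_inA_rsgn, map_emb_rsgn]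
    -- A contracted block which contains p and the next letter q from P would lower the weight, and
    -- f would vanish. So the block ends inside m.
    have hmidsum : ∀ u v : List X, splitSum (fun z t => f.1 (u.map (inA P) ++
        D.μ (v.map (inA P) ++ inP P p :: z) :: t.map (extSpace P).rsgn))
          (m.map (inA P) ++ (w.map (emb P) ++ r.map (inA P))) =
        splitSum (fun z t => D.res (shift f u (P.act v z p)) k (t.map X.rsgn) (r.map X.rsgn)
          ((tpow P (k + 1)).sgn x)) m := by
      intro u v
      have e' : m.map (inA P) ++ (w.map (emb P) ++ r.map (inA P)) =
          m.map (inA P) ++ inP P q :: (w' ++ r.map Sum.inl).map (emb P) := by simp [e]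
      rw [e', splitSum_append_cons, splitSum_map (l := w' ++ r.map Sum.inl),
        splitSum_eq_zero (l := w' ++ r.map Sum.inl), add_zero, splitSum_map]
      · refine splitSum_congr _ fun z t _ => ?_
        have e'' : t.map (inA P) ++ inP P q :: (w' ++ r.map Sum.inl).map (emb P) =
          t.map (inA P) ++ (w.map (emb P) ++ r.map (inA P)) := by simp [e]
        rw [D.word, hmid, res_rep _ hw.bsgn, shift_apply, e'']
        simp only [List.map_append, map_inA_rsgn, map_emb_rsgn, hz, zero_add]
      · intro z t hzt
        have := congrArg wt hzt
        rw [e] at hwt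
        simp only [wt_append, wt_map_inl, wt_inr] at this hwt
        have h0 := h.mid f.2.1 (u := u.map Sum.inl) (t := t.map (bsgn P))
          (by simp only [wt_map_inl, wt_map_bsgn]; omega)
        rw [map_emb_rsgn, ← map_emb_inl]
        exact h0 _
    have hsh : contr D.toAInfStr (fun v => f.1 (l.map (inA P) ++ inP P p :: v))
        (m.map (inA P) ++ (w.map (emb P) ++ r.map (inA P))) = _ := hS.symm
    rw [hmap, contr_append_cons, contr_map_inA, splitSum_map, hsh, splitSum_comm (l := m) (m := r)]
    simp only [hmidsum, hW, rsgn_inP, res_rep _ hw.bsgn, shift_apply, map_rsp_one]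
    abel

end NCDivisor

end Restriction

/-! ### Extending maps on tensor powers to functions of words. -/

section Induction

variable {K : Type u} [Field K] {X : GrMod K} {A : AInfStr X} {P : ABimod A}
  {Y : Type*} [AddCommGroup Y] [Module K Y]

/-- The function of words in `A ⊕ P[1]` which is given by `Φ` on words of weight `k + 1`, and
vanishes on words of any other weight. -/
noncomputable def induce : List (extSpace P) → ∀ k : ℕ, BiFun (tpow P (k + 1)) Y → Y
  | [], _, _ => 0
  | b :: l, 0, Φ => Φ [] (l.map (prA P)) (prP P b) + induce l 0 (fun m r => Φ (prA P b :: m) r)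
  | b :: l, k + 1, Φ => induce l k (fun m r => Φ [] r ∘ₗ twp P k m (prP P b)) +
      induce l (k + 1) (fun m r => Φ (prA P b :: m) r)

theorem induce_isLinear (l : List (extSpace P)) (k : ℕ) :
    IsLinearMap K (induce (P := P) (Y := Y) l k) := by
  induction l generalizing k with
  | nil => exact ⟨fun _ _ => (add_zero 0).symm, fun c _ => (smul_zero c).symm⟩
  | cons b l ih =>
    have ht : ∀ Q : ABimod A, IsLinearMap K fun Φ : BiFun Q Y =>
        (fun m r => Φ (prA P b :: m) r : BiFun Q Y) := fun _ => ⟨fun _ _ => rfl, fun _ _ => rfl⟩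
    cases k with
    | zero =>
      have h0 : IsLinearMap K fun Φ : BiFun P Y => Φ [] (l.map (prA P)) (prP P b) :=
        ⟨fun _ _ => rfl, fun _ _ => rfl⟩
      exact (h0.mk' + (ih 0).mk' ∘ₗ (ht P).mk').isLinear
    | succ k =>
      have hp : IsLinearMap K fun Φ : BiFun (tpow P (k + 2)) Y =>
          (fun m r => Φ [] r ∘ₗ twp P k m (prP P b) : BiFun (tpow P (k + 1)) Y) :=
        ⟨fun _ _ => rfl, fun _ _ => rfl⟩
      exact ((ih k).mk' ∘ₗ hp.mk' + (ih (k + 1)).mk' ∘ₗ (ht _).mk').isLinear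

theorem induce_zero (l : List (extSpace P)) (k : ℕ) : induce (Y := Y) l k 0 = 0 :=
  (induce_isLinear l k).map_zero

theorem BiMultilin.tail {Q : ABimod A} {Φ : BiFun Q Y} (hΦ : BiMultilin Φ) (a : X) :
    BiMultilin (P := Q) fun m r => Φ (a :: m) r :=
  ⟨fun r => (hΦ.1 r).prepend [a], fun m => hΦ.2 (a :: m)⟩

theorem BiMultilin.peel {k : ℕ} {Φ : BiFun (tpow P (k + 2)) Y} (hΦ : BiMultilin Φ)
    (p : P.carrier) :
    BiMultilin (P := tpow P (k + 1)) fun m r => Φ [] r ∘ₗ twp P k m p :=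
  ⟨fun r => .of_apply fun x => tw_comp (Q := P) (P := tpow P (k + 1)) (Φ [] r) p x,
    fun m => (hΦ.2 []).comp_lin (LinearMap.lcomp K Y (twp P k m p))⟩

theorem isLinear_tail {Q : ABimod A} {Φ : BiFun Q Y} (hΦ : BiMultilin Φ) :
    IsLinearMap K fun b : extSpace P => (fun m r => Φ (prA P b :: m) r : BiFun Q Y) :=
  ⟨fun b c => funext fun m => funext fun r => by
    rw [map_add]; exact (hΦ.1 r [] m).map_add _ _,
    fun c b => funext fun m => funext fun r => by
    rw [map_smul]; exact (hΦ.1 r [] m).map_smul _ _⟩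

theorem isLinear_peel {k : ℕ} (Φ : BiFun (tpow P (k + 2)) Y) :
    IsLinearMap K fun b : extSpace P =>
      (fun m r => Φ [] r ∘ₗ twp P k m (prP P b) : BiFun (tpow P (k + 1)) Y) :=
  ⟨fun b c => funext fun m => funext fun r => by rw [map_add, map_add, LinearMap.comp_add]; rfl,
    fun c b => funext fun m => funext fun r => by
    rw [map_smul, map_smul, LinearMap.comp_smul]; rfl⟩

theorem IsMultilin.map_prA {f : List X → Y} (hf : IsMultilin K f) :
    IsMultilin K fun l : List (extSpace P) => f (l.map (prA P)) := fun u v => by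
  simpa [Function.comp_def] using ((hf (u.map (prA P)) (v.map (prA P))).mk' ∘ₗ prA P).isLinear

theorem induce_multilin {k : ℕ} {Φ : BiFun (tpow P (k + 1)) Y} (hΦ : BiMultilin Φ) :
    IsMultilin K fun l => induce l k Φ := by
  intro u v
  induction u generalizing k with
  | nil =>
    cases k with
    | zero => exact (Φ [] (v.map (prA P)) ∘ₗ prP P +
        (induce_isLinear v 0).mk' ∘ₗ (isLinear_tail hΦ).mk').isLinear
    | succ k => exact ((induce_isLinear v k).mk' ∘ₗ (isLinear_peel Φ).mk' +
        (induce_isLinear v (k + 1)).mk' ∘ₗ (isLinear_tail hΦ).mk').isLinear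
  | cons c u ih =>
    cases k with
    | zero =>
      have h := ((hΦ.2 []).comp_lin (LinearMap.applyₗ (prP P c))).map_prA u v
      exact (h.mk' + (ih (hΦ.tail (prA P c))).mk').isLinear
    | succ k => exact ((ih (hΦ.peel (prP P c))).mk' + (ih (hΦ.tail (prA P c))).mk').isLinear

theorem induce_one {k : ℕ} {Φ : BiFun (tpow P (k + 1)) Y}
    (hΦ : ∀ l r, A.one ∈ l ∨ A.one ∈ r → Φ l r = 0) {l : List (extSpace P)}
    (hl : inA P A.one ∈ l) : induce l k Φ = 0 := by
  induction l generalizing k with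
  | nil => simp at hl
  | cons b l ih =>
    have h2 : induce l k (fun m r => Φ (prA P b :: m) r) = 0 := by
      rcases List.mem_cons.1 hl with rfl | h
      · have : (fun m r => Φ (prA P (inA P A.one) :: m) r) = 0 :=
          funext fun m => funext fun r => hΦ _ _ (.inl (by simp))
        rw [this, induce_zero]
      · exact ih (fun m r hm => hΦ _ _ (hm.imp_left (List.mem_cons_of_mem _))) h
    have h3 : ∀ h : inA P A.one ∈ l, A.one ∈ l.map (prA P) := fun h =>
      List.mem_map_of_mem (f := prA P) h
    cases k with
    | zero =>
      rw [induce, h2, add_zero]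
      rcases List.mem_cons.1 hl with rfl | h
      · rw [prP_inA]; exact map_zero _
      · rw [hΦ _ _ (.inr (h3 h))]; rfl
    | succ k =>
      rw [induce, h2, add_zero]
      rcases List.mem_cons.1 hl with rfl | h
      · have : (fun m r => Φ [] r ∘ₗ twp P k m (prP P (inA P A.one))) = 0 :=
          funext fun m => funext fun r => by
            rw [prP_inA, map_zero, LinearMap.comp_zero]; rfl
        rw [this, induce_zero]
      · refine ih (fun m r hm => ?_) h
        rcases hm with hm | hm
        · have : twp P k m = 0 := (tw_mred P (tpow P (k + 1))).2 m hm
          rw [this, LinearMap.zero_apply, LinearMap.comp_zero]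
        · rw [hΦ _ _ (.inr hm), LinearMap.zero_comp]

theorem isHom_prA {l : List (extSpace P)} {n : List ℤ} (h : (extSpace P).IsHom l n) :
    X.IsHom (l.map (prA P)) n := by
  induction h with
  | nil => exact .nil
  | cons h _ ih => exact .cons h.1 ih

/-- Converse to the degree count in `res_mem`: each of the k + 1 tensor factors adds 2. -/
theorem induce_mem {S : ℤ → Submodule K Y} {k : ℕ} {d : ℤ} {Φ : BiFun (tpow P (k + 1)) Y}
    (hΦ : ∀ l m r n i x, X.IsHom l m → X.IsHom r n → x ∈ (tpow P (k + 1)).gr i →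
      Φ l r x ∈ S (GrMod.rdeg m + i + GrMod.rdeg n + d)) {l : List (extSpace P)} {n : List ℤ}
    (hl : (extSpace P).IsHom l n) : induce l k Φ ∈ S (GrMod.rdeg n + (d + 2 * (k + 1))) := by
  induction hl generalizing k d with
  | nil => exact zero_mem _
  | @cons b j l n hb hl ih =>
    have h2 : induce l k (fun m r => Φ (prA P b :: m) r) ∈
        S (GrMod.rdeg (j :: n) + (d + 2 * (k + 1))) := by
      have := ih (d := d + (j - 1)) (Φ := fun m r => Φ (prA P b :: m) r)
        fun l m r n i x hl hr hx => by
          have := hΦ _ _ _ _ _ _ (List.Forall₂.cons hb.1 hl) hr hx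
          rw [GrMod.rdeg_cons] at this
          rw [show GrMod.rdeg m + i + GrMod.rdeg n + (d + (j - 1)) =
            j - 1 + GrMod.rdeg m + i + GrMod.rdeg n + d by ring]
          exact this
      rw [GrMod.rdeg_cons, show j - 1 + GrMod.rdeg n + (d + 2 * ((k : ℤ) + 1)) =
        GrMod.rdeg n + (d + (j - 1) + 2 * (k + 1)) by ring]
      exact this
    cases k with
    | zero =>
      refine add_mem ?_ h2
      have := hΦ [] [] _ _ _ _ .nil (isHom_prA hl) hb.2
      rw [GrMod.rdeg_nil] at this
      rw [GrMod.rdeg_cons, show j - 1 + GrMod.rdeg n + (d + 2 * (((0 : ℕ) : ℤ) + 1)) =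
        0 + (j + 1) + GrMod.rdeg n + d by push_cast; ring]
      exact this
    | succ k =>
      refine add_mem ?_ h2
      have := ih (d := d + (j + 1)) (Φ := fun m r => Φ [] r ∘ₗ twp P k m (prP P b))
        fun l m r n i x hl hr hx => by
          have := hΦ [] [] r n _ _ .nil hr (tw_mem_gr (P := tpow P (k + 1)) hb.2 hl hx rfl)
          rw [GrMod.rdeg_nil] at this
          rw [show GrMod.rdeg m + i + GrMod.rdeg n + (d + (j + 1)) =
            0 + (j + 1 + GrMod.rdeg m + i) + GrMod.rdeg n + d by ring]
          exact this
      rw [GrMod.rdeg_cons, show j - 1 + GrMod.rdeg n + (d + 2 * (((k + 1 : ℕ) : ℤ) + 1)) =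
        GrMod.rdeg n + (d + (j + 1) + 2 * (k + 1)) by push_cast; ring]
      exact this

theorem induce_inA {k : ℕ} (Φ : BiFun (tpow P (k + 1)) Y) (a : X) (l : List (extSpace P)) :
    induce (inA P a :: l) k Φ = induce l k fun m r => Φ (a :: m) r := by
  cases k with
  | zero => exact (congrArg (· + _) (map_zero (Φ [] (l.map (prA P))))).trans (zero_add _)
  | succ k =>
    have : (fun m r => Φ [] r ∘ₗ twp P k m (prP P (inA P a))) = 0 :=
      funext fun m => funext fun r => by rw [prP_inA, map_zero, LinearMap.comp_zero]; rfl
    rw [induce, this, induce_zero, zero_add, prA_inA]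

theorem tail_zero {k : ℕ} {Φ : BiFun (tpow P (k + 1)) Y} (hΦ : BiMultilin Φ) (p : P.carrier) :
    (fun m r => Φ (prA P (inP P p) :: m) r) = 0 :=
  funext fun m => funext fun r => (hΦ.1 r [] m).map_zero

theorem induce_inP_zero {Φ : BiFun (tpow P (0 + 1)) Y} (hΦ : BiMultilin Φ) (p : P.carrier)
    (l : List (extSpace P)) : induce (inP P p :: l) 0 Φ = Φ [] (l.map (prA P)) p := by
  rw [induce, tail_zero hΦ, induce_zero, add_zero, prP_inP]

theorem induce_inP_succ {k : ℕ} {Φ : BiFun (tpow P (k + 2)) Y} (hΦ : BiMultilin Φ) (p : P.carrier)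
    (l : List (extSpace P)) : induce (inP P p :: l) (k + 1) Φ =
      induce l k fun m r => Φ [] r ∘ₗ twp P k m p := by
  rw [induce, tail_zero hΦ, induce_zero, add_zero, prP_inP]

/-- Each tensor factor consumes the P-component of one letter, so with fewer than k + 1 letters from
P some factor is zero. -/
theorem induce_vanish {k : ℕ} {Φ : BiFun (tpow P (k + 1)) Y} (hΦ : BiMultilin Φ) :
    VanishBelow (P := P) (k + 1) fun l => induce l k Φ := by
  intro w hw
  induction w generalizing k with
  | nil => rfl
  | cons b w ih =>
    cases b with
    | inl a => exact (induce_inA Φ a _).trans (ih (hΦ.tail a) hw)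
    | inr p =>
      cases k with
      | zero => simp at hw
      | succ k => exact (induce_inP_succ hΦ p _).trans (ih (hΦ.peel p) (by simpa using hw))

theorem induce_map_inA_append {k : ℕ} (Φ : BiFun (tpow P (k + 1)) Y) (l : List X)
    (v : List (extSpace P)) :
    induce (l.map (inA P) ++ v) k Φ = induce v k fun m r => Φ (l ++ m) r := by
  induction l generalizing Φ with
  | nil => rfl
  | cons a l ih => exact (induce_inA Φ a _).trans (ih _)

theorem BiMultilin.drop {Q : ABimod A} {Φ : BiFun Q Y} (hΦ : BiMultilin Φ) (l : List X) :
    BiMultilin (P := Q) fun m r => Φ (l ++ m) r :=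
  ⟨fun r => (hΦ.1 r).prepend l, fun m => hΦ.2 (l ++ m)⟩

theorem induce_rep_append {k : ℕ} {Φ : BiFun (tpow P (k + 1)) Y} (hΦ : BiMultilin Φ)
    {w : List (X ⊕ P.carrier)} {x : (tpow P (k + 1)).carrier} (hw : Rep P k w x) (r : List X) :
    induce (w.map (emb P) ++ r.map (inA P)) k Φ = Φ [] r x := by
  induction hw with
  | one p =>
    have hr : (r.map (inA P)).map (prA P) = r := by simp [Function.comp_def]
    exact (induce_inP_zero hΦ p _).trans (congrArg (fun r => Φ [] r p) hr)
  | @cons k w x p m hw ih =>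
    have e : (m.map Sum.inl ++ w).map (emb P) ++ r.map (inA P) =
      m.map (inA P) ++ (w.map (emb P) ++ r.map (inA P)) := by simp
    refine (induce_inP_succ hΦ p _).trans ?_
    refine (congrArg (fun l => induce l k _) e).trans ?_
    rw [induce_map_inA_append]
    exact (ih ((hΦ.peel p).drop m)).trans
      (congrArg (fun m => Φ [] r (twp P k m p x)) m.append_nil)

theorem induce_rep {k : ℕ} {Φ : BiFun (tpow P (k + 1)) Y} (hΦ : BiMultilin Φ)
    {w : List (X ⊕ P.carrier)} {x : (tpow P (k + 1)).carrier} (hw : Rep P k w x) (l r : List X) :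
    induce (l.map (inA P) ++ (w.map (emb P) ++ r.map (inA P))) k Φ = Φ l r x := by
  rw [induce_map_inA_append]
  exact (induce_rep_append (hΦ.drop l) hw r).trans (congrArg (fun l => Φ l r x) l.append_nil)

/-- Every element of the hom complex defined on a tensor power of `P` is the restriction of a
function of words. -/
theorem NCDivisor.exists_res_eq (D : NCDivisor A P) {Q : ABimod A} {k : ℕ} {d : ℤ}
    {Φ : PreHom (tpow P (k + 1)) Q} (hΦ : Φ ∈ hom (tpow P (k + 1)) Q d) :
    ∃ g : MRed D.toAInfStr Q.carrier, D.res g k = Φ ∧ VanishBelow (k + 1) g.1 ∧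
      ∀ l n, (extSpace P).IsHom l n → g.1 l ∈ Q.gr (GrMod.rdeg n + (d + 2 * (k + 1))) := by
  have hm := hom_multilin hΦ
  refine ⟨⟨fun l => induce l k Φ, induce_multilin hm, fun l hl => induce_one hΦ.2.2.1
    (D.one_eq ▸ hl)⟩, ?_, induce_vanish hm, fun l n hl => induce_mem hΦ.2.2.2 hl⟩
  funext l r
  exact Rep.ext fun w x hw => (res_rep _ hw l r).trans (induce_rep hm hw l r)

end Induction

/-! ### Sums over decompositions of a word into nonempty blocks. -/

section Blocks

variable {α β M : Type*} [AddCommMonoid M]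

/-- A composition of n + 1 is determined by its first block, of size i + 1, and a composition of the
rest. -/
theorem sum_composition_succ (n : ℕ) (g : List ℕ → M) :
    ∑ c : Composition (n + 1), g c.blocks =
      ∑ i ∈ Finset.range (n + 1), ∑ c : Composition (n - i), g ((i + 1) :: c.blocks) := by
  rw [Finset.sum_sigma']
  symm
  refine Finset.sum_bij (fun x hx => (⟨(x.1 + 1) :: x.2.blocks, fun {i} hi => ?_, ?_⟩ :
    Composition (n + 1))) (fun _ _ => Finset.mem_univ _) ?_ ?_ (fun _ _ => rfl)
  · rcases List.mem_cons.1 hi with rfl | h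
    · omega
    · exact x.2.blocks_pos h
  · have := Finset.mem_range.1 (Finset.mem_sigma.1 hx).1
    rw [List.sum_cons, x.2.blocks_sum]; omega
  · rintro ⟨i, c⟩ _ ⟨j, d⟩ _ h
    have h' := congrArg Composition.blocks h
    simp only [List.cons.injEq, add_left_inj] at h'
    obtain ⟨rfl, h2⟩ := h'
    rw [Composition.ext h2]
  · rintro c -
    obtain ⟨b, hb, hs⟩ := c
    cases b with
    | nil => simp at hs
    | cons j b =>
      have hj := hb List.mem_cons_self
      rw [List.sum_cons] at hs
      refine ⟨⟨j - 1, ⟨b, fun hi => hb (List.mem_cons_of_mem _ hi), by omega⟩⟩, ?_, ?_⟩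
      · simp; omega
      · refine Composition.ext ?_
        simp; omega

/-- The sum of `f [F u₁, …, F u_k]` over all ways of writing `l` as a concatenation of nonempty
words `u₁, …, u_k`. -/
def fsum (F : List α → β) (f : List β → M) (l : List α) : M :=
  ∑ c : Composition l.length, f ((l.splitWrtComposition c).map F)

variable {F G : List α → β}

theorem fsum_nil (f : List β → M) : fsum F f [] = f [] := by
  have : ∀ c : Composition 0, c.blocks = [] := fun c => c.blocks_eq_nil.2 rfl
  have e : ∀ c : Composition 0, f ((([] : List α).splitWrtComposition c).map F) = f [] := fun c => by
    rw [List.splitWrtComposition, this c]; rfl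
  refine (Finset.sum_congr rfl fun c _ => e c).trans ?_
  have hc : Fintype.card (Composition 0) = 1 := composition_card 0
  rw [Finset.sum_const, Finset.card_univ, hc, one_smul]

theorem fsum_cons (f : List β → M) (a : α) (l : List α) :
    fsum F f (a :: l) = splitSum (fun u v => fsum F (fun t => f (F (a :: u) :: t)) v) l := by
  have := sum_composition_succ l.length
    fun b => f (((a :: l).splitWrtCompositionAux b).map F)
  refine this.trans (Finset.sum_congr rfl fun i hi => ?_)
  have hlen : (l.drop i).length = l.length - i := List.length_drop
  simp only [List.splitWrtCompositionAux_cons, List.map_cons, List.take_succ_cons,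
    List.drop_succ_cons]
  rw [fsum]
  simp only [List.splitWrtComposition]
  rw [hlen]

theorem fsum_add (f g : List β → M) (l : List α) :
    fsum F (fun t => f t + g t) l = fsum F f l + fsum F g l := Finset.sum_add_distrib

theorem fsum_zero (l : List α) : fsum F (fun _ => (0 : M)) l = 0 := Finset.sum_const_zero

theorem fsum_hom {N H : Type*} [AddCommMonoid N] [FunLike H M N] [AddMonoidHomClass H M N]
    (φ : H) (f : List β → M) (l : List α) :
    φ (fsum F f l) = fsum F (fun t => φ (f t)) l := map_sum φ _ _

theorem fsum_splitSum {γ : Type*} (f : List γ → List γ → List β → M) (m : List γ) (l : List α) :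
    fsum F (fun t => splitSum (fun u v => f u v t) m) l =
      splitSum (fun u v => fsum F (f u v) l) m := Finset.sum_comm

theorem fsum_congr {f g : List β → M} (l : List α) (hl : l ≠ []) (h : ∀ t, t ≠ [] → f t = g t) :
    fsum F f l = fsum F g l := by
  cases l with
  | nil => exact absurd rfl hl
  | cons a l =>
    rw [fsum_cons, fsum_cons]
    exact splitSum_congr _ fun u v _ => congrArg (fun k => fsum F k v)
      (funext fun t => h _ (by simp))

theorem fsum_eq_single {f : List β → M} (h : ∀ t, 2 ≤ t.length → f t = 0) (l : List α)
    (hl : l ≠ []) : fsum F f l = f [F l] := by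
  cases l with
  | nil => exact absurd rfl hl
  | cons a l =>
    rw [fsum_cons, splitSum_single_right, fsum_nil]
    intro u v _ hv
    rw [fsum_congr v hv (g := fun _ => 0), fsum_zero]
    intro t ht
    have := List.length_pos_iff.2 ht
    exact h _ (by simp; omega)

/-- Induction on words, with the induction hypothesis for all proper right factors. -/
theorem suffix_induction {motive : List α → Prop} (nil : motive [])
    (cons : ∀ a l, (∀ u v, l = u ++ v → motive v) → motive (a :: l)) (l : List α) : motive l := by
  have key : ∀ n, ∀ l : List α, l.length ≤ n → motive l := by
    intro n
    induction n with
    | zero => intro l hl; rw [List.eq_nil_of_length_eq_zero (by omega : l.length = 0)]; exact nil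
    | succ n ih =>
      intro l hl
      cases l with
      | nil => exact nil
      | cons a l =>
        refine cons a l fun u v h => ih v ?_
        have := congrArg List.length h
        simp at this hl; omega
  exact key _ l le_rfl

theorem fsum_congr_left (f : List β → M) (l : List α) (h : ∀ u, u.length ≤ l.length → F u = G u) :
    fsum F f l = fsum G f l := by
  induction l using suffix_induction generalizing f with
  | nil => rw [fsum_nil, fsum_nil]
  | cons a l ih =>
    rw [fsum_cons, fsum_cons]
    refine splitSum_congr _ fun u v huv => ?_
    have e := congrArg List.length huv
    rw [List.length_append] at e
    rw [h (a :: u) (by simp; omega),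
      ih u v huv (fun t => f (G (a :: u) :: t)) fun w hw => h w (by simp; omega)]

/-- Cutting the word of block images amounts to cutting the original word at a boundary between
blocks. -/
theorem fsum_splitSum_eq (H : List β → List β → M) (l : List α) :
    fsum F (fun t => splitSum H t) l =
      splitSum (fun u v => fsum F (fun s => fsum F (H s) v) u) l := by
  induction l using suffix_induction generalizing H with
  | nil => simp only [fsum_nil, splitSum_nil]
  | cons a l ih =>
    rw [fsum_cons, splitSum_cons, fsum_nil, fsum_cons]
    simp only [splitSum_cons, fsum_add, splitSum_add]
    congr 1
    refine (splitSum_congr _ fun u v huv => ih u v huv fun s t => H (F (a :: u) :: s) t).trans ?_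
    exact (splitSum_assoc (fun x y v =>
      fsum F (fun s => fsum F (H (F (a :: x) :: s)) v) y) l).symm.trans
        (splitSum_congr _ fun u v _ => (fsum_cons (fun s => fsum F (H s) v) a u).symm)

/-- Single out the block that contains b; the words to its left and right are then decomposed
independently. -/
theorem fsum_append_cons (f : List β → M) (u : List α) (b : α) (w : List α) :
    fsum F f (u ++ b :: w) = splitSum (fun u₁ u₂ => splitSum (fun w₁ w₂ =>
      fsum F (fun x => fsum F (fun z => f (x ++ F (u₂ ++ b :: w₁) :: z)) w₂) u₁) w) u := by
  induction u using suffix_induction generalizing f with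
  | nil =>
    rw [List.nil_append, fsum_cons, splitSum_nil]
    simp only [fsum_nil, List.nil_append]
  | cons a u ih =>
    rw [List.cons_append, fsum_cons, splitSum_append_cons, splitSum_cons, add_comm]
    simp only [fsum_nil, List.nil_append, List.cons_append]
    congr 1
    have e : ∀ x y, u = x ++ y → fsum F (fun t => f (F (a :: x) :: t)) (y ++ b :: w) =
        splitSum (fun s v => splitSum (fun w₁ w₂ => fsum F (fun s => fsum F (fun z =>
          f (F (a :: x) :: (s ++ F (v ++ b :: w₁) :: z))) w₂) s) w) y :=
      fun x y h => ih x y h fun t => f (F (a :: x) :: t)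
    rw [splitSum_congr _ e]
    have hs := splitSum_assoc (fun x y v => splitSum (fun w₁ w₂ => fsum F (fun s => fsum F (fun z =>
      f (F (a :: x) :: (s ++ F (v ++ b :: w₁) :: z))) w₂) y) w) u
    rw [splitSum₃] at hs
    rw [← hs]
    refine splitSum_congr _ fun u v _ => ?_
    rw [splitSum_comm]
    refine splitSum_congr _ fun w₁ w₂ _ => ?_
    rw [fsum_cons]
    rfl

theorem fsum_map (f : List β → M) (g : α → α) (g' : β → β) (h : ∀ u, F (u.map g) = g' (F u))
    (l : List α) : fsum F f (l.map g) = fsum F (fun t => f (t.map g')) l := by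
  induction l using suffix_induction generalizing f with
  | nil => simp [fsum_nil]
  | cons a l ih =>
    rw [List.map_cons, fsum_cons, fsum_cons, splitSum_map]
    refine splitSum_congr _ fun u v huv => ?_
    rw [ih u v huv, ← List.map_cons, h]
    rfl

end Blocks

/-! ### A∞-homomorphisms and the failure to be one. -/

section Morphisms

variable {K : Type u} [Field K] {X : GrMod K} {M M' : AInfStr X}
  {Y : Type*} [AddCommGroup Y] [Module K Y] {F : List X → X} {f : List X → Y}

theorem fsum_isLinear {Z : Type*} [AddCommGroup Z] [Module K Z] {g : Z → List X → Y} (l : List X)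
    (h : ∀ t, IsLinearMap K fun a => g a t) : IsLinearMap K fun a => fsum F (g a) l :=
  ⟨fun a b => by simp only [fsum, (h _).map_add, Finset.sum_add_distrib],
    fun c a => by simp only [fsum, (h _).map_smul, Finset.smul_sum]⟩

/-- The sum over all block decompositions of the words which extend a given letter. -/
noncomputable def ins (F : List X → X) (hf : IsMultilin K f) (x w : List X) : X →ₗ[K] Y :=
  (fsum_isLinear (F := F) (g := fun a z => f (x ++ a :: z)) w fun t => hf x t).mk'

theorem ins_apply (hf : IsMultilin K f) (x w : List X) (a : X) :
    ins F hf x w a = fsum F (fun z => f (x ++ a :: z)) w := rfl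

theorem ins_isLinear (hf : IsMultilin K f) (w u : List X) :
    IsLinearMap K fun a => fsum F (fun x => ins F hf x w a) u :=
  fsum_isLinear u fun x => (ins F hf x w).isLinear

theorem fsum_multilin (hF : IsMultilin K F) (hf : IsMultilin K f) :
    IsMultilin K fun l => fsum F f l := by
  intro u w
  simp only [fsum_append_cons]
  exact IsLinearMap.splitSum (f := fun b u₁ u₂ => splitSum (fun w₁ w₂ => fsum F (fun x =>
    fsum F (fun z => f (x ++ F (u₂ ++ b :: w₁) :: z)) w₂) u₁) w) u fun u₁ u₂ _ =>
    IsLinearMap.splitSum (f := fun b w₁ w₂ => fsum F (fun x =>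
      fsum F (fun z => f (x ++ F (u₂ ++ b :: w₁) :: z)) w₂) u₁) w fun w₁ w₂ _ =>
      ((ins_isLinear (F := F) hf w₂ u₁).mk' ∘ₗ (hF u₂ w₁).mk').isLinear

variable (M M' F) in
/-- The failure of `F` to satisfy the equations of an `A∞`-homomorphism. -/
noncomputable def defect (l : List X) : X := fsum F M'.μ l - contr M F l

theorem defect_multilin (hF : IsMultilin K F) : IsMultilin K (defect M M' F) := fun u v =>
  ((fsum_multilin hF M'.multilin u v).mk' - (contr_multilin hF u v).mk').isLinear

/-- An operation of M' applied to consecutive block images amounts to a subword m, decomposed into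
blocks on its own. The signs of the later images come from signs of the letters because F commutes
with the sign operator. -/
theorem fsum_contr (hf : IsMultilin K f) (hs : ∀ u, F (u.map X.rsgn) = X.rsgn (F u)) (l : List X) :
    fsum F (contr M' f) l = splitSum₃ (fun u m w =>
      fsum F (fun x => ins F hf x (w.map X.rsgn) (fsum F M'.μ m)) u) l := by
  have e : ∀ x m w, fsum F (fun y => fsum F (fun z => f (x ++ M'.μ y :: z.map X.rsgn)) w) m =
      ins F hf x (w.map X.rsgn) (fsum F M'.μ m) := fun x m w => by
    rw [fsum_hom]
    simp only [ins_apply, fsum_map (F := F) _ X.rsgn X.rsgn hs]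
  have : contr M' f = fun t => splitSum (fun x yz => splitSum (fun y z =>
    f (x ++ M'.μ y :: z.map X.rsgn)) yz) t := rfl
  rw [this, fsum_splitSum_eq, splitSum₃]
  refine splitSum_congr _ fun u v _ => ?_
  rw [← fsum_splitSum]
  refine congrArg (fun h => fsum F h u) (funext fun x => ?_)
  rw [fsum_splitSum_eq]
  exact splitSum_congr _ fun m w _ => e x m w

/-- The letter produced by the contraction lies in exactly one block; m is the subword from which
that block arises. -/
theorem contr_fsum (hf : IsMultilin K f) (l : List X) :
    contr M (fsum F f) l = splitSum₃ (fun u m w =>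
      fsum F (fun x => ins F hf x (w.map X.rsgn) (contr M F m)) u) l := by
  have e : ∀ c k e : List X, fsum F (fun x => ins F hf x (e.map X.rsgn) (contr M F k)) c =
      splitSum (fun s y => splitSum (fun v d => fsum F (fun x =>
        ins F hf x (e.map X.rsgn) (F (s ++ M.μ v :: d.map X.rsgn))) c) y) k := fun c k e => by
    have := contr_comp (A := M) (ins_isLinear (F := F) hf (e.map X.rsgn) c).mk' F k
    exact this
  simp only [contr, splitSum₃, fsum_append_cons, splitSum_map] at e ⊢
  rw [splitSum_congr l fun u x _ => splitSum_congr x fun v w _ => rfl,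
    splitSum_rot₁ fun c s v w => splitSum (fun d e => fsum F (fun x => fsum F (fun z =>
      f (x ++ F (s ++ M.μ v :: d.map X.rsgn) :: z)) (e.map X.rsgn)) c) w]
  refine splitSum_congr _ fun c m _ => ?_
  rw [← splitSum_rot₃ fun s v d e => fsum F (fun x => fsum F (fun z =>
      f (x ++ F (s ++ M.μ v :: d.map X.rsgn) :: z)) (e.map X.rsgn)) c]
  exact splitSum_congr _ fun k t _ => (e c k t).symm

theorem fsum_contr_sub (hf : IsMultilin K f) (hs : ∀ u, F (u.map X.rsgn) = X.rsgn (F u))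
    (l : List X) : fsum F (contr M' f) l - contr M (fsum F f) l = splitSum₃ (fun u m w =>
      fsum F (fun x => ins F hf x (w.map X.rsgn) (defect M M' F m)) u) l := by
  rw [fsum_contr hf hs, contr_fsum hf]
  simp only [splitSum₃, splitSum, ← Finset.sum_sub_distrib]
  refine Finset.sum_congr rfl fun i _ => Finset.sum_congr rfl fun j _ => ?_
  exact ((ins_isLinear (F := F) hf _ _).map_sub _ _).symm

/-- The defect satisfies a cocycle identity. -/
theorem contr_defect (hF : IsMultilin K F) (hs : ∀ u, F (u.map X.rsgn) = X.rsgn (F u))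
    (l : List X) : contr M (defect M M' F) l = -splitSum₃ (fun u m w =>
      fsum F (fun x => ins F M'.multilin x (w.map X.rsgn) (defect M M' F m)) u) l := by
  -- The A∞ relation of M' holds on each word of block images, so one of the two terms in
  -- `fsum_contr_sub` drops out.
  have h0 : fsum F (contr M' M'.μ) l = 0 := by
    have : contr M' M'.μ = fun _ => 0 := funext M'.assoc
    rw [this, fsum_zero]
  rw [← fsum_contr_sub M'.multilin hs, h0, zero_sub, neg_neg]
  have h1 : contr M (defect M M' F) l =
      contr M (fsum F M'.μ) l + contr M (fun l => -contr M F l) l := by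
    rw [← contr_add]
    simp only [← sub_eq_add_neg]; rfl
  rw [h1, contr_neg, contr_contr hF, neg_zero, add_zero]

theorem fsum_mem {S : ℤ → Submodule K Y} {c : ℤ}
    (hF : ∀ l n, X.IsHom l n → F l ∈ X.gr (GrMod.rdeg n + 1))
    (hf : ∀ l n, X.IsHom l n → f l ∈ S (GrMod.rdeg n + c)) {l : List X} {n : List ℤ}
    (hl : X.IsHom l n) : fsum F f l ∈ S (GrMod.rdeg n + c) := by
  induction l using suffix_induction generalizing f c n with
  | nil => rw [fsum_nil]; exact hf _ _ hl
  | cons a l ih =>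
    rw [fsum_cons]
    obtain _ | ⟨ha, hl⟩ := hl
    rename_i j n
    refine splitSum_mem fun u v huv => ?_
    subst huv
    obtain ⟨d₁, d₂, rfl, h₁, h₂⟩ := isHom_append hl
    have := ih u v rfl (f := fun t => f (F (a :: u) :: t)) (c := GrMod.rdeg (j :: d₁) + c)
      (fun t e ht => by
        have := hf _ _ (List.Forall₂.cons (hF _ _ (.cons ha h₁)) ht)
        rw [GrMod.rdeg_cons, add_sub_cancel_right] at this
        rw [show GrMod.rdeg e + (GrMod.rdeg (j :: d₁) + c) =
          GrMod.rdeg (j :: d₁) + GrMod.rdeg e + c by ring]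
        exact this) h₂
    rw [show GrMod.rdeg (j :: (d₁ ++ d₂)) + c = GrMod.rdeg d₂ + (GrMod.rdeg (j :: d₁) + c) by
      simp only [GrMod.rdeg_cons, GrMod.rdeg_append]; ring]
    exact this

theorem defect_mem (hF : ∀ l n, X.IsHom l n → F l ∈ X.gr (GrMod.rdeg n + 1)) {l : List X}
    {n : List ℤ} (hl : X.IsHom l n) : defect M M' F l ∈ X.gr (GrMod.rdeg n + 2) := by
  refine sub_mem (fsum_mem (S := X.gr) hF M'.μ_mem hl) (contr_mem hl fun x e hx he => ?_)
  have := hF x e hx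
  rwa [he, show GrMod.rdeg n + 1 + 1 = GrMod.rdeg n + 2 by ring] at this

theorem rsgn_of_mem_rdeg (hF : IsMultilin K F)
    (h : ∀ l n, X.IsHom l n → F l ∈ X.gr (GrMod.rdeg n + 1)) (u : List X) :
    F (u.map X.rsgn) = X.rsgn (F u) :=
  hF.map_rsgn.ext_hom (hF.comp_lin X.rsgn) (fun l n hl => by
    rw [hF.map_hom hl, X.rsgn_of_mem (h l n hl), add_sub_cancel_right]) u

/-- A unit entry must form a block by itself, and on the side of M' only its products with a single
neighbouring image survive. They match the two boundary terms of `contr_one`. -/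
theorem defect_one (hF : IsMultilin K F) (hs : ∀ u, F (u.map X.rsgn) = X.rsgn (F u))
    (hone : F [M.one] = M'.one) (h0 : ∀ l, 2 ≤ l.length → M.one ∈ l → F l = 0)
    {l : List X} (hl : M.one ∈ l) : defect M M' F l = 0 := by
  obtain ⟨u, w, rfl⟩ := List.append_of_mem hl
  have e : fsum F M'.μ (u ++ M.one :: w) =
      fsum F (fun x => fsum F (fun z => M'.μ (x ++ M'.one :: z)) w) u := by
    have hz : ∀ x, fsum F (fun z => M'.μ (x ++ 0 :: z)) = fun _ => 0 := fun x => funext fun w => by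
      simp only [M'.multilin.zero_mid, fsum_zero]
    rw [fsum_append_cons, splitSum_single_right, splitSum_single_left, List.nil_append, hone]
    · intro w₁ w₂ _ hw
      have := List.length_pos_iff.2 hw
      rw [h0 _ (by simp; omega) (by simp)]
      simp only [hz, fsum_zero]
    · intro u₁ u₂ _ hu
      have := List.length_pos_iff.2 hu
      refine splitSum_eq_zero fun w₁ w₂ _ => ?_
      rw [h0 _ (by simp; omega) (by simp)]
      simp only [hz, fsum_zero]
  have h3 : ∀ x z : List X, 3 ≤ (x ++ M'.one :: z).length → M'.μ (x ++ M'.one :: z) = 0 :=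
    fun x z h => M'.μ_eq_zero _ h (by simp)
  rw [defect, e, contr_one hF h0]
  by_cases hu : u = [] <;> by_cases hw : w = []
  · subst hu hw
    simp [fsum_nil, M'.μ_one]
  · subst hu
    rw [fsum_nil, fsum_eq_single (fun t ht => h3 [] t (by simp; omega)) w hw]
    rw [if_neg hw, if_pos rfl, List.nil_append, List.nil_append, M'.one_left, hs, GrMod.rsgn]
    simp
  · subst hw
    simp only [fsum_nil]
    rw [fsum_eq_single (fun t ht => h3 t [] (by simp; omega)) u hu]
    simp [hu, M'.one_right]
  · rw [fsum_congr u hu (g := fun _ => 0) fun x hx => ?_, fsum_zero]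
    · simp [hu, hw]
    · rw [fsum_congr w hw (g := fun _ => 0) fun z hz => ?_, fsum_zero]
      have := List.length_pos_iff.2 hx
      have := List.length_pos_iff.2 hz
      exact h3 _ _ (by simp; omega)

/-- The extra letter in the length bound accounts for contractions of the empty block, which insert
a letter. -/
theorem defect_congr {G : List X → X} (l : List X)
    (h : ∀ u, u.length ≤ l.length + 1 → F u = G u) : defect M M' F l = defect M M' G l := by
  rw [defect, defect, fsum_congr_left (G := G) _ _ fun u hu => h u (by omega)]
  congr 1
  simp only [contr, splitSum₃]
  refine splitSum_congr _ fun u vw h₁ => splitSum_congr _ fun v w h₂ => h _ ?_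
  subst h₁ h₂
  simp only [List.length_append, List.length_cons, List.length_map]; omega

end Morphisms

/-! ### Correcting a prospective homomorphism. -/

section Obstruction

variable {K : Type u} [Field K] {X : GrMod K} {A : AInfStr X} {P : ABimod A}
  {Y : Type*} [AddCommGroup Y] [Module K Y]

theorem splitSum₃_map {α β M : Type*} [AddCommMonoid M] (f : List α → List α → List α → M)
    (g : β → α) (l : List β) : splitSum₃ f (l.map g) =
      splitSum₃ (fun u v w => f (u.map g) (v.map g) (w.map g)) l := by
  simp only [splitSum₃, splitSum_map]

theorem splitSum₃_hom {α M N F : Type*} [AddCommMonoid M] [AddCommMonoid N] [FunLike F M N]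
    [AddMonoidHomClass F M N] (φ : F) (f : List α → List α → List α → M) (l : List α) :
    φ (splitSum₃ f l) = splitSum₃ (fun u v w => φ (f u v w)) l := by
  simp only [splitSum₃, splitSum_hom]

theorem splitSum₃_congr {α M : Type*} [AddCommMonoid M] {f g : List α → List α → List α → M}
    (l : List α) (h : ∀ u v w, l = u ++ (v ++ w) → f u v w = g u v w) :
    splitSum₃ f l = splitSum₃ g l :=
  splitSum_congr _ fun u _ h₁ => splitSum_congr _ fun v w h₂ => h u v w (h₂ ▸ h₁)

theorem splitSum₃_eq_zero {α M : Type*} [AddCommMonoid M] {f : List α → List α → List α → M}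
    {l : List α} (h : ∀ u v w, l = u ++ (v ++ w) → f u v w = 0) : splitSum₃ f l = 0 :=
  splitSum_eq_zero fun u _ h₁ => splitSum_eq_zero fun v w h₂ => h u v w (h₂ ▸ h₁)

namespace NCDivisor

/-- The conditions for an isomorphism of noncommutative divisors, other than the equations of an
`A∞`-homomorphism. -/
structure IsPre (D D' : NCDivisor A P) (F : List (extSpace P) → extSpace P) : Prop where
  multilin : IsMultilin K F
  nil : F [] = 0
  mem : ∀ l n, (extSpace P).IsHom l n → F l ∈ (extSpace P).gr (GrMod.rdeg n + 1)
  one : F [D.one] = D'.one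
  eq_zero : ∀ l, 2 ≤ l.length → D.one ∈ l → F l = 0
  sub : ∀ a, F [inA P a] = inA P a
  sub_eq_zero : ∀ l : List X, 2 ≤ l.length → F (l.map (inA P)) = 0
  quot : ∀ p, prP P (F [inP P p]) = p
  quot_eq_zero : ∀ (l r : List X) (p : P.carrier), 1 ≤ l.length + r.length →
    prP P (F (l.map (inA P) ++ inP P p :: r.map (inA P))) = 0

variable {D D' : NCDivisor A P} {F : List (extSpace P) → extSpace P}

theorem IsPre.map_rsgn (hF : IsPre D D' F) (u : List (extSpace P)) :
    F (u.map (extSpace P).rsgn) = (extSpace P).rsgn (F u) :=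
  rsgn_of_mem_rdeg hF.multilin hF.mem u

/-- On A the map is the identity without higher terms, so only the decomposition into single letters
counts. -/
theorem IsPre.fsum_inA (hF : IsPre D D' F) {f : List (extSpace P) → Y} (hf : IsMultilin K f)
    (l : List X) : fsum F f (l.map (inA P)) = f (l.map (inA P)) := by
  induction l generalizing f with
  | nil => exact fsum_nil f
  | cons a l ih =>
    rw [List.map_cons, fsum_cons, splitSum_map, splitSum_single_left, List.map_nil, hF.sub]
    · exact ih (hf.prepend [inA P a])
    · intro u v _ hu
      have h := hF.sub_eq_zero (a :: u) (by have := List.length_pos_iff.2 hu; simp; omega)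
      rw [List.map_cons] at h
      have h0 : ∀ t, f (0 :: t) = 0 := fun t => hf.zero_mid [] t
      simp only [h, h0, fsum_zero]

/-- The difference of a prospective homomorphism and a correction term. -/
theorem IsPre.sub_correction (hF : IsPre D D' F) {g : List (extSpace P) → extSpace P}
    (hg : g ∈ MRed D.toAInfStr (extSpace P))
    (hmem : ∀ l n, (extSpace P).IsHom l n → g l ∈ (extSpace P).gr (GrMod.rdeg n + 1))
    (h₁ : VanishBelow 1 g) (h₂ : VanishBelow 2 fun l => prP P (g l)) :
    IsPre D D' fun l => F l - g l := by
  have hA : ∀ l : List X, g (l.map (inA P)) = 0 := fun l => by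
    have := h₁ (l.map Sum.inl) (by simp)
    rwa [map_emb_inl] at this
  have hP : ∀ (l r : List X) (p : P.carrier),
      prP P (g (l.map (inA P) ++ inP P p :: r.map (inA P))) = 0 := fun l r p => by
    have := h₂ (l.map Sum.inl ++ .inr p :: r.map Sum.inl) (by simp)
    simpa using this
  refine ⟨fun u v => ((hF.multilin u v).mk' - (hg.1 u v).mk').isLinear, ?_, fun l n hl =>
    sub_mem (hF.mem l n hl) (hmem l n hl), ?_, fun l hl h => ?_, fun a => ?_, fun l hl => ?_,
    fun p => ?_, fun l r p h => ?_⟩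
  · rw [hF.nil, show g [] = 0 from hA [], sub_zero]
  · rw [hF.one, hg.2 _ (by simp), sub_zero]
  · rw [hF.eq_zero l hl h, hg.2 l h, sub_zero]
  · rw [hF.sub, show g [inA P a] = 0 from hA [a], sub_zero]
  · rw [hF.sub_eq_zero l hl, hA, sub_zero]
  · rw [map_sub, hF.quot, show prP P (g [inP P p]) = 0 from hP [] [] p, sub_zero]
  · rw [map_sub, hF.quot_eq_zero l r p h, hP, sub_zero]

theorem fsum_sub {G : List (extSpace P) → extSpace P} (f g : List (extSpace P) → Y)
    (l : List (extSpace P)) : fsum G (fun t => f t - g t) l = fsum G f l - fsum G g l :=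
  Finset.sum_sub_distrib _ _

/-- Up to weight m the sum is affine in g. A block on which g is nonzero has weight at least m > 0
and so uses up all letters from P. Hence there is at most one such block, and the remaining letters
are from A, where F and F - g are the identity. -/
theorem IsPre.fsum_correction (hF : IsPre D D' F) {g : List (extSpace P) → extSpace P}
    (hF' : IsPre D D' fun l => F l - g l) {m : ℕ} (hm : 0 < m) (hg : VanishBelow m g)
    {f : List (extSpace P) → Y} (hf : IsMultilin K f) {w : List (X ⊕ P.carrier)} (hw : wt w ≤ m) :
    fsum (fun l => F l - g l) f (w.map (emb P)) = fsum F f (w.map (emb P)) -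
      splitSum₃ (fun u v t => f (u.map (emb P) ++ g (v.map (emb P)) :: t.map (emb P))) w := by
  have hg0 : g [] = 0 := hg [] hm
  induction w using suffix_induction generalizing f with
  | nil =>
    have := hf.zero_mid [] []
    simp only [List.nil_append] at this
    simp [fsum_nil, splitSum₃, splitSum_nil, hg0, this]
  | cons b w ih =>
    have hwt : ∀ u v : List (X ⊕ P.carrier), w = u ++ v → wt (b :: u) + wt v ≤ m := fun u v h => by
      rw [← wt_append, List.cons_append, ← h]; exact hw
    have hsub : ∀ (c d : extSpace P) t, f ((c - d) :: t) = f (c :: t) - f (d :: t) :=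
      fun c d t => (hf [] t).map_sub c d
    have h0 : ∀ t, f (0 :: t) = 0 := fun t => hf.zero_mid [] t
    -- If g is applied to the first block, no letter from P is left, and the corrected map is the
    -- identity on the rest.
    have e₁ : ∀ u v, w = u ++ v → fsum (fun l => F l - g l)
        (fun t => f (g (emb P b :: u.map (emb P)) :: t)) (v.map (emb P)) =
        f (g ((b :: u).map (emb P)) :: v.map (emb P)) := fun u v h => by
      by_cases hu : wt (b :: u) < m
      · have := hg _ hu
        rw [List.map_cons] at this
        simp only [List.map_cons, this, h0, fsum_zero]
      · obtain ⟨l, rfl⟩ := eq_map_inl_of_wt (w := v) (by have := hwt u v h; omega)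
        rw [map_emb_inl]
        exact hF'.fsum_inA (hf.prepend [g (emb P b :: u.map (emb P))]) l
    -- If g is applied to a later block, the first block has no letter from P, and F vanishes on it
    -- unless it is a single letter.
    have e₂ : splitSum (fun u v => splitSum₃ (fun x y z => f (F (emb P b :: u.map (emb P)) ::
        (x.map (emb P) ++ g (y.map (emb P)) :: z.map (emb P)))) v) w =
        splitSum₃ (fun x y z => f (emb P b ::
        (x.map (emb P) ++ g (y.map (emb P)) :: z.map (emb P)))) w := by
      have hz : ∀ c x z, f (c :: (x ++ 0 :: z)) = 0 := fun c x z => hf.zero_mid (c :: x) z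
      rw [splitSum_single_left]
      · refine splitSum₃_congr _ fun x y z h => ?_
        by_cases hy : wt y < m
        · rw [hg y hy, hz, hz]
        · have := hwt x (y ++ z) h
          rw [wt_append] at this
          cases b with
          | inl a => rw [emb_inl, List.map_nil, hF.sub]
          | inr p => rw [wt_inr] at this; omega
      · intro u v h hu
        refine splitSum₃_eq_zero fun x y z h' => ?_
        by_cases hy : wt y < m
        · rw [hg y hy, hz]
        · have := hwt u v h
          rw [h', wt_append, wt_append] at this
          obtain ⟨l, hl⟩ := eq_map_inl_of_wt (w := b :: u) (by omega)
          have h1 := hF.sub_eq_zero l (by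
            have := congrArg List.length hl
            have := List.length_pos_iff.2 hu
            simp at *; omega)
          rw [← map_emb_inl, ← hl, List.map_cons] at h1
          rw [h1, h0]
    have hsplit : splitSum₃ (fun u v t =>
        f (u.map (emb P) ++ g (v.map (emb P)) :: t.map (emb P))) (b :: w) =
        splitSum (fun u v => f (g ((b :: u).map (emb P)) :: v.map (emb P))) w +
        splitSum₃ (fun x y z => f (emb P b ::
          (x.map (emb P) ++ g (y.map (emb P)) :: z.map (emb P)))) w := by
      rw [splitSum₃, splitSum_cons, splitSum_cons]
      simp only [List.map_nil, hg0, List.nil_append, h0, zero_add]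
      rfl
    rw [List.map_cons, fsum_cons, fsum_cons, splitSum_map, splitSum_map, hsplit, ← e₂,
      ← splitSum_congr _ e₁]
    simp only [hsub, fsum_sub]
    have e₃ := fun u v (h : w = u ++ v) => ih u v h (f := fun t => f (F (emb P b ::
      u.map (emb P)) :: t)) (hf.prepend [_]) (by have := hwt u v h; omega)
    simp only [sub_eq_add_neg, splitSum_add, splitSum_neg] at e₃ ⊢
    rw [splitSum_congr _ e₃, splitSum_add, splitSum_neg]
    abel

end NCDivisor

end Obstruction

/-! ### Obstruction cocycles and their removal. -/

section Steps

variable {K : Type u} [Field K] {X : GrMod K} {A : AInfStr X} {P Q : ABimod A}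
  {Y : Type*} [AddCommGroup Y] [Module K Y]

theorem rsp_congr {d e : ℤ} (h : Even (d - e)) : rsp X d = rsp X e := by
  by_cases he : Even e
  · rw [rsp_of_even X he, rsp_of_even X ((Int.even_sub.1 h).2 he)]
  · rw [rsp_of_odd X he, rsp_of_odd X fun hd => he ((Int.even_sub.1 h).1 hd)]

theorem eps_congr {d e : ℤ} (h : Even (d - e)) : GrMod.eps d = GrMod.eps e := by
  by_cases he : Even e
  · rw [GrMod.eps_of_even he, GrMod.eps_of_even ((Int.even_sub.1 h).2 he)]
  · rw [GrMod.eps_of_odd he, GrMod.eps_of_odd fun hd => he ((Int.even_sub.1 h).1 hd)]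

theorem map_emb_word (l r : List X) (w : List (X ⊕ P.carrier)) :
    (l.map Sum.inl ++ (w ++ r.map Sum.inl)).map (emb P) =
      l.map (inA P) ++ (w.map (emb P) ++ r.map (inA P)) := by simp

namespace NCDivisor

variable {D D' : NCDivisor A P} {F : List (extSpace P) → extSpace P}

/-- The failure of `F` to satisfy the equations of an `A∞`-homomorphism from `D` to `D'`. -/
noncomputable abbrev dfct (D D' : NCDivisor A P) (F : List (extSpace P) → extSpace P) :
    List (extSpace P) → extSpace P := defect D.toAInfStr D'.toAInfStr F

theorem IsPre.dfct_multilin (hF : IsPre D D' F) : IsMultilin K (dfct D D' F) :=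
  defect_multilin hF.multilin

theorem IsPre.dfct_mred (hF : IsPre D D' F) (pr : extSpace P →ₗ[K] Y) :
    (fun l => pr (dfct D D' F l)) ∈ MRed D.toAInfStr Y :=
  ⟨hF.dfct_multilin.comp_lin pr, fun l hl => by
    change pr (dfct D D' F l) = 0
    rw [dfct, defect_one hF.multilin hF.map_rsgn hF.one hF.eq_zero hl, map_zero]⟩

/-- In the cocycle identity the inner defect must contain all letters from P, as it vanishes in
lower weight. The outer blocks are then words in A, where F is the identity. -/
theorem IsPre.contr_dfct (hF : IsPre D D' F) {k : ℕ} (hE : VanishBelow (k + 1) (dfct D D' F))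
    {w : List (X ⊕ P.carrier)} {x : (tpow P (k + 1)).carrier} (hw : Rep P k w x) (l r : List X) :
    contr D.toAInfStr (dfct D D' F) (l.map (inA P) ++ (w.map (emb P) ++ r.map (inA P))) =
      -splitSum (fun a y => splitSum (fun b z => D'.μ (a.map (inA P) ++
        dfct D D' F (y.map (inA P) ++ (w.map (emb P) ++ b.map (inA P))) ::
          (z.map X.rsgn).map (inA P))) r) l := by
  have hins : ∀ (w : List (extSpace P)) (a : extSpace P),
      IsMultilin K fun x => ins F D'.multilin x w a := fun w a u v =>
    fsum_isLinear (g := fun b z => D'.μ (u ++ b :: v ++ a :: z)) w fun t => by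
      simpa using D'.multilin u (v ++ a :: t)
  have hz : ∀ (u v t : List (X ⊕ P.carrier)), wt v ≤ k → fsum F (fun x => ins F D'.multilin x
      ((t.map (emb P)).map (extSpace P).rsgn) (dfct D D' F (v.map (emb P)))) (u.map (emb P)) = 0 :=
    fun u v t hv => by
      rw [hE v (by omega)]
      simp only [map_zero, fsum_zero]
  rw [dfct, contr_defect hF.multilin hF.map_rsgn, ← map_emb_word, splitSum₃_map, hw.splitSum₃ _ hz]
  refine congrArg _ (splitSum_congr _ fun a y _ => splitSum_congr _ fun b z _ => ?_)
  rw [map_emb_word, map_emb_inl, map_emb_inl, map_inA_rsgn, hF.fsum_inA (hins _ _), ins_apply,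
    hF.fsum_inA]
  have := D'.multilin.prepend (a.map (inA P) ++ [dfct D D' F
    (y.map (inA P) ++ (w.map (emb P) ++ b.map (inA P)))])
  simpa using this

-- The target Q will be A or P, with its projection and inclusion. The structure maps of the
-- diagonal bimodule differ from μ_A by shift signs, those of P do not differ from the P-component
-- of μ_B; accordingly δ is 1 for A and 0 for P.
variable {pr : extSpace P →ₗ[K] Q.carrier} {inn : Q.carrier →ₗ[K] extSpace P} {δ d : ℤ} {k : ℕ}

/-- The lowest order part of the failure of `F` to be a homomorphism is a cocycle. -/
theorem IsPre.homD_res (hF : IsPre D D' F) (hE : VanishBelow (k + 1) (dfct D D' F))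
    (hpr : ∀ v : List (X ⊕ P.carrier), wt v = k + 1 → ∀ a z : List X,
      pr (D'.μ (a.map (inA P) ++ dfct D D' F (v.map (emb P)) :: z.map (inA P))) =
        GrMod.eps δ • Q.act a (z.map (rsp X δ)) (pr (dfct D D' F (v.map (emb P)))))
    (hd : Even (d - (δ + 1))) :
    homD (tpow P (k + 1)) Q d (D.res ⟨_, hF.dfct_mred pr⟩ k) = 0 := by
  have hE' : VanishBelow (k + 1) fun l => pr (dfct D D' F l) := fun w hw => by
    change pr (dfct D D' F (w.map (emb P))) = 0
    rw [hE w hw, map_zero]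
  funext l r
  refine Rep.ext fun w x hw => ?_
  have hb := bd_res (f := ⟨_, hF.dfct_mred pr⟩) hw hE' l r
  have hc := contr_comp pr (dfct D D' F) (A := D.toAInfStr)
    (l.map (inA P) ++ (w.map (emb P) ++ r.map (inA P)))
  rw [hF.contr_dfct hE hw, map_neg] at hc
  have hμ : ∀ a y b z : List X, pr (D'.μ (a.map (inA P) ++
      dfct D D' F (y.map (inA P) ++ (w.map (emb P) ++ b.map (inA P))) ::
        (z.map X.rsgn).map (inA P))) = GrMod.eps δ • Q.act a (z.map (rsp X d))
          (pr (dfct D D' F (y.map (inA P) ++ (w.map (emb P) ++ b.map (inA P))))) :=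
    fun a y b z => by
      rw [rsp_congr hd, map_rsp_add_one, ← map_emb_word]
      exact hpr _ (by simp [hw.wt]) a _
  rw [homD_eq, Pi.sub_apply, Pi.sub_apply, Pi.smul_apply, Pi.smul_apply, LinearMap.sub_apply,
    LinearMap.smul_apply, hb, ← hc, comp_apply]
  simp only [splitSum_hom, hμ, splitSum_zsmul, res_rep _ hw, smul_neg, smul_smul]
  rw [eps_congr hd, GrMod.eps_add_one, neg_mul, GrMod.eps_mul_self, neg_smul, one_smul]
  simp

/-- At this weight the homomorphism equation is affine in the correction: the defect changes by
μ_{B'} applied after g and by g applied after a contraction, which together form the differential of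
g. -/
theorem IsPre.dfct_correction (hF : IsPre D D' F) {g : List (extSpace P) → extSpace P}
    (hF' : IsPre D D' fun l => F l - g l) {m : ℕ} (hm : 0 < m) (hg : VanishBelow m g)
    {w : List (X ⊕ P.carrier)} (hw : wt w ≤ m) :
    dfct D D' (fun l => F l - g l) (w.map (emb P)) = dfct D D' F (w.map (emb P)) -
      splitSum₃ (fun u v t => D'.μ (u.map (emb P) ++ g (v.map (emb P)) :: t.map (emb P))) w +
      contr D.toAInfStr g (w.map (emb P)) := by
  have h : contr D.toAInfStr (fun l => F l - g l) (w.map (emb P)) =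
      contr D.toAInfStr F (w.map (emb P)) - contr D.toAInfStr g (w.map (emb P)) := by
    simp only [sub_eq_add_neg, contr_add, contr_neg]
  rw [dfct, defect, hF.fsum_correction hF' hm hg D'.multilin hw, h, dfct, defect]
  abel

theorem IsPre.dfct_correction_of_lt (hF : IsPre D D' F) {g : List (extSpace P) → extSpace P}
    (hF' : IsPre D D' fun l => F l - g l) {m : ℕ} (hgm : IsMultilin K g) (hg : VanishBelow m g)
    {w : List (X ⊕ P.carrier)} (hw : wt w < m) :
    dfct D D' (fun l => F l - g l) (w.map (emb P)) = dfct D D' F (w.map (emb P)) := by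
  rw [hF.dfct_correction hF' (by omega) hg hw.le, hg.contr hgm w hw, splitSum₃_eq_zero, sub_zero,
    add_zero]
  rintro u v t rfl
  simp only [wt_append] at hw
  rw [hg v (by omega), D'.multilin.zero_mid]

/-- If the lowest order part of the failure of `F` to be a homomorphism is a coboundary, it can be
removed by a correction. -/
theorem IsPre.exists_correction (hF : IsPre D D' F) (hE : VanishBelow (k + 1) (dfct D D' F))
    (hinn : ∀ (φ : Q.carrier) (a z : List X),
      pr (D'.μ (a.map (inA P) ++ inn φ :: z.map (inA P))) =
        GrMod.eps δ • Q.act a (z.map (rsp X δ)) φ)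
    (hpi : ∀ φ, pr (inn φ) = φ) (hd : Even (d - (δ + 1)))
    (hob : D.res ⟨_, hF.dfct_mred pr⟩ k ∈ coboundaries (tpow P (k + 1)) Q d) :
    ∃ g : MRed D.toAInfStr Q.carrier, VanishBelow (k + 1) g.1 ∧
      (∀ l n, (extSpace P).IsHom l n → g.1 l ∈ Q.gr (GrMod.rdeg n + (d - 1 + 2 * (k + 1)))) ∧
      (IsPre D D' (fun l => F l - inn (g.1 l)) →
        VanishBelow (k + 2) fun l => pr (dfct D D' (fun l => F l - inn (g.1 l)) l)) := by
  obtain ⟨h, hh, e⟩ := mem_coboundaries.1 hob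
  -- The primitive h of the obstruction is extended to words of all weights; the factor (-1)^δ
  -- compensates for the one in `hinn`.
  obtain ⟨g, hg, hgv, hgm⟩ := D.exists_res_eq (zsmul_mem hh (GrMod.eps δ))
  refine ⟨g, hgv, hgm, fun hF' => ?_⟩
  have hd' : Even (d - 1 - δ) := by rwa [sub_sub, add_comm 1 δ]
  have hgv' : VanishBelow (k + 1) fun l => inn (g.1 l) := fun w hw => by
    change inn (g.1 (w.map (emb P))) = 0
    rw [hgv w hw, map_zero]
  intro w hw
  change pr (dfct D D' (fun l => F l - inn (g.1 l)) (w.map (emb P))) = 0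
  -- Below weight k + 1 nothing changes. In weight k + 1 the projected defect changes by minus the
  -- differential of h, which is the obstruction.
  rcases Nat.lt_succ_iff_lt_or_eq.1 hw with hw | hw
  · rw [hF.dfct_correction_of_lt hF' (g.2.1.comp_lin inn) hgv' hw, hE w hw, map_zero]
  obtain ⟨l, w, r, x, rfl, hx⟩ := exists_rep hw
  have hz : ∀ (u v t : List (X ⊕ P.carrier)), wt v ≤ k →
      pr (D'.μ (u.map (emb P) ++ inn (g.1 (v.map (emb P))) :: t.map (emb P))) = 0 :=
    fun u v t hv => by
      rw [hgv v (by omega), map_zero, D'.multilin.zero_mid, map_zero]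
  have hb := bd_res hx hgv l r
  have hr : D.res ⟨_, hF.dfct_mred pr⟩ k l r x =
      pr (dfct D D' F (l.map (inA P) ++ (w.map (emb P) ++ r.map (inA P)))) :=
    res_rep ⟨_, hF.dfct_mred pr⟩ hx l r
  rw [← e, homD_eq] at hr
  rw [hF.dfct_correction hF' (by omega) hgv' hw.le, map_add, map_sub, contr_comp, splitSum₃_hom,
    hx.splitSum₃ _ hz]
  simp only [hpi, map_emb_word, map_emb_inl, hinn]
  have hφ : ∀ y b : List X, g.1 (y.map (inA P) ++ (w.map (emb P) ++ b.map (inA P))) =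
      GrMod.eps δ • h y b x := fun y b => by
    rw [← res_rep g hx, hg]; rfl
  rw [← hb, hg, bd_eps_smul, ← hr]
  simp only [hφ, Pi.sub_apply, Pi.smul_apply, LinearMap.sub_apply, LinearMap.smul_apply, map_zsmul,
    smul_smul, GrMod.eps_mul_self, one_smul, comp_apply, rsp_congr hd', eps_congr hd']
  abel

end NCDivisor

end Steps

/-! ### The inductive construction of the isomorphism. -/

section Induction

variable {K : Type u} [Field K] {X : GrMod K} {A : AInfStr X} {P : ABimod A}
  {Y : Type*} [AddCommGroup Y] [Module K Y]

/-- The map of words whose only component is the identity of letters. -/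
def letter {α : Type*} [Zero α] : List α → α
  | [a] => a
  | _ => 0

theorem letter_of_length_ne {α : Type*} [Zero α] {l : List α} (h : l.length ≠ 1) : letter l = 0 := by
  match l, h with
  | [], _ => rfl
  | [_], h => exact absurd rfl h
  | _ :: _ :: _, _ => rfl

theorem letter_multilin : IsMultilin K (letter : List X → X) := fun u v => by
  by_cases h : u = [] ∧ v = []
  · obtain ⟨rfl, rfl⟩ := h
    exact LinearMap.id.isLinear
  · have : ∀ a, letter (u ++ a :: v) = (0 : X) := fun a => letter_of_length_ne fun e => h <| by
      simp only [List.length_append, List.length_cons] at e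
      exact ⟨List.eq_nil_of_length_eq_zero (by omega), List.eq_nil_of_length_eq_zero (by omega)⟩
    simp only [this]
    exact (0 : X →ₗ[K] X).isLinear

theorem fsum_letter {f : List X → Y} (hf : IsMultilin K f) (l : List X) :
    fsum letter f l = f l := by
  induction l generalizing f with
  | nil => exact fsum_nil f
  | cons a l ih =>
    rw [fsum_cons, splitSum_single_left]
    · exact ih (hf.prepend [a])
    · intro u v _ hu
      have h0 : ∀ t, f (0 :: t) = 0 := fun t => hf.zero_mid [] t
      simp only [letter_of_length_ne (l := a :: u)
        (by have := List.length_pos_iff.2 hu; simp; omega), h0, fsum_zero]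

theorem contr_letter (l : List X) : contr A letter l = A.μ l := by
  rw [contr, splitSum₃, splitSum_single_left, splitSum_single_right]
  · rfl
  · intro v w _ hw
    exact letter_of_length_ne (by have := List.length_pos_iff.2 hw; simp; omega)
  · intro u v _ hu
    exact splitSum_eq_zero fun _ _ _ =>
      letter_of_length_ne (by have := List.length_pos_iff.2 hu; simp; omega)

theorem defect_letter (M M' : AInfStr X) (l : List X) : defect M M' letter l = M'.μ l - M.μ l := by
  rw [defect, fsum_letter M'.multilin, contr_letter]

namespace NCDivisor

variable {D D' : NCDivisor A P} {F : List (extSpace P) → extSpace P}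

theorem isPre_letter (D D' : NCDivisor A P) : IsPre D D' letter := by
  refine ⟨letter_multilin, rfl, fun l n hl => ?_, D.one_eq.trans D'.one_eq.symm, fun l h _ =>
    letter_of_length_ne (by omega), fun _ => rfl, fun l h =>
    letter_of_length_ne (by rw [List.length_map]; omega), fun _ => rfl, fun l r p h => ?_⟩
  · match l, n, hl with
    | [], _, _ => exact zero_mem _
    | [b], _, .cons h .nil =>
      change b ∈ _
      simpa [GrMod.rdeg_cons] using h
    | _ :: _ :: _, _, _ => exact zero_mem _
  · rw [letter_of_length_ne (by simp; omega), map_zero]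

/-- The projection from `A ⊕ P[1]` to the diagonal bimodule. -/
def prD (P : ABimod A) : extSpace P →ₗ[K] (diag A).carrier := prA P

/-- The inclusion of the diagonal bimodule into `A ⊕ P[1]`. -/
def inD (P : ABimod A) : (diag A).carrier →ₗ[K] extSpace P := inA P

theorem inD_prD (b : extSpace P) (h : prP P b = 0) : inD P (prD P b) = b := by
  have := inA_add_inP P b
  rwa [h, map_zero, add_zero] at this

theorem prA_word (D : NCDivisor A P) (a z : List X) (b : X) :
    prA P (D.μ (a.map (inA P) ++ inA P b :: z.map (inA P))) = A.μ (a ++ b :: z) := by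
  rw [← prA_inA P (A.μ _), ← D.sub, List.map_append, List.map_cons]

theorem prD_word (D : NCDivisor A P) (a z : List X) (φ : (diag A).carrier) :
    prD P (D.μ (a.map (inA P) ++ inD P φ :: z.map (inA P))) =
      GrMod.eps 1 • (diag A).act a (z.map (rsp X 1)) φ := by
  have h : ∀ b : X, (diag A).act a (z.map X.rsgn) b = -A.μ (a ++ b :: z) := fun b => by
    rw [diag_act, GrMod.map_rsgn_rsgn]
  rw [rsp_of_odd X (by decide), GrMod.eps_of_odd (by decide), neg_smul, one_smul]
  exact (D.prA_word a z φ).trans (neg_eq_iff_eq_neg.2 (h φ)).symm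

/-- The `A`-component of the lowest order part of the failure of `F` to be a homomorphism. -/
noncomputable def IsPre.obsA (hF : IsPre D D' F) (k : ℕ) : PreHom (tpow P (k + 1)) (diag A) :=
  D.res ⟨_, hF.dfct_mred (prD P)⟩ k

/-- The `P`-component of the lowest order part of the failure of `F` to be a homomorphism. -/
noncomputable def IsPre.obsP (hF : IsPre D D' F) (k : ℕ) : PreHom (tpow P (k + 1)) P :=
  D.res ⟨_, hF.dfct_mred (prP P)⟩ k

/-- The defect raises reduced degree by two as a map to B, and the k + 1 letters from P shift this
by 2(k + 1). As its P-component vanishes in this weight, its values lie in A, where μ_{B'} is μ_A;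
so the projection to A is compatible with the operations involved. -/
theorem IsPre.obsA_mem (hF : IsPre D D' F) {k : ℕ} (hE : VanishBelow (k + 1) (dfct D D' F))
    (hP : VanishBelow (k + 2) fun l => prP P (dfct D D' F l)) :
    hF.obsA k ∈ cocycles (tpow P (k + 1)) (diag A) (-(2 * k)) := by
  refine ⟨D.res_mem_hom (c := 2) k (fun l n hl => ?_) (by ring),
    hF.homD_res (δ := 1) hE (fun v hv a z => ?_) ⟨-k - 1, by ring⟩⟩
  · exact (defect_mem hF.mem hl).1
  · have := prD_word D' a z (prD P (dfct D D' F (v.map (emb P))))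
    rwa [inD_prD _ (hP v (by omega))] at this

/-- No condition on the A-component is needed because P[1] is the quotient of B' by A. The shift in
P[1] makes the degree one higher than in `obsA_mem`. -/
theorem IsPre.obsP_mem (hF : IsPre D D' F) {k : ℕ} (hE : VanishBelow (k + 1) (dfct D D' F)) :
    hF.obsP k ∈ cocycles (tpow P (k + 1)) P (1 - 2 * k) := by
  refine ⟨D.res_mem_hom (c := 3) k (fun l n hl => ?_) (by ring),
    hF.homD_res (δ := 0) hE (fun v hv a z => ?_) ⟨-k, by ring⟩⟩
  · have := (defect_mem (M := D.toAInfStr) (M' := D'.toAInfStr) hF.mem hl).2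
    rwa [add_assoc] at this
  · rw [prP_word, rsp_of_even X (by decide), GrMod.eps_of_even (by decide), one_smul]
    simp

/-- A word with at most k letters has weight at most k. Hence corrections of growing weight leave
short words alone, and the successive corrections converge. -/
theorem correction_eq_of_length_le {k : ℕ} {g : List (extSpace P) → Y} (hg : IsMultilin K g)
    (hv : VanishBelow (k + 1) g) {l : List (extSpace P)} (hl : l.length ≤ k) : g l = 0 :=
  hg.eq_zero_of_letters fun w hw => hv w (by have := wt_le_length w; omega)

theorem IsPre.exists_correction_inA (hF : IsPre D D' F) {k : ℕ}
    (hE : VanishBelow (k + 1) (dfct D D' F))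
    (hP : VanishBelow (k + 2) fun l => prP P (dfct D D' F l))
    (hob : hF.obsA k ∈ coboundaries (tpow P (k + 1)) (diag A) (-(2 * k))) :
    ∃ G, IsPre D D' G ∧ VanishBelow (k + 2) (dfct D D' G) ∧ ∀ l, l.length ≤ k → G l = F l := by
  obtain ⟨g, hv, hm, h⟩ := hF.exists_correction (δ := 1) (inn := inD P) hE
    (fun φ a z => prD_word D' a z φ) (fun _ => rfl) ⟨-k - 1, by ring⟩ hob
  have hv' : VanishBelow (k + 1) fun l => inD P (g.1 l) := fun w hw =>
    (congrArg (inD P) (hv w hw)).trans (map_zero _)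
  have hF' : IsPre D D' fun l => F l - inD P (g.1 l) := by
    refine hF.sub_correction ⟨g.2.1.comp_lin _, fun l hl => ?_⟩ (fun l n hl => ?_)
      (hv'.mono (by omega)) (fun _ _ => rfl)
    · exact (congrArg (inD P) (g.2.2 l hl)).trans (map_zero _)
    · have := hm l n hl
      rw [show GrMod.rdeg n + (-(2 * (k : ℤ)) - 1 + 2 * (k + 1)) = GrMod.rdeg n + 1 by ring] at this
      exact inA_mem P this
  refine ⟨_, hF', fun w hw => ?_, fun l hl => ?_⟩
  -- A correction with values in A must not create a P-component of the defect up to weight k + 1.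
  -- It does not: where g is nonzero it absorbs all letters from P, and a word in A has its product
  -- in A.
  · refine (inD_prD _ ?_).symm.trans ((congrArg (inD P) (h hF' w hw)).trans (map_zero _))
    have h1 : prP P (dfct D D' F (w.map (emb P))) = 0 := hP w hw
    have h2 : prP P (contr D.toAInfStr (fun l => inD P (g.1 l)) (w.map (emb P))) = 0 := by
      rw [contr_comp]
      exact contr_zero _
    rw [hF.dfct_correction hF' (by omega) hv' (by omega), map_add, map_sub, h1, h2, splitSum₃_hom,
      splitSum₃_eq_zero, sub_zero, add_zero]
    rintro u v t rfl
    simp only [wt_append] at hw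
    by_cases hvk : wt v < k + 1
    · have : inD P (g.1 (v.map (emb P))) = 0 := hv' v hvk
      rw [this, D'.multilin.zero_mid, map_zero]
    · obtain ⟨u, rfl⟩ := eq_map_inl_of_wt (w := u) (by omega)
      obtain ⟨t, rfl⟩ := eq_map_inl_of_wt (w := t) (by omega)
      rw [map_emb_inl, map_emb_inl, prP_word]
      exact map_zero _
  · have : inD P (g.1 l) = 0 := correction_eq_of_length_le (g.2.1.comp_lin (inD P)) hv' hl
    change F l - inD P (g.1 l) = F l
    rw [this, sub_zero]

theorem IsPre.exists_correction_inP (hF : IsPre D D' F) {k : ℕ}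
    (hE : VanishBelow (k + 2) (dfct D D' F))
    (hob : hF.obsP (k + 1) ∈ coboundaries (tpow P (k + 2)) P (1 - 2 * (k + 1 : ℕ))) :
    ∃ G, IsPre D D' G ∧ VanishBelow (k + 2) (dfct D D' G) ∧
      (VanishBelow (k + 3) fun l => prP P (dfct D D' G l)) ∧
      ∀ l, l.length ≤ k + 1 → G l = F l := by
  obtain ⟨g, hv, hm, h⟩ := hF.exists_correction (δ := 0) (inn := inP P) hE
    (fun φ a z => by
      rw [prP_word, rsp_of_even X (by decide), GrMod.eps_of_even (by decide), one_smul]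
      simp) (fun _ => rfl) ⟨-k - 1, by push_cast; ring⟩ hob
  have hv' : VanishBelow (k + 2) fun l => inP P (g.1 l) := fun w hw =>
    (congrArg (inP P) (hv w hw)).trans (map_zero _)
  have hF' : IsPre D D' fun l => F l - inP P (g.1 l) := by
    refine hF.sub_correction ⟨g.2.1.comp_lin _, fun l hl => ?_⟩ (fun l n hl => ?_)
      (hv'.mono (by omega)) (fun w hw => hv w (by omega))
    · exact (congrArg (inP P) (g.2.2 l hl)).trans (map_zero _)
    · have := inP_mem P (hm l n hl)
      rwa [show GrMod.rdeg n + (1 - 2 * ((k + 1 : ℕ) : ℤ) - 1 + 2 * ((k + 1 : ℕ) + 1)) - 1 =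
        GrMod.rdeg n + 1 by ring] at this
  refine ⟨_, hF', fun w hw => ?_, h hF', fun l hl => ?_⟩
  · rw [hF.dfct_correction_of_lt hF' (g.2.1.comp_lin (inP P)) hv' hw]
    exact hE w hw
  · have : inP P (g.1 l) = 0 := correction_eq_of_length_le (g.2.1.comp_lin (inP P)) hv' hl
    change F l - inP P (g.1 l) = F l
    rw [this, sub_zero]

/-- `F` satisfies the equations of an `A∞`-homomorphism on words with at most `k` letters in
`P[1]`, and the `P[1]`-components of those on words with `k + 1` such letters. -/
structure IsHomBelow (D D' : NCDivisor A P) (k : ℕ) (F : List (extSpace P) → extSpace P) : Prop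
    extends IsPre D D' F where
  vanish : VanishBelow (k + 1) (dfct D D' F)
  vanish_prP : VanishBelow (k + 2) fun l => prP P (dfct D D' F l)

/-- The two structures agree on words in A, and their P-components on words with one letter from P
are both given by μ_P. -/
theorem isHomBelow_letter (D D' : NCDivisor A P) : IsHomBelow D D' 0 letter := by
  refine ⟨isPre_letter D D', fun w hw => ?_, fun w hw => ?_⟩
  · obtain ⟨l, rfl⟩ := eq_map_inl_of_wt (w := w) (by omega)
    rw [map_emb_inl, dfct, defect_letter, D.sub, D'.sub, sub_self]
  · change prP P (dfct D D' letter (w.map (emb P))) = 0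
    rw [dfct, defect_letter]
    rcases Nat.lt_succ_iff_lt_or_eq.1 hw with hw | hw
    · obtain ⟨l, rfl⟩ := eq_map_inl_of_wt (w := w) (by omega)
      rw [map_emb_inl, D.sub, D'.sub, sub_self, map_zero]
    · obtain ⟨l, w, r, x, rfl, hx⟩ := exists_rep hw
      cases hx with
      | one p =>
        rw [map_emb_word, map_sub]
        exact sub_eq_zero.2 ((D'.quot l r x).trans (D.quot l r x).symm)

/-- This is the only obstruction whose degree is not negative; its class is the difference of the
sections. -/
theorem obsA_letter (D D' : NCDivisor A P) :
    (isPre_letter D D').obsA 0 = D'.theta - D.theta := by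
  have key : ∀ (l r : List X) (p : P.carrier),
      resOne ⟨_, (isPre_letter D D').dfct_mred (prD P)⟩ l r p = (D'.theta - D.theta) l r p :=
    fun l r p => by
      rw [resOne_apply]
      change prD P (defect _ _ _ _) = _
      rw [defect_letter, map_sub]
      rfl
  exact funext fun l => funext fun r => LinearMap.ext fun p => key l r p

/-- `IsHomBelow` at k controls all components that lower the weight by at most k. Those lowering it
by k + 1 go from weight k + 1 to A and from weight k + 2 to P. Correcting the former first makes the
latter the lowest order of the defect, so that they form a cocycle. -/
theorem IsHomBelow.exists_succ {P' : ABimod A} {ψ : PreHom (tensor P P') (diag A)}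
    (hψ : IsHtpyEquiv ψ) {φ : PreHom (tensor P' P) (diag A)} (hφ : IsHtpyEquiv φ) {k : ℕ}
    (hvan : cocycles (tpow P (k + 1)) (diag A) (1 - 2 * (k + 1 : ℕ)) ≤
      coboundaries (tpow P (k + 1)) (diag A) (1 - 2 * (k + 1 : ℕ)))
    (hF : IsHomBelow D D' k F)
    (hob : hF.toIsPre.obsA k ∈ coboundaries (tpow P (k + 1)) (diag A) (-(2 * k))) :
    ∃ G, IsHomBelow D D' (k + 1) G ∧ ∀ l, l.length ≤ k → G l = F l := by
  obtain ⟨G, hG, hE, e⟩ := hF.exists_correction_inA hF.vanish hF.vanish_prP hob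
  obtain ⟨H, hH, h₁, h₂, e'⟩ := hG.exists_correction_inP hE
    (cocycles_le_coboundaries_tpow hψ hφ hvan (hG.obsP_mem hE))
  exact ⟨H, ⟨hH, h₁, h₂⟩, fun l hl => (e' l (by omega)).trans (e l hl)⟩

theorem exists_seq (hP : P.Invertible)
    (hvan : ∀ i : ℕ, 1 ≤ i → ∀ n : ℤ, n < 0 → Subsingleton (HomCoh (tpow P i) (diag A) n))
    (h : D.sectionClass = D'.sectionClass) :
    ∃ F : ℕ → List (extSpace P) → extSpace P, (∀ k, IsHomBelow D D' k (F k)) ∧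
      ∀ k l, l.length ≤ k → F (k + 1) l = F k l := by
  obtain ⟨P', φ, ψ, hφ, hψ⟩ := hP.exists_htpyEquiv
  have hv : ∀ (k : ℕ) (n : ℤ), n < 0 → cocycles (tpow P (k + 1)) (diag A) n ≤
      coboundaries (tpow P (k + 1)) (diag A) n := fun k n hn =>
    subsingleton_homCoh.1 (hvan (k + 1) (by omega) n hn)
  have h0 : D'.theta - D.theta ∈ coboundaries P (diag A) 0 := by
    unfold sectionClass homClass at h
    have h' := (Submodule.Quotient.eq _).1 h.symm
    exact h'
  have step : ∀ (k : ℕ) (F : {F // IsHomBelow D D' (k + 1) F}),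
      ∃ G : {G // IsHomBelow D D' (k + 2) G}, ∀ l, l.length ≤ k + 1 → G.1 l = F.1 l := fun k F => by
    -- The obstructions now have degrees -2(k + 1) for the A-component and 1 - 2(k + 2) for the
    -- P-component, both negative.
    obtain ⟨G, hG, e⟩ := F.2.exists_succ hψ hφ (hv _ _ (by push_cast; omega))
      (hv _ _ (by push_cast; omega) (F.2.obsA_mem F.2.vanish F.2.vanish_prP))
    exact ⟨⟨G, hG⟩, e⟩
  -- The first A-obstruction has degree zero and bounds because the sections agree. The
  -- P-obstruction has degree -1 and is covered by the vanishing hypothesis.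
  obtain ⟨F₁, hF₁, e₁⟩ := (isHomBelow_letter D D').exists_succ hψ hφ (hv _ _ (by decide)) (by
    rw [obsA_letter]; exact h0)
  choose next hnext using step
  let S : (k : ℕ) → {F // IsHomBelow D D' (k + 1) F} := fun k => Nat.rec ⟨F₁, hF₁⟩ next k
  refine ⟨fun k => Nat.casesOn k letter fun k => (S k).1, fun k => ?_, fun k => ?_⟩
  · cases k with
    | zero => exact isHomBelow_letter D D'
    | succ k => exact (S k).2
  · cases k with
    | zero => exact e₁
    | succ k => exact hnext k (S k)

/-- The linear part is unipotent for A ⊂ A ⊕ P[1]: it is the identity on A and on the quotient,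
hence bijective. -/
theorem IsPre.isIso (hF : IsPre D D' F) (h : ∀ l, dfct D D' F l = 0) : IsIso D D' F := by
  refine ⟨hF.multilin, hF.nil, hF.mem, fun l => _root_.sub_eq_zero.1 (h l), hF.one, hF.eq_zero, ?_, hF.sub,
    hF.sub_eq_zero, hF.quot, hF.quot_eq_zero⟩
  have hl := hF.multilin [] []
  have hb : ∀ b, F [b] = inA P (prA P b + prA P (F [inP P (prP P b)])) + inP P (prP P b) :=
    fun b => by
    have := hl.map_add (inA P (prA P b)) (inP P (prP P b))
    rw [inA_add_inP] at this
    refine this.trans ?_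
    simp only [List.nil_append, hF.sub]
    rw [map_add, add_assoc]
    congr 1
    conv_lhs => rw [← inA_add_inP P (F [inP P (prP P b)]), hF.quot]
  have hp : ∀ b, prP P (F [b]) = prP P b := fun b => by rw [hb]; simp
  have ha : ∀ b, prA P (F [b]) = prA P b + prA P (F [inP P (prP P b)]) := fun b => by
    conv_lhs => rw [hb]
    simp
  refine ⟨fun b c e => ?_, fun c => ?_⟩
  · have e : F [b] = F [c] := e
    have e₁ : prP P b = prP P c := by rw [← hp, e, hp]
    have e₂ := congrArg (prA P) e
    rw [ha, ha c, e₁] at e₂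
    exact Prod.ext (add_right_cancel e₂) e₁
  · refine ⟨inA P (prA P c - prA P (F [inP P (prP P c)])) + inP P (prP P c), ?_⟩
    change F [_] = _
    rw [hb]
    simp [inA_add_inP]

theorem isomorphic_of_sectionClass_eq (hP : P.Invertible)
    (hvan : ∀ i : ℕ, 1 ≤ i → ∀ n : ℤ, n < 0 → Subsingleton (HomCoh (tpow P i) (diag A) n))
    (h : D.sectionClass = D'.sectionClass) : D.Isomorphic D' := by
  obtain ⟨F, hF, e⟩ := exists_seq hP hvan h
  have e' : ∀ (l : List (extSpace P)) (k : ℕ), l.length ≤ k → F l.length l = F k l :=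
    fun l k hk => by
    induction k, hk using Nat.le_induction with
    | base => rfl
    | succ k hk ih => rw [ih, e k l hk]
  -- On each word the sequence is constant from the index equal to its length onwards, so G is its
  -- limit.
  let G : List (extSpace P) → extSpace P := fun l => F l.length l
  have hG : ∀ (l : List (extSpace P)) (k : ℕ), l.length ≤ k → G l = F k l := e'
  have hpre : IsPre D D' G := by
    refine ⟨fun u v => ?_, (hF 0).nil, fun l => (hF _).mem l, (hF 1).one, fun l => (hF _).eq_zero l,
      (hF 1).sub, fun l hl => (hF _).sub_eq_zero l hl, (hF 1).quot, fun l r p h =>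
      (hF _).quot_eq_zero l r p h⟩
    have := (hF (u.length + v.length + 1)).multilin u v
    have e : ∀ a, G (u ++ a :: v) = F (u.length + v.length + 1) (u ++ a :: v) := fun a =>
      hG _ _ (by simp; omega)
    simpa only [e] using this
  refine ⟨G, hpre.isIso fun l => ?_⟩
  refine hpre.dfct_multilin.eq_zero_of_letters fun w hw => ?_
  -- The equation on a word involves G only on words with at most one letter more. There G agrees
  -- with the approximation of index `l.length + 1`, whose defect vanishes up to that weight.
  rw [dfct, defect_congr (G := F (l.length + 1)) _ fun u hu => hG u _ (by simpa [hw] using hu)]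
  exact (hF (l.length + 1)).vanish w (by have := wt_le_length w; omega)

end NCDivisor

end Induction

end NCGeom

theorem mainTheorem10 {K : Type u} [Field K] {X : NCGeom.GrMod K} (A : NCGeom.AInfStr X)
    (P : NCGeom.ABimod A) (hP : P.Invertible)
    (hvan : ∀ i : ℕ, 1 ≤ i → ∀ n : ℤ, n < 0 →
      Subsingleton (NCGeom.HomCoh (NCGeom.tpow P i) (NCGeom.diag A) n)) :
    (∀ D D' : NCGeom.NCDivisor A P, D.sectionClass = D'.sectionClass → D.Isomorphic D') ∧
    ∃ K₁ : NCGeom.HomCoh P (NCGeom.diag A) 0 →ₗ[K] NCGeom.HomCoh P (NCGeom.diag A) 0,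
      (∀ x y, K₁ x = y ↔ NCGeom.SelfConj P x y) ∧
      ∀ D : NCGeom.NCDivisor A P, K₁ D.sectionClass = D.sectionClass := by
  refine ⟨fun D D' h => NCGeom.NCDivisor.isomorphic_of_sectionClass_eq hP hvan h, ?_⟩
  obtain ⟨K₁, hK⟩ := NCGeom.exists_selfConj hP
  exact ⟨K₁, hK, fun D => (hK _ _).2 D.sectionClass_fixed⟩
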